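/- **Notation.** For real $a$, let $\int_{\searrow a}$ denote integration along the contour that comes in a straight line from $e^{\pi i/3}\infty$ to $a$ and continues in a straight line to $e^{-\pi i/3}\infty$, and let $\int_{\nwarrow b}$ denote integration along the contour that comes in a straight line from $e^{-2\pi i/3}\infty$ to $b$ and continues in a straight line to $e^{2\pi i/3}\infty$. Below, $a$ is the vertex of the $\zeta$ (or $z$) contour and $b$ the vertex of the $\omega$ (or $w$) contour; any vertices with the stated constraints may be used (the values do not depend on the choice), and in double integrals always $b<a$. Let $\delta\in\mathbb R$, $u>0$, $S\in\mathbb R$, and $J=\left(\begin{smallmatrix}0&1\\-1&0\end{smallmatrix}\right)$. **Half-space functions.** Put $f^{-\delta,u}(X)=e^{-\delta^3/3-\delta^2u+\delta X}$, $$e^{\delta,u}(S)=-\int_{\searrow a}\frac{d\zeta}{2\pi i}\,\frac{e^{\zeta^3/3+\zeta^2u-\zeta S}}{e^{\delta^3/3+\delta^2u-\delta S}}\frac1{(\zeta-\delta)^2}\quad(a<\delta),$$ $$j^{\delta,u}(S,X)=\Big[\tfrac{\sinh\delta(X-S)}{\delta}+(X-S)e^{\delta(X-S)}\Big]f^{-\delta,-u}(S)$$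 (with $\tfrac{\sinh \delta x}{\delta}=x$ for $\delta=0$), and $$g_1(X)=\int_{\searrow a}\frac{d\zeta}{2\pi i}e^{\zeta^3/3-\zeta^2u-\zeta X}\frac{\zeta+\delta}{2\zeta}\ (a>0),\qquad g_2(X)=\int_{\searrow a}\frac{d\zeta}{2\pi i}e^{\zeta^3/3+\zeta^2u-\zeta X}\frac1{\zeta-\delta}\ (a<\delta),$$ $$g_3(X)=\int_{\searrow a}\frac{d\zeta}{2\pi i}e^{\zeta^3/3-\zeta^2u-\zeta X}\frac1{\zeta+\delta}\ (a>-\delta),\qquad g_4(X)=\int_{\searrow a}\frac{d\zeta}{2\pi i}e^{\zeta^3/3+\zeta^2u-\zeta X}\frac{2\zeta}{(\zeta-\delta)(\zeta+\delta)^2}\ (a<-|\delta|).$$ Let $\mathcal A=(\mathcal A_{ij})_{i,j\in\{1,2\}}$ be the anti-symmetric matrix kernel with $$\mathcal A_{11}(X,Y)=-\int_{\searrow a}\frac{d\zeta}{2\pi i}\int_{\nwarrow b}\frac{d\omega}{2\pi i}\frac{e^{\zeta^3/3-\zeta^2u-\zeta X}}{e^{\omega^3/3+\omega^2u-\omega Y}}(\zeta-\delta)(\omega+\delta)\frac{\zeta+\omega}{4\zeta\omega(\zeta-\omega)}\quad(b<0<a),$$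 $$\mathcal A_{12}(X,Y)=-\int_{\searrow a}\frac{d\zeta}{2\pi i}\int_{\nwarrow b}\frac{d\omega}{2\pi i}\frac{e^{\zeta^3/3-\zeta^2u-\zeta X}}{e^{\omega^3/3-\omega^2u-\omega Y}}\frac{\zeta-\delta}{\omega-\delta}\frac{\zeta+\omega}{2\zeta(\zeta-\omega)}=-\mathcal A_{21}(Y,X)\quad(a>0,\ \delta<b<a),$$ $$\mathcal A_{22}(X,Y)=\mathcal E_0(X,Y)+\mathcal E_1(X,Y)+\int\frac{d\zeta}{2\pi i}\int\frac{d\omega}{2\pi i}\frac{e^{\zeta^3/3+\zeta^2u-\zeta X}}{e^{\omega^3/3-\omega^2u-\omega Y}}\frac1{\zeta-\omega}\Big(\frac1{\zeta+\delta}+\frac1{\omega-\delta}\Big),$$ where the contours in $\mathcal A_{22}$ are $\searrow a$, $\nwarrow b$ with $b<a<-\delta$ for the term $1/(\zeta+\delta)$ and with $\delta<b<a$ for the term $1/(\omega-\delta)$, and $$\mathcal E_0(X,Y)=-\operatorname{sgn}(X-Y)e^{\delta|X-Y|+2\delta^2u},\qquad \mathcal E_1(X,Y)=-\operatorname{sgn}(X-Y)\int_{\searrow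 a}\frac{d\zeta}{2\pi i}e^{-\zeta|X-Y|+2\zeta^2u}\frac{2\zeta}{\zeta^2-\delta^2}\quad(a>|\delta|).$$ Let $\widetilde{\mathcal A}_{12}$ be given by the formula for $\mathcal A_{12}$ with the constraints on the contours replaced by $a>0$, $b<\min(\delta,a)$, and let $$\widetilde{\mathcal A}_{22}(X,Y)=\int_{\searrow a}\frac{d\zeta}{2\pi i}\int_{\nwarrow b}\frac{d\omega}{2\pi i}\frac{e^{\zeta^3/3+\zeta^2u-\zeta X}}{e^{\omega^3/3-\omega^2u-\omega Y}}\frac{1}{(\zeta+\delta)(\omega-\delta)}\frac{\zeta+\omega}{\zeta-\omega}\quad(a<-\delta,\ b<\min(\delta,a)),$$ $$h_1(Y)=\int_S^\infty\widetilde{\mathcal A}_{22}(Y,V)f^{-\delta,u}(V)\,dV+\int_S^\infty\mathcal E_1(Y,V)f^{-\delta,u}(V)\,dV-g_4(Y)-j^{\delta,u}(S,Y),$$ $$h_2(Y)=\int_S^\infty\widetilde{\mathcal A}_{12}(Y,V)f^{-\delta,u}(V)\,dV+g_3(Y).$$ **Half-space distribution.** Define $F^{(\delta,u)}_{0,\mathrm{half}}(S)=\partial_S\,G^{(\delta,u)}(S)$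 with $$G^{(\delta,u)}(S)=\operatorname{pf}(J-\mathcal A)\cdot\Big[e^{\delta,u}(S)-\Big\langle(-g_1\ \ g_2)\,\Big|\,(1-J^{-1}\mathcal A)^{-1}\begin{pmatrix}-h_1\\h_2\end{pmatrix}\Big\rangle\Big].$$ Here $\operatorname{pf}(J-\mathcal A)=\sum_{n\ge0}\frac{(-1)^n}{n!}\int_{(S,\infty)^n}\operatorname{pf}\big[\mathcal A(x_i,x_j)\big]_{1\le i,j\le n}\,dx_1\cdots dx_n$ is the Fredholm Pfaffian over $L^2(S,\infty)\times L^2(S,\infty)$, the inner Pfaffian being that of the $2n\times2n$ matrix with blocks $\mathcal A(x_i,x_j)$. The brackets denote $\langle (f_1\ f_2)|(\varphi_1,\varphi_2)^{t}\rangle=\int_S^\infty (f_1\varphi_1+f_2\varphi_2)\,dX$, and the inverse is taken on the pairs $(\varphi_1,\varphi_2)$ with $e^{-\theta X}\varphi_1,\ e^{\theta X}\varphi_2\in L^2(S,\infty)$, that is, on $L^2(S,\infty)\times L^2(S,\infty)$ after conjugation by $\operatorname{diag}(e^{-\theta X},e^{\theta X})$, with any $\theta>|\delta|$; say $\theta=|\delta|+1$.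 **Baik–Rains distribution.** For real $\tau,s$ put $$\mathcal R_\tau(s)=-e^{-\frac23\tau^3-s\tau}\int_{\searrow a}\frac{dz}{2\pi i}e^{z^3/3-z(s+\tau^2)}\frac1{(z+\tau)^2},\qquad \Psi_\tau(x)=\int_{\searrow a}\frac{dz}{2\pi i}e^{z^3/3-z(x+\tau^2)}\frac1{z+\tau}\quad(a<-\tau),$$ $$\Phi_\tau(y)=e^{-\frac23\tau^3-s\tau}\int_{\searrow a}\frac{dz}{2\pi i}\int_{\nwarrow b}\frac{dw}{2\pi i}\frac{e^{z^3/3-z(y+\tau^2)}}{e^{w^3/3-w(s+\tau^2)}}\frac1{(z-w)(w-\tau)}\quad(\tau<b<a),$$ $$K_{\mathrm{Ai},\tau}(x,y)=-\int_{\searrow a}\frac{dz}{2\pi i}\int_{\nwarrow b}\frac{dw}{2\pi i}\frac{e^{z^3/3-z(x+\tau^2)}}{e^{w^3/3-w(y+\tau^2)}}\frac1{z-w}\quad(b<a).$$ Let $F_{\mathrm{GUE}}(r)=\det(1-K_{\mathrm{Ai},0})_{L^2(r,\infty)}$ (Fredholm determinant) be the GUE Tracy–Widom distribution function. The extended Baik–Rains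 distribution is $$F_{\mathrm{BR},\tau}(s)=\partial_s\Big[F_{\mathrm{GUE}}(s+\tau^2)\Big(\mathcal R_\tau(s)-\big\langle\Psi_\tau\,\big|\,(1-K_{\mathrm{Ai},\tau})^{-1}\Phi_\tau\big\rangle\Big)\Big],$$ where the inverse is taken on $L^2(s,\infty)$ and the bracket is $\int_s^\infty \Psi_\tau(x)\,\big((1-K_{\mathrm{Ai},\tau})^{-1}\Phi_\tau\big)(x)\,dx$. **Theorem 2.9.** Let $\tau,s\in\mathbb R$. For $u\in\mathbb R$ set $\delta=\tau-u$ (so that $u+\delta=\tau$) and $S=s+\delta(2u+\delta)$. Then $$\lim_{u\to\infty}F^{(\delta,u)}_{0,\mathrm{half}}(S)=F_{\mathrm{BR},\tau}(s).$$ In particular both sides are meaningful. The right-hand side is: the Fredholm determinant and the bracket converge, $1-K_{\mathrm{Ai},\tau}$ has a bounded inverse on $L^2(s,\infty)$, and the $s$-derivative exists. For all sufficiently large $u$ the left-hand side is: at all points of a neighbourhood of $S$ the Fredholm Pfaffian, the $V$-integrals in $h_1,h_2$ and the bracket converge and $1-J^{-1}\mathcal A$ has a bounded inverse on the weighted space above;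 and $G^{(\delta,u)}$ is differentiable at $S$. -/

import Mathlib

open Filter Topology MeasureTheory

noncomputable section

namespace HalfSpaceLPP

/-! ### Airy-type contours -/

/-- `(1 / 2πi) ∫ f(ζ) dζ` along the downward oriented contour that comes in a straight line from
`exp(πi/3)∞` to the real point `a` and goes on in a straight line to `exp(-πi/3)∞`. -/
def contourDown (a : ℝ) (f : ℂ → ℂ) : ℂ :=
  (2 * Real.pi * Complex.I)⁻¹ *
    ∫ t in Set.Ioi (0 : ℝ),
      (Complex.exp (-(Real.pi / 3 * Complex.I)) * f (a + t * Complex.exp (-(Real.pi / 3 * Complex.I)))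
        - Complex.exp (Real.pi / 3 * Complex.I) * f (a + t * Complex.exp (Real.pi / 3 * Complex.I)))

/-- `(1 / 2πi) ∫ f(ω) dω` along the upward oriented contour that comes in a straight line from
`exp(-2πi/3)∞` to the real point `b` and goes on in a straight line to `exp(2πi/3)∞`. -/
def contourUp (b : ℝ) (f : ℂ → ℂ) : ℂ :=
  (2 * Real.pi * Complex.I)⁻¹ *
    ∫ t in Set.Ioi (0 : ℝ),
      (Complex.exp (2 * Real.pi / 3 * Complex.I)
          * f (b + t * Complex.exp (2 * Real.pi / 3 * Complex.I))
        - Complex.exp (-(2 * Real.pi / 3 * Complex.I))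
          * f (b + t * Complex.exp (-(2 * Real.pi / 3 * Complex.I))))

/-! In every contour integral below the real vertex of the contour is one explicit point that lies
on the required side of the poles. For a double integral the vertex of the `ω` contour lies to the
left of the vertex of the `ζ` contour, so that the two contours are disjoint. By Cauchy's theorem
any other admissible vertex gives the same value. -/

/-! ### Pfaffians, Fredholm determinants and Fredholm Pfaffians -/

/-- The Pfaffian of a `2n × 2n` matrix,
`(1 / (2^n n!)) ∑_σ sgn σ · a(σ 1, σ 2) a(σ 3, σ 4) ⋯ a(σ (2n-1), σ (2n))`.
The index set `{1, …, 2n}` is written as `Fin n × Fin 2`, the pair `(i, c)` (counted from zero)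
being the number `2 i + c + 1`. -/
def pfaffian {n : ℕ} (a : Matrix (Fin n × Fin 2) (Fin n × Fin 2) ℂ) : ℂ :=
  (1 / (2 ^ n * (n.factorial : ℂ))) *
    ∑ σ : Equiv.Perm (Fin n × Fin 2),
      ((Equiv.Perm.sign σ : ℤ) : ℂ) * ∏ i : Fin n, a (σ (i, 0)) (σ (i, 1))

/-- The `2n × 2n` matrix whose `2 × 2` block at `(i, j)` is `K (x i) (x j)`. -/
def blockMatrix {n : ℕ} (K : ℝ → ℝ → Matrix (Fin 2) (Fin 2) ℂ) (x : Fin n → ℝ) :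
    Matrix (Fin n × Fin 2) (Fin n × Fin 2) ℂ :=
  Matrix.of fun p q => K (x p.1) (x q.1) p.2 q.2

/-- The `n`-th term of the Fredholm Pfaffian of `J - K` over `(S, ∞)`. -/
def fredholmPfaffianTerm (S : ℝ) (K : ℝ → ℝ → Matrix (Fin 2) (Fin 2) ℂ) (n : ℕ) : ℂ :=
  ((-1) ^ n / (n.factorial : ℂ)) *
    ∫ x in Set.univ.pi (fun _ : Fin n => Set.Ioi S), pfaffian (blockMatrix K x)

/-- The Fredholm Pfaffian `pf(J - K)` on `L²(S, ∞) × L²(S, ∞)`. -/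
def fredholmPfaffian (S : ℝ) (K : ℝ → ℝ → Matrix (Fin 2) (Fin 2) ℂ) : ℂ :=
  ∑' n : ℕ, fredholmPfaffianTerm S K n

/-- All the integrals in the Fredholm Pfaffian, and the series, converge absolutely. -/
def FredholmPfaffianConverges (S : ℝ) (K : ℝ → ℝ → Matrix (Fin 2) (Fin 2) ℂ) : Prop :=
  (∀ n : ℕ, IntegrableOn (fun x : Fin n → ℝ => pfaffian (blockMatrix K x))
    (Set.univ.pi fun _ : Fin n => Set.Ioi S)) ∧
  Summable fun n : ℕ => fredholmPfaffianTerm S K n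

/-- The `n`-th term of the Fredholm determinant of `1 - K` over `(s, ∞)`. -/
def fredholmDetTerm (s : ℝ) (K : ℝ → ℝ → ℂ) (n : ℕ) : ℂ :=
  ((-1) ^ n / (n.factorial : ℂ)) *
    ∫ x in Set.univ.pi (fun _ : Fin n => Set.Ioi s),
      (Matrix.of fun i j : Fin n => K (x i) (x j)).det

/-- The Fredholm determinant `det(1 - K)` on `L²(s, ∞)`. -/
def fredholmDet (s : ℝ) (K : ℝ → ℝ → ℂ) : ℂ :=
  ∑' n : ℕ, fredholmDetTerm s K n

/-- All the integrals in the Fredholm determinant, and the series, converge absolutely. -/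
def FredholmDetConverges (s : ℝ) (K : ℝ → ℝ → ℂ) : Prop :=
  (∀ n : ℕ, IntegrableOn (fun x : Fin n → ℝ => (Matrix.of fun i j : Fin n => K (x i) (x j)).det)
    (Set.univ.pi fun _ : Fin n => Set.Ioi s)) ∧
  Summable fun n : ℕ => fredholmDetTerm s K n

/-! ### Integral operators on `L²(μ)` and their resolvents -/

/-- `T` is the bounded operator on `L²(μ)` with integral kernel `k`. At most one `T` is. -/
def HasKernel {α : Type*} [MeasurableSpace α] (μ : Measure α) (k : α → α → ℂ)
    (T : Lp ℂ 2 μ →L[ℂ] Lp ℂ 2 μ) : Prop :=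
  ∀ f : Lp ℂ 2 μ, (∀ᵐ x ∂μ, Integrable (fun y => k x y * f y) μ) ∧
    ∀ᵐ x ∂μ, T f x = ∫ y, k x y * f y ∂μ

open Classical in
/-- The bounded operator on `L²(μ)` with kernel `k` (zero if there is none). -/
def integralOp {α : Type*} [MeasurableSpace α] (μ : Measure α) (k : α → α → ℂ) :
    Lp ℂ 2 μ →L[ℂ] Lp ℂ 2 μ :=
  if h : ∃ T, HasKernel μ k T then h.choose else 0

open Classical in
/-- `(1 - k)⁻¹ h` as an element of `L²(μ)`. -/
def resolventApply {α : Type*} [MeasurableSpace α] (μ : Measure α) (k : α → α → ℂ)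
    (h : α → ℂ) : Lp ℂ 2 μ :=
  if hm : MemLp h 2 μ then Ring.inverse (1 - integralOp μ k) (hm.toLp h) else 0

/-- The scalar product `⟨g, (1 - k)⁻¹ h⟩ = ∫ g (1 - k)⁻¹ h dμ`. -/
def resolventPairing {α : Type*} [MeasurableSpace α] (μ : Measure α) (k : α → α → ℂ)
    (g h : α → ℂ) : ℂ :=
  ∫ x, g x * resolventApply μ k h x ∂μ

/-- The scalar product `⟨g, (1 - k)⁻¹ h⟩` is meaningful: `k` is the kernel of a bounded operator
on `L²(μ)`, the operator `1 - k` has a bounded inverse, `h` is in `L²(μ)`, and the integral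
converges. -/
def ResolventPairingDefined {α : Type*} [MeasurableSpace α] (μ : Measure α) (k : α → α → ℂ)
    (g h : α → ℂ) : Prop :=
  (∃ T, HasKernel μ k T) ∧ IsUnit (1 - integralOp μ k) ∧ MemLp h 2 μ ∧
    Integrable (fun x => g x * resolventApply μ k h x) μ

/-! ### The half-space functions -/

/-- The function `f^{-δ,u}(X) = exp(-δ³/3 - δ² u + δ X)`. -/
def fFun (δ u X : ℝ) : ℂ :=
  Complex.exp (-(δ : ℂ) ^ 3 / 3 - (δ : ℂ) ^ 2 * u + δ * X)

/-- The function `e^{δ,u}(S)`; the contour passes to the left of `δ`. -/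
def eFun (δ u S : ℝ) : ℂ :=
  -contourDown (δ - 1) fun ζ =>
    Complex.exp (ζ ^ 3 / 3 + ζ ^ 2 * u - ζ * S)
      / Complex.exp ((δ : ℂ) ^ 3 / 3 + (δ : ℂ) ^ 2 * u - δ * S) * (1 / (ζ - δ) ^ 2)

/-- `sinh(δ x) / δ`, continued by its limit `x` at `δ = 0`. -/
def sinhQuot (δ x : ℝ) : ℝ :=
  if δ = 0 then x else Real.sinh (δ * x) / δ

/-- The function `j^{δ,u}(S, X)`. -/
def jFun (δ u S X : ℝ) : ℂ :=
  ((sinhQuot δ (X - S) + (X - S) * Real.exp (δ * (X - S)) : ℝ) : ℂ) * fFun δ (-u) S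

/-- The function `g₁^{δ,u}`; the contour passes to the right of `0`. -/
def g1 (δ u X : ℝ) : ℂ :=
  contourDown 1 fun ζ => Complex.exp (ζ ^ 3 / 3 - ζ ^ 2 * u - ζ * X) * ((ζ + δ) / (2 * ζ))

/-- The function `g₂^{δ,u}`; the contour passes to the left of `δ`. -/
def g2 (δ u X : ℝ) : ℂ :=
  contourDown (δ - 1) fun ζ => Complex.exp (ζ ^ 3 / 3 + ζ ^ 2 * u - ζ * X) * (1 / (ζ - δ))

/-- The function `g₃^{δ,u}`; the contour passes to the right of `-δ`. -/
def g3 (δ u X : ℝ) : ℂ :=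
  contourDown (-δ + 1) fun ζ => Complex.exp (ζ ^ 3 / 3 - ζ ^ 2 * u - ζ * X) * (1 / (ζ + δ))

/-- The function `g₄^{δ,u}`; the contour passes to the left of `δ` and `-δ`. -/
def g4 (δ u X : ℝ) : ℂ :=
  contourDown (-|δ| - 1) fun ζ =>
    Complex.exp (ζ ^ 3 / 3 + ζ ^ 2 * u - ζ * X) * (2 * ζ / ((ζ - δ) * (ζ + δ) ^ 2))

/-! ### The anti-symmetric half-space kernel -/

/-- `𝒜₁₁`; `ζ` passes to the right of `0`, and `ω` to the left of `0` and `ζ`. -/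
def A11 (δ u X Y : ℝ) : ℂ :=
  -contourDown 1 fun ζ => contourUp (-1) fun ω =>
    Complex.exp (ζ ^ 3 / 3 - ζ ^ 2 * u - ζ * X) / Complex.exp (ω ^ 3 / 3 + ω ^ 2 * u - ω * Y)
      * ((ζ - δ) * (ω + δ)) * ((ζ + ω) / (4 * ζ * ω * (ζ - ω)))

/-- The integrand of `𝒜₁₂` and of its modification. -/
def A12Integrand (δ u X Y : ℝ) (ζ ω : ℂ) : ℂ :=
  Complex.exp (ζ ^ 3 / 3 - ζ ^ 2 * u - ζ * X) / Complex.exp (ω ^ 3 / 3 - ω ^ 2 * u - ω * Y)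
    * ((ζ - δ) / (ω - δ)) * ((ζ + ω) / (2 * ζ * (ζ - ω)))

/-- `𝒜₁₂`; `ζ` passes to the right of `0`, and `ω` between `δ` and `ζ`. -/
def A12 (δ u X Y : ℝ) : ℂ :=
  -contourDown (|δ| + 2) fun ζ => contourUp (|δ| + 1) fun ω => A12Integrand δ u X Y ζ ω

/-- `ℰ₀`. -/
def E0 (δ u X Y : ℝ) : ℂ :=
  -(Real.sign (X - Y) : ℂ) * Complex.exp (δ * |X - Y| + 2 * (δ : ℂ) ^ 2 * u)

/-- `ℰ₁`; the contour passes to the right of `δ` and `-δ`. -/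
def E1 (δ u X Y : ℝ) : ℂ :=
  -(Real.sign (X - Y) : ℂ) * contourDown (|δ| + 1) fun ζ =>
    Complex.exp (-ζ * |X - Y| + 2 * ζ ^ 2 * u) * (2 * ζ / (ζ ^ 2 - (δ : ℂ) ^ 2))

/-- `𝒜₂₂`; in the term with `1 / (ζ + δ)` the contours are `ζ` to the left of `-δ` and `ω` to the
left of `ζ`; in the term with `1 / (ω - δ)` the contour of `ω` passes between `δ` and `ζ`. -/
def A22 (δ u X Y : ℝ) : ℂ :=
  (E0 δ u X Y + E1 δ u X Y)
  + (contourDown (-δ - 1) fun ζ => contourUp (-δ - 2) fun ω =>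
      Complex.exp (ζ ^ 3 / 3 + ζ ^ 2 * u - ζ * X) / Complex.exp (ω ^ 3 / 3 - ω ^ 2 * u - ω * Y)
        * (1 / (ζ - ω)) * (1 / (ζ + δ)))
  + (contourDown (δ + 2) fun ζ => contourUp (δ + 1) fun ω =>
      Complex.exp (ζ ^ 3 / 3 + ζ ^ 2 * u - ζ * X) / Complex.exp (ω ^ 3 / 3 - ω ^ 2 * u - ω * Y)
        * (1 / (ζ - ω)) * (1 / (ω - δ)))

/-- The anti-symmetric `2 × 2` matrix kernel `𝒜`, with `𝒜₂₁(X, Y) = -𝒜₁₂(Y, X)`. -/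
def kernelA (δ u : ℝ) (X Y : ℝ) : Matrix (Fin 2) (Fin 2) ℂ :=
  !![A11 δ u X Y, A12 δ u X Y; -A12 δ u Y X, A22 δ u X Y]

/-- The modification of `𝒜₁₂` in which `ω` passes to the left of `δ` and `ζ`. -/
def A12tilde (δ u X Y : ℝ) : ℂ :=
  -contourDown 1 fun ζ => contourUp (-|δ| - 1) fun ω => A12Integrand δ u X Y ζ ω

/-- The kernel `𝒜̃₂₂`; `ζ` passes to the left of `-δ`, and `ω` to the left of `δ` and `ζ`. -/
def A22tilde (δ u X Y : ℝ) : ℂ :=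
  contourDown (-δ - 1) fun ζ => contourUp (-|δ| - 2) fun ω =>
    Complex.exp (ζ ^ 3 / 3 + ζ ^ 2 * u - ζ * X) / Complex.exp (ω ^ 3 / 3 - ω ^ 2 * u - ω * Y)
      * (1 / ((ζ + δ) * (ω - δ))) * ((ζ + ω) / (ζ - ω))

/-- The function `h₁^{δ,u}`, which also depends on `S`. -/
def h1 (δ u S Y : ℝ) : ℂ :=
  (∫ V in Set.Ioi S, A22tilde δ u Y V * fFun δ u V)
    + (∫ V in Set.Ioi S, E1 δ u Y V * fFun δ u V) - g4 δ u Y - jFun δ u S Y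

/-- The function `h₂^{δ,u}`, which also depends on `S`. -/
def h2 (δ u S Y : ℝ) : ℂ :=
  (∫ V in Set.Ioi S, A12tilde δ u Y V * fFun δ u V) + g3 δ u Y

/-! ### The half-space distribution -/

/-- The matrix `J`. -/
def J : Matrix (Fin 2) (Fin 2) ℂ := !![0, 1; -1, 0]

/-- Pairs of functions on `(S, ∞)` are functions on `{0, 1} × (S, ∞)`, with this measure. -/
def pairMeasure (S : ℝ) : Measure (Fin 2 × ℝ) :=
  (Measure.count : Measure (Fin 2)).prod (volume.restrict (Set.Ioi S))

/-- The conjugating weights `exp(-θ X)` and `exp(θ X)` of the two components. The entry `𝒜₂₂` and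
the functions `h₁`, `g₂` grow at most like `X exp(|δ| X)`, while `𝒜₁₁`, `g₁`, `h₂` decay faster
than any exponential; any `θ > |δ|` gives `L²` objects, and the same scalar product. -/
def weight (δ : ℝ) (i : Fin 2) (X : ℝ) : ℂ :=
  Complex.exp (if i = 0 then -((|δ| + 1) * X : ℝ) else ((|δ| + 1) * X : ℝ))

/-- The matrix kernel `J⁻¹ 𝒜`, conjugated by the weights. -/
def conjKernel (δ u : ℝ) (p q : Fin 2 × ℝ) : ℂ :=
  weight δ p.1 p.2 * (J⁻¹ * kernelA δ u p.2 q.2) p.1 q.1 * (weight δ q.1 q.2)⁻¹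

/-- The row vector `(-g₁, g₂)`, divided by the weights. -/
def conjRow (δ u : ℝ) (p : Fin 2 × ℝ) : ℂ :=
  (![-g1 δ u p.2, g2 δ u p.2] p.1) * (weight δ p.1 p.2)⁻¹

/-- The column vector `(-h₁, h₂)`, multiplied by the weights. -/
def conjColumn (δ u S : ℝ) (p : Fin 2 × ℝ) : ℂ :=
  weight δ p.1 p.2 * ![-h1 δ u S p.2, h2 δ u S p.2] p.1

/-- The function `pf(J - 𝒜) · [e^{δ,u}(S) - ⟨(-g₁, g₂), (1 - J⁻¹𝒜)⁻¹ (-h₁, h₂)⟩]` of `S`, taken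
over `L²(S, ∞) × L²(S, ∞)`. -/
def halfPrimitive (δ u S : ℝ) : ℂ :=
  fredholmPfaffian S (kernelA δ u) *
    (eFun δ u S
      - resolventPairing (pairMeasure S) (conjKernel δ u) (conjRow δ u) (conjColumn δ u S))

/-- All the objects that enter `halfPrimitive δ u S` are well defined. -/
def HalfDefined (δ u S : ℝ) : Prop :=
  FredholmPfaffianConverges S (kernelA δ u) ∧
  (∀ Y, S < Y → IntegrableOn (fun V => A22tilde δ u Y V * fFun δ u V) (Set.Ioi S) ∧
    IntegrableOn (fun V => E1 δ u Y V * fFun δ u V) (Set.Ioi S) ∧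
    IntegrableOn (fun V => A12tilde δ u Y V * fFun δ u V) (Set.Ioi S)) ∧
  ResolventPairingDefined (pairMeasure S) (conjKernel δ u) (conjRow δ u) (conjColumn δ u S)

/-- The limiting distribution function `F^{(δ,u)}_{0,half}` of stationary half-space last passage
percolation. -/
def Fhalf (δ u S : ℝ) : ℂ :=
  deriv (halfPrimitive δ u) S

/-! ### The extended Baik-Rains distribution -/

/-- The function `R_τ(s)`; the contour passes to the left of `-τ`. -/
def Rfun (τ s : ℝ) : ℂ :=
  -Complex.exp (-(2 / 3) * (τ : ℂ) ^ 3 - s * τ) * contourDown (-τ - 1) fun z =>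
    Complex.exp (z ^ 3 / 3 - z * (s + (τ : ℂ) ^ 2)) * (1 / (z + τ) ^ 2)

/-- The function `Ψ_τ`; the contour passes to the left of `-τ`. -/
def Psi (τ x : ℝ) : ℂ :=
  contourDown (-τ - 1) fun z =>
    Complex.exp (z ^ 3 / 3 - z * (x + (τ : ℂ) ^ 2)) * (1 / (z + τ))

/-- The function `Φ_τ`, which also depends on `s`; `w` passes between `τ` and `z`. -/
def Phi (τ s y : ℝ) : ℂ :=
  Complex.exp (-(2 / 3) * (τ : ℂ) ^ 3 - s * τ) *
    contourDown (τ + 2) fun z => contourUp (τ + 1) fun w =>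
      Complex.exp (z ^ 3 / 3 - z * (y + (τ : ℂ) ^ 2))
        / Complex.exp (w ^ 3 / 3 - w * (s + (τ : ℂ) ^ 2)) * (1 / ((z - w) * (w - τ)))

/-- The shifted Airy kernel `K_{Ai,τ}(x, y) = K_Ai(x + τ², y + τ²)`; `w` passes to the left
of `z`. -/
def airyKernel (τ x y : ℝ) : ℂ :=
  -contourDown 1 fun z => contourUp (-1) fun w =>
    Complex.exp (z ^ 3 / 3 - z * (x + (τ : ℂ) ^ 2))
      / Complex.exp (w ^ 3 / 3 - w * (y + (τ : ℂ) ^ 2)) * (1 / (z - w))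

/-- The GUE Tracy-Widom distribution function `det(1 - K_Ai)` on `L²(s, ∞)`, with the Airy
kernel `K_Ai`. -/
def FGUE (s : ℝ) : ℂ :=
  fredholmDet s (airyKernel 0)

/-- The function `F_GUE(s + τ²) (R_τ - ⟨Ψ_τ, (1 - K_{Ai,τ})⁻¹ Φ_τ⟩)` of `s`, the scalar product
being on `L²(s, ∞)`. -/
def brPrimitive (τ s : ℝ) : ℂ :=
  FGUE (s + τ ^ 2) *
    (Rfun τ s
      - resolventPairing (volume.restrict (Set.Ioi s)) (airyKernel τ) (Psi τ) (Phi τ s))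

/-- All the objects that enter `brPrimitive τ s` are well defined. -/
def BRDefined (τ s : ℝ) : Prop :=
  FredholmDetConverges (s + τ ^ 2) (airyKernel 0) ∧
  ResolventPairingDefined (volume.restrict (Set.Ioi s)) (airyKernel τ) (Psi τ) (Phi τ s)

/-- The extended Baik-Rains distribution function. -/
def FBR (τ s : ℝ) : ℂ :=
  deriv (brPrimitive τ) s

end HalfSpaceLPP

end

noncomputable section
namespace HalfSpaceLPP
open Complex ComplexConjugate
open scoped Real
open Set (Ioi Ioo)
open Matrix (cons_val_one cons_val_fin_one cons_val_zero of_apply)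
open Metric (ball closedBall mem_ball isOpen_ball mem_ball_self ball_mem_nhds ball_subset_ball
  closedBall_subset_ball sphere_subset_closedBall)

/-- `f` is holomorphic within distance `ρ` of `z` and bounded by `C exp(-ε t²)` there. -/
def DecayNear (f : ℂ → ℂ) (ρ C ε t : ℝ) (z : ℂ) : Prop :=
  ∀ w, ‖w - z‖ ≤ ρ → DifferentiableAt ℂ f w ∧ ‖f w‖ ≤ C * rexp (-ε * t ^ 2)

theorem DecayNear.norm_deriv_le {f : ℂ → ℂ} {ρ C ε t : ℝ} {z : ℂ} (h : DecayNear f ρ C ε t z)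
    (hρ : 0 < ρ) : ‖deriv f z‖ ≤ C / ρ * rexp (-ε * t ^ 2) := by
  have := Complex.norm_deriv_le_of_forall_mem_sphere_norm_le (f := f) (c := z) (R := ρ)
    (C := C * rexp (-ε * t ^ 2)) hρ ?_ ?_
  · rw [div_mul_eq_mul_div]; exact this
  · apply DifferentiableOn.diffContOnCl
    rw [closure_ball _ hρ.ne']
    intro w hw
    exact (h w (by simpa [dist_eq_norm] using hw)).1.differentiableWithinAt
  · intro w hw
    exact (h w (by rw [mem_sphere_iff_norm] at hw; exact hw.le)).2

theorem DecayNear.continuousAt_deriv {f : ℂ → ℂ} {ρ C ε t : ℝ} {z : ℂ}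
    (h : DecayNear f ρ C ε t z) (hρ : 0 < ρ) : ContinuousAt (deriv f) z := by
  have : DifferentiableOn ℂ f (ball z ρ) := fun w hw =>
    (h w (by rw [mem_ball, dist_eq_norm] at hw; exact hw.le)).1.differentiableWithinAt
  exact (this.analyticAt (ball_mem_nhds z hρ)).deriv.continuousAt

theorem integrableOn_pow_mul_gauss (n : ℕ) {ε : ℝ} (hε : 0 < ε) :
    Integrable (fun t : ℝ => t ^ n * rexp (-ε * t ^ 2)) := by
  have := integrable_rpow_mul_exp_neg_mul_sq hε (s := n) (by have := n.cast_nonneg (α := ℝ); linarith)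
  simpa using this

theorem hasDerivAt_half_ray {f : ℂ → ℂ} {v d v' d' : ℝ → ℂ} {ρ C ε B : ℝ} (hρ : 0 < ρ)
    (hε : 0 < ε) (hC : 0 ≤ C)
    (hv : ∀ x, HasDerivAt v (v' x) x) (hd : ∀ x, HasDerivAt d (d' x) x)
    (hvB : ∀ x, ‖v' x‖ ≤ B) (hdB : ∀ x, ‖d x‖ ≤ B) (hdB' : ∀ x, ‖d' x‖ ≤ B)
    (hf : ∀ x, ∀ t : ℝ, 0 ≤ t → DecayNear f ρ C ε t (v x + t * d x)) (x₀ : ℝ) :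
    HasDerivAt (fun x => ∫ t in Ioi (0 : ℝ), d x * f (v x + t * d x))
      (-(v' x₀ * f (v x₀))) x₀ := by
  have hB : 0 ≤ B := (norm_nonneg _).trans (hvB 0)
  have hdiff : ∀ x t : ℝ, 0 ≤ t → DifferentiableAt ℂ f (v x + t * d x) := fun x t ht =>
    (hf x t ht _ (by simpa using hρ.le)).1
  have hbd : ∀ x t : ℝ, 0 ≤ t → ‖f (v x + t * d x)‖ ≤ C * rexp (-ε * t ^ 2) := fun x t ht =>
    (hf x t ht _ (by simpa using hρ.le)).2
  have hcont : ∀ x, ContinuousOn (fun t : ℝ => d x * f (v x + t * d x)) (Set.Ici 0) := by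
    intro x t ht
    apply ContinuousAt.continuousWithinAt
    refine continuousAt_const.mul ?_
    exact ContinuousAt.comp (f := fun t : ℝ => v x + t * d x) (g := f)
      (hdiff x t ht).continuousAt (by fun_prop)
  have hcont' : ContinuousOn (fun t : ℝ => d' x₀ * f (v x₀ + t * d x₀)
      + (v' x₀ + t * d' x₀) * (deriv f (v x₀ + t * d x₀) * d x₀)) (Set.Ici 0) := by
    intro t ht
    apply ContinuousAt.continuousWithinAt
    have h1 : ContinuousAt (fun t : ℝ => f (v x₀ + t * d x₀)) t :=
      ContinuousAt.comp (f := fun t : ℝ => v x₀ + t * d x₀) (g := f)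
      (hdiff x₀ t ht).continuousAt (by fun_prop)
    have h2 : ContinuousAt (fun t : ℝ => deriv f (v x₀ + t * d x₀)) t :=
      ContinuousAt.comp (f := fun t : ℝ => v x₀ + t * d x₀) (g := deriv f)
      ((hf x₀ t ht).continuousAt_deriv hρ) (by fun_prop)
    have h3 : ContinuousAt (fun t : ℝ => v' x₀ + t * d' x₀) t := by fun_prop
    exact (continuousAt_const.mul h1).add (h3.mul (h2.mul continuousAt_const))
  set bound : ℝ → ℝ := fun t => B * C * (t ^ 0 * rexp (-ε * t ^ 2))
      + B * (C / ρ) * B * (t ^ 0 * rexp (-ε * t ^ 2))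
      + B * (C / ρ) * B * (t ^ 1 * rexp (-ε * t ^ 2)) with hbound
  have hbi : Integrable bound (volume.restrict (Ioi 0)) := by
    apply Integrable.restrict
    have h0 := integrableOn_pow_mul_gauss 0 hε
    have h1 := integrableOn_pow_mul_gauss 1 hε
    exact ((h0.const_mul _).add (h0.const_mul _)).add (h1.const_mul _)
  have hFb : ∀ x t : ℝ, 0 ≤ t → ‖d' x * f (v x + t * d x)
      + (v' x + t * d' x) * (deriv f (v x + t * d x) * d x)‖ ≤ bound t := by
    intro x t ht
    have e := (Real.exp_pos (-ε * t ^ 2)).le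
    calc _ ≤ ‖d' x‖ * ‖f (v x + t * d x)‖
          + (‖v' x‖ + t * ‖d' x‖) * (‖deriv f (v x + t * d x)‖ * ‖d x‖) := by
          refine (norm_add_le _ _).trans ?_
          rw [norm_mul, norm_mul, norm_mul]
          gcongr
          refine (norm_add_le _ _).trans ?_
          rw [norm_mul, norm_real, Real.norm_of_nonneg ht]
      _ ≤ B * (C * rexp (-ε * t ^ 2))
          + (B + t * B) * (C / ρ * rexp (-ε * t ^ 2) * B) := by
          gcongr
          · exact hdB' x
          · exact hbd x t ht
          · exact hvB x
          · exact hdB' x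
          · exact (hf x t ht).norm_deriv_le hρ
          · exact hdB x
      _ = bound t := by simp only [hbound]; ring
  have key := hasDerivAt_integral_of_dominated_loc_of_deriv_le
    (μ := volume.restrict (Ioi (0 : ℝ))) (F := fun x (t : ℝ) => d x * f (v x + t * d x))
    (F' := fun x (t : ℝ) => d' x * f (v x + t * d x)
      + (v' x + t * d' x) * (deriv f (v x + t * d x) * d x)) (x₀ := x₀) (s := Set.univ)
    (bound := bound) univ_mem
    (.of_forall fun x => ((hcont x).mono Set.Ioi_subset_Ici_self).aestronglyMeasurable
      measurableSet_Ioi) ?_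
    ((hcont'.mono Set.Ioi_subset_Ici_self).aestronglyMeasurable measurableSet_Ioi) ?_ hbi ?_
  · refine key.2.congr_deriv ?_
    have hder : ∀ t ∈ Set.Ici (0 : ℝ), HasDerivAt
        (fun t : ℝ => (v' x₀ + t * d' x₀) * f (v x₀ + t * d x₀))
        (d' x₀ * f (v x₀ + t * d x₀)
      + (v' x₀ + t * d' x₀) * (deriv f (v x₀ + t * d x₀) * d x₀)) t := by
      intro t ht
      have h1 : HasDerivAt (fun t : ℝ => v' x₀ + t * d' x₀) (d' x₀) t := by
        simpa using ((hasDerivAt_id (t : ℂ)).comp_ofReal.mul_const (d' x₀)).const_add (v' x₀)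
      have h2 : HasDerivAt (fun t : ℝ => v x₀ + t * d x₀) (d x₀) t := by
        simpa using ((hasDerivAt_id (t : ℂ)).comp_ofReal.mul_const (d x₀)).const_add (v x₀)
      exact h1.mul ((hdiff x₀ t ht).hasDerivAt.comp t h2)
    have hlim : Tendsto (fun t : ℝ => (v' x₀ + t * d' x₀) * f (v x₀ + t * d x₀)) atTop (𝓝 0) := by
      have hg : Tendsto (fun t : ℝ => B * C * (t ^ 0 * rexp (-ε * t ^ 2))
        + B * C * (t ^ 1 * rexp (-ε * t ^ 2))) atTop (𝓝 0) := by
        have hp : ∀ n : ℕ, Tendsto (fun t : ℝ => t ^ n * rexp (-ε * t ^ 2)) atTop (𝓝 0) := by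
          intro n
          have h1 : Tendsto (fun t : ℝ => t ^ n * rexp (-ε * t)) atTop (𝓝 0) := by
            have := tendsto_rpow_mul_exp_neg_mul_atTop_nhds_zero n ε hε
            simpa using this
          refine squeeze_zero' ?_ ?_ h1
          · filter_upwards [eventually_ge_atTop 0] with t ht
            positivity
          · filter_upwards [eventually_ge_atTop 1] with t ht
            exact mul_le_mul_of_nonneg_left (Real.exp_le_exp.mpr (by nlinarith [mul_pos hε (zero_lt_one.trans_le ht)])) (by positivity)
        simpa using ((hp 0).const_mul (B * C)).add ((hp 1).const_mul (B * C))
      refine squeeze_zero_norm' ?_ hg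
      filter_upwards [eventually_ge_atTop 0] with t ht
      rw [norm_mul]
      calc _ ≤ (‖v' x₀‖ + t * ‖d' x₀‖) * ‖f (v x₀ + t * d x₀)‖ := by
            gcongr
            refine (norm_add_le _ _).trans ?_
            rw [norm_mul, norm_real, Real.norm_of_nonneg ht]
        _ ≤ (B + t * B) * (C * rexp (-ε * t ^ 2)) := by
            gcongr
            · exact hvB x₀
            · exact hdB' x₀
            · exact hbd x₀ t ht
        _ = _ := by ring
    have := integral_Ioi_of_hasDerivAt_of_tendsto' (a := 0) hder ?_ hlim
    · rw [this]; simp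
    · refine Integrable.mono' hbi
        ((hcont'.mono Set.Ioi_subset_Ici_self).aestronglyMeasurable measurableSet_Ioi) ?_
      filter_upwards [ae_restrict_mem measurableSet_Ioi] with t ht
      exact hFb x₀ t (le_of_lt ht)
  · refine Integrable.mono' hbi (((hcont x₀).mono Set.Ioi_subset_Ici_self).aestronglyMeasurable
      measurableSet_Ioi) ?_
    filter_upwards [ae_restrict_mem measurableSet_Ioi] with t ht
    have ht0 : 0 ≤ t := le_of_lt ht
    rw [norm_mul]
    calc _ ≤ B * (C * rexp (-ε * t ^ 2)) := by
          gcongr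
          · exact hdB x₀
          · exact hbd x₀ t ht0
      _ ≤ bound t := by
          simp only [hbound]
          have : 0 ≤ C / ρ := by positivity
          have e1 : 0 ≤ B * (C / ρ) * B * (t ^ 0 * rexp (-ε * t ^ 2)) := by positivity
          have e2 : 0 ≤ B * (C / ρ) * B * (t ^ 1 * rexp (-ε * t ^ 2)) := by positivity
          nlinarith
  · filter_upwards [ae_restrict_mem measurableSet_Ioi] with t ht x _
    exact hFb x t (le_of_lt ht)
  · filter_upwards [ae_restrict_mem measurableSet_Ioi] with t ht x _
    have h2 : HasDerivAt (fun x => v x + t * d x) (v' x + t * d' x) x :=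
      (hv x).add ((hd x).const_mul (t : ℂ))
    have h3 := (hd x).mul ((hdiff x t (le_of_lt ht)).hasDerivAt.comp x h2)
    exact h3.congr_deriv (by simp only [Function.comp_apply]; ring)

/-- The integral of `f` along the half line from `v` in the direction `d`. -/
def halfRay (v : ℝ) (d : ℂ) (f : ℂ → ℂ) : ℂ := ∫ t in Ioi (0 : ℝ), d * f (v + t * d)

/-- `(1 / 2πi) ∫ f` along the contour from `v + conj d ∞` to `v` and on to `v + d ∞`. -/
def ray (v : ℝ) (d : ℂ) (f : ℂ → ℂ) : ℂ :=
  (2 * π * I)⁻¹ * (halfRay v d f - halfRay v (conj d) f)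

/-- `(1 / 2πi) ∫ f` along the upward oriented vertical line through `a`. -/
def vl (a : ℝ) (f : ℂ → ℂ) : ℂ := (2 * π)⁻¹ * ∫ t : ℝ, f (a + t * I)

/-- `f` is holomorphic near the contour with vertex `v` and direction `d` and has Gaussian decay. -/
def RayDecay (f : ℂ → ℂ) (ρ C ε v : ℝ) (d : ℂ) : Prop :=
  ∀ t : ℝ, 0 ≤ t → DecayNear f ρ C ε t (v + t * d) ∧ DecayNear f ρ C ε t (v + t * conj d)

theorem integrableOn_halfRay {f : ℂ → ℂ} {ρ C ε v : ℝ} {d : ℂ} (hρ : 0 ≤ ρ) (hε : 0 < ε)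
    (h : ∀ t : ℝ, 0 ≤ t → DecayNear f ρ C ε t (v + t * d)) :
    IntegrableOn (fun t : ℝ => d * f (v + t * d)) (Ioi 0) := by
  have hi := (integrableOn_pow_mul_gauss 0 hε).const_mul C
  refine Integrable.const_mul ?_ d
  refine Integrable.mono' hi.restrict ?_ ?_
  · refine ContinuousOn.aestronglyMeasurable ?_ measurableSet_Ioi
    intro t ht
    apply ContinuousAt.continuousWithinAt
    exact ContinuousAt.comp (f := fun t : ℝ => v + t * d) (g := f)
      (h t (le_of_lt ht) _ (by simpa using hρ)).1.continuousAt (by fun_prop)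
  · filter_upwards [ae_restrict_mem measurableSet_Ioi] with t ht
    simpa using (h t (le_of_lt ht) _ (by simpa using hρ)).2

theorem ray_eq_of_homotopy {f : ℂ → ℂ} {v₀ v₁ : ℝ} {d₀ d₁ : ℂ} {ρ C ε : ℝ} (hρ : 0 < ρ)
    (hε : 0 < ε) (hC : 0 ≤ C)
    (hf : ∀ l : ℝ, 0 ≤ l → l ≤ 1 →
      RayDecay f ρ C ε (v₀ + l * (v₁ - v₀)) (d₀ + l * (d₁ - d₀))) :
    ray v₀ d₀ f = ray v₁ d₁ f := by
  have hs : ∀ x : ℝ, 0 ≤ Real.sin x ^ 2 ∧ Real.sin x ^ 2 ≤ 1 := fun x =>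
    ⟨sq_nonneg _, Real.sin_sq_le_one x⟩
  have hl : ∀ x : ℝ, HasDerivAt (fun x => ((Real.sin x ^ 2 : ℝ) : ℂ))
      ((2 * Real.sin x * Real.cos x : ℝ) : ℂ) x := fun x => by
    have := ((Real.hasDerivAt_sin x).pow 2).ofReal_comp
    simpa using this
  have hl' : ∀ x : ℝ, ‖((2 * Real.sin x * Real.cos x : ℝ) : ℂ)‖ ≤ 1 := fun x => by
    rw [norm_real, ← Real.sin_two_mul]; exact Real.abs_sin_le_one _
  have half : ∀ d₀ d₁ : ℂ, (∀ l : ℝ, 0 ≤ l → l ≤ 1 → ∀ t : ℝ, 0 ≤ t → DecayNear f ρ C ε t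
      ((v₀ + l * (v₁ - v₀) : ℝ) + t * (d₀ + l * (d₁ - d₀)))) → ∀ x : ℝ,
      HasDerivAt (fun x => halfRay (v₀ + Real.sin x ^ 2 * (v₁ - v₀))
        (d₀ + ((Real.sin x ^ 2 : ℝ) : ℂ) * (d₁ - d₀)) f)
        (-(((2 * Real.sin x * Real.cos x : ℝ) : ℂ) * (v₁ - v₀)
          * f (v₀ + ((Real.sin x ^ 2 : ℝ) : ℂ) * (v₁ - v₀)))) x := by
    intro d₀ d₁ h x
    have := hasDerivAt_half_ray (f := f)
      (v := fun x => v₀ + ((Real.sin x ^ 2 : ℝ) : ℂ) * (v₁ - v₀))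
      (d := fun x => d₀ + ((Real.sin x ^ 2 : ℝ) : ℂ) * (d₁ - d₀))
      (v' := fun x => ((2 * Real.sin x * Real.cos x : ℝ) : ℂ) * (v₁ - v₀))
      (d' := fun x => ((2 * Real.sin x * Real.cos x : ℝ) : ℂ) * (d₁ - d₀))
      (B := ‖(v₁ - v₀ : ℂ)‖ + ‖d₀‖ + ‖d₁ - d₀‖) hρ hε hC
      (fun x => ((hl x).mul_const _).const_add _) (fun x => ((hl x).mul_const _).const_add _)
      ?_ ?_ ?_ ?_ x
    · convert this using 2
      rw [halfRay]
      push_cast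
      rfl
    · intro x
      rw [norm_mul]
      have := mul_le_mul_of_nonneg_right (hl' x) (norm_nonneg (v₁ - v₀ : ℂ))
      linarith [norm_nonneg d₀, norm_nonneg (d₁ - d₀)]
    · intro x
      refine (norm_add_le _ _).trans ?_
      rw [norm_mul, norm_real, Real.norm_of_nonneg (hs x).1]
      have := mul_le_mul_of_nonneg_right (hs x).2 (norm_nonneg (d₁ - d₀ : ℂ))
      linarith [norm_nonneg (v₁ - v₀ : ℂ)]
    · intro x
      rw [norm_mul]
      have := mul_le_mul_of_nonneg_right (hl' x) (norm_nonneg (d₁ - d₀ : ℂ))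
      linarith [norm_nonneg d₀, norm_nonneg (v₁ - v₀ : ℂ)]
    · intro x t ht
      have := h (Real.sin x ^ 2) (hs x).1 (hs x).2 t ht
      push_cast at this ⊢
      exact this
  have h1 := half d₀ d₁ (fun l h0 h1 t ht => (hf l h0 h1 t ht).1)
  have h2 := half (conj d₀) (conj d₁) (fun l h0 h1 t ht => by
    have := (hf l h0 h1 t ht).2
    simpa using this)
  have h3 : ∀ x : ℝ, HasDerivAt (fun x => halfRay (v₀ + Real.sin x ^ 2 * (v₁ - v₀))
        (d₀ + ((Real.sin x ^ 2 : ℝ) : ℂ) * (d₁ - d₀)) f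
      - halfRay (v₀ + Real.sin x ^ 2 * (v₁ - v₀))
        (conj d₀ + ((Real.sin x ^ 2 : ℝ) : ℂ) * (conj d₁ - conj d₀)) f) 0 x := fun x =>
    ((h1 x).sub (h2 x)).congr_deriv (sub_self _)
  have h4 := is_const_of_deriv_eq_zero (fun x => (h3 x).differentiableAt) (fun x => (h3 x).deriv)
    0 (π / 2)
  simp only [ray]
  simp at h4
  rw [h4]

theorem integrable_vl {f : ℂ → ℂ} {ρ C ε v : ℝ} (hρ : 0 ≤ ρ) (hε : 0 < ε)
    (h : RayDecay f ρ C ε v I) : Integrable (fun t : ℝ => f (v + t * I)) := by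
  have h' : ∀ t : ℝ, DifferentiableAt ℂ f (v + t * I) ∧
      ‖f (v + t * I)‖ ≤ C * rexp (-ε * t ^ 2) := by
    intro t
    rcases le_total 0 t with ht | ht
    · exact (h t ht).1 _ (by simpa using hρ)
    · have := (h (-t) (by linarith)).2 (v + t * I) (by simpa using hρ)
      simpa using this
  have hi := (integrableOn_pow_mul_gauss 0 hε).const_mul C
  refine Integrable.mono' hi ?_ ?_
  · refine Continuous.aestronglyMeasurable ?_
    rw [continuous_iff_continuousAt]
    intro t
    exact ContinuousAt.comp (f := fun t : ℝ => (v : ℂ) + t * I) (g := f)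
      (h' t).1.continuousAt (by fun_prop)
  · filter_upwards with t
    simpa using (h' t).2

theorem ray_I_eq_vl {f : ℂ → ℂ} {v : ℝ} (h : Integrable (fun t : ℝ => f (v + t * I))) :
    ray v I f = vl v f := by
  rw [ray, vl, halfRay, halfRay, ← intervalIntegral.integral_Iic_add_Ioi (b := 0)
    h.integrableOn h.integrableOn]
  have h1 := integral_comp_neg_Ioi (0 : ℝ) (fun t : ℝ => f (v + t * I))
  simp only [neg_zero] at h1
  rw [← h1, integral_const_mul, integral_const_mul]
  simp only [conj_I, ofReal_neg, mul_neg, neg_mul]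
  have : (π : ℂ) ≠ 0 := by simp [Real.pi_ne_zero]
  push_cast
  field_simp
  ring

theorem exp_pi_div_three : cexp (π / 3 * I) = 1 / 2 + Real.sqrt 3 / 2 * I := by
  have : (π / 3 * I : ℂ) = ((π / 3 : ℝ) : ℂ) * I := by push_cast; ring
  rw [this, exp_mul_I, ← ofReal_cos, ← ofReal_sin, Real.cos_pi_div_three, Real.sin_pi_div_three]
  push_cast; ring

theorem exp_neg_pi_div_three : cexp (-(π / 3 * I)) = conj (cexp (π / 3 * I)) := by
  rw [← exp_conj]; congr 1; simp [map_div₀, Complex.conj_ofNat]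

theorem contourDown_eq_ray {f : ℂ → ℂ} {ρ C ε v : ℝ} (hρ : 0 ≤ ρ) (hε : 0 < ε)
    (h : RayDecay f ρ C ε v (cexp (π / 3 * I))) :
    contourDown v f = -ray v (cexp (π / 3 * I)) f := by
  rw [contourDown, ray, halfRay, halfRay, exp_neg_pi_div_three, integral_sub]
  · ring
  · exact integrableOn_halfRay hρ hε (fun t ht => (h t ht).2)
  · exact integrableOn_halfRay hρ hε (fun t ht => (h t ht).1)

theorem contourUp_eq_neg_contourDown (b : ℝ) (f : ℂ → ℂ) :
    contourUp b f = -contourDown (-b) (fun z => f (-z)) := by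
  have h1 : cexp (2 * π / 3 * I) = -cexp (-(π / 3 * I)) := by
    rw [← neg_one_mul, ← exp_pi_mul_I, ← exp_add]; congr 1; ring
  have h2 : cexp (-(2 * π / 3 * I)) = -cexp (π / 3 * I) := by
    rw [← inv_inj, ← exp_neg, neg_neg, h1, inv_neg, ← exp_neg]
  rw [contourUp, contourDown, neg_mul_eq_mul_neg (2 * π * I)⁻¹]
  congr 1
  rw [← integral_neg]
  refine integral_congr_ae (.of_forall fun t => ?_)
  simp only [h1, h2]
  push_cast
  ring_nf

theorem vl_neg (b : ℝ) (f : ℂ → ℂ) : vl b f = vl (-b) (fun z => f (-z)) := by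
  rw [vl, vl, ← integral_neg_eq_self]
  congr 2; ext t; push_cast; ring_nf

theorem vl_add_im (b y : ℝ) (f : ℂ → ℂ) : vl b (fun z => f (z + y * I)) = vl b f := by
  rw [vl, vl]
  congr 1
  have := integral_add_right_eq_self (μ := volume) (fun t : ℝ => f (b + t * I)) y
  rw [← this]
  congr 1; ext t; push_cast; ring_nf

theorem vl_add_re (b c : ℝ) (f : ℂ → ℂ) : vl b (fun z => f (z + c)) = vl (b + c) f := by
  rw [vl, vl]
  congr 2; ext t; push_cast; ring_nf

theorem contourDown_add_re (b c : ℝ) (f : ℂ → ℂ) :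
    contourDown b (fun z => f (z + c)) = contourDown (b + c) f := by
  rw [contourDown, contourDown]
  congr 2; ext t; push_cast; ring_nf

theorem contourUp_add_re (b c : ℝ) (f : ℂ → ℂ) :
    contourUp b (fun z => f (z + c)) = contourUp (b + c) f := by
  rw [contourUp, contourUp]
  congr 2; ext t; push_cast; ring_nf

theorem vl_gauss_div {h : ℝ} (hh : 0 < h) : vl h (fun z => cexp (z ^ 2) / z) = 1 / 2 := by
  have h1 : ∀ t : ℝ, cexp ((h + t * I) ^ 2) / (h + t * I)
      = ∫ l in Ioi (0 : ℝ), cexp ((h + t * I) ^ 2) * cexp (-(h + t * I) * l) := by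
    intro t
    rw [integral_const_mul, integral_exp_mul_complex_Ioi (by simpa using hh)]
    simp only [ofReal_zero, mul_zero, exp_zero]
    rw [div_eq_mul_inv, neg_div_neg_eq, one_div]
  have h2 : ∀ l : ℝ, ∫ t : ℝ, cexp ((h + t * I) ^ 2) * cexp (-(h + t * I) * l)
      = (Real.sqrt π * rexp (-(1 / 4) * l ^ 2) : ℝ) := by
    intro l
    have := GaussianFourier.integral_cexp_neg_mul_sq_add_real_mul_I (b := 1) (by simp) (l / 2 - h)
    have e : ∀ t : ℝ, cexp ((h + t * I) ^ 2) * cexp (-(h + t * I) * l)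
        = cexp (-1 * (t + ((l / 2 - h : ℝ) : ℂ) * I) ^ 2) * (rexp (-(1 / 4) * l ^ 2) : ℝ) := by
      intro t
      rw [ofReal_exp, ← exp_add, ← exp_add]
      congr 1
      push_cast
      linear_combination (t ^ 2 + (l / 2 - h) ^ 2 : ℂ) * I_sq
    simp_rw [e]
    rw [integral_mul_const, this]
    rw [div_one, ← ofReal_ofNat, ← ofReal_one, ← ofReal_div, ← ofReal_cpow Real.pi_pos.le,
      ← Real.sqrt_eq_rpow, ofReal_mul]
  rw [vl]
  simp_rw [h1]
  rw [integral_integral_swap]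
  · simp_rw [h2]
    rw [integral_complex_ofReal, integral_const_mul, integral_gaussian_Ioi]
    have : Real.sqrt π * (Real.sqrt (π / (1 / 4)) / 2) = π := by
      rw [show π / (1 / 4) = 2 ^ 2 * π by ring, Real.sqrt_mul (by norm_num),
        Real.sqrt_sq (by norm_num)]
      rw [mul_div_assoc', mul_left_comm, Real.mul_self_sqrt Real.pi_pos.le]
      ring
    rw [this]
    have : (π : ℂ) ≠ 0 := by simp [Real.pi_ne_zero]
    simp; field_simp
  · have i1 : Integrable (fun t : ℝ => rexp (h ^ 2) * rexp (-1 * t ^ 2)) :=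
      (integrable_exp_neg_mul_sq one_pos).const_mul _
    have i2 : IntegrableOn (fun l : ℝ => rexp (-h * l)) (Ioi 0) :=
      integrableOn_exp_mul_Ioi (by linarith) 0
    refine (i1.mul_prod i2).mono' (Continuous.aestronglyMeasurable ?_) ?_
    · simp only [Function.uncurry_def]; fun_prop
    · filter_upwards with p
      simp only [Function.uncurry_def]
      rw [norm_mul, norm_exp, norm_exp, ← Real.exp_add]
      rw [← Real.exp_add, ← Real.exp_add]
      apply le_of_eq
      congr 1
      simp [pow_two]; ring

/-- Directions between `exp (iπ/3)` and `i`. -/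
def SteepDir (d : ℂ) : Prop := 0 ≤ d.re ∧ d.re ≤ 1 / 2 ∧ 4 / 5 ≤ d.im ∧ d.im ≤ 1

theorem steepDir_I : SteepDir I := by norm_num [SteepDir]
theorem steepDir_exp : SteepDir (cexp (π / 3 * I)) := by
  rw [exp_pi_div_three]
  have h1 : (4 / 5 : ℝ) ≤ Real.sqrt 3 / 2 := by
    have : (8 / 5 : ℝ) ≤ Real.sqrt 3 := Real.le_sqrt_of_sq_le (by norm_num)
    linarith
  have h2 : Real.sqrt 3 / 2 ≤ (1 : ℝ) := by
    have : Real.sqrt 3 ≤ 2 := by rw [Real.sqrt_le_left (by norm_num)]; norm_num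
    linarith
  refine ⟨?_, ?_, ?_, ?_⟩ <;> simp <;> linarith

theorem SteepDir.segment {d e : ℂ} (hd : SteepDir d) (he : SteepDir e) {l : ℝ} (h0 : 0 ≤ l)
    (h1 : l ≤ 1) : SteepDir (d + l * (e - d)) := by
  obtain ⟨a1, a2, a3, a4⟩ := hd
  obtain ⟨b1, b2, b3, b4⟩ := he
  refine ⟨?_, ?_, ?_, ?_⟩ <;> simp <;> nlinarith

/-- `w` is close to the point at time `t` of a contour with vertex `v` and a steep direction. -/
structure NearRay (v M ρ t : ℝ) (w : ℂ) : Prop where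
  re_le : w.re ≤ M + t / 2
  le_re : -M ≤ w.re
  le_im : 4 / 5 * t - 1 ≤ |w.im|
  im_le : |w.im| ≤ t + 1
  le_re' : v - ρ ≤ w.re
  re_le' : w.re ≤ v + 2 * ρ + |w.im|

theorem nearRay {v M ρ t : ℝ} {d w : ℂ} (hd : SteepDir d) (hM : |v| + 1 ≤ M) (hρ : ρ ≤ 1)
    (ht : 0 ≤ t) (hw : ‖w - (v + t * d)‖ ≤ ρ) : NearRay v M ρ t w := by
  obtain ⟨a1, a2, a3, a4⟩ := hd
  have h1 := (abs_re_le_norm _).trans hw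
  have h2 := (abs_im_le_norm _).trans hw
  simp only [sub_re, add_re, ofReal_re, mul_re, ofReal_im, zero_mul, sub_zero, sub_im, add_im,
    mul_im, zero_add, add_zero] at h1 h2
  rw [abs_le] at h1 h2
  have := abs_le.mp (show |v| ≤ M - 1 by linarith)
  have e1 := mul_le_mul_of_nonneg_left a2 ht
  have e2 := mul_le_mul_of_nonneg_left a3 ht
  have e3 := mul_le_mul_of_nonneg_left a4 ht
  have e4 := mul_nonneg ht a1
  have e5 := le_abs_self w.im
  refine ⟨?_, ?_, ?_, ?_, ?_, ?_⟩ <;> try linarith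
  rw [abs_le]; constructor <;> linarith

theorem nearRay_conj {v M ρ t : ℝ} {d w : ℂ} (hd : SteepDir d) (hM : |v| + 1 ≤ M) (hρ : ρ ≤ 1)
    (ht : 0 ≤ t) (hw : ‖w - (v + t * conj d)‖ ≤ ρ) : NearRay v M ρ t w := by
  have h := nearRay (w := conj w) hd hM hρ ht (by
    rw [← norm_conj]; simpa using hw)
  obtain ⟨h1, h2, h3, h4, h5, h6⟩ := h
  simp only [conj_re, conj_im, abs_neg] at *
  exact ⟨h1, h2, h3, h4, h5, h6⟩

theorem rayDecay_of_nearRay {f : ℂ → ℂ} {v M ρ C ε : ℝ} {d : ℂ} (hd : SteepDir d)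
    (hM : |v| + 1 ≤ M) (hρ : ρ ≤ 1)
    (h : ∀ t w, 0 ≤ t → NearRay v M ρ t w →
      DifferentiableAt ℂ f w ∧ ‖f w‖ ≤ C * rexp (-ε * t ^ 2)) :
    RayDecay f ρ C ε v d := fun t ht =>
  ⟨fun w hw => h t w ht (nearRay hd hM hρ ht hw), fun w hw => h t w ht (nearRay_conj hd hM hρ ht hw)⟩

theorem NearRay.dist_le {v M ρ t p : ℝ} {w : ℂ} (h : NearRay v M ρ t w) (hρ : 8 * ρ ≤ |v - p|) :
    |v - p| / 4 ≤ ‖w - p‖ := by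
  have h1 := abs_re_le_norm (w - p)
  have h2 := abs_im_le_norm (w - p)
  simp only [sub_re, ofReal_re, sub_im, ofReal_im, sub_zero] at h1 h2
  have h3 := h.le_re'
  have h4 := h.re_le'
  rcases abs_cases (v - p) with ⟨e, _⟩ | ⟨e, _⟩ <;> rw [e] at hρ ⊢
  · have := le_abs_self (w.re - p)
    linarith
  · have := neg_abs_le (w.re - p)
    by_cases h5 : |w.im| < -(v - p) / 4
    · linarith
    · linarith

theorem exists_gauss_bound (k D p M : ℝ) (hk : 0 < k) : ∃ C : ℝ, ∀ (v ρ t : ℝ) (w : ℂ), 0 ≤ t →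
    NearRay v M ρ t w → (k * (w - p) ^ 2 - D * w : ℂ).re ≤ C - k / 20 * t ^ 2 := by
  set N := |M| + |p| with hN
  set C₁ := N ^ 2 + 1 + (N + 2) ^ 2 with hC₁
  refine ⟨k * C₁ + |D| * (|M| + 10 * |D| / k), fun v ρ t w ht h => ?_⟩
  have hre : (k * (w - p) ^ 2 - D * w : ℂ).re = k * ((w.re - p) ^ 2 - w.im ^ 2) - D * w.re := by
    simp [pow_two]
  rw [hre]
  have h1 : |w.re - p| ≤ N + t / 2 := by
    have := h.re_le; have := h.le_re; have := le_abs_self M; have := abs_le.mp (le_refl |p|)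
    rw [abs_le]; constructor <;> linarith [abs_nonneg M]
  have hN0 : 0 ≤ N := by positivity
  have h2 : (w.re - p) ^ 2 ≤ (N + t / 2) ^ 2 := by
    rw [← sq_abs]; gcongr
  have h3 : 16 / 25 * t ^ 2 - 8 / 5 * t - 1 ≤ w.im ^ 2 := by
    rw [← sq_abs w.im]
    have := h.le_im
    rcases le_total (4 / 5 * t - 1) 0 with h0 | h0
    · have h5 : 16 / 25 * t ^ 2 - 8 / 5 * t - 1 = (4 / 5 * t - 1) * (4 / 5 * t) - (4 / 5 * t + 1) := by ring
      have h6 := mul_nonneg (neg_nonneg.mpr h0) ht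
      linarith [sq_nonneg |w.im|]
    · linarith [pow_le_pow_left₀ h0 this 2]
  have h4 : (w.re - p) ^ 2 - w.im ^ 2 ≤ C₁ - t ^ 2 / 10 := by
    linarith [sq_nonneg ((N + 2) - t / 2), sq_nonneg t]
  have h5 : -(D * w.re) ≤ |D| * (|M| + t / 2) := by
    have : |w.re| ≤ |M| + t / 2 := by
      have := h.re_le; have := h.le_re; have := le_abs_self M
      rw [abs_le]; constructor <;> linarith
    calc -(D * w.re) ≤ |D * w.re| := neg_le_abs _
      _ = |D| * |w.re| := abs_mul _ _
      _ ≤ _ := by gcongr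
  have h6 : |D| * (t / 2) ≤ |D| * (10 * |D| / k) + k / 20 * t ^ 2 := by
    have : |D| * (10 * |D| / k) + k / 20 * t ^ 2 - |D| * (t / 2)
        = 1 / k * (10 * (|D| - k * t / 40) ^ 2 + 7 / 160 * (k * t) ^ 2) := by
      field_simp; ring
    have h7 : 0 ≤ 1 / k * (10 * (|D| - k * t / 40) ^ 2 + 7 / 160 * (k * t) ^ 2) := by positivity
    linarith
  have h8 := mul_le_mul_of_nonneg_left h4 hk.le
  linarith

theorem exists_cubic_bound (γ M κ : ℝ) (hκ : 0 < κ) (hκ1 : κ ≤ 1) : ∃ C : ℝ,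
    ∀ (v ρ t : ℝ) (w : ℂ), 0 ≤ t → NearRay v M ρ t w → (κ ≤ w.re ∨ t / 2 - M ≤ w.re) →
      (w ^ 3 / 3 - w * γ : ℂ).re ≤ C - κ / 4 * t ^ 2 := by
  set N := |M| + 1 with hN
  have hN1 : 1 ≤ N := by have := abs_nonneg M; linarith
  set P := 20 * N ^ 2 + |γ| with hP
  have hP0 : 0 ≤ P := by positivity
  set T := 2 * N + 4 * P + 4 with hT
  set C := (N + T) ^ 3 + (N + T) * (T + 1) ^ 2 + |γ| * (N + T) + T ^ 2 with hC
  refine ⟨C, fun v ρ t w ht h hor => ?_⟩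
  have hre : (w ^ 3 / 3 - w * γ : ℂ).re = -w.re * (w.im ^ 2 - w.re ^ 2 / 3) - γ * w.re := by
    have : (w ^ 3 / 3 : ℂ).re = w.re ^ 3 / 3 - w.re * w.im ^ 2 := by
      rw [show (3 : ℂ) = ((3 : ℝ) : ℂ) by norm_num, div_ofReal_re]
      simp [pow_succ]; ring
    rw [sub_re, this]; simp; ring
  rw [hre]
  have hM := le_abs_self M
  have hM' := neg_abs_le M
  have hx : |w.re| ≤ N + t := by
    have := h.re_le; have := h.le_re
    rw [abs_le]; constructor <;> linarith
  have hγ : -(γ * w.re) ≤ |γ| * |w.re| := by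
    rw [← abs_mul]; exact neg_le_abs _
  rcases le_total t T with htT | htT
  · have hx' : |w.re| ≤ N + T := by linarith
    have e1 : -w.re * (w.im ^ 2 - w.re ^ 2 / 3) ≤ |w.re| ^ 3 + |w.re| * |w.im| ^ 2 := by
      have a1 := le_abs_self w.re
      have a2 := neg_le_abs w.re
      rw [sq_abs]
      have a3 : |w.re| ^ 3 = |w.re| * w.re ^ 2 := by rw [pow_succ', sq_abs]
      rw [a3]
      have a4 := sq_nonneg w.re
      have a5 := sq_nonneg w.im
      have a6 := mul_le_mul_of_nonneg_right a1 a4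
      have a7 := mul_le_mul_of_nonneg_right a2 a5
      have a8 := mul_nonneg (abs_nonneg w.re) a4
      linarith
    have e2 : |w.re| ^ 3 ≤ (N + T) ^ 3 := by gcongr
    have e3 : |w.re| * |w.im| ^ 2 ≤ (N + T) * (T + 1) ^ 2 := by
      have := h.im_le
      gcongr; linarith
    have e4 : |γ| * |w.re| ≤ |γ| * (N + T) := by gcongr
    have e5 : κ / 4 * t ^ 2 ≤ T ^ 2 := by
      have : t ^ 2 ≤ T ^ 2 := by gcongr
      have := mul_le_mul_of_nonneg_right hκ1 (sq_nonneg t)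
      linarith [sq_nonneg T]
    linarith
  · have hx1 : κ ≤ w.re := by
      rcases hor with h1 | h1
      · exact h1
      · linarith
    have h3 : 16 / 25 * t ^ 2 - 8 / 5 * t - 1 ≤ w.im ^ 2 := by
      rw [← sq_abs w.im]
      linarith [pow_le_pow_left₀ (by linarith) h.le_im 2]
    have h4 : w.re ^ 2 ≤ (N + t / 2) ^ 2 := by
      have := h.re_le
      gcongr
      · linarith
      · linarith
    have h5 : w.im ^ 2 - w.re ^ 2 / 3 ≥ t ^ 2 / 2 - P + |γ| := by
      have hN2 : 1 ≤ N ^ 2 := one_le_pow₀ hN1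
      have := mul_nonneg (sub_nonneg.mpr hN1) ht
      linarith [sq_nonneg (17 * t - 290 * N)]
    have h6 : t ^ 2 / 2 - P ≥ t ^ 2 / 4 := by
      have := mul_nonneg ht (by linarith : 0 ≤ t - 1)
      linarith
    have hx0 : 0 ≤ w.re := by linarith
    have h7 : |w.re| = w.re := abs_of_nonneg hx0
    rw [h7] at hγ
    have hC0 : 0 ≤ C := by positivity
    linarith [mul_le_mul_of_nonneg_left h5 hx0, mul_le_mul_of_nonneg_left h6 hx0, mul_le_mul_of_nonneg_right hx1 (sq_nonneg t)]

theorem RayDecay.integrableOn_add {f : ℂ → ℂ} {ρ C ε v : ℝ} {d : ℂ} (hρ : 0 ≤ ρ) (hε : 0 < ε)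
    (h : RayDecay f ρ C ε v d) : IntegrableOn (fun t : ℝ => d * f (v + t * d)) (Ioi 0) ∧
      IntegrableOn (fun t : ℝ => conj d * f (v + t * conj d)) (Ioi 0) :=
  ⟨integrableOn_halfRay hρ hε (fun t ht => (h t ht).1),
    integrableOn_halfRay hρ hε (fun t ht => (h t ht).2)⟩

theorem ray_gauss_div {v p : ℝ} {d : ℂ} (hd : SteepDir d) (hvp : v ≠ p) :
    (∃ ρ C ε, 0 < ρ ∧ 0 < ε ∧ RayDecay (fun z => cexp ((z - p) ^ 2) / (z - p)) ρ C ε v d) ∧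
    ray v d (fun z => cexp ((z - p) ^ 2) / (z - p)) = if p < v then 1 / 2 else -(1 / 2) := by
  have hpos : 0 < |v - p| := abs_pos.mpr (sub_ne_zero.mpr hvp)
  set ρ := min 1 (|v - p| / 8) with hρ
  have hρ0 : 0 < ρ := by positivity
  have hρ1 : ρ ≤ 1 := min_le_left _ _
  have hρ8 : 8 * ρ ≤ |v - p| := by have := min_le_right 1 (|v - p| / 8); linarith
  obtain ⟨C, hC⟩ := exists_gauss_bound 1 0 p (|v| + 1) one_pos
  have key : ∀ e, SteepDir e → RayDecay (fun z => cexp ((z - p) ^ 2) / (z - p)) ρ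
      (rexp C / (|v - p| / 4)) (1 / 20) v e := by
    intro e he
    refine rayDecay_of_nearRay he le_rfl hρ1 fun t w ht hw => ?_
    have hd := hw.dist_le hρ8
    have hne : w - p ≠ 0 := norm_pos_iff.mp (by linarith)
    constructor
    · fun_prop (disch := exact hne)
    · rw [norm_div, norm_exp, div_mul_eq_mul_div, ← Real.exp_add]
      have := hC v ρ t w ht hw
      simp only [ofReal_one, one_mul, ofReal_zero, zero_mul, sub_zero] at this
      gcongr
      linarith
  refine ⟨⟨ρ, _, _, hρ0, by norm_num, key d hd⟩, ?_⟩
  have h1 : ray v d (fun z => cexp ((z - p) ^ 2) / (z - p))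
      = ray v I (fun z => cexp ((z - p) ^ 2) / (z - p)) := by
    refine ray_eq_of_homotopy (ρ := ρ) (C := rexp C / (|v - p| / 4)) (ε := 1 / 20) hρ0
      (by norm_num) (by positivity) fun l h0 h1 => ?_
    have := key _ (hd.segment steepDir_I h0 h1)
    simpa using this
  rw [h1, ray_I_eq_vl (integrable_vl hρ0.le (by norm_num) (key _ steepDir_I))]
  have h2 : vl v (fun z => cexp ((z - p) ^ 2) / (z - p))
      = vl (v - p) (fun z => cexp (z ^ 2) / z) := by
    have := vl_add_re v (-p) (fun z => cexp (z ^ 2) / z)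
    simpa [sub_eq_add_neg] using this
  rw [h2]
  split_ifs with h3
  · exact vl_gauss_div (by linarith)
  · have h4 : v < p := lt_of_le_of_ne (not_lt.mp h3) hvp
    rw [vl_neg]
    have h5 := vl_gauss_div (h := -(v - p)) (by linarith)
    rw [← h5]
    simp only [vl, neg_sq, div_neg, integral_neg, mul_neg]

theorem ray_cross {F : ℂ → ℂ} {v₀ v₁ p ρ C ε : ℝ} {d : ℂ} (hd : SteepDir d) (hρ : 0 < ρ)
    (hε : 0 < ε) (hC : 0 ≤ C) (h₀ : v₀ < p) (h₁ : p < v₁)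
    (hF : ∀ l : ℝ, 0 ≤ l → l ≤ 1 → RayDecay F ρ C ε (v₀ + l * (v₁ - v₀)) d) :
    ray v₁ d (fun z => F z / (z - p)) = ray v₀ d (fun z => F z / (z - p)) + F p := by
  set E : ℂ → ℂ := fun z => cexp ((z - p) ^ 2) with hE
  set G : ℂ → ℂ := fun z => F z - F p * E z with hG
  set h : ℂ → ℂ := dslope G p with hh
  have hEd : Differentiable ℂ E := by simp only [hE]; fun_prop
  have hGp : G p = 0 := by simp [hG, hE]
  have hne : ∀ z : ℂ, z ≠ p → h z = F z / (z - p) - F p * (E z / (z - p)) := by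
    intro z hz
    have hz' : z - p ≠ 0 := sub_ne_zero.mpr hz
    simp only [hh]
    rw [dslope_of_ne _ hz, slope_def_field, hGp, sub_zero]
    simp only [hG]; field_simp
  have hpd : ∀ w : ℂ, ‖w - p‖ ≤ ρ → DifferentiableAt ℂ F w := by
    have hl : (0 : ℝ) ≤ (p - v₀) / (v₁ - v₀) := by apply div_nonneg <;> linarith
    have hl' : (p - v₀) / (v₁ - v₀) ≤ 1 := by rw [div_le_one (by linarith)]; linarith
    have := (hF _ hl hl' 0 le_rfl).1
    rw [div_mul_cancel₀ _ (by linarith : (v₁ - v₀) ≠ 0)] at this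
    intro w hw
    exact (this w (by simpa using hw)).1
  set M := |v₀| + |v₁| + 1 with hM
  obtain ⟨C₂, hC₂⟩ := exists_gauss_bound 1 0 p M one_pos
  set ρ' := min (ρ / 2) 1 with hρ'
  have hρ'0 : 0 < ρ' := by positivity
  have hρ'1 : ρ' ≤ 1 := min_le_right _ _
  have hρ'2 : ρ' ≤ ρ / 2 := min_le_left _ _
  have hball : ∀ w : ℂ, ‖w - p‖ ≤ ρ' → DifferentiableAt ℂ h w := by
    intro w hw
    have hopen : ball (p : ℂ) ρ ∈ 𝓝 (p : ℂ) := ball_mem_nhds _ hρ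
    have hGd : DifferentiableOn ℂ G (ball (p : ℂ) ρ) := by
      intro z hz
      rw [mem_ball, dist_eq_norm] at hz
      exact ((hpd z hz.le).sub ((hEd z).const_mul _)).differentiableWithinAt
    have := (Complex.differentiableOn_dslope hopen).mpr hGd
    refine (this w ?_).differentiableAt (Metric.isOpen_ball.mem_nhds ?_) <;>
    · rw [mem_ball, dist_eq_norm]; linarith
  obtain ⟨B, hB⟩ := (isCompact_closedBall (p : ℂ) ρ').exists_bound_of_continuousOn
    (f := h) (fun w hw => (hball w (by simpa [dist_eq_norm] using hw)).continuousAt.continuousWithinAt)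
  set ε' := min ε (1 / 20) with hε'
  have hε'0 : 0 < ε' := by positivity
  set T := (ρ' + 1) * (5 / 4) with hT
  set C' := (C + ‖F p‖ * rexp C₂) / ρ' + |B| * rexp (ε' * T ^ 2) with hC'
  have hC'0 : 0 ≤ C' := by positivity
  have hMl : ∀ l : ℝ, 0 ≤ l → l ≤ 1 → |v₀ + l * (v₁ - v₀)| + 1 ≤ M := by
    intro l h0 h1
    have : |v₀ + l * (v₁ - v₀)| ≤ (1 - l) * |v₀| + l * |v₁| := by
      rw [show v₀ + l * (v₁ - v₀) = (1 - l) * v₀ + l * v₁ by ring]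
      refine (abs_add_le _ _).trans ?_
      rw [abs_mul, abs_mul, abs_of_nonneg h0, abs_of_nonneg (by linarith : 0 ≤ 1 - l)]
    have e0 := mul_nonneg h0 (abs_nonneg v₀)
    have e1 := mul_nonneg (sub_nonneg.mpr h1) (abs_nonneg v₁)
    linarith
  have hdec : ∀ l : ℝ, 0 ≤ l → l ≤ 1 → RayDecay h ρ' C' ε' (v₀ + l * (v₁ - v₀)) d := by
    intro l h0 h1
    have main : ∀ t w, 0 ≤ t → NearRay (v₀ + l * (v₁ - v₀)) M ρ' t w →
        (DifferentiableAt ℂ F w ∧ ‖F w‖ ≤ C * rexp (-ε * t ^ 2)) →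
        DifferentiableAt ℂ h w ∧ ‖h w‖ ≤ C' * rexp (-ε' * t ^ 2) := by
      intro t w ht hw hFw
      have ee : rexp (-ε * t ^ 2) ≤ rexp (-ε' * t ^ 2) := by
        apply Real.exp_le_exp.mpr
        have := mul_le_mul_of_nonneg_right (min_le_left ε (1 / 20)) (sq_nonneg t)
        linarith
      by_cases hwp : ‖w - p‖ ≤ ρ'
      · refine ⟨hball w hwp, ?_⟩
        have h1 : ‖h w‖ ≤ |B| := (hB w (by simpa [dist_eq_norm] using hwp)).trans (le_abs_self B)
        have htT : t ≤ T := by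
          have a1 := hw.le_im
          have a2 := (abs_im_le_norm (w - p)).trans hwp
          simp only [sub_im, ofReal_im, sub_zero] at a2
          linarith
        have h2 : 1 ≤ rexp (ε' * T ^ 2) * rexp (-ε' * t ^ 2) := by
          rw [← Real.exp_add]
          apply Real.one_le_exp
          have : t ^ 2 ≤ T ^ 2 := by gcongr
          linarith [mul_le_mul_of_nonneg_left this hε'0.le]
        calc ‖h w‖ ≤ |B| * 1 := by simpa using h1
          _ ≤ |B| * (rexp (ε' * T ^ 2) * rexp (-ε' * t ^ 2)) := by gcongr
          _ ≤ C' * rexp (-ε' * t ^ 2) := by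
            rw [← mul_assoc]
            gcongr
            have : 0 ≤ (C + ‖F p‖ * rexp C₂) / ρ' := by positivity
            linarith
      · push Not at hwp
        have hwne : w ≠ p := by rintro rfl; simp at hwp; linarith
        have hw0 : w - p ≠ 0 := sub_ne_zero.mpr hwne
        refine ⟨?_, ?_⟩
        · exact (differentiableAt_dslope_of_ne hwne).mpr (hFw.1.sub ((hEd w).const_mul _))
        · have hEw : ‖E w‖ ≤ rexp C₂ * rexp (-ε' * t ^ 2) := by
            simp only [hE]
            rw [norm_exp, ← Real.exp_add]
            apply Real.exp_le_exp.mpr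
            have := hC₂ _ _ t w ht hw
            simp only [ofReal_one, one_mul, ofReal_zero, zero_mul, sub_zero] at this
            have := mul_le_mul_of_nonneg_right (min_le_right ε (1 / 20)) (sq_nonneg t)
            linarith
          rw [hne w hwne, mul_div_assoc', ← sub_div, norm_div]
          calc _ ≤ (C * rexp (-ε' * t ^ 2)
                + ‖F p‖ * (rexp C₂ * rexp (-ε' * t ^ 2))) / ρ' := by
                gcongr
                refine (norm_sub_le _ _).trans ?_
                rw [norm_mul]
                gcongr
                exact hFw.2.trans (by gcongr)
            _ = (C + ‖F p‖ * rexp C₂) / ρ' * rexp (-ε' * t ^ 2) := by ring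
            _ ≤ _ := by
              gcongr
              have : 0 ≤ |B| * rexp (ε' * T ^ 2) := by positivity
              linarith
    intro t ht
    refine ⟨fun w hw => main t w ht ?_ ?_, fun w hw => main t w ht ?_ ?_⟩
    · exact nearRay hd (hMl l h0 h1) hρ'1 ht (by push_cast at hw ⊢; exact hw)
    · exact (hF l h0 h1 t ht).1 w (by push_cast at hw ⊢; linarith)
    · exact nearRay_conj hd (hMl l h0 h1) hρ'1 ht (by push_cast at hw ⊢; exact hw)
    · exact (hF l h0 h1 t ht).2 w (by push_cast at hw ⊢; linarith)
  have hhom : ray v₀ d h = ray v₁ d h := by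
    refine ray_eq_of_homotopy hρ'0 hε'0 hC'0 fun l h0 h1 => ?_
    simpa using hdec l h0 h1
  have hnp : ∀ v : ℝ, v ≠ p → ∀ t : ℝ, 0 < t → (v + t * d : ℂ) ≠ p ∧ (v + t * conj d : ℂ) ≠ p := by
    intro v hv t ht
    have : 0 < t * d.im := mul_pos ht (by linarith [hd.2.2.1])
    constructor <;>
    · intro hc
      have h0 := congrArg im hc
      simp only [add_im, ofReal_im, im_ofReal_mul, conj_im, zero_add, mul_neg] at h0
      linarith
  have hsplit : ∀ v : ℝ, v ≠ p → RayDecay h ρ' C' ε' v d →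
      ray v d (fun z => F z / (z - p)) = ray v d h + F p * ray v d (fun z => E z / (z - p)) := by
    intro v hv hdv
    obtain ⟨⟨ρ₂, C₃, ε₂, r0, e0, hg⟩, -⟩ := ray_gauss_div hd hv
    have i1 := hdv.integrableOn_add hρ'0.le hε'0
    have i2 := hg.integrableOn_add r0.le e0
    have hs : ∀ e : ℂ, (∀ t : ℝ, 0 < t → (v + t * e : ℂ) ≠ p) →
        IntegrableOn (fun t : ℝ => e * h (v + t * e)) (Ioi 0) →
        IntegrableOn (fun t : ℝ => e * (E (v + t * e) / (v + t * e - p))) (Ioi 0) →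
        halfRay v e (fun z => F z / (z - p)) = halfRay v e h
          + F p * halfRay v e (fun z => E z / (z - p)) := fun e he i1 i2 => by
      rw [halfRay, halfRay, halfRay, ← integral_const_mul, ← integral_add i1 (i2.const_mul _)]
      refine setIntegral_congr_fun measurableSet_Ioi fun t ht => ?_
      beta_reduce
      rw [hne _ (he t ht)]; ring
    rw [ray, ray, ray, hs d (fun t ht => (hnp v hv t ht).1) i1.1 i2.1,
      hs (conj d) (fun t ht => (hnp v hv t ht).2) i1.2 i2.2]
    ring
  rw [hsplit v₁ h₁.ne' (by simpa using hdec 1 zero_le_one le_rfl),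
    hsplit v₀ h₀.ne (by simpa using hdec 0 le_rfl zero_le_one), ← hhom,
    (ray_gauss_div hd h₁.ne').2, (ray_gauss_div hd h₀.ne).2, if_pos h₁, if_neg h₀.not_gt]
  ring

/-- An entire function that decays along steep contours, also along vertical lines to the right
of `b`. -/
structure DecayExp (e : ℂ → ℂ) (b : ℝ) : Prop where
  diff : Differentiable ℂ e
  bound : ∀ M κ : ℝ, 0 < κ → ∃ C ε : ℝ, 0 ≤ C ∧ 0 < ε ∧ ∀ (v ρ t : ℝ) (w : ℂ), 0 ≤ t →
    NearRay v M ρ t w → (b + κ ≤ w.re ∨ t / 2 - M ≤ w.re) → ‖e w‖ ≤ C * rexp (-ε * t ^ 2)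

/-- The exponential of `z³/3 - x z`. -/
def aexp (x z : ℂ) : ℂ := cexp (z ^ 3 / 3 - z * x)

theorem decayExp_aexp (γ : ℝ) : DecayExp (aexp γ) 0 := by
  refine ⟨by unfold aexp; fun_prop, fun M κ hκ => ?_⟩
  obtain ⟨C, hC⟩ := exists_cubic_bound γ M (min κ 1) (by positivity) (min_le_right _ _)
  refine ⟨rexp C, min κ 1 / 4, by positivity, by positivity, fun v ρ t w ht hw h => ?_⟩
  rw [aexp, norm_exp, ← Real.exp_add]
  apply Real.exp_le_exp.mpr
  have := hC v ρ t w ht hw (h.imp_left fun h => by have := min_le_left κ 1; linarith)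
  linarith

theorem decayExp_gauss {k : ℝ} (hk : 0 < k) (D b : ℝ) :
    DecayExp (fun z => cexp (-z * D + k * z ^ 2)) b := by
  refine ⟨by fun_prop, fun M κ hκ => ?_⟩
  obtain ⟨C, hC⟩ := exists_gauss_bound k D 0 M hk
  refine ⟨rexp C, k / 20, by positivity, by positivity, fun v ρ t w ht hw h => ?_⟩
  rw [norm_exp, ← Real.exp_add]
  apply Real.exp_le_exp.mpr
  have := hC v ρ t w ht hw
  rw [show (-w * D + k * w ^ 2 : ℂ) = k * (w - (0 : ℝ)) ^ 2 - D * w by push_cast; ring]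
  linarith

/-- `R` is holomorphic and bounded by `M` in the region of all points to the right of `lo` and
to the left of a wedge with vertex `hi`. -/
def RegOn (R : ℂ → ℂ) (lo hi M : ℝ) : Prop :=
  ∀ z : ℂ, lo ≤ z.re → z.re ≤ hi + |z.im| → DifferentiableAt ℂ R z ∧ ‖R z‖ ≤ M

theorem RegOn.mono {R : ℂ → ℂ} {lo hi lo' hi' M : ℝ} (h : RegOn R lo hi M) (h1 : lo ≤ lo')
    (h2 : hi' ≤ hi) : RegOn R lo' hi' M := fun z a b => h z (by linarith) (by linarith)

theorem RegOn.nonneg {R : ℂ → ℂ} {lo hi M : ℝ} (h : RegOn R lo hi M) (hl : lo ≤ hi) : 0 ≤ M :=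
  (norm_nonneg _).trans (h lo (by simp) (by simpa using hl)).2

theorem regOn_const (c : ℂ) (lo hi : ℝ) : RegOn (fun _ => c) lo hi ‖c‖ :=
  fun _ _ _ => ⟨differentiableAt_const _, le_rfl⟩

theorem RegOn.mul {R Q : ℂ → ℂ} {lo hi M N : ℝ} (hR : RegOn R lo hi M) (hQ : RegOn Q lo hi N) :
    RegOn (fun z => R z * Q z) lo hi (M * N) := fun z a b => by
  have h1 := hR z a b
  have h2 := hQ z a b
  refine ⟨h1.1.mul h2.1, ?_⟩
  rw [norm_mul]
  exact mul_le_mul h1.2 h2.2 (norm_nonneg _) ((norm_nonneg _).trans h1.2)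

theorem RegOn.add {R Q : ℂ → ℂ} {lo hi M N : ℝ} (hR : RegOn R lo hi M) (hQ : RegOn Q lo hi N) :
    RegOn (fun z => R z + Q z) lo hi (M + N) := fun z a b => by
  have h1 := hR z a b
  have h2 := hQ z a b
  exact ⟨h1.1.add h2.1, (norm_add_le _ _).trans (add_le_add h1.2 h2.2)⟩

theorem regOn_inv_left {p : ℂ} {lo : ℝ} (hp : p.re < lo) (hi : ℝ) :
    RegOn (fun z => (z - p)⁻¹) lo hi (lo - p.re)⁻¹ := fun z a b => by
  have h1 : lo - p.re ≤ ‖z - p‖ := by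
    have := (le_abs_self _).trans (abs_re_le_norm (z - p))
    simp only [sub_re] at this; linarith
  have h2 : z - p ≠ 0 := norm_pos_iff.mp (by linarith)
  refine ⟨by fun_prop (disch := exact h2), ?_⟩
  rw [norm_inv]
  exact inv_anti₀ (by linarith) h1

theorem regOn_inv_right {p : ℝ} {hi : ℝ} (hp : hi < p) (lo : ℝ) :
    RegOn (fun z => (z - p)⁻¹) lo hi ((p - hi) / 2)⁻¹ := fun z a b => by
  have h1 : (p - hi) / 2 ≤ ‖z - p‖ := by
    have h1 := abs_re_le_norm (z - p)
    have h2 := abs_im_le_norm (z - p)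
    simp only [sub_re, sub_im, ofReal_re, ofReal_im, sub_zero] at h1 h2
    have := neg_abs_le (z.re - p)
    linarith
  have h2 : z - p ≠ 0 := norm_pos_iff.mp (by linarith)
  refine ⟨by fun_prop (disch := exact h2), ?_⟩
  rw [norm_inv]
  exact inv_anti₀ (by linarith) h1

theorem RegOn.congr {R Q : ℂ → ℂ} {lo hi M : ℝ} (h : RegOn R lo hi M)
    (he : ∀ z : ℂ, lo - 1 < z.re → Q z = R z) : RegOn Q lo hi M := fun z a b => by
  obtain ⟨h1, h2⟩ := h z a b
  have hz : Q z = R z := he z (by linarith)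
  refine ⟨?_, by rwa [hz]⟩
  refine h1.congr_of_eventuallyEq ?_
  have : {w : ℂ | lo - 1 < w.re} ∈ 𝓝 z :=
    (isOpen_lt continuous_const continuous_re).mem_nhds (show lo - 1 < z.re by linarith)
  filter_upwards [this] with w hw using he w hw

theorem rayDecay_mul {e R : ℂ → ℂ} {b lo hi M N κ ρ v C ε : ℝ} {d : ℂ} (he : Differentiable ℂ e)
    (hC : ∀ (v ρ t : ℝ) (w : ℂ), 0 ≤ t → NearRay v N ρ t w →
      (b + κ ≤ w.re ∨ t / 2 - N ≤ w.re) → ‖e w‖ ≤ C * rexp (-ε * t ^ 2))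
    (hR : RegOn R lo hi M) (hd : SteepDir d) (hN : |v| + 1 ≤ N) (hρ : ρ ≤ 1)
    (hlo : lo ≤ v - ρ) (hhi : v + 2 * ρ ≤ hi) (hor : b + κ ≤ v - ρ ∨ d.re = 1 / 2) :
    RayDecay (fun z => e z * R z) ρ (C * M) ε v d := by
  have main : ∀ t w, 0 ≤ t → NearRay v N ρ t w → v + t * d.re - ρ ≤ w.re →
      DifferentiableAt ℂ (fun z => e z * R z) w ∧
      ‖e w * R w‖ ≤ C * M * rexp (-ε * t ^ 2) := by
    intro t w ht hw h
    have h1 := hR w (by linarith [hw.le_re']) (by linarith [hw.re_le'])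
    refine ⟨(he w).mul h1.1, ?_⟩
    rw [norm_mul]
    have h2 := hC v ρ t w ht hw (hor.imp (fun h => by linarith [hw.le_re']) fun h' => by
      rw [h'] at h
      have := neg_abs_le v
      linarith)
    calc _ ≤ (C * rexp (-ε * t ^ 2)) * M :=
          mul_le_mul h2 h1.2 (norm_nonneg _) ((norm_nonneg _).trans h2)
      _ = _ := by ring
  intro t ht
  refine ⟨fun w hw => main t w ht (nearRay hd hN hρ ht hw) ?_,
    fun w hw => main t w ht (nearRay_conj hd hN hρ ht hw) ?_⟩ <;>
  · have h1 := (abs_re_le_norm _).trans hw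
    simp only [sub_re, add_re, ofReal_re, re_ofReal_mul, conj_re] at h1
    linarith [(abs_le.mp h1).1]

theorem DecayExp.exists_rayDecay {e R : ℂ → ℂ} {b lo hi M v₀ v₁ : ℝ} (he : DecayExp e b)
    (hR : RegOn R lo hi M) (h1 : lo < v₀) (h2 : lo < v₁) (h3 : v₀ < hi) (h4 : v₁ < hi) :
    ∃ ρ C ε : ℝ, 0 < ρ ∧ 0 ≤ C ∧ 0 < ε ∧ ∀ l : ℝ, 0 ≤ l → l ≤ 1 → ∀ d, SteepDir d →
      (d.re = 1 / 2 ∨ (b < v₀ ∧ b < v₁)) →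
      RayDecay (fun z => e z * R z) ρ C ε (v₀ + l * (v₁ - v₀)) d := by
  have hM0 := hR.nonneg (by linarith)
  have m1 := lt_min h1 h2
  have m2 := max_lt h3 h4
  set m := min v₀ v₁
  set m' := max v₀ v₁
  obtain ⟨κ, hκ0, hκ⟩ : ∃ κ : ℝ, 0 < κ ∧ (b < v₀ ∧ b < v₁ → b + 2 * κ ≤ m) := by
    by_cases hb : b < v₀ ∧ b < v₁
    · exact ⟨(m - b) / 2, by linarith [lt_min hb.1 hb.2], fun _ => by linarith⟩
    · exact ⟨1, one_pos, fun h => absurd h hb⟩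
  obtain ⟨C, ε, hC0, hε, hC⟩ := he.bound (max |m| |m'| + 1) κ hκ0
  obtain ⟨ρ, hρ0, g1, g2, g3, g4⟩ : ∃ ρ > 0, ρ ≤ 1 ∧ ρ ≤ κ ∧ lo + 2 * ρ ≤ m ∧ m' + 2 * ρ ≤ hi :=
    ⟨min (min 1 κ) (min ((m - lo) / 2) ((hi - m') / 2)), by grind, by grind, by grind, by grind,
      by grind⟩
  refine ⟨ρ, C * M, ε, hρ0, by positivity, hε, fun l h0 h1 d hd hor => ?_⟩
  have b1 := Convex.min_le_combo v₀ v₁ (sub_nonneg.mpr h1) h0 (by ring)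
  have b2 := Convex.combo_le_max v₀ v₁ (sub_nonneg.mpr h1) h0 (by ring)
  have hv : (1 - l) • v₀ + l • v₁ = v₀ + l * (v₁ - v₀) := by simp only [smul_eq_mul]; ring
  rw [hv] at b1 b2
  exact rayDecay_mul he.diff hC hR hd (by linarith [abs_le_max_abs_abs b1 b2]) g1 (by linarith)
    (by linarith) (hor.symm.imp_left fun h => by linarith [hκ h])

theorem exp_dir_re : (cexp (π / 3 * I)).re = 1 / 2 := by
  rw [exp_pi_div_three]; simp

section
variable {e R : ℂ → ℂ} {b lo hi M a c : ℝ}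

theorem DecayExp.rayDecay (he : DecayExp e b) (hR : RegOn R lo hi M) (h1 : lo < a) (h2 : a < hi)
    {d : ℂ} (hd : SteepDir d) (hor : d.re = 1 / 2 ∨ b < a) :
    ∃ ρ C ε : ℝ, 0 ≤ ρ ∧ 0 ≤ C ∧ 0 < ε ∧ RayDecay (fun z => e z * R z) ρ C ε a d := by
  obtain ⟨ρ, C, ε, hρ, hC, hε, h⟩ := he.exists_rayDecay hR h1 h1 h2 h2
  have := h 0 le_rfl zero_le_one d hd (hor.imp_right fun h => ⟨h, h⟩)
  exact ⟨ρ, C, ε, hρ.le, hC, hε, by simpa using this⟩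

theorem DecayExp.integrable_vl (he : DecayExp e b) (hR : RegOn R lo hi M) (h1 : lo < c)
    (h2 : c < hi) (h3 : b < c) : Integrable (fun t : ℝ => e (c + t * I) * R (c + t * I)) := by
  obtain ⟨ρ, C, ε, hρ, hC, hε, h⟩ := he.rayDecay hR h1 h2 steepDir_I (Or.inr h3)
  exact HalfSpaceLPP.integrable_vl hρ hε h

theorem DecayExp.contourDown_eq_ray (he : DecayExp e b) (hR : RegOn R lo hi M) (h1 : lo < a)
    (h2 : a < hi) : contourDown a (fun z => e z * R z)
      = -ray a (cexp (π / 3 * I)) (fun z => e z * R z) := by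
  obtain ⟨ρ, C, ε, hρ, hC, hε, h⟩ := he.rayDecay hR h1 h2 steepDir_exp (Or.inl exp_dir_re)
  exact HalfSpaceLPP.contourDown_eq_ray hρ hε h

theorem DecayExp.contourDown_eq (he : DecayExp e b) (hR : RegOn R lo hi M) (h1 : lo < a)
    (h2 : lo < c) (h3 : a < hi) (h4 : c < hi) (h5 : b < c) :
    contourDown a (fun z => e z * R z) = -vl c (fun z => e z * R z) := by
  obtain ⟨ρ, C, ε, hρ, hC, hε, h⟩ := he.exists_rayDecay hR h1 h2 h3 h4
  rw [he.contourDown_eq_ray hR h1 h3, ← ray_I_eq_vl (he.integrable_vl hR h2 h4 h5),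
    ray_eq_of_homotopy (v₁ := c) (d₁ := cexp (π / 3 * I)) hρ hε hC fun l h0 h1 => by
      simpa using h l h0 h1 _ steepDir_exp (Or.inl exp_dir_re)]
  obtain ⟨ρ, C, ε, hρ, hC, hε, h⟩ := he.exists_rayDecay hR h2 h2 h4 h4
  rw [ray_eq_of_homotopy hρ hε hC fun l h0 h1 =>
    h l h0 h1 _ (steepDir_exp.segment steepDir_I h0 h1) (Or.inr ⟨h5, h5⟩)]

theorem DecayExp.contourDown_cross {p : ℝ} (he : DecayExp e b) (hR : RegOn R lo hi M) (h1 : lo < a)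
    (h2 : a < p) (h3 : p < c) (h4 : c < hi) (h5 : b < c) :
    contourDown a (fun z => e z * (R z * (z - p)⁻¹))
      = -vl c (fun z => e z * (R z * (z - p)⁻¹)) + e p * R p := by
  have r1 := (hR.mono (lo' := lo) (hi' := (a + p) / 2) le_rfl (by linarith)).mul
    (regOn_inv_right (p := p) (by linarith) lo)
  have r2 := (hR.mono (lo' := (p + c) / 2) (hi' := hi) (by linarith) le_rfl).mul
    (regOn_inv_left (p := p) (by simp; linarith) hi)
  rw [he.contourDown_eq_ray r1 h1 (by linarith), ← he.contourDown_eq r2 (a := c) (by linarith)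
    (by linarith) h4 h4 h5, he.contourDown_eq_ray r2 (by linarith) h4]
  obtain ⟨ρ, C, ε, hρ, hC, hε, h⟩ := he.exists_rayDecay hR (v₀ := a) (v₁ := c)
    (by linarith) (by linarith) (by linarith) (by linarith)
  have := ray_cross steepDir_exp hρ hε hC h2 h3
    fun l h0 h1 => h l h0 h1 _ steepDir_exp (Or.inl exp_dir_re)
  generalize cexp (π / 3 * I) = d at this ⊢
  simp only [div_eq_mul_inv, mul_assoc] at this
  rw [this]; ring

theorem DecayExp.vl_shift (he : DecayExp e b) (hR : RegOn R lo hi M) (h1 : lo < a)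
    (h2 : lo < c) (h3 : a < hi) (h4 : c < hi) (h5 : b < c) (h6 : b < a) :
    vl a (fun z => e z * R z) = vl c (fun z => e z * R z) := by
  rw [← neg_inj, ← he.contourDown_eq hR h1 h1 h3 h3 h6, ← he.contourDown_eq hR h1 h2 h3 h4 h5]

theorem RayDecay.translate {f : ℂ → ℂ} {ρ C ε v : ℝ} (hC : 0 ≤ C) (hε : 0 < ε)
    (h : RayDecay f ρ C ε v I) (y : ℝ) :
    RayDecay (fun z => f (z + y * I)) ρ (C * rexp (ε * y ^ 2)) (ε / 2) v I := by
  have h' : ∀ t : ℝ, DecayNear f ρ C ε t (v + t * I) := by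
    intro t
    rcases le_total 0 t with ht | ht
    · exact (h t ht).1
    · have := (h (-t) (by linarith)).2
      intro w hw
      have := this w (by simpa using hw)
      simpa using this
  have key : ∀ t : ℝ, DecayNear (fun z => f (z + y * I)) ρ (C * rexp (ε * y ^ 2)) (ε / 2) t
      (v + t * I) := by
    intro t w hw
    have := h' (t + y) (w + y * I) (by
      push_cast
      rwa [show (w + y * I - (v + (t + y) * I) : ℂ) = w - (v + t * I) by ring])
    refine ⟨this.1.comp w (by fun_prop), this.2.trans ?_⟩
    rw [mul_assoc, ← Real.exp_add]
    have : -ε * (t + y) ^ 2 ≤ ε * y ^ 2 + -(ε / 2) * t ^ 2 := by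
      have := mul_nonneg hε.le (sq_nonneg (t + 2 * y))
      linarith
    gcongr
  intro t ht
  refine ⟨key t, ?_⟩
  intro w hw
  have := key (-t) w (by simpa using hw)
  simpa using this

theorem DecayExp.vl_cross {p : ℂ} (he : DecayExp e b) (hR : RegOn R lo hi M) (h1 : lo < a)
    (h2 : a < p.re) (h3 : p.re < c) (h4 : c < hi) (h5 : b < a) :
    vl c (fun z => e z * (R z * (z - p)⁻¹)) = vl a (fun z => e z * (R z * (z - p)⁻¹)) + e p * R p := by
  obtain ⟨ρ, C, ε, hρ, hC, hε, h⟩ := he.exists_rayDecay hR (v₀ := a) (v₁ := c)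
    (by linarith) (by linarith) (by linarith) (by linarith)
  set F : ℂ → ℂ := fun z => e (z + p.im * I) * R (z + p.im * I) with hF
  have hdec : ∀ l : ℝ, 0 ≤ l → l ≤ 1 → RayDecay F ρ (C * rexp (ε * p.im ^ 2)) (ε / 2)
      (a + l * (c - a)) I := fun l h0 h1 =>
    (h l h0 h1 I steepDir_I (Or.inr ⟨h5, by linarith⟩)).translate hC hε p.im
  have hcr := ray_cross steepDir_I hρ (by positivity) (by positivity) h2 h3 hdec
  have hlim : ∀ v : ℝ, v ≠ p.re → (∃ l : ℝ, 0 ≤ l ∧ l ≤ 1 ∧ v = a + l * (c - a)) →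
      ray v I (fun z => F z / (z - p.re)) = vl v (fun z => e z * (R z * (z - p)⁻¹)) := by
    rintro v hv ⟨l, h0, h1, rfl⟩
    have hi := HalfSpaceLPP.integrable_vl hρ.le (by positivity) (hdec l h0 h1)
    set v := a + l * (c - a)
    rw [ray_I_eq_vl, ← vl_add_im v p.im (fun z => e z * (R z * (z - p)⁻¹))]
    · congr 1
      ext z
      simp only [hF]
      have hz : z - p.re = z + p.im * I - p := by apply Complex.ext <;> simp
      rw [div_eq_mul_inv, mul_assoc, hz]
    · have hne : ∀ t : ℝ, (v + t * I - p.re : ℂ) ≠ 0 := by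
        intro t hc
        have := congrArg re hc
        simp at this
        exact hv (by linarith)
      have hb : ∀ t : ℝ, ‖(v + t * I - p.re : ℂ)⁻¹‖ ≤ |v - p.re|⁻¹ := by
        intro t
        rw [norm_inv]
        refine inv_anti₀ (abs_pos.mpr (sub_ne_zero.mpr hv)) ?_
        have := abs_re_le_norm (v + t * I - p.re : ℂ)
        simpa using this
      simp only [div_eq_mul_inv]
      refine Integrable.mul_bdd (c := |v - p.re|⁻¹) hi ?_ (.of_forall hb)
      refine Continuous.aestronglyMeasurable ?_
      exact Continuous.inv₀ (by fun_prop) hne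
  rw [← hlim c h3.ne' ⟨1, by norm_num, le_rfl, by ring⟩, ← hlim a h2.ne ⟨0, le_rfl, by norm_num, by ring⟩,
    hcr]
  simp [hF]

end

/-- The double integral `(1 / 2πi)² ∫∫ G` along two upward oriented vertical lines. -/
def vl2 (a b : ℝ) (G : ℂ → ℂ → ℂ) : ℂ :=
  (2 * π)⁻¹ * ((2 * π)⁻¹ * ∫ p : ℝ × ℝ, G (a + p.1 * I) (b + p.2 * I))

theorem vl2_eq_vl_vl {a b : ℝ} {G : ℂ → ℂ → ℂ}
    (h : Integrable (fun p : ℝ × ℝ => G (a + p.1 * I) (b + p.2 * I))) :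
    vl2 a b G = vl a fun z => vl b fun w => G z w := by
  simp only [vl2, vl]
  rw [integral_const_mul, Measure.volume_eq_prod,
    integral_prod (fun p : ℝ × ℝ => G (a + p.1 * I) (b + p.2 * I)) h]

theorem vl2_eq_vl_vl_symm {a b : ℝ} {G : ℂ → ℂ → ℂ}
    (h : Integrable (fun p : ℝ × ℝ => G (a + p.1 * I) (b + p.2 * I))) :
    vl2 a b G = vl b fun w => vl a fun z => G z w := by
  simp only [vl2, vl]
  rw [integral_const_mul, Measure.volume_eq_prod,
    integral_prod_symm (fun p : ℝ × ℝ => G (a + p.1 * I) (b + p.2 * I)) h]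

theorem vl_const_mul (a : ℝ) (c : ℂ) (f : ℂ → ℂ) : vl a (fun z => c * f z) = c * vl a f := by
  simp only [vl, integral_const_mul]; ring

theorem vl_neg_fun (a : ℝ) (f : ℂ → ℂ) : vl a (fun z => -f z) = -vl a f := by
  simp only [vl, integral_neg, mul_neg]

theorem vl_add {a : ℝ} {f g : ℂ → ℂ} (hf : Integrable fun t : ℝ => f (a + t * I))
    (hg : Integrable fun t : ℝ => g (a + t * I)) : vl a (fun z => f z + g z) = vl a f + vl a g := by
  simp only [vl, integral_add hf hg]; ring

theorem vl_congr {a : ℝ} {f g : ℂ → ℂ} (h : ∀ z : ℂ, z.re = a → f z = g z) : vl a f = vl a g := by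
  simp only [vl]
  congr 2; ext t; exact h _ (by simp)

theorem vl2_congr {a b : ℝ} {F G : ℂ → ℂ → ℂ}
    (h : ∀ z w : ℂ, z.re = a → w.re = b → F z w = G z w) : vl2 a b F = vl2 a b G := by
  simp only [vl2]
  congr 3; ext t; exact h _ _ (by simp) (by simp)

theorem vl2_const_mul (a b : ℝ) (c : ℂ) (F : ℂ → ℂ → ℂ) :
    vl2 a b (fun z w => c * F z w) = c * vl2 a b F := by
  simp only [vl2, integral_const_mul]; ring

theorem contourDown_const_mul (a : ℝ) (c : ℂ) (f : ℂ → ℂ) :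
    contourDown a (fun z => c * f z) = c * contourDown a f := by
  simp only [contourDown]
  rw [mul_left_comm, ← integral_const_mul c]
  congr 2; ext t; ring

theorem contourUp_const_mul (a : ℝ) (c : ℂ) (f : ℂ → ℂ) :
    contourUp a (fun z => c * f z) = c * contourUp a f := by
  simp only [contourUp]
  rw [mul_left_comm, ← integral_const_mul c]
  congr 2; ext t; ring

theorem ray_region {d : ℂ} (hd : d.re = 1 / 2) (hd' : 4 / 5 ≤ d.im) (a : ℝ) {t : ℝ} (ht : 0 < t) :
    (a < (a + t * d : ℂ).re ∧ (a + t * d : ℂ).re ≤ a + |(a + t * d : ℂ).im|) ∧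
    (a < (a + t * conj d : ℂ).re ∧ (a + t * conj d : ℂ).re ≤ a + |(a + t * conj d : ℂ).im|) := by
  have e : |t * d.im| = t * d.im := abs_of_nonneg (by positivity)
  have e2 := mul_le_mul_of_nonneg_left hd' ht.le
  simp [hd, e]
  constructor <;> linarith

theorem contourDown_congr {a : ℝ} {f g : ℂ → ℂ}
    (h : ∀ z : ℂ, a < z.re → z.re ≤ a + |z.im| → f z = g z) :
    contourDown a f = contourDown a g := by
  simp only [contourDown]
  congr 1
  refine setIntegral_congr_fun measurableSet_Ioi fun t (ht : 0 < t) => ?_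
  obtain ⟨h1, h2⟩ := ray_region exp_dir_re steepDir_exp.2.2.1 a ht
  beta_reduce
  rw [exp_neg_pi_div_three, h _ h1.1 h1.2, h _ h2.1 h2.2]

theorem DecayExp.contourUp_eq {e R : ℂ → ℂ} {k lo hi M b c : ℝ} (he : DecayExp e k)
    (hR : RegOn (fun z => R (-z)) lo hi M) (h1 : lo < -b) (h2 : lo < -c) (h3 : -b < hi)
    (h4 : -c < hi) (h5 : k < -c) :
    contourUp b (fun w => e (-w) * R w) = vl c (fun w => e (-w) * R w) := by
  have := he.contourDown_eq hR h1 h2 h3 h4 h5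
  rw [contourUp_eq_neg_contourDown, vl_neg c]
  grind

theorem DecayExp.vl_cross_neg {e R : ℂ → ℂ} {k lo hi M b c : ℝ} {p : ℂ} (he : DecayExp e k)
    (hR : RegOn (fun z => R (-z)) lo hi M) (h1 : lo < -c) (h2 : b < p.re) (h3 : p.re < c)
    (h4 : -b < hi) (h5 : k < -c) :
    vl c (fun w => e (-w) * (R w * (w - p)⁻¹))
      = vl b (fun w => e (-w) * (R w * (w - p)⁻¹)) + e (-p) * R p := by
  have := he.vl_cross (p := -p) hR h1 (by simpa using h3) (c := -b) (by simpa using h2) h4 h5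
  rw [vl_neg b, vl_neg c]
  simp only [neg_neg] at this ⊢
  have e1 : ∀ z : ℂ, (-z - p)⁻¹ = -(z - -p)⁻¹ := fun z => by rw [← inv_neg]; congr 1; ring
  simp only [e1, mul_neg, vl_neg_fun]
  rw [this]; ring

theorem DecayExp.contourUp_cross {e R : ℂ → ℂ} {k lo hi M b c : ℝ} {p : ℝ} (he : DecayExp e k)
    (hR : RegOn (fun z => R (-z)) lo hi M) (h1 : lo < -b) (h2 : p < b) (h3 : c < p)
    (h4 : -c < hi) (h5 : k < -c) :
    contourUp b (fun w => e (-w) * (R w * (w - p)⁻¹))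
      = vl c (fun w => e (-w) * (R w * (w - p)⁻¹)) + e (-p) * R p := by
  have := he.contourDown_cross (p := -p) hR h1 (by linarith) (c := -c) (by linarith) h4 h5
  rw [contourUp_eq_neg_contourDown, vl_neg c]
  simp only [neg_neg, ofReal_neg] at this ⊢
  have e1 : ∀ z : ℂ, (-z - p)⁻¹ = (-1) * (z - -p)⁻¹ := fun z => by grind
  have e2 : ∀ z : ℂ, e z * (R (-z) * ((-1) * (z - -p)⁻¹)) = (-1) * (e z * (R (-z) * (z - -p)⁻¹)) :=
    fun z => by ring
  simp only [e1, e2, vl_const_mul, contourDown_const_mul]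
  rw [this]; ring

theorem integrable_gauss_linear {ε : ℝ} (hε : 0 < ε) (c : ℝ) :
    Integrable (fun t : ℝ => (c + |t|) * rexp (-ε * t ^ 2)) := by
  have h0 := (integrableOn_pow_mul_gauss 0 hε).const_mul c
  have h1 := (integrableOn_pow_mul_gauss 1 hε).norm
  refine (h0.add h1).congr (.of_forall fun t => ?_)
  simp [add_mul]

theorem aexp_line_bound (x : ℝ) {a : ℝ} (ha : 0 < a) : ∃ C ε : ℝ, 0 ≤ C ∧ 0 < ε ∧
    ∀ t : ℝ, ‖aexp x (a + t * I)‖ ≤ C * rexp (-ε * t ^ 2) := by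
  obtain ⟨ρ, C, ε, hρ, hC, hε, h⟩ := (decayExp_aexp x).rayDecay (regOn_const 1 (a - 1) (a + 1))
    (by linarith) (by linarith) steepDir_I (Or.inr ha)
  refine ⟨C, ε, hC, hε, fun t => ?_⟩
  rcases le_total 0 t with ht | ht
  · simpa using ((h t ht).1 (a + t * I) (by simpa using hρ)).2
  · simpa using ((h (-t) (by linarith)).2 (a + t * I) (by simpa using hρ)).2

theorem aexp_ray_bound (x a : ℝ) : ∃ C ε : ℝ, 0 ≤ C ∧ 0 < ε ∧
    ∀ t : ℝ, 0 ≤ t → ‖aexp x (a + t * cexp (π / 3 * I))‖ ≤ C * rexp (-ε * t ^ 2) ∧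
      ‖aexp x (a + t * conj (cexp (π / 3 * I)))‖ ≤ C * rexp (-ε * t ^ 2) := by
  obtain ⟨ρ, C, ε, hρ, hC, hε, h⟩ := (decayExp_aexp x).rayDecay (regOn_const 1 (a - 1) (a + 1))
    (by linarith) (by linarith) steepDir_exp (Or.inl exp_dir_re)
  refine ⟨C, ε, hC, hε, fun t ht => ⟨?_, ?_⟩⟩
  · simpa using ((h t ht).1 (a + t * _) (by simpa using hρ)).2
  · simpa using ((h t ht).2 (a + t * _) (by simpa using hρ)).2

theorem norm_exp_dir : ‖cexp (π / 3 * I)‖ = 1 := by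
  rw [norm_exp]; simp

/-- `R` has at most linear growth in both variables on a pair of vertical lines. -/
def LineLin (R : ℂ → ℂ → ℂ) (a b : ℝ) : Prop :=
  ∃ N : ℝ, 0 ≤ N ∧ ∀ z w : ℂ, z.re = a → w.re = b → ‖R z w‖ ≤ N * ((1 + ‖z‖) * (1 + ‖w‖))

/-- `R` has at most linear growth in both variables, on a region in the first variable and a
vertical line in the second one. -/
def LinReg (R : ℂ → ℂ → ℂ) (lo hi b : ℝ) : Prop :=
  ∃ N : ℝ, 0 ≤ N ∧ ∀ z w : ℂ, lo ≤ z.re → z.re ≤ hi + |z.im| → w.re = b →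
    ‖R z w‖ ≤ N * ((1 + ‖z‖) * (1 + ‖w‖))

theorem LinReg.lineLin {R : ℂ → ℂ → ℂ} {lo hi a b : ℝ} (h : LinReg R lo hi b) (h1 : lo ≤ a)
    (h2 : a ≤ hi) : LineLin R a b := by
  obtain ⟨N, hN, h⟩ := h
  exact ⟨N, hN, fun z w hz hw => h z w (hz ▸ h1) (by linarith [abs_nonneg z.im]) hw⟩

theorem LineLin.congr {R Q : ℂ → ℂ → ℂ} {a b : ℝ} (h : LineLin R a b)
    (he : ∀ z w, Q z w = R z w) : LineLin Q a b := by
  rwa [show Q = R from funext fun z => funext (he z)]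

theorem integrable_double {x y a b N : ℝ} {R : ℂ → ℂ → ℂ} {T : Set ℝ} {d : ℂ} {C ε : ℝ}
    (hm : Measurable fun p : ℂ × ℂ => R p.1 p.2) (hb : b < 0) (hT : MeasurableSet T)
    (hN : ∀ t ∈ T, ∀ w : ℂ, w.re = b →
      ‖R (a + t * d) w‖ ≤ N * ((1 + ‖(a + t * d : ℂ)‖) * (1 + ‖w‖)))
    (hε : 0 < ε) (hC : 0 ≤ C) (hd : ‖d‖ = 1) (hN0 : 0 ≤ N)
    (hT2 : ∀ t ∈ T, ‖aexp x (a + t * d)‖ ≤ C * rexp (-ε * t ^ 2)) :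
    Integrable (fun p : ℝ × ℝ => aexp x (a + p.1 * d) * aexp y (-(b + p.2 * I))
      * R (a + p.1 * d) (b + p.2 * I)) ((volume.restrict T).prod volume) := by
  obtain ⟨C₂, ε₂, hC₂, hε₂, h2⟩ := aexp_line_bound y (a := -b) (by linarith)
  have i1 := ((integrable_gauss_linear hε (1 + |a|)).restrict (s := T)).const_mul C
  have i2 := (integrable_gauss_linear hε₂ (1 + |b|)).const_mul C₂
  refine ((i1.mul_prod i2).const_mul N).mono' ?_ ?_
  · refine Measurable.aestronglyMeasurable ?_
    refine Measurable.mul (by unfold aexp; fun_prop) ?_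
    fun_prop
  · have hae : ∀ᵐ p ∂((volume.restrict T).prod (volume : Measure ℝ)), p.1 ∈ T := by
      have : ∀ᵐ t ∂(volume.restrict T), t ∈ T := ae_restrict_mem hT
      exact Measure.quasiMeasurePreserving_fst.ae this
    filter_upwards [hae] with p hp
    rw [norm_mul, norm_mul]
    have e1 := hT2 p.1 hp
    have e2 := h2 (-p.2)
    have e3 := hN p.1 hp (b + p.2 * I) (by simp)
    have e4 : ‖(a + p.1 * d : ℂ)‖ ≤ |a| + |p.1| := by
      refine (norm_add_le _ _).trans ?_
      simp [hd]
    have e5 : ‖(b + p.2 * I : ℂ)‖ ≤ |b| + |p.2| := by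
      refine (norm_add_le _ _).trans ?_
      simp
    have e6 : (-(b + p.2 * I) : ℂ) = ((-b : ℝ) : ℂ) + ((-p.2 : ℝ) : ℂ) * I := by push_cast; ring
    rw [e6]
    rw [neg_sq] at e2
    have e7 : N * ((1 + ‖(a + p.1 * d : ℂ)‖) * (1 + ‖(b + p.2 * I : ℂ)‖))
        ≤ N * ((1 + |a| + |p.1|) * (1 + |b| + |p.2|)) := by
      apply mul_le_mul_of_nonneg_left _ hN0
      apply mul_le_mul <;> first | positivity | linarith
    calc _ ≤ (C * rexp (-ε * p.1 ^ 2)) * (C₂ * rexp (-ε₂ * p.2 ^ 2))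
          * (N * ((1 + |a| + |p.1|) * (1 + |b| + |p.2|))) := by
          gcongr
          exact e3.trans e7
      _ = _ := by ring

theorem LineLin.integrable {x y a b : ℝ} {R : ℂ → ℂ → ℂ} (h : LineLin R a b)
    (hm : Measurable fun p : ℂ × ℂ => R p.1 p.2) (ha : 0 < a) (hb : b < 0) :
    Integrable (fun p : ℝ × ℝ => aexp x (a + p.1 * I) * aexp y (-(b + p.2 * I))
      * R (a + p.1 * I) (b + p.2 * I)) := by
  obtain ⟨N, hN0, hN⟩ := h
  obtain ⟨C, ε, hC, hε, h⟩ := aexp_line_bound x ha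
  have := integrable_double (T := Set.univ) (d := I) (x := x) (y := y) (a := a) hm hb
    MeasurableSet.univ (fun t _ w hw => hN _ w (by simp) hw) hε hC (by simp) hN0 (fun t _ => h t)
  rwa [Measure.restrict_univ, ← Measure.volume_eq_prod] at this

theorem vl2_cross {x y a b c lo hi : ℝ} {R G : ℂ → ℂ → ℂ} {p : ℂ → ℂ}
    (hG : ∀ z w, G z w = R z w * (w - p z)⁻¹)
    (hm : Measurable fun q : ℂ × ℂ => G q.1 q.2) (ha : 0 < a) (hc : c < 0)
    (hR : ∀ z : ℂ, z.re = a → ∃ M, RegOn (fun v => R z (-v)) lo hi M)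
    (h1 : lo < -c) (h2 : ∀ z : ℂ, z.re = a → b < (p z).re ∧ (p z).re < c) (h4 : -b < hi)
    (hb : LineLin G a b) (hc' : LineLin G a c) :
    vl2 a b (fun z w => aexp x z * aexp y (-w) * G z w)
      = vl2 a c (fun z w => aexp x z * aexp y (-w) * G z w)
        - vl a (fun z => aexp x z * (aexp y (-p z) * R z (p z))) := by
  have hbc : b < c := (h2 a (by simp)).1.trans (h2 a (by simp)).2
  have ib := hb.integrable (x := x) (y := y) hm ha (hbc.trans hc)
  have ic := hc'.integrable (x := x) (y := y) hm ha hc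
  have key : ∀ z : ℂ, z.re = a → aexp x z * (aexp y (-p z) * R z (p z))
      = (vl c fun w => aexp x z * aexp y (-w) * G z w)
        + -(vl b fun w => aexp x z * aexp y (-w) * G z w) := by
    intro z hz
    obtain ⟨M, hM⟩ := hR z hz
    simp only [hG, mul_assoc]
    rw [vl_const_mul, vl_const_mul,
      (decayExp_aexp y).vl_cross_neg hM h1 (h2 z hz).1 (h2 z hz).2 h4 (by linarith)]
    ring
  rw [vl_congr key, vl_add, vl_neg_fun, ← vl2_eq_vl_vl ic, ← vl2_eq_vl_vl ib]
  · ring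
  · have := (Measure.volume_eq_prod ℝ ℝ ▸ ic).integral_prod_left
    simpa only [vl] using this.const_mul _
  · have := (Measure.volume_eq_prod ℝ ℝ ▸ ib).integral_prod_left
    simp only [vl]
    exact (this.const_mul _).neg

/-- The inner integral over a vertical line may be exchanged with the outer contour integral, and
is integrable along the rays of the contour. -/
theorem contourDown_vl {x y a b lo hi : ℝ} {R : ℂ → ℂ → ℂ}
    (hm : Measurable fun p : ℂ × ℂ => R p.1 p.2) (hb : b < 0) (hN : LinReg R lo hi b)
    (h1 : lo ≤ a) (h2 : a ≤ hi) :
    (IntegrableOn (fun t : ℝ => vl b fun w => aexp x (a + t * cexp (π / 3 * I))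
      * aexp y (-w) * R (a + t * cexp (π / 3 * I)) w) (Ioi 0) ∧
    IntegrableOn (fun t : ℝ => vl b fun w => aexp x (a + t * conj (cexp (π / 3 * I)))
      * aexp y (-w) * R (a + t * conj (cexp (π / 3 * I))) w) (Ioi 0)) ∧
    contourDown a (fun z => vl b fun w => aexp x z * aexp y (-w) * R z w)
      = vl b (fun w => contourDown a fun z => aexp x z * aexp y (-w) * R z w) := by
  obtain ⟨N, hN0, hN⟩ := hN
  obtain ⟨C, ε, hC, hε, h⟩ := aexp_ray_bound x a
  simp only [contourDown, vl, exp_neg_pi_div_three]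
  have hreg := fun t (ht : t ∈ Ioi (0 : ℝ)) => ray_region exp_dir_re steepDir_exp.2.2.1 a ht
  have hdn := norm_exp_dir
  generalize cexp (π / 3 * I) = d at *
  have i1 := integrable_double (d := d) (x := x) (y := y) (a := a) hm hb measurableSet_Ioi
    (fun t ht w hw => hN _ w (by linarith [(hreg t ht).1.1]) (by linarith [(hreg t ht).1.2]) hw) hε
    hC hdn hN0 (fun t ht => (h t (le_of_lt ht)).1)
  have i2 := integrable_double (d := conj d) (x := x) (y := y) (a := a) hm hb measurableSet_Ioi
    (fun t ht w hw => hN _ w (by linarith [(hreg t ht).2.1]) (by linarith [(hreg t ht).2.2]) hw) hε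
    hC (by simpa using hdn) hN0 (fun t ht => (h t (le_of_lt ht)).2)
  refine ⟨⟨i1.integral_prod_left.const_mul _, i2.integral_prod_left.const_mul _⟩, ?_⟩
  have sw := integral_integral_swap (f := fun t s : ℝ => conj d * (aexp x (a + t * conj d)
    * aexp y (-(b + s * I)) * R (a + t * conj d) (b + s * I))
    - d * (aexp x (a + t * d) * aexp y (-(b + s * I)) * R (a + t * d) (b + s * I)))
    (μ := volume.restrict (Ioi 0)) ((i2.const_mul (conj d)).sub (i1.const_mul d))
  rw [integral_const_mul, ← sw, mul_left_comm, ← integral_const_mul (((2 * π)⁻¹ : ℝ) : ℂ)]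
  congr 1
  refine integral_congr_ae ?_
  filter_upwards [i1.prod_right_ae, i2.prod_right_ae] with t ht1 ht2
  rw [integral_sub (ht2.const_mul _) (ht1.const_mul _), integral_const_mul, integral_const_mul]
  push_cast
  ring

theorem contourDown_vl_eq {x y a a' b' lo hi : ℝ} {R : ℂ → ℂ → ℂ}
    (hm : Measurable fun p : ℂ × ℂ => R p.1 p.2) (ha' : 0 < a') (hb' : b' < 0)
    (h2 : ∀ w : ℂ, w.re = b' → ∃ M, RegOn (fun z => R z w) lo hi M) (hN : LinReg R lo hi b')
    (l5 : lo < a) (l6 : lo < a') (l7 : a < hi) (l8 : a' < hi) :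
    contourDown a (fun z => vl b' fun w => aexp x z * aexp y (-w) * R z w)
      = -vl2 a' b' (fun z w => aexp x z * aexp y (-w) * R z w) := by
  rw [(contourDown_vl hm hb' hN l5.le l7.le).2,
    vl2_eq_vl_vl_symm ((hN.lineLin l6.le l8.le).integrable hm ha' hb'), ← vl_neg_fun]
  refine vl_congr fun w hw => ?_
  obtain ⟨M, hM⟩ := h2 w hw
  simp only [mul_assoc, mul_left_comm (aexp x _)]
  rw [contourDown_const_mul, vl_const_mul, (decayExp_aexp x).contourDown_eq hM l5 l6 l7 l8 ha',
    mul_neg]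

theorem double_contour {x y a a' b b' lo hi lo₁ hi₁ : ℝ} {R : ℂ → ℂ → ℂ}
    (hm : Measurable fun p : ℂ × ℂ => R p.1 p.2) (ha' : 0 < a') (hb' : b' < 0)
    (h1 : ∀ z : ℂ, a < z.re → ∃ M, RegOn (fun w => R z (-w)) lo₁ hi₁ M)
    (h2 : ∀ w : ℂ, w.re = b' → ∃ M, RegOn (fun z => R z w) lo hi M) (hN : LinReg R lo hi b')
    (l1 : lo₁ < -b) (l2 : lo₁ < -b') (l3 : -b < hi₁) (l4 : -b' < hi₁)
    (l5 : lo < a) (l6 : lo < a') (l7 : a < hi) (l8 : a' < hi) :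
    contourDown a (fun z => contourUp b fun w => aexp x z * aexp y (-w) * R z w)
      = -vl2 a' b' (fun z w => aexp x z * aexp y (-w) * R z w) := by
  rw [← contourDown_vl_eq hm ha' hb' h2 hN l5 l6 l7 l8]
  refine contourDown_congr fun z hz _ => ?_
  obtain ⟨M, hM⟩ := h1 z hz
  simp only [mul_assoc]
  rw [contourUp_const_mul, vl_const_mul, (decayExp_aexp y).contourUp_eq hM l1 l2 l3 l4 (by linarith)]

theorem norm_inv_le_of_re {z : ℂ} {c : ℝ} (hc : 0 < c) (h : c ≤ |z.re|) : ‖z⁻¹‖ ≤ c⁻¹ := by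
  rw [norm_inv]
  exact inv_anti₀ hc (h.trans (abs_re_le_norm z))

theorem ne_zero_of_re {z : ℂ} (h : z.re ≠ 0) : z ≠ 0 := fun e => h (by rw [e]; rfl)

theorem regOn_moebius' {p : ℂ} {lo : ℝ} (r q : ℂ) (hp : p.re < lo) (hi : ℝ) :
    RegOn (fun z => (r * z + q) * (z - p)⁻¹) lo hi (‖r‖ + ‖q + r * p‖ * (lo - p.re)⁻¹) :=
  fun z a b => by
  obtain ⟨h1, h2⟩ := regOn_inv_left hp hi z a b
  refine ⟨((differentiableAt_id.const_mul r).add_const q).mul h1, ?_⟩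
  have h3 : z - p ≠ 0 := ne_zero_of_re (by simp; linarith)
  have : (r * z + q) * (z - p)⁻¹ = r + (q + r * p) * (z - p)⁻¹ := by field_simp; ring
  beta_reduce
  rw [this]
  refine (norm_add_le _ _).trans ?_
  rw [norm_mul]
  gcongr

theorem regOn_moebius {p q : ℂ} {lo : ℝ} (hp : p.re < lo) (hi : ℝ) :
    RegOn (fun z => (z + q) * (z - p)⁻¹) lo hi (1 + ‖q + p‖ * (lo - p.re)⁻¹) := by
  simpa using regOn_moebius' 1 q hp hi

theorem RegOn.neg_inv {p : ℂ} {lo hi M : ℝ} (h : RegOn (fun z => (z - -p)⁻¹) lo hi M) :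
    RegOn (fun v => (-v - p)⁻¹) lo hi M := by
  have := (regOn_const (-1) lo hi).mul h
  rw [norm_neg, norm_one, one_mul] at this
  exact this.congr fun v _ => by rw [neg_one_mul, ← inv_neg]; congr 1; ring

theorem RegOn.neg_arg_inv {p : ℂ} {lo : ℝ} (hp : -p.re < lo) (hi : ℝ) :
    RegOn (fun v => (-v - p)⁻¹) lo hi (lo - (-p).re)⁻¹ := (regOn_inv_left (by simpa) hi).neg_inv

theorem RegOn.neg_arg_inv_right {p : ℝ} {hi : ℝ} (hp : hi < -p) (lo : ℝ) :
    RegOn (fun v => (-v - p)⁻¹) lo hi ((-p - hi) / 2)⁻¹ :=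
  RegOn.neg_inv (by simpa using regOn_inv_right hp lo)

theorem laplace_integral {α : Type*} [MeasurableSpace α] {μ : Measure α} [SFinite μ] {κ g : α → ℂ}
    {r : ℝ} (hκ : Measurable κ) (hr : r < 0) (hre : ∀ p, (κ p).re = r) (hg : Integrable g μ)
    (S : ℝ) : IntegrableOn (fun v : ℝ => ∫ p, cexp (κ p * v) * g p ∂μ) (Ioi S) ∧
    ∫ v in Ioi S, ∫ p, cexp (κ p * v) * g p ∂μ = -∫ p, cexp (κ p * S) * g p * (κ p)⁻¹ ∂μ := by
  have i2 : Integrable (fun q : ℝ × α => cexp (κ q.2 * q.1) * g q.2)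
      ((volume.restrict (Ioi S)).prod μ) := by
    refine ((integrableOn_exp_mul_Ioi hr S).mul_prod hg.norm).mono' ?_ (.of_forall fun q => ?_)
    · exact AEStronglyMeasurable.mul (Measurable.aestronglyMeasurable (by fun_prop))
        (hg.aestronglyMeasurable.comp_quasiMeasurePreserving Measure.quasiMeasurePreserving_snd)
    · simp [norm_exp, hre]
  refine ⟨i2.integral_prod_left, ?_⟩
  rw [integral_integral_swap i2, ← integral_neg]
  congr 1; ext p
  rw [integral_mul_const, integral_exp_mul_complex_Ioi ((hre p).trans_lt hr)]
  ring

theorem contourDown_add {a : ℝ} {f g : ℂ → ℂ}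
    (f1 : IntegrableOn (fun t : ℝ => f (a + t * cexp (π / 3 * I))) (Ioi 0))
    (f2 : IntegrableOn (fun t : ℝ => f (a + t * conj (cexp (π / 3 * I)))) (Ioi 0))
    (g1 : IntegrableOn (fun t : ℝ => g (a + t * cexp (π / 3 * I))) (Ioi 0))
    (g2 : IntegrableOn (fun t : ℝ => g (a + t * conj (cexp (π / 3 * I)))) (Ioi 0)) :
    contourDown a (fun z => f z + g z) = contourDown a f + contourDown a g := by
  simp only [contourDown, exp_neg_pi_div_three]
  have key := integral_add
    ((f2.const_mul (conj (cexp (π / 3 * I)))).sub (f1.const_mul (cexp (π / 3 * I))))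
    ((g2.const_mul (conj (cexp (π / 3 * I)))).sub (g1.const_mul (cexp (π / 3 * I))))
  simp only [Pi.sub_apply] at key
  rw [← mul_add, ← key]
  congr 2; ext t; ring

/-- `f` is bounded on a vertical line. -/
def LineBd (f : ℂ → ℂ) (a : ℝ) : Prop := ∃ N : ℝ, ∀ z : ℂ, z.re = a → ‖f z‖ ≤ N

section
variable {f g : ℂ → ℂ} {R : ℂ → ℂ → ℂ} {a b c lo hi M : ℝ} {e q : ℂ}

theorem lineBd_const (q : ℂ) (a : ℝ) : LineBd (fun _ => q) a := ⟨‖q‖, fun _ _ => le_rfl⟩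

theorem LineBd.mul (hf : LineBd f a) (hg : LineBd g a) : LineBd (fun z => f z * g z) a := by
  obtain ⟨N, h⟩ := hf
  obtain ⟨M, k⟩ := hg
  refine ⟨N * M, fun z hz => ?_⟩
  rw [norm_mul]
  exact mul_le_mul (h z hz) (k z hz) (norm_nonneg _) ((norm_nonneg _).trans (h z hz))

theorem LineBd.add (hf : LineBd f a) (hg : LineBd g a) : LineBd (fun z => f z + g z) a := by
  obtain ⟨N, h⟩ := hf
  obtain ⟨M, k⟩ := hg
  exact ⟨N + M, fun z hz => (norm_add_le _ _).trans (add_le_add (h z hz) (k z hz))⟩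

theorem lineBd_inv (h : a + q.re ≠ 0) : LineBd (fun z => (z + q)⁻¹) a :=
  ⟨|a + q.re|⁻¹, fun z hz => norm_inv_le_of_re (abs_pos.mpr h) (by simp [hz])⟩

theorem RegOn.lineBd (h : RegOn f lo hi M) (h1 : lo ≤ a) (h2 : a ≤ hi) : LineBd f a :=
  ⟨M, fun z hz => (h z (hz ▸ h1) (by linarith [abs_nonneg z.im])).2⟩

theorem lineLin_mul (hf : LineBd f a) (hg : LineBd g b) : LineLin (fun z w => f z * g w) a b := by
  obtain ⟨N, h⟩ := hf
  obtain ⟨M, k⟩ := hg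
  refine ⟨|N| * |M|, by positivity, fun z w hz hw => ?_⟩
  rw [norm_mul]
  refine (mul_le_mul ((h z hz).trans (le_abs_self N)) ((k w hw).trans (le_abs_self M))
    (norm_nonneg _) (abs_nonneg _)).trans (le_mul_of_one_le_right (by positivity) ?_)
  exact one_le_mul_of_one_le_of_one_le (by simp) (by simp)

theorem norm_rational_le (e q : ℂ) {z w : ℂ} {d : ℝ} (hd : 0 < d) (h : d ≤ |z.re - (w.re + c)|) :
    ‖(e * (z + w) + q) * (z - w - c)⁻¹‖
      ≤ (‖e‖ + ‖q‖) * d⁻¹ * ((1 + ‖z‖) * (1 + ‖w‖)) := by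
  have h1 := norm_inv_le_of_re (z := z - w - c) hd (by simpa [sub_sub] using h)
  have h2 : ‖e * (z + w) + q‖ ≤ (‖e‖ + ‖q‖) * ((1 + ‖z‖) * (1 + ‖w‖)) := by
    refine (norm_add_le _ _).trans ?_
    rw [norm_mul]
    have := mul_le_mul_of_nonneg_left (norm_add_le z w) (norm_nonneg e)
    have : 0 ≤ ‖e‖ * (1 + ‖z‖ * ‖w‖) + ‖q‖ * (‖z‖ + ‖w‖ + ‖z‖ * ‖w‖) := by positivity
    linarith
  rw [norm_mul, mul_right_comm]
  gcongr

theorem linReg_of_factor (hR : ∀ z w, R z w = f z * g w * ((e * (z + w) + q) * (z - w - c)⁻¹))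
    (hf : RegOn f lo hi M) (hg : LineBd g b) (h : b + c < lo) : LinReg R lo hi b := by
  obtain ⟨N, k⟩ := hg
  refine ⟨|M| * |N| * ((‖e‖ + ‖q‖) * (lo - (b + c))⁻¹),
    mul_nonneg (by positivity) (mul_nonneg (by positivity) (by simp; linarith)),
    fun z w h1 h2 hw => ?_⟩
  rw [hR, norm_mul, norm_mul, mul_assoc (|M| * |N|)]
  have := (hf z h1 h2).2.trans (le_abs_self M)
  have := (k w hw).trans (le_abs_self N)
  have := norm_rational_le (z := z) (w := w) e q (by linarith : 0 < lo - (b + c))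
    (le_trans (by rw [hw]; linarith) (le_abs_self (z.re - (w.re + c))))
  gcongr

theorem lineLin_of_factor (hR : ∀ z w, R z w = f z * g w * ((e * (z + w) + q) * (z - w - c)⁻¹))
    (hf : LineBd f a) (hg : LineBd g b) (h : b + c ≠ a) : LineLin R a b := by
  obtain ⟨M, h'⟩ := hf
  obtain ⟨N, k⟩ := hg
  refine ⟨|M| * |N| * ((‖e‖ + ‖q‖) * |a - (b + c)|⁻¹), by positivity, fun z w hz hw => ?_⟩
  rw [hR, norm_mul, norm_mul, mul_assoc (|M| * |N|)]
  have := (h' z hz).trans (le_abs_self M)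
  have := (k w hw).trans (le_abs_self N)
  have := norm_rational_le (z := z) (w := w) e q (abs_pos.mpr (sub_ne_zero.mpr h.symm))
    (by rw [hz, hw])
  gcongr

end

theorem double_translate (a b c d : ℝ) (F : ℂ → ℂ → ℂ) :
    contourDown (a + c) (fun ζ => contourUp (b + d) (F ζ))
      = contourDown a (fun z => contourUp b fun w => F (z + c) (w + d)) := by
  rw [← contourDown_add_re]
  congr 1
  ext z
  rw [← contourUp_add_re]

theorem double_eval {x y a a' b b' lo hi lo₁ hi₁ cz cw c M M₁ : ℝ} {C e q : ℂ} {F R : ℂ → ℂ → ℂ}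
    {f g : ℂ → ℂ} (hF : ∀ z w, F (z + cz) (w + cw) = C * (aexp x z * aexp y (-w) * R z w))
    (hR : ∀ z w, R z w = f z * g w * ((e * (z + w) + q) * (z - w - c)⁻¹))
    (hm : Measurable fun p : ℂ × ℂ => R p.1 p.2) (hf : RegOn f lo hi M)
    (hg : RegOn (fun w => g (-w)) lo₁ hi₁ M₁) (ha' : 0 < a') (hb' : b' < 0) (hc : b' + c < lo)
    (hc' : c - a < lo₁) (l1 : lo₁ < -b) (l2 : lo₁ < -b') (l3 : -b < hi₁) (l4 : -b' < hi₁)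
    (l5 : lo < a) (l6 : lo < a') (l7 : a < hi) (l8 : a' < hi) :
    contourDown (a + cz) (fun ζ => contourUp (b + cw) (F ζ))
      = -(C * vl2 a' b' (fun z w => aexp x z * aexp y (-w) * R z w)) := by
  have hg' : LineBd g b' := ⟨M₁, fun w hw => by
    simpa using (hg (-w) (by simp [hw, l2.le]) (by simp [hw]; linarith [abs_nonneg w.im])).2⟩
  rw [double_translate]
  simp only [hF, contourUp_const_mul, contourDown_const_mul]
  rw [double_contour hm ha' hb' (fun z hz => ⟨_, (((regOn_const (f z) _ _).mul hg).mul
      (regOn_moebius' (-e) (e * z + q) (p := c - z) (by simp; linarith) _)).congr fun w _ => by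
        rw [hR]; ring_nf⟩)
    (fun w hw => ⟨_, ((hf.mul (regOn_const (g w) _ _)).mul
      (regOn_moebius' e (e * w + q) (p := w + c) (by simpa [hw]) _)).congr fun z _ => by
        rw [hR]; ring_nf⟩)
    (linReg_of_factor hR hf hg' hc) l1 l2 l3 l4 l5 l6 l7 l8, mul_neg]

/-- The real part of the vertical line on which all integrals are taken. -/
def lineA (τ : ℝ) : ℝ := |τ| + 2

theorem two_le_lineA (τ : ℝ) : 2 ≤ lineA τ := by
  rw [lineA]; linarith [abs_nonneg τ]

theorem lineA_pos (τ : ℝ) : 0 < lineA τ := two_pos.trans_le (two_le_lineA τ)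

theorem lineA_facts (τ : ℝ) : 0 ≤ |τ| ∧ τ ≤ |τ| ∧ -|τ| ≤ τ ∧ lineA τ = |τ| + 2 :=
  ⟨abs_nonneg τ, le_abs_self τ, neg_abs_le τ, rfl⟩

/-- The double integral over the vertical lines through `lineA τ` and `b` of the Airy exponentials
and `R`. -/
def kkb (τ b : ℝ) (R : ℂ → ℂ → ℂ) (x y : ℝ) : ℂ :=
  vl2 (lineA τ) b fun z w => aexp (x + τ ^ 2 : ℝ) z * aexp (y + τ ^ 2 : ℝ) (-w) * R z w

/-- The kernel given by a double integral over vertical lines of the Airy exponentials and `R`. -/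
def kk (τ : ℝ) (R : ℂ → ℂ → ℂ) (x y : ℝ) : ℂ :=
  vl2 (lineA τ) (-lineA τ) fun z w =>
    aexp (x + τ ^ 2 : ℝ) z * aexp (y + τ ^ 2 : ℝ) (-w) * R z w

/-- The function given by an integral over a vertical line of the Airy exponential and `r`. -/
def vv (τ : ℝ) (r : ℂ → ℂ) (x : ℝ) : ℂ :=
  vl (lineA τ) fun z => aexp (x + τ ^ 2 : ℝ) z * r z

/-- The rational factor of `𝒜₁₁`. -/
def R11 (τ u : ℝ) (z w : ℂ) : ℂ :=
  ((z + (2 * u - τ)) * (z + u)⁻¹) * ((w - (2 * u - τ)) * (w - u)⁻¹)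
    * ((z + w) * (z - w + 2 * u)⁻¹) * 4⁻¹

/-- The rational factor of `𝒜₁₂`. -/
def R12 (τ u : ℝ) (z w : ℂ) : ℂ :=
  ((z + (2 * u - τ)) * (z + u)⁻¹) * (w + (2 * u - τ))⁻¹ * ((z + w + 2 * u) * (z - w)⁻¹) * 2⁻¹

/-- The rational factor of `𝒜₂₂`. -/
def R22 (τ u : ℝ) (z w : ℂ) : ℂ :=
  (z - w - 2 * u)⁻¹ * ((z - (2 * u - τ))⁻¹ + (w + (2 * u - τ))⁻¹)

theorem kk_eq_kkb (τ : ℝ) (R : ℂ → ℂ → ℂ) : kk τ R = kkb τ (-lineA τ) R := rfl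

theorem contour_eq_kkb {τ x y a b A B b' lo hi lo₁ hi₁ cz cw c M M₁ : ℝ} {C e q : ℂ}
    {F R : ℂ → ℂ → ℂ} {f g : ℂ → ℂ} (hF : ∀ z w, F (z + cz) (w + cw)
      = C * (aexp (x + τ ^ 2 : ℝ) z * aexp (y + τ ^ 2 : ℝ) (-w) * R z w))
    (hR : ∀ z w, R z w = f z * g w * ((e * (z + w) + q) * (z - w - c)⁻¹))
    (hm : Measurable fun p : ℂ × ℂ => R p.1 p.2) (hf : RegOn f lo hi M)
    (hg : RegOn (fun w => g (-w)) lo₁ hi₁ M₁) (hA : a + cz = A) (hB : b + cw = B) (hb' : b' < 0)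
    (hc : b' + c < lo) (hc' : c - a < lo₁) (l1 : lo₁ < -b) (l2 : lo₁ < -b') (l3 : -b < hi₁)
    (l4 : -b' < hi₁) (l5 : lo < a) (l6 : lo < lineA τ) (l7 : a < hi) (l8 : lineA τ < hi) :
    contourDown A (fun ζ => contourUp B (F ζ)) = -(C * kkb τ b' R x y) :=
  hA ▸ hB ▸ double_eval hF hR hm hf hg (lineA_pos τ) hb' hc hc' l1 l2 l3 l4 l5 l6 l7 l8

theorem airyKernel_eq (τ x y : ℝ) : airyKernel τ x y = kk τ (fun z w => (z - w)⁻¹) x y := by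
  obtain ⟨h0, -, -, hA⟩ := lineA_facts τ
  rw [airyKernel, kk_eq_kkb, contour_eq_kkb (τ := τ) (x := x) (y := y) (a := 1) (b := -1)
    (b' := -lineA τ) (lo := 0) (hi := lineA τ + 1) (lo₁ := 0) (hi₁ := lineA τ + 1) (cz := 0)
    (cw := 0) (c := 0) (C := 1) (e := 0) (q := 1) (f := 1) (g := 1) (R := fun z w => (z - w)⁻¹) ?_
    (fun z w => by simp) (by fun_prop) (regOn_const 1 _ _) (regOn_const 1 _ _), one_mul, neg_neg]
  any_goals linarith
  intro z w
  have e : cexp (z ^ 3 / 3 - z * (x + (τ : ℂ) ^ 2)) / cexp (w ^ 3 / 3 - w * (y + (τ : ℂ) ^ 2))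
      = aexp (x + τ ^ 2 : ℝ) z * aexp (y + τ ^ 2 : ℝ) (-w) := by
    simp only [aexp, ← exp_sub, ← exp_add]; congr 1; push_cast; ring
  simp [e]

section
variable {τ u : ℝ}

theorem A11_eq (hu : 8 * lineA τ ≤ u) (x y : ℝ) :
    A11 (τ - u) u (x + τ ^ 2 - u ^ 2) (y + τ ^ 2 - u ^ 2)
      = cexp (2 * u ^ 3 / 3 - u * (x + y + 2 * τ ^ 2)) * kk τ (R11 τ u) x y := by
  obtain ⟨h0, h1, h2, hA⟩ := lineA_facts τ
  rw [A11, kk_eq_kkb, contour_eq_kkb (τ := τ) (x := x) (y := y) (a := 1 - u) (b := -1 + u)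
    (b' := -lineA τ) (lo := 1 / 2 - u) (hi := lineA τ + 1) (lo₁ := 1 / 2 - u) (hi₁ := lineA τ + 1)
    (cz := u) (cw := -u) (c := -(2 * u)) (C := cexp (2 * u ^ 3 / 3 - u * (x + y + 2 * τ ^ 2)))
    (e := 1) (q := 0) (f := fun z => (z + (2 * u - τ)) * (z - -u)⁻¹ * 4⁻¹)
    (g := fun w => (w - (2 * u - τ)) * (w - u)⁻¹) (R := R11 τ u) ?_ (fun z w => ?_)
    (by unfold R11; fun_prop) ((regOn_moebius (by simp) _).mul (regOn_const _ _ _))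
    ((regOn_moebius (p := -u) (q := 2 * u - τ) (by simp) _).congr fun w _ => ?_), neg_neg]
  any_goals linarith
  · intro z w
    have e : cexp ((z + u) ^ 3 / 3 - (z + u) ^ 2 * u - (z + u) * (x + τ ^ 2 - u ^ 2 : ℝ))
        / cexp ((w + (-u : ℝ)) ^ 3 / 3 + (w + (-u : ℝ)) ^ 2 * u
          - (w + (-u : ℝ)) * (y + τ ^ 2 - u ^ 2 : ℝ))
        = cexp (2 * u ^ 3 / 3 - u * (x + y + 2 * τ ^ 2))
          * (aexp (x + τ ^ 2 : ℝ) z * aexp (y + τ ^ 2 : ℝ) (-w)) := by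
      simp only [aexp, ← exp_sub, ← exp_add]; congr 1; push_cast; ring
    rw [e, R11]
    push_cast
    simp only [div_eq_mul_inv, mul_inv]
    ring
  · rw [R11]; push_cast; ring_nf
  · rw [show -w - (u : ℂ) = -(w - -u) by ring, inv_neg]; ring

theorem R12_factor (z w : ℂ) : R12 τ u z w = (z + (2 * u - τ)) * (z - -u)⁻¹ * 2⁻¹
    * (w + (2 * u - τ))⁻¹ * ((1 * (z + w) + 2 * u) * (z - w - (0 : ℝ))⁻¹) := by
  rw [R12, ofReal_zero, sub_zero, sub_neg_eq_add]; ring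

theorem A12Integrand_eq (x y : ℝ) (z w : ℂ) :
    A12Integrand (τ - u) u (x + τ ^ 2 - u ^ 2) (y + τ ^ 2 - u ^ 2) (z + u) (w + u)
      = cexp (-u * (x - y)) * (aexp (x + τ ^ 2 : ℝ) z * aexp (y + τ ^ 2 : ℝ) (-w) * R12 τ u z w) := by
  have e : cexp ((z + u) ^ 3 / 3 - (z + u) ^ 2 * u - (z + u) * (x + τ ^ 2 - u ^ 2 : ℝ))
      / cexp ((w + u) ^ 3 / 3 - (w + u) ^ 2 * u - (w + u) * (y + τ ^ 2 - u ^ 2 : ℝ))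
      = cexp (-u * (x - y)) * (aexp (x + τ ^ 2 : ℝ) z * aexp (y + τ ^ 2 : ℝ) (-w)) := by
    simp only [aexp, ← exp_sub, ← exp_add]; congr 1; push_cast; ring
  rw [A12Integrand, e, R12]
  push_cast
  simp only [div_eq_mul_inv, mul_inv]
  ring

theorem A12_eq (hu : 8 * lineA τ ≤ u) (x y : ℝ) :
    A12 (τ - u) u (x + τ ^ 2 - u ^ 2) (y + τ ^ 2 - u ^ 2)
      = cexp (-u * (x - y)) * kk τ (R12 τ u) x y := by
  obtain ⟨h0, h1, h2, hA⟩ := lineA_facts τ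
  have e := abs_of_nonpos (by linarith : τ - u ≤ 0)
  rw [A12, kk_eq_kkb, contour_eq_kkb (a := 2 - τ) (b := 1 - τ) (b' := -lineA τ) (lo := -|τ| - 1)
    (hi := lineA τ + 1) (lo₁ := τ - 3 / 2) (hi₁ := lineA τ + 1) (cz := u) (cw := u) (c := 0)
    (A12Integrand_eq x y) R12_factor (by unfold R12; fun_prop)
    ((regOn_moebius (by simp; linarith) _).mul (regOn_const _ _ _))
    ((RegOn.neg_arg_inv_right (p := -(2 * u - τ)) (by linarith) _).congr fun w _ => ?_), neg_neg]
  any_goals linarith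
  push_cast; ring_nf

theorem A12tilde_eq (hu : 8 * lineA τ ≤ u) (x y : ℝ) :
    A12tilde (τ - u) u (x + τ ^ 2 - u ^ 2) (y + τ ^ 2 - u ^ 2)
      = cexp (-u * (x - y)) * kkb τ (τ - 2 * u - 1) (R12 τ u) x y := by
  obtain ⟨h0, h1, h2, hA⟩ := lineA_facts τ
  have e := abs_of_nonpos (by linarith : τ - u ≤ 0)
  rw [A12tilde, contour_eq_kkb (a := 1 - u) (b := τ - 2 * u - 1) (b' := τ - 2 * u - 1)
    (lo := 1 / 2 - u) (hi := lineA τ + 1) (lo₁ := 2 * u - τ + 1 / 2) (hi₁ := 2 * u - τ + 2)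
    (cz := u) (cw := u) (c := 0) (A12Integrand_eq x y) R12_factor (by unfold R12; fun_prop)
    ((regOn_moebius (by simp) _).mul (regOn_const _ _ _))
    ((RegOn.neg_arg_inv (p := -(2 * u - τ)) (by simp) _).congr fun w _ => ?_), neg_neg]
  any_goals linarith
  push_cast; ring_nf

theorem A22_exp_eq (x y : ℝ) (z w : ℂ) :
    cexp ((z + (-u : ℝ)) ^ 3 / 3 + (z + (-u : ℝ)) ^ 2 * u
        - (z + (-u : ℝ)) * (x + τ ^ 2 - u ^ 2 : ℝ))
      / cexp ((w + u) ^ 3 / 3 - (w + u) ^ 2 * u - (w + u) * (y + τ ^ 2 - u ^ 2 : ℝ))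
      = cexp (-(2 * u ^ 3 / 3) + u * (x + y + 2 * τ ^ 2))
        * (aexp (x + τ ^ 2 : ℝ) z * aexp (y + τ ^ 2 : ℝ) (-w)) := by
  simp only [aexp, ← exp_sub, ← exp_add]; congr 1; push_cast; ring

theorem A22tilde_eq (hu : 8 * lineA τ ≤ u) (x y : ℝ) :
    A22tilde (τ - u) u (x + τ ^ 2 - u ^ 2) (y + τ ^ 2 - u ^ 2)
      = -(cexp (-(2 * u ^ 3 / 3) + u * (x + y + 2 * τ ^ 2)) * kkb τ (τ - 2 * u - 2) (fun z w =>
        (z - (2 * u - τ))⁻¹ * (w + (2 * u - τ))⁻¹ * ((z + w) * (z - w - 2 * u)⁻¹)) x y) := by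
  obtain ⟨h0, h1, h2, hA⟩ := lineA_facts τ
  have e := abs_of_nonpos (by linarith : τ - u ≤ 0)
  rw [A22tilde, contour_eq_kkb (τ := τ) (x := x) (y := y) (a := 2 * u - τ - 1) (b := τ - 2 * u - 2) (b' := τ - 2 * u - 2) (lo := τ - 1)
    (hi := 2 * u - τ - 1 / 2) (lo₁ := 2 * u - τ + 1) (hi₁ := 2 * u - τ + 3) (cz := -u) (cw := u) (c := 2 * u)
    (C := cexp (-(2 * u ^ 3 / 3) + u * (x + y + 2 * τ ^ 2))) (e := 1) (q := 0)
    (f := fun z => (z - (2 * u - τ : ℝ))⁻¹) (g := fun w => (w - (-(2 * u - τ) : ℝ))⁻¹)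
    (R := fun z w => (z - (2 * u - τ))⁻¹ * (w + (2 * u - τ))⁻¹ * ((z + w) * (z - w - 2 * u)⁻¹))
    (fun z w => ?_) (fun z w => ?_) (by fun_prop) (regOn_inv_right (by linarith) _)
    (RegOn.neg_arg_inv (by simp) _)]
  any_goals linarith
  · rw [A22_exp_eq]
    push_cast
    simp only [div_eq_mul_inv, mul_inv]
    ring
  · push_cast; ring

theorem A22_first_eq (hu : 8 * lineA τ ≤ u) (x y : ℝ) :
    (contourDown (-(τ - u) - 1) fun ζ => contourUp (-(τ - u) - 2) fun ω =>
      cexp (ζ ^ 3 / 3 + ζ ^ 2 * u - ζ * (x + τ ^ 2 - u ^ 2 : ℝ))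
        / cexp (ω ^ 3 / 3 - ω ^ 2 * u - ω * (y + τ ^ 2 - u ^ 2 : ℝ))
        * (1 / (ζ - ω)) * (1 / (ζ + (τ - u : ℝ))))
      = -(cexp (-(2 * u ^ 3 / 3) + u * (x + y + 2 * τ ^ 2)) * kkb τ (-(2 * u))
        (fun z w => (z - w - 2 * u)⁻¹ * (z - (2 * u - τ))⁻¹) x y) := by
  obtain ⟨h0, h1, h2, hA⟩ := lineA_facts τ
  rw [contour_eq_kkb (τ := τ) (x := x) (y := y) (a := 2 * u - τ - 1) (b := -τ - 2) (b' := -(2 * u)) (lo := 1 / 2)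
    (hi := 2 * u - τ - 1 / 2) (lo₁ := τ + 3 / 2) (hi₁ := 2 * u + 1) (cz := -u) (cw := u) (c := 2 * u)
    (C := cexp (-(2 * u ^ 3 / 3) + u * (x + y + 2 * τ ^ 2))) (e := 0) (q := 1)
    (f := fun z => (z - (2 * u - τ : ℝ))⁻¹) (g := 1)
    (R := fun z w => (z - w - 2 * u)⁻¹ * (z - (2 * u - τ))⁻¹)
    (fun z w => ?_) (fun z w => ?_) (by fun_prop) (regOn_inv_right (by linarith) _)
    (regOn_const 1 _ _)]
  any_goals linarith
  · rw [A22_exp_eq]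
    push_cast
    simp only [div_eq_mul_inv, mul_inv]
    ring
  · simp; ring

theorem A22_second_eq (hu : 8 * lineA τ ≤ u) (x y : ℝ) :
    (contourDown (τ - u + 2) fun ζ => contourUp (τ - u + 1) fun ω =>
      cexp (ζ ^ 3 / 3 + ζ ^ 2 * u - ζ * (x + τ ^ 2 - u ^ 2 : ℝ))
        / cexp (ω ^ 3 / 3 - ω ^ 2 * u - ω * (y + τ ^ 2 - u ^ 2 : ℝ))
        * (1 / (ζ - ω)) * (1 / (ω - (τ - u : ℝ))))
      = -(cexp (-(2 * u ^ 3 / 3) + u * (x + y + 2 * τ ^ 2)) * kkb τ (τ - 2 * u + 1)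
        (fun z w => (z - w - 2 * u)⁻¹ * (w + (2 * u - τ))⁻¹) x y) := by
  obtain ⟨h0, h1, h2, hA⟩ := lineA_facts τ
  rw [contour_eq_kkb (τ := τ) (x := x) (y := y) (a := τ + 2) (b := τ - 2 * u + 1) (b' := τ - 2 * u + 1) (lo := τ + 3 / 2)
    (hi := lineA τ + 1) (lo₁ := 2 * u - τ - 3 / 2) (hi₁ := 2 * u - τ - 1 / 2) (cz := -u) (cw := u) (c := 2 * u)
    (C := cexp (-(2 * u ^ 3 / 3) + u * (x + y + 2 * τ ^ 2))) (e := 0) (q := 1)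
    (f := 1) (g := fun w => (w - (-(2 * u - τ) : ℝ))⁻¹)
    (R := fun z w => (z - w - 2 * u)⁻¹ * (w + (2 * u - τ))⁻¹)
    (fun z w => ?_) (fun z w => ?_) (by fun_prop) (regOn_const 1 _ _)
    (RegOn.neg_arg_inv_right (by linarith) _)]
  any_goals linarith
  · rw [A22_exp_eq]
    push_cast
    simp only [div_eq_mul_inv, mul_inv]
    ring
  · simp; ring

end

theorem kkb_laplace {τ s y b : ℝ} {R : ℂ → ℂ → ℂ} (hR : LineLin R (lineA τ) b)
    (hm : Measurable fun p : ℂ × ℂ => R p.1 p.2) (hb : b < 0) (hbτ : b + τ < 0) :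
    IntegrableOn (fun v : ℝ => cexp (τ * v) * kkb τ b R y v) (Ioi s) ∧
    ∫ v in Ioi s, cexp (τ * v) * kkb τ b R y v
      = -cexp (τ * s) * kkb τ b (fun z w => R z w * (w + τ)⁻¹) y s := by
  have i0 := hR.integrable (x := y + τ ^ 2) (y := τ ^ 2) hm (lineA_pos τ) hb
  obtain ⟨l1, l2⟩ := laplace_integral (κ := fun p : ℝ × ℝ => (b + p.2 * I : ℂ) + τ) (by fun_prop)
    hbτ (fun p => by simp) i0 s
  have e1 : ∀ (v : ℝ) (w : ℂ), cexp (τ * v) * aexp (v + τ ^ 2 : ℝ) (-w)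
      = cexp ((w + τ) * v) * aexp (τ ^ 2 : ℝ) (-w) := by
    intro v w; simp only [aexp, ← exp_add]; congr 1; push_cast; ring
  have e2 : ∀ (v : ℝ) (q : ℂ → ℂ), cexp (τ * v) * kkb τ b (fun z w => R z w * q w) y v
      = (2 * π)⁻¹ * ((2 * π)⁻¹ * ∫ p : ℝ × ℝ, cexp (((b + p.2 * I : ℂ) + τ) * v)
        * (aexp (y + τ ^ 2 : ℝ) (lineA τ + p.1 * I) * aexp (τ ^ 2 : ℝ) (-(b + p.2 * I))
        * R (lineA τ + p.1 * I) (b + p.2 * I)) * q (b + p.2 * I)) := by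
    intro v q
    rw [kkb, ← vl2_const_mul, vl2]
    congr 3; ext p
    linear_combination (aexp (y + τ ^ 2 : ℝ) (lineA τ + p.1 * I)
      * R (lineA τ + p.1 * I) (b + p.2 * I) * q (b + p.2 * I)) * e1 v (b + p.2 * I)
  have e3 := fun v => e2 v fun _ => 1
  simp only [mul_one] at e3
  simp only [e3]
  refine ⟨(l1.const_mul _).const_mul _, ?_⟩
  rw [integral_const_mul, integral_const_mul, l2, neg_mul, e2]
  ring

/-- The integrand of `ℰ₁`, integrated over a vertical line. -/
def gaussLine (k δ c Δ : ℝ) : ℂ :=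
  vl c fun ζ => cexp (-ζ * Δ + k * ζ ^ 2) * (2 * ζ * (ζ - δ)⁻¹ * (ζ + δ)⁻¹)

theorem regOn_gauss {δ lo hi : ℝ} (h1 : δ < lo) (h2 : hi < -δ) :
    RegOn (fun ζ : ℂ => 2 * ζ * (ζ - δ)⁻¹ * (ζ + δ)⁻¹) lo hi
      (‖(2 : ℂ)‖ * (1 + ‖(0 + δ : ℂ)‖ * (lo - δ)⁻¹) * ((-δ - hi) / 2)⁻¹) :=
  (((regOn_const 2 lo hi).mul (regOn_moebius (p := δ) (q := 0) (by simpa) hi)).mul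
    (regOn_inv_right h2 lo)).congr fun z _ => by push_cast; ring

theorem gaussLine_neg {k δ c : ℝ} (hk : 0 < k) (h1 : δ < c) (h2 : c < -δ) (Δ : ℝ) :
    gaussLine k δ c (-Δ) = -gaussLine k δ c Δ := by
  have e1 : gaussLine k δ c (-Δ) = -gaussLine k δ (-c) Δ := by
    rw [gaussLine, vl_neg, gaussLine, ← vl_neg_fun]
    congr 1
    ext z
    rw [show (-z - δ : ℂ) = -(z + δ) by ring, show (-z + δ : ℂ) = -(z - δ) by ring, inv_neg,
      inv_neg, show -(-z) * ((-Δ : ℝ) : ℂ) + k * (-z) ^ 2 = -z * Δ + k * z ^ 2 by push_cast; ring]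
    ring
  obtain ⟨lo, hlo, hlo'⟩ := exists_between (show δ < min c (-c) by rw [lt_min_iff]; constructor <;> linarith)
  rw [lt_min_iff] at hlo'
  rw [e1, neg_inj]
  exact (decayExp_gauss hk Δ (lo - 1)).vl_shift (regOn_gauss (hi := -lo) hlo (by linarith)) (by linarith) (by linarith) (by linarith)
    (by linarith) (by linarith) (by linarith)

theorem E1_eq_sign_mul {δ u c : ℝ} (hu : 0 < u) (h1 : δ < c) (h2 : c < -δ) (X Y : ℝ) :
    E1 δ u X Y = (Real.sign (X - Y) : ℂ)
      * (gaussLine (2 * u) δ c |X - Y| + cexp (δ * |X - Y| + 2 * (δ : ℂ) ^ 2 * u)) := by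
  have hd : |δ| = -δ := abs_of_nonpos (by linarith)
  have e : ∀ ζ : ℂ, cexp (-ζ * |X - Y| + 2 * ζ ^ 2 * u) * (2 * ζ / (ζ ^ 2 - (δ : ℂ) ^ 2))
      = cexp (-ζ * |X - Y| + (2 * u : ℝ) * ζ ^ 2) * (2 * ζ * (ζ - δ)⁻¹ * (ζ + δ)⁻¹) := by
    intro ζ
    rw [show ζ ^ 2 - (δ : ℂ) ^ 2 = (ζ - δ) * (ζ + δ) by ring, div_eq_mul_inv, mul_inv]
    push_cast
    ring_nf
  have k1 := regOn_moebius (p := δ) (q := 0) (lo := (δ + c) / 2) (by simp; linarith) (-δ + 2)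
  have k2 : RegOn (fun ζ : ℂ => 2 * ζ * (ζ - δ)⁻¹) ((δ + c) / 2) (-δ + 2) _ :=
    ((regOn_const 2 _ _).mul k1).congr fun z _ => by ring
  have k3 := regOn_inv_left (p := -δ) (lo := -δ + 1 / 2) (by simp) (-δ + 2)
  have k4 : RegOn (fun ζ : ℂ => 2 * ζ * (ζ - δ)⁻¹ * (ζ + δ)⁻¹) (-δ + 1 / 2) (-δ + 2) _ :=
    ((k2.mono (by linarith) le_rfl).mul k3).congr fun z _ => by rw [sub_neg_eq_add]
  have g := decayExp_gauss (k := 2 * u) (by linarith) |X - Y| ((δ + c) / 2 - 1)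
  have hδ : (δ : ℂ) ≠ 0 := by
    norm_cast; linarith
  rw [E1, hd]
  simp only [e]
  rw [g.contourDown_eq k4 (c := -δ + 1) (by linarith) (by linarith) (by linarith) (by linarith)
    (by linarith)]
  have := g.vl_cross (p := -δ) (a := c) (c := -δ + 1) k2 (by linarith) (by simpa) (by simp)
    (by linarith) (by linarith)
  simp only [sub_neg_eq_add] at this
  rw [this, gaussLine]
  have e2 : 2 * (-(δ : ℂ)) * (-(δ : ℂ) - (δ : ℂ))⁻¹ = 1 := by
    rw [show -(δ : ℂ) - δ = 2 * -δ by ring]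
    exact mul_inv_cancel₀ (by simpa using hδ)
  rw [e2, mul_one, neg_mul_neg]
  congr 3
  push_cast
  ring

theorem gaussLine_sign {k δ c : ℝ} (hk : 0 < k) (h1 : δ < c) (h2 : c < -δ) (Δ : ℝ) :
    (Real.sign Δ : ℂ) * gaussLine k δ c |Δ| = gaussLine k δ c Δ := by
  rcases lt_trichotomy Δ 0 with h | h | h
  · rw [Real.sign_of_neg h, abs_of_neg h, gaussLine_neg hk h1 h2]; simp
  · have := gaussLine_neg hk h1 h2 0
    rw [neg_zero, self_eq_neg] at this
    simp [h, this]
  · rw [Real.sign_of_pos h, abs_of_pos h]; simp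

theorem E1_eq {δ u c : ℝ} (hu : 0 < u) (h1 : δ < c) (h2 : c < -δ) (X Y : ℝ) :
    E1 δ u X Y = gaussLine (2 * u) δ c (X - Y)
      + (Real.sign (X - Y) : ℂ) * cexp (δ * |X - Y| + 2 * (δ : ℂ) ^ 2 * u) := by
  rw [E1_eq_sign_mul hu h1 h2, mul_add, gaussLine_sign (by linarith) h1 h2]

theorem E0_add_E1 {δ u c : ℝ} (hu : 0 < u) (h1 : δ < c) (h2 : c < -δ) (X Y : ℝ) :
    E0 δ u X Y + E1 δ u X Y = gaussLine (2 * u) δ c (X - Y) := by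
  rw [E1_eq hu h1 h2, E0]; ring

theorem integral_Ioi_add (f : ℝ → ℂ) (s c : ℝ) :
    ∫ V in Ioi (s + c), f V = ∫ v in Ioi s, f (v + c) := by
  have := (measurePreserving_add_right volume c).setIntegral_preimage_emb
    (MeasurableEquiv.addRight c).measurableEmbedding f (Ioi (s + c))
  rw [← this]
  simp

theorem integrableOn_Ioi_add {f : ℝ → ℂ} {s c : ℝ} :
    IntegrableOn f (Ioi (s + c)) ↔ IntegrableOn (fun v => f (v + c)) (Ioi s) := by
  have := (measurePreserving_add_right volume c).integrableOn_comp_preimage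
    (MeasurableEquiv.addRight c).measurableEmbedding (f := f) (s := Ioi (s + c))
  rw [← this]
  simp [Function.comp_def]

theorem gaussLine_laplace {k δ c : ℝ} (hk : 0 < k) (h1 : δ < c) (h2 : c < -δ) (S Y : ℝ) :
    IntegrableOn (fun V : ℝ => gaussLine k δ c (Y - V) * cexp (δ * V)) (Ioi S) ∧
    ∫ V in Ioi S, gaussLine k δ c (Y - V) * cexp (δ * V)
      = -(cexp (δ * S) * vl c fun ζ => cexp (-ζ * (Y - S : ℝ) + k * ζ ^ 2)
        * (2 * ζ * (ζ - δ)⁻¹ * (ζ + δ)⁻¹ * (ζ + δ)⁻¹)) := by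
  obtain ⟨lo, hlo, hlo'⟩ := exists_between h1
  obtain ⟨hi, hhi, hhi'⟩ := exists_between h2
  obtain ⟨l1, l2⟩ := laplace_integral (κ := fun t : ℝ => (c + t * I : ℂ) + δ) (r := c + δ)
    (by fun_prop) (by linarith) (fun p => by simp) ((decayExp_gauss hk Y (lo - 1)).integrable_vl
      (regOn_gauss hlo hhi') hlo' hhi (by linarith)) S
  have e2 : ∀ (v : ℝ) (q : ℂ → ℂ), cexp (δ * v) * vl c (fun ζ => cexp (-ζ * (Y - v : ℝ) + k * ζ ^ 2)
      * (2 * ζ * (ζ - δ)⁻¹ * (ζ + δ)⁻¹ * q ζ)) = (2 * π)⁻¹ * ∫ t : ℝ,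
        cexp (((c + t * I : ℂ) + δ) * v) * (cexp (-(c + t * I) * Y + k * (c + t * I) ^ 2)
        * (2 * (c + t * I) * ((c + t * I) - δ)⁻¹ * ((c + t * I) + δ)⁻¹)) * q (c + t * I) := by
    intro v q
    rw [← vl_const_mul, vl]
    congr 2
    ext t
    have e3 : cexp (δ * v) * cexp (-(c + t * I) * (Y - v : ℝ) + k * (c + t * I) ^ 2)
        = cexp (((c + t * I : ℂ) + δ) * v) * cexp (-(c + t * I) * Y + k * (c + t * I) ^ 2) := by
      rw [← exp_add, ← exp_add]; congr 1; push_cast; ring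
    linear_combination (2 * (c + t * I) * ((c + t * I) - δ)⁻¹ * ((c + t * I) + δ)⁻¹
      * q (c + t * I)) * e3
  have e3 := fun v => e2 v fun _ => 1
  simp only [mul_one] at e3
  simp only [gaussLine, mul_comm _ (cexp (δ * _)), e3]
  refine ⟨l1.const_mul _, ?_⟩
  rw [integral_const_mul, l2, e2]
  ring

theorem sign_laplace {δ S Y : ℝ} (hδ : δ < 0) (hY : S < Y) :
    IntegrableOn (fun V : ℝ => (Real.sign (Y - V) : ℂ) * cexp (δ * |Y - V|) * cexp (δ * V))
      (Ioi S) ∧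
    ∫ V in Ioi S, (Real.sign (Y - V) : ℂ) * cexp (δ * |Y - V|) * cexp (δ * V)
      = (Y - S) * cexp (δ * Y) + cexp (δ * Y) / (2 * δ) := by
  have hre : (2 * δ : ℂ).re < 0 := by simp; linarith
  have j1 : IntegrableOn (fun V : ℝ => -cexp (-(δ * Y)) * cexp ((2 * δ : ℂ) * V)) (Ioi Y) :=
    (integrableOn_exp_mul_complex_Ioi hre Y).const_mul _
  have e1 : Set.EqOn (fun V : ℝ => (Real.sign (Y - V) : ℂ) * cexp (δ * |Y - V|) * cexp (δ * V))
      (fun V : ℝ => -cexp (-(δ * Y)) * cexp ((2 * δ : ℂ) * V)) (Ioi Y) := by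
    intro V (hV : Y < V)
    beta_reduce
    rw [Real.sign_of_neg (by linarith), abs_of_neg (by linarith)]
    push_cast
    rw [mul_assoc, ← exp_add, neg_one_mul, neg_mul, ← exp_add]
    congr 2
    ring
  have e2 : Set.EqOn (fun V : ℝ => (Real.sign (Y - V) : ℂ) * cexp (δ * |Y - V|) * cexp (δ * V))
      (fun _ : ℝ => cexp (δ * Y)) (Ioo S Y) := by
    intro V hV
    beta_reduce
    rw [Real.sign_of_pos (by linarith [hV.2]), abs_of_pos (by linarith [hV.2])]
    push_cast
    rw [one_mul, ← exp_add]
    congr 1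
    ring
  have i1 := j1.congr_fun e1.symm measurableSet_Ioi
  have i3 := ((integrableOn_const (μ := volume) (by simp) (by simp)).congr_fun e2.symm
    measurableSet_Ioo).congr_set_ae Ioo_ae_eq_Ioc.symm
  rw [← Set.Ioc_union_Ioi_eq_Ioi hY.le]
  refine ⟨i3.union i1, ?_⟩
  rw [setIntegral_union (Set.Ioc_disjoint_Ioi le_rfl) measurableSet_Ioi i3 i1,
    setIntegral_congr_set Ioo_ae_eq_Ioc.symm, setIntegral_congr_fun measurableSet_Ioo e2,
    setIntegral_congr_fun measurableSet_Ioi e1, integral_const_mul,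
    integral_exp_mul_complex_Ioi hre]
  have hδ' : (δ : ℂ) ≠ 0 := by norm_cast; exact hδ.ne
  have e3 : cexp (-(δ * Y)) * cexp (2 * δ * Y) = cexp (δ * Y) := by
    rw [← exp_add]; congr 1; ring
  rw [← e3]
  simp [hY.le]
  field_simp

section
variable {τ u : ℝ}

theorem kkb_add {F G : ℂ → ℂ → ℂ} {b : ℝ} (hF : LineLin F (lineA τ) b) (hG : LineLin G (lineA τ) b)
    (mF : Measurable fun p : ℂ × ℂ => F p.1 p.2) (mG : Measurable fun p : ℂ × ℂ => G p.1 p.2)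
    (hb : b < 0) (x y : ℝ) :
    kkb τ b (fun z w => F z w + G z w) x y = kkb τ b F x y + kkb τ b G x y := by
  simp only [kkb, mul_add, vl2]
  rw [integral_add (hF.integrable mF (lineA_pos τ) hb) (hG.integrable mG (lineA_pos τ) hb)]
  ring

theorem kkb_congr {F G : ℂ → ℂ → ℂ} {b : ℝ}
    (h : ∀ z w : ℂ, z.re = lineA τ → w.re = b → F z w = G z w) : kkb τ b F = kkb τ b G := by
  ext x y
  exact vl2_congr fun z w hz hw => by rw [h z w hz hw]

theorem gauss_residue_eq (x y : ℝ) (r : ℂ → ℂ) :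
    cexp (-(2 * u ^ 3 / 3) + u * (x + y + 2 * τ ^ 2)) *
      vl (lineA τ) (fun z => aexp (x + τ ^ 2 : ℝ) z * (aexp (y + τ ^ 2 : ℝ) (-(z - 2 * u)) * r z))
      = vl (lineA τ - u) (fun ζ => cexp (-ζ * (x - y : ℝ) + (2 * u : ℝ) * ζ ^ 2) * r (ζ + u)) := by
  have e' := vl_add_re (lineA τ - u) u
    (fun ζ => cexp (-(ζ - u) * (x - y : ℝ) + (2 * u : ℝ) * (ζ - u) ^ 2) * r ζ)
  simp only [add_sub_cancel_right, sub_add_cancel] at e'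
  rw [e', ← vl_const_mul]
  congr 1
  ext z
  rw [← mul_assoc, ← mul_assoc]
  congr 1
  simp only [aexp, ← exp_add]
  congr 1
  push_cast
  ring

theorem kkb_cross_diag {b lo hi M : ℝ} {f g : ℂ → ℂ} (hu : 8 * lineA τ ≤ u)
    (hf : LineBd f (lineA τ)) (hg : RegOn (fun v => g (-v)) lo hi M) (mf : Measurable f)
    (mg : Measurable g) (h1 : lo < lineA τ) (h2 : b + 2 * u < lineA τ) (h3 : -b < hi) (x y : ℝ) :
    cexp (-(2 * u ^ 3 / 3) + u * (x + y + 2 * τ ^ 2))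
        * kkb τ b (fun z w => (z - w - 2 * u)⁻¹ * (f z * g w)) x y
      = cexp (-(2 * u ^ 3 / 3) + u * (x + y + 2 * τ ^ 2))
        * kk τ (fun z w => (z - w - 2 * u)⁻¹ * (f z * g w)) x y
      + vl (lineA τ - u) (fun ζ => cexp (-ζ * (x - y : ℝ) + (2 * u : ℝ) * ζ ^ 2)
        * (f (ζ + u) * g (ζ + u - 2 * u))) := by
  obtain ⟨h0, -, -, hA⟩ := lineA_facts τ
  have lin : ∀ b, b + 2 * u ≠ lineA τ → lo ≤ -b → -b ≤ hi →
      LineLin (fun z w => (z - w - 2 * u)⁻¹ * (f z * g w)) (lineA τ) b := fun b h h' h'' =>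
    lineLin_of_factor (e := 0) (q := 1) (c := 2 * u) (f := f) (g := g)
      (fun z w => by push_cast; ring) hf
      ⟨M, fun w hw => by
        have := (hg (-w) (by simpa [hw]) (by simp [hw]; linarith [abs_nonneg w.im])).2
        beta_reduce at this
        rwa [neg_neg] at this⟩ h
  have := vl2_cross (x := x + τ ^ 2) (y := y + τ ^ 2) (a := lineA τ) (b := b) (c := -lineA τ)
    (lo := lo) (hi := hi) (R := fun z w => -f z * g w)
    (G := fun z w => (z - w - 2 * u)⁻¹ * (f z * g w)) (p := fun z => z - 2 * u)
    (fun z w => by rw [show z - w - 2 * u = -(w - (z - 2 * u)) by ring, inv_neg]; ring)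
    (by fun_prop) (by linarith) (by linarith) (fun z _ => ⟨_, (regOn_const _ _ _).mul hg⟩)
    (by linarith) (fun z hz => by simp; constructor <;> linarith) h3
    (lin b h2.ne (by linarith) h3.le)
    (lin _ (ne_of_gt (by linarith)) (by linarith) (by linarith))
  have r := gauss_residue_eq (τ := τ) (u := u) x y fun z => -f z * g (z - 2 * u)
  simp only [neg_mul, mul_neg, vl_neg_fun] at this r ⊢
  rw [kkb, this, kk]
  linear_combination -r

theorem A22_eq (hu : 8 * lineA τ ≤ u) (x y : ℝ) :
    A22 (τ - u) u (x + τ ^ 2 - u ^ 2) (y + τ ^ 2 - u ^ 2)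
      = -(cexp (-(2 * u ^ 3 / 3) + u * (x + y + 2 * τ ^ 2)) * kk τ (R22 τ u) x y) := by
  obtain ⟨h0, h1, h2, hA⟩ := lineA_facts τ
  have b1 : LineBd (fun z => (z - (2 * u - τ : ℝ))⁻¹) (lineA τ) :=
    (regOn_inv_right (hi := lineA τ) (by linarith) _).lineBd le_rfl le_rfl
  have c1 := kkb_cross_diag (b := -(2 * u)) (g := fun _ => 1) hu b1 (regOn_const 1 0 (2 * u + 1)) (by fun_prop)
    measurable_const (by linarith) (by linarith) (by linarith) x y
  have c2 := kkb_cross_diag (b := τ - 2 * u + 1) hu (lineBd_const 1 _)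
    (g := fun w => (w - (-(2 * u - τ) : ℝ))⁻¹)
    (RegOn.neg_arg_inv_right (p := -(2 * u - τ)) (hi := 2 * u - τ - 1 / 2) (by linarith) 0)
    measurable_const (by fun_prop) (by linarith) (by linarith) (by linarith) x y
  simp only [mul_one, one_mul, ofReal_neg, sub_neg_eq_add] at c1 c2
  push_cast at c1 c2
  have b2 : LineBd (fun w : ℂ => (w + (2 * u - τ))⁻¹) (-lineA τ) := lineBd_inv (by simp; linarith)
  push_cast at b1
  have key : kk τ (R22 τ u) x y = kk τ (fun z w => (z - w - 2 * u)⁻¹ * (z - (2 * u - τ))⁻¹) x y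
      + kk τ (fun z w => (z - w - 2 * u)⁻¹ * (w + (2 * u - τ))⁻¹) x y := by
    rw [kk_eq_kkb, kk_eq_kkb, kk_eq_kkb, ← kkb_add
      (lineLin_of_factor (c := 2 * u) (e := 0) (q := 1) (g := fun _ => 1)
        (fun z w => by push_cast; ring) b1
        (lineBd_const 1 _) (by linarith))
      (lineLin_of_factor (c := 2 * u) (e := 0) (q := 1) (f := fun _ => 1)
        (fun z w => by push_cast; ring) (lineBd_const 1 _) b2 (by linarith)) (by fun_prop) (by fun_prop) (by linarith)]
    simp only [← mul_add]
    rfl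
  have hlast : gaussLine (2 * u) (τ - u) (lineA τ - u) (x - y)
      = vl (lineA τ - u) (fun ζ => cexp (-ζ * (x - y : ℝ) + (2 * u : ℝ) * ζ ^ 2)
          * (ζ + u - (2 * u - τ))⁻¹)
        + vl (lineA τ - u) (fun ζ => cexp (-ζ * (x - y : ℝ) + (2 * u : ℝ) * ζ ^ 2)
          * (ζ + u - 2 * u + (2 * u - τ))⁻¹) := by
    have r1 := regOn_inv_right (p := u - τ) (hi := lineA τ - u + 1) (by linarith) (lineA τ - u - 1)
    have r2 := regOn_inv_left (p := (τ - u : ℝ)) (lo := lineA τ - u - 1) (by simp; linarith)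
      (lineA τ - u + 1)
    have dg := decayExp_gauss (k := 2 * u) (by linarith) (x - y) (lineA τ - u - 1)
    have e : ∀ ζ : ℂ, ζ + u - (2 * u - τ) = ζ - (u - τ : ℝ) ∧
        ζ + u - 2 * u + (2 * u - τ) = ζ - (τ - u : ℝ) := fun ζ => by
      constructor <;> push_cast <;> ring
    simp only [e]
    rw [← vl_add (dg.integrable_vl r1 (by linarith) (by linarith) (by linarith))
      (dg.integrable_vl r2 (by linarith) (by linarith) (by linarith)), gaussLine]
    refine vl_congr fun ζ hζ => ?_
    have n1 : ζ - (τ - u : ℝ) ≠ 0 := ne_zero_of_re (by simp [hζ]; linarith)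
    have n2 : ζ + (τ - u : ℝ) ≠ 0 := ne_zero_of_re (by simp [hζ]; linarith)
    rw [show ζ - (u - τ : ℝ) = ζ + (τ - u : ℝ) by push_cast; ring]
    field_simp
    ring
  have hE := E0_add_E1 (δ := τ - u) (u := u) (c := lineA τ - u) (by linarith) (by linarith)
    (by linarith) (x + τ ^ 2 - u ^ 2) (y + τ ^ 2 - u ^ 2)
  rw [A22, hE, A22_first_eq hu, A22_second_eq hu, c1, c2, key,
    show x + τ ^ 2 - u ^ 2 - (y + τ ^ 2 - u ^ 2) = x - y by ring, hlast]
  push_cast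
  ring

end

theorem contour_eq_vv {τ y a A lo hi cz M : ℝ} {c : ℂ} {F r : ℂ → ℂ}
    (hF : ∀ z, F (z + cz) = c * (aexp (y + τ ^ 2 : ℝ) z * r z)) (h : RegOn r lo hi M)
    (hA : a + cz = A) (l5 : lo < a) (l6 : lo < lineA τ) (l7 : a < hi) (l8 : lineA τ < hi) :
    contourDown A F = -(c * vv τ r y) := by
  rw [← hA, ← contourDown_add_re]
  simp only [hF, contourDown_const_mul]
  rw [(decayExp_aexp _).contourDown_eq h l5 l6 l7 l8 (lineA_pos τ), mul_neg, vv]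

theorem contour_cross_vv {τ y a A lo hi cz M p : ℝ} {c : ℂ} {F r q : ℂ → ℂ}
    (hF : ∀ z, F (z + cz) = c * (aexp (y + τ ^ 2 : ℝ) z * r z)) (hr : ∀ z, r z = q z * (z - p)⁻¹)
    (h : RegOn q lo hi M) (hA : a + cz = A) (l5 : lo < a) (l6 : a < p) (l7 : p < lineA τ)
    (l8 : lineA τ < hi) :
    contourDown A F = c * (-vv τ r y + aexp (y + τ ^ 2 : ℝ) p * q p) := by
  rw [← hA, ← contourDown_add_re]
  simp only [hF, contourDown_const_mul, hr]
  rw [(decayExp_aexp _).contourDown_cross h l5 l6 l7 l8 (lineA_pos τ), vv]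
  simp only [hr]

theorem Psi_neg_eq (τ x : ℝ) :
    Psi (-τ) x = -vv τ (fun z => (z - τ)⁻¹) x + aexp (x + τ ^ 2 : ℝ) τ := by
  obtain ⟨h0, h1, h2, hA⟩ := lineA_facts τ
  rw [Psi, contour_cross_vv (τ := τ) (y := x) (a := τ - 1) (lo := τ - 2) (hi := lineA τ + 1)
    (cz := 0) (p := τ) (c := 1) (r := fun z => (z - τ)⁻¹) (q := fun _ => 1)
    (fun z => by simp [aexp, ← sub_eq_add_neg]) (fun z => by simp) (regOn_const 1 _ _), one_mul,
    mul_one]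
  all_goals linarith

section
variable {τ u : ℝ}

theorem shift_exp_pos (y : ℝ) (z : ℂ) :
    cexp ((z + u) ^ 3 / 3 - (z + u) ^ 2 * u - (z + u) * (y + τ ^ 2 - u ^ 2 : ℝ))
      = cexp (u ^ 3 / 3 - u * (y + τ ^ 2)) * aexp (y + τ ^ 2 : ℝ) z := by
  rw [aexp, ← exp_add]; congr 1; push_cast; ring

theorem shift_exp_neg (y : ℝ) (z : ℂ) :
    cexp ((z + (-u : ℝ)) ^ 3 / 3 + (z + (-u : ℝ)) ^ 2 * u
      - (z + (-u : ℝ)) * (y + τ ^ 2 - u ^ 2 : ℝ))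
      = cexp (-(u ^ 3 / 3) + u * (y + τ ^ 2)) * aexp (y + τ ^ 2 : ℝ) z := by
  rw [aexp, ← exp_add]; congr 1; push_cast; ring

theorem g1_eq (hu : 8 * lineA τ ≤ u) (y : ℝ) :
    g1 (τ - u) u (y + τ ^ 2 - u ^ 2) = -(cexp (u ^ 3 / 3 - u * (y + τ ^ 2))
      * vv τ (fun z => (z + τ) * (z + u)⁻¹ * 2⁻¹) y) := by
  obtain ⟨h0, h1, h2, hA⟩ := lineA_facts τ
  have k := (regOn_moebius (p := -u) (q := τ) (lo := -u + 1 / 2) (by simp) (lineA τ + 1)).mul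
    (regOn_const 2⁻¹ _ _)
  simp only [sub_neg_eq_add] at k
  refine contour_eq_vv (a := 1 - u) (cz := u) (fun z => ?_) k ?_ ?_ ?_ ?_ ?_
  any_goals linarith
  rw [shift_exp_pos]; push_cast; simp only [div_eq_mul_inv, mul_inv]; ring

theorem g2_eq (y : ℝ) :
    g2 (τ - u) u (y + τ ^ 2 - u ^ 2)
      = cexp (-(u ^ 3 / 3) + u * (y + τ ^ 2)) * Psi (-τ) y := by
  obtain ⟨h0, h1, h2, hA⟩ := lineA_facts τ
  rw [g2, contour_cross_vv (τ := τ) (y := y) (a := τ - 1) (lo := τ - 2) (hi := lineA τ + 1)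
    (cz := -u) (p := τ) (c := cexp (-(u ^ 3 / 3) + u * (y + τ ^ 2)))
    (r := fun z => (z - τ)⁻¹) (q := fun _ => 1) (fun z => ?_) (fun z => by simp)
    (regOn_const 1 _ _), Psi_neg_eq, mul_one]
  any_goals linarith
  rw [shift_exp_neg, mul_assoc, one_div]; push_cast; ring_nf

theorem g3_eq (y : ℝ) :
    g3 (τ - u) u (y + τ ^ 2 - u ^ 2) = -(cexp (u ^ 3 / 3 - u * (y + τ ^ 2))
      * vv τ (fun z => (z + τ)⁻¹) y) := by
  obtain ⟨h0, h1, h2, hA⟩ := lineA_facts τ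
  have k := regOn_inv_left (p := -τ) (lo := -τ + 1 / 2) (by simp) (lineA τ + 1)
  simp only [sub_neg_eq_add] at k
  refine contour_eq_vv (a := -τ + 1) (cz := u) (fun z => ?_) k ?_ ?_ ?_ ?_ ?_
  any_goals linarith
  rw [shift_exp_pos, mul_assoc]; push_cast; simp only [one_div]; ring_nf

/-- The rational factor of `g₄`. -/
def r4 (τ u : ℝ) (z : ℂ) : ℂ :=
  2 * ((z - u) * (z - (2 * u - τ))⁻¹ * (z - (2 * u - τ))⁻¹ * (z - τ)⁻¹)

theorem g4_eq (hu : 8 * lineA τ ≤ u) (y : ℝ) :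
    g4 (τ - u) u (y + τ ^ 2 - u ^ 2) = cexp (-(u ^ 3 / 3) + u * (y + τ ^ 2))
      * (-vv τ (r4 τ u) y + aexp (y + τ ^ 2 : ℝ) τ * (2 * (τ - u : ℂ))⁻¹) := by
  obtain ⟨h0, h1, h2, hA⟩ := lineA_facts τ
  have k1 := regOn_inv_right (p := 2 * u - τ) (hi := lineA τ + 1) (by linarith) (τ - 2)
  have k2 := ((regOn_const 2 _ _).mul (k1.add ((regOn_const (u - τ) _ _).mul (k1.mul k1)))).congr
    (Q := fun z : ℂ => 2 * ((z - u) * (z - (2 * u - τ))⁻¹ * (z - (2 * u - τ))⁻¹)) fun z _ => by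
      have := mul_self_mul_inv (z - (2 * u - τ : ℂ))⁻¹
      rw [inv_inv] at this
      push_cast
      linear_combination 2 * this
  have hne : (τ - u : ℂ) ≠ 0 := by norm_cast; linarith
  rw [g4, contour_cross_vv (τ := τ) (y := y) (a := τ - 1) (cz := -u) (p := τ)
    (c := cexp (-(u ^ 3 / 3) + u * (y + τ ^ 2))) (r := r4 τ u) (fun z => ?_)
    (fun z => by rw [r4]; ring) k2]
  any_goals rw [abs_of_nonpos (by linarith : τ - u ≤ 0)]
  any_goals linarith
  · rw [show (τ - (2 * u - τ) : ℂ) = 2 * (τ - u) by ring]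
    field_simp
  · rw [shift_exp_neg, mul_assoc, r4]; push_cast
    simp only [div_eq_mul_inv, mul_inv, pow_two]
    ring_nf

/-- The constant in the rescaled versions of `h₁` and `h₂`. -/
def expP (τ s : ℝ) : ℂ := cexp (2 * τ ^ 3 / 3 + τ * s)

theorem fFun_eq (v : ℝ) : fFun (τ - u) u (v + (τ ^ 2 - u ^ 2))
    = cexp (2 * τ ^ 3 / 3 - τ ^ 2 * u + u ^ 3 / 3) * cexp ((τ - u) * v) := by
  rw [fFun, ← exp_add]; congr 1; push_cast; ring

/-- The coefficient of the part of the column `(-h₁, h₂)` that does not contribute. -/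
def coefC (τ u s : ℝ) : ℂ :=
  expP τ s * aexp (s + τ ^ 2 : ℝ) (2 * u - τ) * (2 * (τ - u : ℂ))⁻¹

theorem kkb_laplace_shift {s y b c : ℝ} {C : ℂ} {R : ℂ → ℂ → ℂ} {F : ℝ → ℂ}
    (hF : ∀ v, F (v + c) = C * (cexp (τ * v) * kkb τ b R y v)) (hR : LineLin R (lineA τ) b)
    (hm : Measurable fun p : ℂ × ℂ => R p.1 p.2) (hb : b < 0) (hbτ : b + τ < 0) :
    IntegrableOn F (Ioi (s + c)) ∧ ∫ V in Ioi (s + c), F V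
      = -(C * cexp (τ * s)) * kkb τ b (fun z w => R z w * (w + τ)⁻¹) y s := by
  obtain ⟨l1, l2⟩ := kkb_laplace (s := s) (y := y) hR hm hb hbτ
  rw [integrableOn_Ioi_add, integral_Ioi_add]
  simp only [hF]
  refine ⟨l1.const_mul _, ?_⟩
  rw [integral_const_mul, l2]
  ring

theorem A12tilde_laplace (hu : 8 * lineA τ ≤ u) (s y : ℝ) :
    IntegrableOn (fun V => A12tilde (τ - u) u (y + τ ^ 2 - u ^ 2) V * fFun (τ - u) u V)
      (Ioi (s + (τ ^ 2 - u ^ 2))) ∧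
    ∫ V in Ioi (s + (τ ^ 2 - u ^ 2)),
        A12tilde (τ - u) u (y + τ ^ 2 - u ^ 2) V * fFun (τ - u) u V
      = -(cexp (u ^ 3 / 3 - u * (y + τ ^ 2)) * expP τ s
          * kk τ (fun z w => R12 τ u z w * (w + τ)⁻¹) y s)
        - coefC τ u s * g1 (τ - u) u (y + τ ^ 2 - u ^ 2) := by
  obtain ⟨h0, h1, h2, hA⟩ := lineA_facts τ
  have f1 : LineBd (fun z : ℂ => (z + (2 * u - τ)) * (z - -u)⁻¹ * 2⁻¹) (lineA τ) :=
    ((regOn_moebius (by simp; linarith) _).mul (regOn_const _ _ _)).lineBd le_rfl le_rfl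
  have g1 : ∀ b, b + (2 * u - τ) ≠ 0 → LineBd (fun w : ℂ => (w + (2 * u - τ))⁻¹) b :=
    fun b h => lineBd_inv (by simpa)
  have m2 : ∀ b, b < lineA τ → b + (2 * u - τ) ≠ 0 → b + τ ≠ 0 →
      LineLin (fun z w => R12 τ u z w * (w + τ)⁻¹) (lineA τ) b := fun b h h' h'' =>
    lineLin_of_factor (g := fun w => (w + (2 * u - τ))⁻¹ * (w + τ)⁻¹) (c := 0) (e := 1)
      (q := 2 * u)
      (fun z w => by rw [R12_factor]; ring) f1 ((g1 b h').mul (lineBd_inv (by simpa))) (by linarith)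
  obtain ⟨i, lap⟩ := kkb_laplace_shift (τ := τ) (s := s) (y := y) (b := τ - 2 * u - 1)
    (C := cexp (-u * y + (2 * τ ^ 3 / 3 - τ ^ 2 * u + u ^ 3 / 3))) (R := R12 τ u)
    (c := τ ^ 2 - u ^ 2)
    (F := fun V => A12tilde (τ - u) u (y + τ ^ 2 - u ^ 2) V * fFun (τ - u) u V) (fun v => by
      have e : cexp (-u * (y - v)) * (cexp (2 * τ ^ 3 / 3 - τ ^ 2 * u + u ^ 3 / 3)
          * cexp ((τ - u) * v))
          = cexp (-u * y + (2 * τ ^ 3 / 3 - τ ^ 2 * u + u ^ 3 / 3)) * cexp (τ * v) := by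
        simp only [← exp_add]; congr 1; ring
      rw [fFun_eq, ← add_sub_assoc, A12tilde_eq hu]
      linear_combination (kkb τ (τ - 2 * u - 1) (R12 τ u) y v) * e)
    (lineLin_of_factor R12_factor f1 (g1 _ (by linarith)) (by linarith)) (by unfold R12; fun_prop)
    (by linarith) (by linarith)
  refine ⟨i, lap.trans ?_⟩
  have c1 : kkb τ (τ - 2 * u - 1) (fun z w => R12 τ u z w * (w + τ)⁻¹) y s
      = kk τ (fun z w => R12 τ u z w * (w + τ)⁻¹) y s
        - aexp (s + τ ^ 2 : ℝ) (2 * u - τ) * (2 * (τ - u : ℂ))⁻¹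
          * vv τ (fun z => (z + τ) * (z + u)⁻¹ * 2⁻¹) y := by
    refine (vl2_cross (c := -lineA τ) (lo := |τ| + 1) (hi := 2 * u - τ + 2)
      (R := fun z w => ((z + (2 * u - τ)) * (z + u)⁻¹) * ((z + w + 2 * u) * (z - w)⁻¹) * 2⁻¹
        * (w + τ)⁻¹) (p := fun _ => -(2 * u - τ)) (fun z w => by rw [R12, sub_neg_eq_add]; ring)
      (by unfold R12; fun_prop) (by linarith) (by linarith)
      (fun z hz => ?_) (by linarith) (fun z hz => by constructor <;> simp <;> linarith)
      (by linarith) (m2 _ (by linarith) (by linarith) (by linarith))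
      (m2 _ (by linarith) (by linarith) (by linarith))).trans ?_
    · have k1 := regOn_const (-((z + (2 * u - τ)) * (z + u)⁻¹) * 2⁻¹) (|τ| + 1) (2 * u - τ + 2)
      have k3 := regOn_moebius (p := -z) (q := -z - 2 * u) (lo := |τ| + 1)
        (by simp; linarith) (2 * u - τ + 2)
      have k4 := RegOn.neg_arg_inv (p := -τ) (lo := |τ| + 1) (by simp; linarith) (2 * u - τ + 2)
      exact ⟨_, ((k1.mul k4).mul k3).congr fun v _ => by push_cast; ring⟩
    · rw [kk, vv, ← vl_const_mul]
      congr 1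
      refine vl_congr fun z hz => ?_
      have n2 : (z + (2 * u - τ)) * (z + (2 * u - τ))⁻¹ = 1 :=
        mul_inv_cancel₀ (ne_zero_of_re (by simp [hz]; linarith))
      rw [neg_neg, show (-(2 * u - τ) + τ : ℂ) = 2 * (τ - u : ℂ) by ring, sub_neg_eq_add,
        show (z + -(2 * u - τ) + 2 * u : ℂ) = z + τ by ring]
      linear_combination (aexp (y + τ ^ 2 : ℝ) z * aexp (s + τ ^ 2 : ℝ) (2 * u - τ)
        * (z + u)⁻¹ * (z + τ) * 2⁻¹ * (2 * (τ - u : ℂ))⁻¹) * n2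
  have e2 : cexp (-u * y + (2 * τ ^ 3 / 3 - τ ^ 2 * u + u ^ 3 / 3)) * cexp (τ * s)
      = cexp (u ^ 3 / 3 - u * (y + τ ^ 2)) * expP τ s := by
    rw [expP, ← exp_add, ← exp_add]; congr 1; ring
  rw [c1, g1_eq hu, coefC, e2]
  ring

theorem h2_eq (hu : 8 * lineA τ ≤ u) (s y : ℝ) :
    h2 (τ - u) u (s + (τ ^ 2 - u ^ 2)) (y + τ ^ 2 - u ^ 2)
      = cexp (u ^ 3 / 3 - u * (y + τ ^ 2)) *
          (-(expP τ s * kk τ (fun z w => R12 τ u z w * (w + τ)⁻¹) y s)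
            - vv τ (fun z => (z + τ)⁻¹) y)
        - coefC τ u s * g1 (τ - u) u (y + τ ^ 2 - u ^ 2) := by
  rw [h2, (A12tilde_laplace hu s y).2, g3_eq]
  ring

theorem A22tilde_laplace (hu : 8 * lineA τ ≤ u) (s y : ℝ) :
    IntegrableOn (fun V => A22tilde (τ - u) u (y + τ ^ 2 - u ^ 2) V * fFun (τ - u) u V)
      (Ioi (s + (τ ^ 2 - u ^ 2))) ∧
    ∫ V in Ioi (s + (τ ^ 2 - u ^ 2)),
        A22tilde (τ - u) u (y + τ ^ 2 - u ^ 2) V * fFun (τ - u) u V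
      = cexp (-(u ^ 3 / 3) + u * (y + τ ^ 2)) *
          (expP τ s * kk τ (fun z w => R22 τ u z w * (w + τ)⁻¹) y s
            - coefC τ u s * vv τ (fun z => (z - τ)⁻¹) y)
        + fFun (τ - u) u (s + (τ ^ 2 - u ^ 2)) *
          vl (lineA τ - u) (fun ζ => cexp (-ζ * (y - s : ℝ) + (2 * u : ℝ) * ζ ^ 2)
            * (2 * ζ * (ζ - (τ - u : ℝ))⁻¹ * (ζ + (τ - u : ℝ))⁻¹ * (ζ + (τ - u : ℝ))⁻¹)) := by
  obtain ⟨h0, h1, h2, hA⟩ := lineA_facts τ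
  have b1 : LineBd (fun z : ℂ => (z - (2 * u - τ))⁻¹) (lineA τ) := by
    have := (regOn_inv_right (p := 2 * u - τ) (hi := lineA τ) (by linarith) _).lineBd le_rfl le_rfl
    push_cast at this
    exact this
  have b2 : LineBd (fun z : ℂ => (z - τ)⁻¹) (lineA τ) :=
    (regOn_inv_left (by simp; linarith) _).lineBd le_rfl le_rfl
  have b3 : ∀ b, b + (2 * u - τ) ≠ 0 → LineBd (fun w : ℂ => (w + (2 * u - τ))⁻¹) b :=
    fun b h => lineBd_inv (by simpa)
  have b4 : ∀ b, b + τ ≠ 0 → LineBd (fun w : ℂ => (w + τ)⁻¹) b := fun b h => lineBd_inv (by simpa)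
  set f : ℂ → ℂ := fun z => (z - (2 * u - τ))⁻¹ + (z - τ)⁻¹ with hf
  set T : ℂ → ℂ → ℂ := fun z w =>
    (z - (2 * u - τ))⁻¹ * (w + (2 * u - τ))⁻¹ * ((z + w) * (z - w - 2 * u)⁻¹) with hT
  set F₁ : ℂ → ℂ → ℂ := fun z w => (z - w - 2 * u)⁻¹ * (f z * (w + τ)⁻¹) with hF₁
  set F₂ : ℂ → ℂ → ℂ := fun z w => (z - τ)⁻¹ * ((w + (2 * u - τ))⁻¹ * (w + τ)⁻¹) with hF₂
  have mF₁ : ∀ b, b + 2 * u ≠ lineA τ → b + τ ≠ 0 → LineLin F₁ (lineA τ) b := fun b h h' =>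
    lineLin_of_factor (e := 0) (q := 1) (c := 2 * u) (g := fun w => (w + τ)⁻¹)
      (fun z w => by rw [hF₁]; push_cast; ring) (b1.add b2) (b4 b h') h
  have mF₂ : ∀ b, b + (2 * u - τ) ≠ 0 → b + τ ≠ 0 → LineLin F₂ (lineA τ) b := fun b h h' =>
    lineLin_mul b2 ((b3 b h).mul (b4 b h'))
  have hmF₁ : Measurable fun q : ℂ × ℂ => F₁ q.1 q.2 := by fun_prop
  have hmF₂ : Measurable fun q : ℂ × ℂ => F₂ q.1 q.2 := by fun_prop
  have split : ∀ b, b + 2 * u ≠ lineA τ → b + (2 * u - τ) ≠ 0 → ∀ z w : ℂ, z.re = lineA τ →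
      w.re = b → T z w * (w + τ)⁻¹ = F₁ z w + F₂ z w ∧ R22 τ u z w * (w + τ)⁻¹ = F₁ z w + F₂ z w := by
    intro b hb hb' z w hz hw
    have n1 : z - (2 * u - τ) ≠ 0 := ne_zero_of_re (by simp [hz]; linarith)
    have n2 : w + (2 * u - τ) ≠ 0 := ne_zero_of_re (by simpa [hw])
    have n3 : z - w - 2 * u ≠ 0 := ne_zero_of_re (by
      simp only [sub_re, hz, hw, mul_re, ofReal_re, ofReal_im, re_ofNat, im_ofNat]
      contrapose! hb; linarith)
    have n4 : z - τ ≠ 0 := ne_zero_of_re (by simp [hz]; linarith)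
    simp only [hT, hF₁, hF₂, hf, R22]
    generalize (w + τ)⁻¹ = q
    constructor <;> field_simp <;> ring
  have d : ∀ b, b + 2 * u ≠ lineA τ → b + (2 * u - τ) ≠ 0 → b + τ ≠ 0 → b < 0 →
      kkb τ b (fun z w => T z w * (w + τ)⁻¹) y s = kkb τ b F₁ y s + kkb τ b F₂ y s ∧
      kkb τ b (fun z w => R22 τ u z w * (w + τ)⁻¹) y s = kkb τ b F₁ y s + kkb τ b F₂ y s := by
    intro b hb hb' h h'
    rw [← kkb_add (mF₁ b hb h) (mF₂ b hb' h) hmF₁ hmF₂ h',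
      kkb_congr fun z w hz hw => (split b hb hb' z w hz hw).1,
      kkb_congr fun z w hz hw => (split b hb hb' z w hz hw).2]
    exact ⟨rfl, rfl⟩
  obtain ⟨i, lap⟩ := kkb_laplace_shift (τ := τ) (s := s) (y := y) (b := τ - 2 * u - 2)
    (C := -cexp (u * y - u ^ 3 / 3 + u * τ ^ 2 + 2 * τ ^ 3 / 3)) (R := T) (c := τ ^ 2 - u ^ 2)
    (F := fun V => A22tilde (τ - u) u (y + τ ^ 2 - u ^ 2) V * fFun (τ - u) u V) (fun v => by
      have e : cexp (-(2 * u ^ 3 / 3) + u * (y + v + 2 * τ ^ 2))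
          * (cexp (2 * τ ^ 3 / 3 - τ ^ 2 * u + u ^ 3 / 3) * cexp ((τ - u) * v))
          = cexp (u * y - u ^ 3 / 3 + u * τ ^ 2 + 2 * τ ^ 3 / 3) * cexp (τ * v) := by
        simp only [← exp_add]; congr 1; ring
      rw [fFun_eq, ← add_sub_assoc, A22tilde_eq hu]
      linear_combination (-kkb τ (τ - 2 * u - 2) T y v) * e)
    (lineLin_of_factor (e := 1) (q := 0) (c := 2 * u) (fun z w => by rw [hT]; push_cast; ring) b1
      (b3 _ (by linarith)) (by linarith)) (by fun_prop) (by linarith) (by linarith)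
  refine ⟨i, lap.trans ?_⟩
  have reg := RegOn.neg_arg_inv (p := -τ) (lo := |τ| + 1) (by simp; linarith) (2 * u - τ + 3)
  simp only [sub_neg_eq_add] at reg
  have c1 := kkb_cross_diag (b := τ - 2 * u - 2) (f := f) (g := fun w => (w + τ)⁻¹) hu (b1.add b2) reg
    (by fun_prop) (by fun_prop) (by linarith) (by linarith) (by linarith) y s
  have c2 : kkb τ (τ - 2 * u - 2) F₂ y s = kkb τ (-lineA τ) F₂ y s
      - aexp (s + τ ^ 2 : ℝ) (2 * u - τ) * (2 * (τ - u : ℂ))⁻¹ * vv τ (fun z => (z - τ)⁻¹) y := by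
    refine (vl2_cross (c := -lineA τ) (lo := |τ| + 1) (hi := 2 * u - τ + 3)
      (R := fun z w => (z - τ)⁻¹ * (w + τ)⁻¹) (p := fun _ => -(2 * u - τ)) (fun z w => by
        rw [hF₂, sub_neg_eq_add]; ring) hmF₂ (by linarith) (by linarith)
      (fun z hz => ⟨_, (regOn_const (z - τ)⁻¹ _ _).mul reg⟩) (by linarith)
      (fun z hz => by constructor <;> simp <;> linarith) (by linarith)
      (mF₂ _ (by linarith) (by linarith)) (mF₂ _ (by linarith) (by linarith))).trans ?_
    rw [kkb, vv, ← vl_const_mul]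
    congr 2
    ext z
    rw [neg_neg, show (-(2 * u - τ) + τ : ℂ) = 2 * (τ - u : ℂ) by ring]
    ring
  have v1 : vl (lineA τ - u) (fun ζ => cexp (-ζ * (y - s : ℝ) + (2 * u : ℝ) * ζ ^ 2)
      * (f (ζ + u) * (ζ + u - 2 * u + τ)⁻¹))
      = vl (lineA τ - u) (fun ζ => cexp (-ζ * (y - s : ℝ) + (2 * u : ℝ) * ζ ^ 2)
        * (2 * ζ * (ζ - (τ - u : ℝ))⁻¹ * (ζ + (τ - u : ℝ))⁻¹ * (ζ + (τ - u : ℝ))⁻¹)) := by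
    refine vl_congr fun ζ hζ => ?_
    have n1 : ζ - (τ - u : ℝ) ≠ 0 := ne_zero_of_re (by simp [hζ]; linarith)
    have n2 : ζ + (τ - u : ℝ) ≠ 0 := ne_zero_of_re (by simp [hζ]; linarith)
    simp only [hf]
    rw [show ζ + u - (2 * u - τ) = ζ + (τ - u : ℝ) by push_cast; ring,
      show ζ + u - 2 * u + τ = ζ + (τ - u : ℝ) by push_cast; ring,
      show ζ + u - τ = ζ - (τ - u : ℝ) by push_cast; ring]
    field_simp
    ring
  have e2 : cexp (u * y - u ^ 3 / 3 + u * τ ^ 2 + 2 * τ ^ 3 / 3) * cexp (τ * s)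
      = cexp (-(u ^ 3 / 3) + u * (y + τ ^ 2)) * expP τ s := by
    rw [expP, ← exp_add, ← exp_add]; congr 1; ring
  have e3 : cexp (u * y - u ^ 3 / 3 + u * τ ^ 2 + 2 * τ ^ 3 / 3) * cexp (τ * s)
      = cexp (2 * τ ^ 3 / 3 - τ ^ 2 * u + u ^ 3 / 3) * cexp ((τ - u) * s)
        * cexp (-(2 * u ^ 3 / 3) + u * (y + s + 2 * τ ^ 2)) := by
    simp only [← exp_add]; congr 1; ring
  rw [v1, kk_eq_kkb] at c1
  rw [(d _ (by linarith) (by linarith) (by linarith) (by linarith)).1, c2, kk_eq_kkb,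
    (d _ (by linarith) (by linarith) (by linarith) (by linarith)).2, fFun_eq, coefC]
  linear_combination (kkb τ (-lineA τ) F₁ y s + kkb τ (-lineA τ) F₂ y s
      - aexp (s + τ ^ 2 : ℝ) (2 * u - τ) * (2 * (τ - u : ℂ))⁻¹ * vv τ (fun z => (z - τ)⁻¹) y) * e2
    + (kkb τ (τ - 2 * u - 2) F₁ y s - kkb τ (-lineA τ) F₁ y s) * e3
    + cexp (2 * τ ^ 3 / 3 - τ ^ 2 * u + u ^ 3 / 3) * cexp ((τ - u) * s) * c1

theorem E1_laplace (hu : 8 * lineA τ ≤ u) {s y : ℝ} (hy : s < y) :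
    IntegrableOn (fun V => E1 (τ - u) u (y + τ ^ 2 - u ^ 2) V * fFun (τ - u) u V)
      (Ioi (s + (τ ^ 2 - u ^ 2))) ∧
    (∫ V in Ioi (s + (τ ^ 2 - u ^ 2)),
        E1 (τ - u) u (y + τ ^ 2 - u ^ 2) V * fFun (τ - u) u V)
      - jFun (τ - u) u (s + (τ ^ 2 - u ^ 2)) (y + τ ^ 2 - u ^ 2)
      = coefC τ u s * (cexp (-(u ^ 3 / 3) + u * (y + τ ^ 2)) * aexp (y + τ ^ 2 : ℝ) τ)
        - fFun (τ - u) u (s + (τ ^ 2 - u ^ 2)) *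
          vl (lineA τ - u) (fun ζ => cexp (-ζ * (y - s : ℝ) + (2 * u : ℝ) * ζ ^ 2)
            * (2 * ζ * (ζ - (τ - u : ℝ))⁻¹ * (ζ + (τ - u : ℝ))⁻¹ * (ζ + (τ - u : ℝ))⁻¹)) := by
  obtain ⟨h0, h1, h2, hA⟩ := lineA_facts τ
  set δ : ℝ := τ - u with hδ
  set S : ℝ := s + (τ ^ 2 - u ^ 2) with hS
  set Y : ℝ := y + τ ^ 2 - u ^ 2 with hY
  have hδ0 : δ < 0 := by linarith
  have hYS : Y - S = y - s := by rw [hY, hS]; ring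
  obtain ⟨i1, l1⟩ := gaussLine_laplace (k := 2 * u) (δ := δ) (c := lineA τ - u) (by linarith)
    (by linarith) (by linarith) S Y
  obtain ⟨i2, l2⟩ := sign_laplace hδ0 (S := S) (Y := Y) (by linarith)
  have e : ∀ V : ℝ, E1 δ u Y V * fFun δ u V
      = cexp (-(δ : ℂ) ^ 3 / 3 - (δ : ℂ) ^ 2 * u) *
          (gaussLine (2 * u) δ (lineA τ - u) (Y - V) * cexp (δ * V))
        + cexp (-(δ : ℂ) ^ 3 / 3 + (δ : ℂ) ^ 2 * u) *
          ((Real.sign (Y - V) : ℂ) * cexp (δ * |Y - V|) * cexp (δ * V)) := by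
    intro V
    have e1 : fFun δ u V = cexp (-(δ : ℂ) ^ 3 / 3 - (δ : ℂ) ^ 2 * u) * cexp (δ * V) := by
      rw [fFun, ← exp_add]
    have e2 : cexp (δ * |Y - V| + 2 * (δ : ℂ) ^ 2 * u) * cexp (-(δ : ℂ) ^ 3 / 3 - (δ : ℂ) ^ 2 * u)
        = cexp (-(δ : ℂ) ^ 3 / 3 + (δ : ℂ) ^ 2 * u) * cexp (δ * |Y - V|) := by
      rw [← exp_add, ← exp_add]; congr 1; ring
    rw [E1_eq (c := lineA τ - u) (by linarith) (by linarith) (by linarith), e1]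
    linear_combination ((Real.sign (Y - V) : ℂ) * cexp (δ * V)) * e2
  have i3 := (i1.const_mul (cexp (-(δ : ℂ) ^ 3 / 3 - (δ : ℂ) ^ 2 * u)))
  have i4 := (i2.const_mul (cexp (-(δ : ℂ) ^ 3 / 3 + (δ : ℂ) ^ 2 * u)))
  simp only [e]
  refine ⟨i3.add i4, ?_⟩
  rw [integral_add i3 i4, integral_const_mul, integral_const_mul, l1, l2, jFun, sinhQuot,
    if_neg hδ0.ne, hYS]
  generalize vl (lineA τ - u) _ = W
  have hδc : (δ : ℂ) ≠ 0 := by exact_mod_cast hδ0.ne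
  have f1 : fFun δ u S = cexp (-(δ : ℂ) ^ 3 / 3 - (δ : ℂ) ^ 2 * u) * cexp (δ * S) := by
    rw [fFun, ← exp_add]
  have f2 : fFun δ (-u) S = cexp (-(δ : ℂ) ^ 3 / 3 + (δ : ℂ) ^ 2 * u) * cexp (δ * S) := by
    rw [fFun, ← exp_add]; congr 1; push_cast; ring
  have f3 : cexp (δ * S) * cexp (δ * (y - s)) = cexp (δ * Y) := by
    rw [← exp_add, ← ofReal_sub, ← hYS]; congr 1; push_cast; ring
  have f4 : coefC τ u s * (cexp (-(u ^ 3 / 3) + u * (y + τ ^ 2)) * aexp (y + τ ^ 2 : ℝ) τ)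
      = cexp (-(δ : ℂ) ^ 3 / 3 + (δ : ℂ) ^ 2 * u) * cexp (δ * S) * cexp (-(δ * (y - s)))
        * (2 * δ)⁻¹ := by
    have : expP τ s * aexp (s + τ ^ 2 : ℝ) (2 * u - τ) *
        (cexp (-(u ^ 3 / 3) + u * (y + τ ^ 2)) * aexp (y + τ ^ 2 : ℝ) τ)
        = cexp (-(δ : ℂ) ^ 3 / 3 + (δ : ℂ) ^ 2 * u) * cexp (δ * S) * cexp (-(δ * (y - s))) := by
      simp only [expP, aexp, ← exp_add]
      congr 1
      rw [hS, hδ]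
      push_cast
      ring
    rw [← this, coefC, hδ]
    push_cast
    ring
  rw [f4, f1, f2, ← f3]
  push_cast [Real.sinh_eq]
  have hYS' : (Y : ℂ) - S = y - s := by exact_mod_cast hYS
  rw [hYS']
  field_simp
  ring

theorem h1_eq (hu : 8 * lineA τ ≤ u) {s y : ℝ} (hy : s < y) :
    h1 (τ - u) u (s + (τ ^ 2 - u ^ 2)) (y + τ ^ 2 - u ^ 2)
      = cexp (-(u ^ 3 / 3) + u * (y + τ ^ 2)) *
          (expP τ s * kk τ (fun z w => R22 τ u z w * (w + τ)⁻¹) y s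
            + vv τ (r4 τ u) y - aexp (y + τ ^ 2 : ℝ) τ * (2 * (τ - u : ℂ))⁻¹)
        + coefC τ u s * g2 (τ - u) u (y + τ ^ 2 - u ^ 2) := by
  rw [h1, (A22tilde_laplace hu s y).2, g4_eq hu, g2_eq, Psi_neg_eq]
  linear_combination (E1_laplace hu hy).2

end

theorem RayDecay.integrableOn_ray {f : ℂ → ℂ} {ρ C ε v : ℝ} {d : ℂ} (hd : d ≠ 0) (hρ : 0 ≤ ρ)
    (hε : 0 < ε) (h : RayDecay f ρ C ε v d) :
    IntegrableOn (fun t : ℝ => f (v + t * d)) (Ioi 0) ∧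
    IntegrableOn (fun t : ℝ => f (v + t * conj d)) (Ioi 0) := by
  have hd' : conj d ≠ 0 := by simpa using hd
  have k1 := (integrableOn_halfRay hρ hε fun t ht => (h t ht).1).const_mul d⁻¹
  have k2 := (integrableOn_halfRay hρ hε fun t ht => (h t ht).2).const_mul (conj d)⁻¹
  simp only [inv_mul_cancel_left₀ hd, inv_mul_cancel_left₀ hd'] at k1 k2
  exact ⟨k1, k2⟩

theorem DecayExp.integrableOn_ray {e R : ℂ → ℂ} {b lo hi M a : ℝ} (he : DecayExp e b)
    (hR : RegOn R lo hi M) (h1 : lo < a) (h2 : a < hi) :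
    IntegrableOn (fun t : ℝ => e (a + t * cexp (π / 3 * I))
      * R (a + t * cexp (π / 3 * I))) (Ioi 0) ∧
    IntegrableOn (fun t : ℝ => e (a + t * conj (cexp (π / 3 * I)))
      * R (a + t * conj (cexp (π / 3 * I)))) (Ioi 0) := by
  obtain ⟨ρ, C, ε, hρ, hC, hε, h⟩ := he.rayDecay hR h1 h2 steepDir_exp (.inl exp_dir_re)
  exact h.integrableOn_ray (exp_ne_zero _) hρ hε

theorem eFun_eq (τ u s : ℝ) : eFun (τ - u) u (s + (τ ^ 2 - u ^ 2)) = Rfun (-τ) s := by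
  rw [eFun, Rfun, ← contourDown_const_mul]
  simp only [neg_mul, neg_neg]
  rw [← neg_one_mul (contourDown _ _), ← contourDown_const_mul,
    show τ - u - 1 = (τ - 1) + -u by ring, ← contourDown_add_re]
  congr 1
  ext z
  have e : cexp ((z + (-u : ℝ)) ^ 3 / 3 + (z + (-u : ℝ)) ^ 2 * u
      - (z + (-u : ℝ)) * (s + (τ ^ 2 - u ^ 2) : ℝ))
      / cexp (((τ - u : ℝ) : ℂ) ^ 3 / 3 + ((τ - u : ℝ) : ℂ) ^ 2 * u
        - (τ - u : ℝ) * (s + (τ ^ 2 - u ^ 2) : ℝ))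
      = cexp (-(2 / 3 * ((-τ : ℝ) : ℂ) ^ 3) - s * (-τ : ℝ))
        * cexp (z ^ 3 / 3 - z * (s + ((-τ : ℝ) : ℂ) ^ 2)) := by
    rw [← exp_sub, ← exp_add]; congr 1; push_cast; ring
  rw [e]
  rw [show z + ((-u : ℝ) : ℂ) - ((τ - u : ℝ) : ℂ) = z + ((-τ : ℝ) : ℂ) by push_cast; ring]
  ring

theorem Phi_neg_eq (τ s y : ℝ) :
    Phi (-τ) s y = -(expP τ s * kk τ (fun z w => (z - w)⁻¹ * (w + τ)⁻¹) y s)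
      - vv τ (fun z => (z + τ)⁻¹) y := by
  obtain ⟨h0, h1, h2, hA⟩ := lineA_facts τ
  have s1 : ∀ z : ℂ, -τ + 2 < z.re →
      (contourUp (-τ + 1) fun w => aexp (y + τ ^ 2 : ℝ) z * aexp (s + τ ^ 2 : ℝ) (-w)
        * ((z - w)⁻¹ * (w + τ)⁻¹))
      = (vl (-lineA τ) fun w => aexp (y + τ ^ 2 : ℝ) z * aexp (s + τ ^ 2 : ℝ) (-w)
        * ((z - w)⁻¹ * (w + τ)⁻¹))
        + aexp (s + τ ^ 2 : ℝ) τ * (aexp (y + τ ^ 2 : ℝ) z * (z + τ)⁻¹) := by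
    intro z hz
    have k := regOn_inv_left (p := -z) (lo := τ - 3 / 2) (by simp; linarith) (lineA τ + 1)
    have k' : RegOn (fun v => (z - -v)⁻¹) (τ - 3 / 2) (lineA τ + 1) _ :=
      k.congr fun v _ => by rw [sub_neg_eq_add, sub_neg_eq_add, add_comm]
    have := (decayExp_aexp (s + τ ^ 2)).contourUp_cross (R := fun w => (z - w)⁻¹) (p := -τ)
      (b := -τ + 1) (c := -lineA τ) k' (by linarith) (by linarith) (by linarith) (by linarith)
      (by linarith)
    simp only [ofReal_neg, sub_neg_eq_add, neg_neg] at this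
    simp only [mul_assoc]
    rw [contourUp_const_mul, vl_const_mul, this]
    ring
  have hm : Measurable fun p : ℂ × ℂ => (p.1 - p.2)⁻¹ * (p.2 + τ)⁻¹ := by fun_prop
  have lin : LinReg (fun z w => (z - w)⁻¹ * (w + τ)⁻¹) (-τ + 1) (lineA τ + 1) (-lineA τ) :=
    linReg_of_factor (f := fun _ => 1) (g := fun w => (w + τ)⁻¹) (c := 0) (e := 0) (q := 1)
      (fun z w => by simp [mul_comm]) (regOn_const 1 _ _) (lineBd_inv (by simp; linarith))
      (by linarith)
  have s3 : contourDown (-τ + 2) (fun z => contourUp (-τ + 1) fun w =>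
      aexp (y + τ ^ 2 : ℝ) z * aexp (s + τ ^ 2 : ℝ) (-w) * ((z - w)⁻¹ * (w + τ)⁻¹))
      = -kk τ (fun z w => (z - w)⁻¹ * (w + τ)⁻¹) y s
        - aexp (s + τ ^ 2 : ℝ) τ * vv τ (fun z => (z + τ)⁻¹) y := by
    have k := regOn_inv_left (p := -τ) (lo := -τ + 1) (by simp) (lineA τ + 1)
    simp only [sub_neg_eq_add] at k
    obtain ⟨i1, i2⟩ := (contourDown_vl (x := y + τ ^ 2) (y := s + τ ^ 2) (a := -τ + 2) hm
      (by linarith) lin (by linarith) (by linarith)).1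
    obtain ⟨i3, i4⟩ := (decayExp_aexp (y + τ ^ 2)).integrableOn_ray (a := -τ + 2) k (by linarith)
      (by linarith)
    rw [contourDown_congr fun z hz _ => s1 z hz, contourDown_add
        (f := fun z => vl (-lineA τ) fun w => aexp (y + τ ^ 2 : ℝ) z
          * aexp (s + τ ^ 2 : ℝ) (-w) * ((z - w)⁻¹ * (w + τ)⁻¹))
        (g := fun z => aexp (s + τ ^ 2 : ℝ) τ * (aexp (y + τ ^ 2 : ℝ) z * (z + τ)⁻¹)) i1 i2
        (Integrable.const_mul i3 (aexp (s + τ ^ 2 : ℝ) τ))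
        (Integrable.const_mul i4 (aexp (s + τ ^ 2 : ℝ) τ)), contourDown_const_mul,
      (decayExp_aexp (y + τ ^ 2)).contourDown_eq k (c := lineA τ) (by linarith) (by linarith)
        (by linarith) (by linarith) (by linarith),
      contourDown_vl_eq (a' := lineA τ) hm (by linarith) (by linarith) (fun w hw =>
        ⟨_, (regOn_inv_left (p := w) (by linarith) _).mul (regOn_const (w + τ)⁻¹ _ _)⟩) lin
        (by linarith) (by linarith) (by linarith) (by linarith), kk, vv]
    ring
  rw [Phi]
  have e : ∀ z w : ℂ, cexp (z ^ 3 / 3 - z * (y + ((-τ : ℝ) : ℂ) ^ 2))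
      / cexp (w ^ 3 / 3 - w * (s + ((-τ : ℝ) : ℂ) ^ 2)) * (1 / ((z - w) * (w - (-τ : ℝ))))
      = aexp (y + τ ^ 2 : ℝ) z * aexp (s + τ ^ 2 : ℝ) (-w) * ((z - w)⁻¹ * (w + τ)⁻¹) := by
    intro z w
    rw [← exp_sub, aexp, aexp, ← exp_add, one_div, mul_inv]
    push_cast
    rw [sub_neg_eq_add]
    congr 2
    ring
  simp only [e]
  have e1 : cexp (-(2 / 3) * ((-τ : ℝ) : ℂ) ^ 3 - s * (-τ : ℝ)) = expP τ s := by
    rw [expP]; congr 1; push_cast; ring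
  have e2 : expP τ s * aexp (s + τ ^ 2 : ℝ) τ = 1 := by
    rw [expP, aexp, ← exp_add, exp_eq_one_iff]
    exact ⟨0, by push_cast; ring⟩
  rw [s3, e1]
  linear_combination (-vv τ (fun z => (z + τ)⁻¹) y) * e2

theorem airyKernel_neg (τ x y : ℝ) : airyKernel (-τ) x y = airyKernel τ x y := by
  simp [airyKernel]

section
variable {n : ℕ}

theorem pfaffian_conj (M a : Matrix (Fin n × Fin 2) (Fin n × Fin 2) ℂ) :
    pfaffian (M * a * M.transpose) = M.det * pfaffian a := by
  have key : ∑ σ : Equiv.Perm (Fin n × Fin 2), ((Equiv.Perm.sign σ : ℤ) : ℂ) *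
      ∏ i : Fin n, (M * a * M.transpose) (σ (i, 0)) (σ (i, 1))
      = M.det * ∑ σ : Equiv.Perm (Fin n × Fin 2), ((Equiv.Perm.sign σ : ℤ) : ℂ) *
        ∏ i : Fin n, a (σ (i, 0)) (σ (i, 1)) := by
    have e1 : ∀ p q, (M * a * M.transpose) p q
        = ∑ k : (Fin n × Fin 2) × (Fin n × Fin 2), a k.1 k.2 * (M p k.1 * M q k.2) := by
      intro p q
      rw [Fintype.sum_prod_type, Finset.sum_comm, Matrix.mul_apply]
      refine Finset.sum_congr rfl fun k _ => ?_
      rw [Matrix.mul_apply, Finset.sum_mul]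
      exact Finset.sum_congr rfl fun l _ => by rw [Matrix.transpose_apply]; ring
    simp only [e1, Finset.prod_univ_sum, Fintype.piFinset_univ, Finset.mul_sum]
    rw [Finset.sum_comm]
    let E : (Fin n → (Fin n × Fin 2) × (Fin n × Fin 2)) ≃ (Fin n × Fin 2 → Fin n × Fin 2) :=
      (Equiv.arrowCongr (Equiv.refl _) (finTwoArrowEquiv (Fin n × Fin 2)).symm).trans
        (Equiv.curry _ _ _).symm
    rw [Fintype.sum_equiv E _ (fun F : Fin n × Fin 2 → Fin n × Fin 2 =>
      (∏ i : Fin n, a (F (i, 0)) (F (i, 1))) * (M.submatrix id F).det)]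
    · symm
      refine Fintype.sum_of_injective (fun σ : Equiv.Perm (Fin n × Fin 2) =>
        (σ : Fin n × Fin 2 → Fin n × Fin 2)) DFunLike.coe_injective _ _ (fun F hF => ?_)
        fun σ => ?_
      · have : ¬Function.Injective F := fun h => hF
          ⟨Equiv.ofBijective F (Finite.injective_iff_bijective.mp h), rfl⟩
        simp only [Function.Injective, not_forall] at this
        obtain ⟨p, q, h1, h2⟩ := this
        rw [Matrix.det_zero_of_column_eq h2 (fun k => by simp [h1]), mul_zero]
      · rw [Matrix.det_permute']
        ring
    · intro f
      rw [Matrix.det_apply', Finset.mul_sum]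
      refine Finset.sum_congr rfl fun σ _ => ?_
      simp only [Finset.prod_mul_distrib, Fintype.prod_prod_type, Fin.prod_univ_two,
        Matrix.submatrix_apply, id]
      simp [E]
      ring
  rw [pfaffian, pfaffian, key]
  ring

/-- The standard symplectic matrix. -/
def stdJ (n : ℕ) : Matrix (Fin n × Fin 2) (Fin n × Fin 2) ℂ :=
  Matrix.of fun p q => if p.1 = q.1 then J p.2 q.2 else 0

theorem J_perm (p : Equiv.Perm (Fin 2)) : J (p 0) (p 1) = ((Equiv.Perm.sign p : ℤ) : ℂ) := by
  have h : p = 1 ∨ p = Equiv.swap 0 1 := by revert p; decide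
  rcases h with rfl | rfl
  · simp [J]
  · simp [J, Equiv.Perm.sign_swap]

theorem pfaffian_stdJ (n : ℕ) : pfaffian (stdJ n) = 1 := by
  let e : Equiv.Perm (Fin n) × (Fin n → Equiv.Perm (Fin 2)) → Equiv.Perm (Fin n × Fin 2) :=
    fun x => Equiv.prodCongrLeft (fun _ => x.1) * Equiv.prodCongrRight x.2
  have he : ∀ x i c, e x (i, c) = (x.1 i, x.2 i c) := fun x i c => rfl
  have hinj : Function.Injective e := by
    rintro ⟨ρ, a⟩ ⟨ρ', a'⟩ h
    have h1 : ∀ i c, (ρ i, a i c) = (ρ' i, a' i c) := fun i c => by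
      rw [← he (ρ, a), ← he (ρ', a'), h]
    ext i
    · exact congrArg (fun x => (x.1 : ℕ)) (h1 i 0)
    · rename_i c
      exact congrArg (fun x => (x.2 : ℕ)) (h1 i c)
  have key : ∑ σ : Equiv.Perm (Fin n × Fin 2), ((Equiv.Perm.sign σ : ℤ) : ℂ) *
      ∏ i : Fin n, stdJ n (σ (i, 0)) (σ (i, 1))
      = ∑ _x : Equiv.Perm (Fin n) × (Fin n → Equiv.Perm (Fin 2)), (1 : ℂ) := by
    symm
    refine Fintype.sum_of_injective e hinj _ _ (fun σ hσ => ?_) fun x => ?_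
    · by_contra hne
      have hp : ∀ i, stdJ n (σ (i, 0)) (σ (i, 1)) ≠ 0 := fun i h0 =>
        hne (by rw [Finset.prod_eq_zero (Finset.mem_univ i) h0, mul_zero])
      have h1 : ∀ i, (σ (i, 0)).1 = (σ (i, 1)).1 := fun i => by
        by_contra h
        exact hp i (by simp [stdJ, h])
      have h2 : ∀ i c, (σ (i, c)).1 = (σ (i, 0)).1 := fun i c => by
        fin_cases c
        · rfl
        · exact (h1 i).symm
      have h3 : Function.Surjective fun i => (σ (i, 0)).1 := fun k => by
        obtain ⟨⟨i, c⟩, h⟩ := σ.surjective (k, 0)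
        exact ⟨i, by show (σ (i, 0)).1 = k; rw [← h2 i c, h]⟩
      have h4 : ∀ i, Function.Injective fun c => (σ (i, c)).2 := fun i c c' h => by
        have : σ (i, c) = σ (i, c') := Prod.ext (by rw [h2, h2 i c']) h
        exact congrArg Prod.snd (σ.injective this)
      refine hσ ⟨(Equiv.ofBijective _ (Finite.surjective_iff_bijective.mp h3),
        fun i => Equiv.ofBijective _ (Finite.injective_iff_bijective.mp (h4 i))), ?_⟩
      ext1 ⟨i, c⟩
      rw [he]
      exact Prod.ext (h2 i c).symm rfl
    · have h1 : ((Equiv.Perm.sign (e x) : ℤ) : ℂ)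
          = ∏ i, ((Equiv.Perm.sign (x.2 i) : ℤ) : ℂ) := by
        simp only [e, Equiv.Perm.sign_mul, Equiv.Perm.sign_prodCongrLeft,
          Equiv.Perm.sign_prodCongrRight]
        simp
      have h2 : ∀ i, stdJ n (e x (i, 0)) (e x (i, 1)) = ((Equiv.Perm.sign (x.2 i) : ℤ) : ℂ) := by
        intro i
        rw [he, he, ← J_perm]
        simp [stdJ]
      rw [h1]
      simp only [h2, ← Finset.prod_mul_distrib]
      refine (Finset.prod_eq_one fun i _ => ?_).symm
      rcases Int.units_eq_one_or (Equiv.Perm.sign (x.2 i)) with h | h <;> simp [h]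
  rw [pfaffian, key]
  have : (n.factorial : ℂ) ≠ 0 := by exact_mod_cast n.factorial_ne_zero
  simp [Fintype.card_perm]
  field_simp

/-- The Pfaffian of an off-diagonal block matrix is a determinant. -/
theorem pfaffian_offdiag (B : Matrix (Fin n) (Fin n) ℂ) :
    pfaffian (Matrix.of fun p q : Fin n × Fin 2 =>
      if p.2 = 0 then (if q.2 = 0 then 0 else B p.1 q.1)
      else (if q.2 = 0 then -B q.1 p.1 else 0)) = B.det := by
  let M : Matrix (Fin n × Fin 2) (Fin n × Fin 2) ℂ :=
    Matrix.blockDiagonal fun c : Fin 2 => if c = 0 then B else 1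
  have hM : M.det = B.det := by
    simp [M, Matrix.det_blockDiagonal, Fin.prod_univ_two]
  rw [← hM, ← mul_one M.det, ← pfaffian_stdJ n, ← pfaffian_conj]
  congr 1
  ext ⟨i, c⟩ ⟨j, d⟩
  fin_cases c <;> fin_cases d <;>
  simp [M, stdJ, Matrix.mul_apply, Fintype.sum_prod_type, J, Matrix.blockDiagonal_apply,
    Matrix.one_apply, Fin.sum_univ_two]

end

section
variable {n : ℕ}

theorem pfaffian_sq_of_congr (M : Matrix (Fin n × Fin 2) (Fin n × Fin 2) ℂ) :
    pfaffian (M * stdJ n * M.transpose) ^ 2 = (M * stdJ n * M.transpose).det := by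
  have hJ : (stdJ n).det = 1 := by
    have : stdJ n = (Matrix.blockDiagonal fun _ : Fin n => J).submatrix
        (Equiv.prodComm _ _) (Equiv.prodComm _ _) := by
      ext ⟨i, c⟩ ⟨j, d⟩
      simp [stdJ, Matrix.blockDiagonal_apply]
    rw [this, Matrix.det_submatrix_equiv_self, Matrix.det_blockDiagonal]
    simp [J, Matrix.det_fin_two]
  rw [pfaffian_conj, pfaffian_stdJ, Matrix.det_mul, Matrix.det_mul, hJ, Matrix.det_transpose]
  ring

attribute [local instance] Matrix.linftyOpNormedRing Matrix.linftyOpNormedAlgebra in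
theorem pfaffian_sq (a : Matrix (Fin n × Fin 2) (Fin n × Fin 2) ℂ) (ha : a.transpose = -a) :
    pfaffian a ^ 2 = a.det := by
  have hJT : (stdJ n).transpose = -stdJ n := by
    ext ⟨i, c⟩ ⟨j, d⟩
    by_cases h : i = j
    · subst h
      fin_cases c <;> fin_cases d <;> simp [stdJ, J]
    · simp [stdJ, h, Ne.symm h]
  have hJJ : stdJ n * -stdJ n = 1 := by
    ext ⟨i, c⟩ ⟨j, d⟩
    by_cases h : i = j
    · subst h
      fin_cases c <;> fin_cases d <;>
      simp [stdJ, J, Matrix.mul_apply, Fintype.sum_prod_type]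
    · simp [stdJ, h, Matrix.mul_apply, Fintype.sum_prod_type]
  let T : Matrix (Fin n × Fin 2) (Fin n × Fin 2) ℂ →L[ℂ] Matrix (Fin n × Fin 2) (Fin n × Fin 2) ℂ :=
    LinearMap.toContinuousLinearMap (Matrix.transposeLinearEquiv _ _ ℂ ℂ).toLinearMap
  have hT : ∀ M, T M = M.transpose := fun M => rfl
  have hd : HasStrictFDerivAt (fun M : Matrix (Fin n × Fin 2) (Fin n × Fin 2) ℂ =>
      M * stdJ n * T M + M * stdJ n - stdJ n * T M) _ 1 :=
    ((((hasStrictFDerivAt_id (𝕜 := ℂ) (1 : Matrix (Fin n × Fin 2) (Fin n × Fin 2) ℂ)).mul_const'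
      (stdJ n)).mul' T.hasStrictFDerivAt).add
      ((hasStrictFDerivAt_id (𝕜 := ℂ) (1 : Matrix (Fin n × Fin 2) (Fin n × Fin 2) ℂ)).mul_const'
      (stdJ n))).sub (T.hasStrictFDerivAt.const_mul (stdJ n))
  have hm := hd.map_nhds_eq_of_surj (by
    rw [LinearMap.range_eq_top]
    intro Y
    refine ⟨(2⁻¹ : ℂ) • (Y * -stdJ n), ?_⟩
    change id 1 * stdJ n * T _ + (2⁻¹ : ℂ) • (Y * -stdJ n) * stdJ n * T 1
      + (2⁻¹ : ℂ) • (Y * -stdJ n) * stdJ n - stdJ n * T _ = Y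
    have h1 : Y * -stdJ n * stdJ n = Y := by
      rw [mul_assoc, neg_mul, ← mul_neg, hJJ, mul_one]
    rw [hT 1, Matrix.transpose_one, smul_mul_assoc, h1, id, one_mul, mul_one, add_assoc,
      add_sub_cancel_left, ← add_smul]
    norm_num)
  have h0 : (1 : Matrix (Fin n × Fin 2) (Fin n × Fin 2) ℂ) * stdJ n * T 1 + 1 * stdJ n
      - stdJ n * T 1 = stdJ n := by simp [hT]
  rw [h0] at hm
  have hs : ∀ᶠ Y in 𝓝 (stdJ n), Y.transpose = -Y → pfaffian Y ^ 2 = Y.det := by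
    suffices h : ∀ᶠ Y in map (fun M : Matrix (Fin n × Fin 2) (Fin n × Fin 2) ℂ =>
        M * stdJ n * T M + M * stdJ n - stdJ n * T M) (𝓝 1),
        Y.transpose = -Y → pfaffian Y ^ 2 = Y.det by
      have hm' : map (fun M : Matrix (Fin n × Fin 2) (Fin n × Fin 2) ℂ =>
        M * stdJ n * T M + M * stdJ n - stdJ n * T M) (𝓝 1) = 𝓝 (stdJ n) := hm
      rwa [hm'] at h
    rw [eventually_map]
    refine .of_forall fun M hM => ?_
    simp only [hT] at hM ⊢
    have h2 : (2 : ℂ) • (M * stdJ n - stdJ n * M.transpose) = 0 := by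
      have : (M * stdJ n * M.transpose + M * stdJ n - stdJ n * M.transpose).transpose
        = - (M * stdJ n * M.transpose) + (M * stdJ n - stdJ n * M.transpose) := by
        simp [Matrix.transpose_sub, Matrix.transpose_add, Matrix.transpose_mul, hJT, mul_assoc]
        abel
      rw [this] at hM
      rw [two_smul]
      have h3 := congrArg (fun X => X + (M * stdJ n * M.transpose)
        + (M * stdJ n - stdJ n * M.transpose)) hM
      beta_reduce at h3
      calc _ = _ := by abel
        _ = _ := h3
        _ = _ := by abel
    have h3 : M * stdJ n - stdJ n * M.transpose = 0 :=
      (smul_eq_zero.mp h2).resolve_left two_ne_zero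
    rw [add_sub_assoc, h3, add_zero]
    exact pfaffian_sq_of_congr M
  let L : ℂ → Matrix (Fin n × Fin 2) (Fin n × Fin 2) ℂ := fun t => stdJ n + t • (a - stdJ n)
  have hLa : ∀ t, (L t).transpose = -L t := fun t => by
    simp only [L, Matrix.transpose_add, Matrix.transpose_smul, Matrix.transpose_sub, ha, hJT]
    rw [neg_add, ← smul_neg]
    congr 2
    abel
  have hLc : Continuous L := by fun_prop
  have h1 : ∀ᶠ t in 𝓝 (0 : ℂ), pfaffian (L t) ^ 2 = (L t).det := by
    have : Tendsto L (𝓝 0) (𝓝 (stdJ n)) := by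
      have := hLc.tendsto 0
      simpa [L] using this
    filter_upwards [this.eventually hs] with t ht using ht (hLa t)
  have hp : AnalyticOnNhd ℂ (fun t => pfaffian (L t) ^ 2) Set.univ :=
    analyticOnNhd_univ_iff_differentiable.mpr (by
      simp only [pfaffian, L, Matrix.add_apply, Matrix.smul_apply, smul_eq_mul]
      fun_prop)
  have hq : AnalyticOnNhd ℂ (fun t => (L t).det) Set.univ :=
    analyticOnNhd_univ_iff_differentiable.mpr (by
      simp only [Matrix.det_apply', L, Matrix.add_apply, Matrix.smul_apply, smul_eq_mul]
      fun_prop)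
  have := congrFun (hp.eq_of_eventuallyEq hq h1) 1
  simpa [L] using this

open scoped Matrix ComplexOrder in
theorem norm_det_sq_le {ι : Type*} [Fintype ι] [DecidableEq ι] (a : Matrix ι ι ℂ)
    (ha : ∀ p q, ‖a p q‖ ≤ 1) :
    ‖a.det‖ ^ 2 ≤ (Fintype.card ι : ℝ) ^ Fintype.card ι := by
  rcases isEmpty_or_nonempty ι with hι | hι
  · simp
  have hN : (0 : ℝ) < Fintype.card ι := by exact_mod_cast Fintype.card_pos
  have hp := Matrix.posSemidef_self_mul_conjTranspose a
  have h1 : ((∏ i, hp.1.eigenvalues i : ℝ) : ℂ) = ((‖a.det‖ ^ 2 : ℝ) : ℂ) := by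
    have := hp.1.det_eq_prod_eigenvalues
    rw [Matrix.det_mul, Matrix.det_conjTranspose] at this
    rw [Complex.sq_norm, ← Complex.mul_conj]
    exact (this.trans (by simp)).symm
  have h2 : ((∑ i, hp.1.eigenvalues i : ℝ) : ℂ) = ((∑ i, ∑ j, ‖a i j‖ ^ 2 : ℝ) : ℂ) := by
    have := hp.1.trace_eq_sum_eigenvalues
    rw [Complex.ofReal_sum]
    refine (Eq.trans ?_ this.symm).trans ?_
    · simp
    · simp only [Matrix.trace, Matrix.diag, Matrix.mul_apply, Matrix.conjTranspose_apply,
        RCLike.star_def, Complex.mul_conj, Complex.normSq_eq_norm_sq]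
      push_cast
      rfl
  have h1' := Complex.ofReal_injective h1
  have h2' := Complex.ofReal_injective h2
  have h3 : ∑ i, hp.1.eigenvalues i ≤ Fintype.card ι * Fintype.card ι := by
    rw [h2']
    calc _ ≤ ∑ _i : ι, ∑ _j : ι, (1 : ℝ) := Finset.sum_le_sum fun i _ =>
          Finset.sum_le_sum fun j _ => pow_le_one₀ (norm_nonneg _) (ha i j)
      _ = _ := by simp
  have h4 := Real.geom_mean_le_arith_mean_weighted Finset.univ
    (fun _ : ι => (Fintype.card ι : ℝ)⁻¹) hp.1.eigenvalues (fun _ _ => by positivity)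
    (by simp [hN.ne']) fun i _ => hp.eigenvalues_nonneg i
  rw [← Finset.mul_sum, Real.finset_prod_rpow _ _ fun i _ => hp.eigenvalues_nonneg i, h1'] at h4
  have h5 : (‖a.det‖ ^ 2) ^ (Fintype.card ι : ℝ)⁻¹ ≤ Fintype.card ι :=
    h4.trans (by rw [inv_mul_le_iff₀ hN]; exact h3)
  calc ‖a.det‖ ^ 2 = ((‖a.det‖ ^ 2) ^ (Fintype.card ι : ℝ)⁻¹) ^ Fintype.card ι :=
        (Real.rpow_inv_natCast_pow (by positivity) Fintype.card_ne_zero).symm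
    _ ≤ _ := pow_le_pow_left₀ (by positivity) h5 _

theorem norm_pfaffian_le (a : Matrix (Fin n × Fin 2) (Fin n × Fin 2) ℂ) (ha : a.transpose = -a)
    (m : Fin n × Fin 2 → ℝ) (hm : ∀ p, 0 < m p) (h : ∀ p q, ‖a p q‖ ≤ m p * m q) :
    ‖pfaffian a‖ ≤ (∏ p, m p) * √((2 * n : ℝ) ^ n) := by
  let D : Matrix (Fin n × Fin 2) (Fin n × Fin 2) ℂ := Matrix.diagonal fun p => (m p : ℂ)
  let b : Matrix (Fin n × Fin 2) (Fin n × Fin 2) ℂ :=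
    Matrix.of fun p q => (m p : ℂ)⁻¹ * a p q * (m q : ℂ)⁻¹
  have hne : ∀ p, (m p : ℂ) ≠ 0 := fun p => by exact_mod_cast (hm p).ne'
  have hab : a = D * b * D.transpose := by
    ext p q
    have hp := hne p
    have hq := hne q
    simp only [D, b, Matrix.diagonal_transpose, Matrix.mul_diagonal, Matrix.diagonal_mul,
      of_apply]
    field_simp
  have hb : b.transpose = -b := by
    ext p q
    have : a q p = -a p q := congrFun (congrFun ha p) q
    simp only [b, Matrix.transpose_apply, of_apply, Matrix.neg_apply, this]
    ring
  have hb1 : ∀ p q, ‖b p q‖ ≤ 1 := fun p q => by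
    have hp := hm p
    have hq := hm q
    simp only [b, of_apply, norm_mul, norm_inv, Complex.norm_of_nonneg hp.le,
      Complex.norm_of_nonneg hq.le]
    rw [← div_eq_mul_inv, div_le_one hq, inv_mul_le_iff₀ hp]
    exact h p q
  have h1 : (‖pfaffian b‖ ^ 2) ^ 2 ≤ ((2 * n : ℝ) ^ n) ^ 2 := by
    have := norm_det_sq_le b hb1
    rw [← pfaffian_sq b hb, norm_pow] at this
    refine this.trans (le_of_eq ?_)
    simp only [Fintype.card_prod, Fintype.card_fin]
    push_cast
    ring
  have h2 : ‖pfaffian b‖ ≤ √((2 * n : ℝ) ^ n) :=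
    Real.le_sqrt_of_sq_le ((pow_le_pow_iff_left₀ (by positivity) (by positivity) two_ne_zero).mp h1)
  rw [hab, pfaffian_conj, norm_mul]
  refine mul_le_mul (le_of_eq ?_) h2 (norm_nonneg _) (Finset.prod_nonneg fun p _ => (hm p).le)
  simp only [D, Matrix.det_diagonal, norm_prod]
  exact Finset.prod_congr rfl fun p _ => Complex.norm_of_nonneg (hm p).le

theorem summable_hadamard (C : ℝ) :
    Summable fun n : ℕ => C ^ n * √((2 * n : ℝ) ^ n) / n.factorial := by
  have h1 := Real.summable_pow_div_factorial (4 * C ^ 2 * rexp 1)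
  refine Summable.of_norm_bounded (summable_geometric_two.add h1) fun n => ?_
  have hn : (0 : ℝ) < n.factorial := by exact_mod_cast n.factorial_pos
  have h2 : (n : ℝ) ^ n ≤ rexp 1 ^ n * n.factorial := by
    rw [← Real.exp_nat_mul, mul_one, ← div_le_iff₀ hn]
    exact Real.pow_div_factorial_le_exp n n.cast_nonneg n
  set a := |2 * C| ^ n * √((2 * n : ℝ) ^ n) / n.factorial with ha
  have h3 : a ^ 2 ≤ 2 ^ n * ((4 * C ^ 2 * rexp 1) ^ n / n.factorial) := by
    have : a ^ 2 = (8 * C ^ 2) ^ n * (n : ℝ) ^ n / n.factorial ^ 2 := by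
      rw [ha, div_pow, mul_pow, Real.sq_sqrt (by positivity), ← pow_mul, mul_comm n 2, pow_mul,
        sq_abs, ← mul_pow, ← mul_pow]
      ring
    rw [this, div_le_iff₀ (by positivity)]
    calc (8 * C ^ 2) ^ n * (n : ℝ) ^ n ≤ (8 * C ^ 2) ^ n * (rexp 1 ^ n * n.factorial) := by
          gcongr
      _ = _ := by
        rw [show (8 : ℝ) * C ^ 2 = 2 * (4 * C ^ 2) by ring, mul_pow 2, mul_pow (4 * C ^ 2)]
        field_simp
  have h4 : ‖C ^ n * √((2 * n : ℝ) ^ n) / n.factorial‖ = (1 / 2) ^ n * a := by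
    rw [norm_div, norm_mul, norm_pow, Real.norm_eq_abs, Real.norm_of_nonneg (Real.sqrt_nonneg _),
      Real.norm_of_nonneg hn.le, ha, abs_mul, abs_two, mul_pow, one_div, inv_pow]
    field_simp
    ring
  rw [h4]
  have h5 : (1 / 2 : ℝ) ^ n * a ≤ (1 / 2) ^ n * (1 + a ^ 2) := by
    gcongr
    linarith [sq_nonneg (a - 1), sq_nonneg a]
  refine h5.trans ?_
  rw [mul_add, mul_one]
  gcongr
  calc (1 / 2 : ℝ) ^ n * a ^ 2 ≤ (1 / 2) ^ n * (2 ^ n * ((4 * C ^ 2 * rexp 1) ^ n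
        / n.factorial)) := by gcongr
    _ = _ := by rw [← mul_assoc, ← mul_pow]; norm_num
end

theorem differentiableOn_integral_of_bound {α : Type*} [MeasurableSpace α] {μ : Measure α}
    {F : ℂ → α → ℂ} {c : ℂ} {r : ℝ} {bound : α → ℝ}
    (hm : ∀ z ∈ ball c r, AEStronglyMeasurable (F z) μ)
    (hd : ∀ᵐ x ∂μ, DifferentiableOn ℂ (fun z => F z x) (ball c r))
    (hb : ∀ᵐ x ∂μ, ∀ z ∈ ball c r, ‖F z x‖ ≤ bound x) (hbi : Integrable bound μ) :
    DifferentiableOn ℂ (fun z => ∫ x, F z x ∂μ) (ball c r) := by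
  intro z₀ hz₀
  rw [mem_ball, dist_eq_norm] at hz₀
  set ρ := (r - ‖z₀ - c‖) / 2 with hρ
  have hρ0 : 0 < ρ := by rw [hρ]; linarith
  have hsub : ∀ z ∈ ball z₀ ρ, ∀ w ∈ closedBall z ρ, w ∈ ball c r := by
    intro z hz w hw
    rw [mem_ball, dist_eq_norm] at hz ⊢
    rw [Metric.mem_closedBall, dist_eq_norm] at hw
    have : w - c = (w - z) + (z - z₀) + (z₀ - c) := by ring
    rw [this]
    have := norm_add₃_le (a := w - z) (b := z - z₀) (c := z₀ - c)
    linarith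
  have hself : ∀ z ∈ ball z₀ ρ, z ∈ ball c r := fun z hz =>
    hsub z hz z (Metric.mem_closedBall_self hρ0.le)
  have hz0 : z₀ ∈ ball z₀ ρ := mem_ball_self hρ0
  have hder : ∀ᵐ x ∂μ, ∀ z ∈ ball z₀ ρ,
      HasDerivAt (fun z => F z x) (deriv (fun z => F z x) z) z := by
    filter_upwards [hd] with x hx z hz
    exact (hx.differentiableAt (Metric.isOpen_ball.mem_nhds (hself z hz))).hasDerivAt
  refine (hasDerivAt_integral_of_dominated_loc_of_deriv_le (F := F)
    (F' := fun z x => deriv (fun z => F z x) z) (bound := fun x => bound x / ρ)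
    (ball_mem_nhds z₀ hρ0) ?_ ?_ ?_ ?_ (hbi.div_const ρ) hder).2
    |>.differentiableAt.differentiableWithinAt
  · filter_upwards [ball_mem_nhds z₀ hρ0] with z hz using hm z (hself z hz)
  · refine Integrable.mono' hbi (hm z₀ (hself z₀ hz0)) ?_
    filter_upwards [hb] with x hx using hx z₀ (hself z₀ hz0)
  · let w : ℕ → ℂ := fun n => z₀ + (ρ / 2 * (1 / ((n : ℝ) + 1)) : ℝ)
    have hw : ∀ n, w n ∈ ball z₀ ρ := fun n => by
      have h1 : (1 : ℝ) / ((n : ℝ) + 1) ≤ 1 := by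
        rw [div_le_one (by positivity)]
        simp
      have h2 : (0 : ℝ) < 1 / ((n : ℝ) + 1) := by positivity
      rw [mem_ball, dist_eq_norm, add_sub_cancel_left, Complex.norm_of_nonneg (by positivity)]
      calc ρ / 2 * (1 / ((n : ℝ) + 1)) ≤ ρ / 2 * 1 := by gcongr
        _ < ρ := by linarith
    have hwt : Tendsto w atTop (𝓝[≠] z₀) := by
      refine tendsto_nhdsWithin_iff.mpr ⟨?_, .of_forall fun n => ?_⟩
      · have h := (tendsto_one_div_add_atTop_nhds_zero_nat (𝕜 := ℝ)).const_mul (ρ / 2)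
        rw [mul_zero] at h
        have h2 := ((continuous_ofReal.tendsto 0).comp h).const_add z₀
        simpa [w, Function.comp_def] using h2
      · have h2 : (0 : ℝ) < ρ / 2 * (1 / ((n : ℝ) + 1)) := by positivity
        simp only [w, Set.mem_compl_iff, Set.mem_singleton_iff, add_eq_left, ofReal_eq_zero]
        exact h2.ne'
    refine aestronglyMeasurable_of_tendsto_ae atTop
      (f := fun n x => slope (fun z => F z x) z₀ (w n)) (fun n => ?_) ?_
    · simp only [slope_def_field]
      have h1 := ((hm _ (hself _ (hw n))).sub (hm _ (hself _ hz0))).const_mul (w n - z₀)⁻¹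
      refine h1.congr (.of_forall fun x => ?_)
      simp only [Pi.sub_apply]
      rw [inv_mul_eq_div]
    · filter_upwards [hder] with x hx
      exact ((hx z₀ hz0).tendsto_slope).comp hwt
  · filter_upwards [hb, hd] with x hx hdx z hz
    refine Complex.norm_deriv_le_of_forall_mem_sphere_norm_le hρ0 ?_ fun w hw =>
      hx w (hsub z hz w (sphere_subset_closedBall hw))
    refine DifferentiableOn.diffContOnCl ?_
    rw [closure_ball _ hρ0.ne']
    exact hdx.mono (hsub z hz)

theorem tendsto_deriv_of_bound {l : Filter ℝ} [l.IsCountablyGenerated] {F : ℝ → ℂ → ℂ} {f : ℂ → ℂ}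
    {c : ℂ} {r M : ℝ} (hr : 0 < r) (hd : ∀ᶠ u in l, DifferentiableOn ℂ (F u) (ball c r))
    (hf : DifferentiableOn ℂ f (ball c r))
    (hb : ∀ᶠ u in l, ∀ z ∈ ball c r, ‖F u z‖ ≤ M)
    (hl : ∀ z ∈ ball c r, Tendsto (fun u => F u z) l (𝓝 (f z))) :
    Tendsto (fun u => deriv (F u) c) l (𝓝 (deriv f c)) := by
  have hR : 0 < r / 2 := by linarith
  have hsub : closedBall c (r / 2) ⊆ ball c r :=
    closedBall_subset_ball (by linarith)
  have key : ∀ g : ℂ → ℂ, DifferentiableOn ℂ g (ball c r) →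
      deriv g c = (2 * π * I : ℂ)⁻¹ • ∮ z in C(c, r / 2), (1 / (z - c) ^ 2) • g z :=
    fun g hg => by
      have : DiffContOnCl ℂ g (ball c (r / 2)) := by
        refine DifferentiableOn.diffContOnCl ?_
        rw [closure_ball _ hR.ne']
        exact hg.mono hsub
      rw [this.deriv_eq_smul_circleIntegral hR, smul_smul,
        inv_mul_cancel₀ (by simp [Real.pi_ne_zero]), one_smul]
  have hmem : ∀ θ, circleMap c (r / 2) θ ∈ ball c r := fun θ =>
    hsub (circleMap_mem_closedBall c hR.le θ)
  have hn : ∀ θ, ‖circleMap c (r / 2) θ - c‖ = r / 2 := fun θ => by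
    simp [circleMap, abs_of_pos hr]
  rw [key f hf]
  refine Tendsto.congr' (hd.mono fun u hu => (key _ hu).symm) (Tendsto.const_smul ?_ _)
  refine intervalIntegral.tendsto_integral_filter_of_dominated_convergence
    (fun _ => r / 2 * (1 / (r / 2) ^ 2 * M)) ?_ ?_ intervalIntegrable_const ?_
  · filter_upwards [hd] with u hu
    refine Continuous.aestronglyMeasurable ?_
    have h1 : Continuous fun θ => F u (circleMap c (r / 2) θ) :=
      hu.continuousOn.comp_continuous (continuous_circleMap c _) hmem
    have h2 : Continuous fun θ => 1 / (circleMap c (r / 2) θ - c) ^ 2 := by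
      refine continuous_const.div₀ (by fun_prop) fun θ h0 => ?_
      have := hn θ
      rw [pow_eq_zero_iff two_ne_zero] at h0
      rw [h0, norm_zero] at this
      linarith
    simp only [deriv_circleMap]
    exact ((continuous_circleMap 0 (r / 2)).mul continuous_const).smul (h2.smul h1)
  · filter_upwards [hb] with u hu
    refine .of_forall fun θ _ => ?_
    rw [norm_smul, norm_smul, norm_div, norm_one, norm_pow, hn, deriv_circleMap, norm_mul, norm_I, mul_one,
      norm_circleMap_zero, abs_of_pos hR]
    have := hu _ (hmem θ)
    gcongr
  · refine .of_forall fun θ _ => ?_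
    exact ((hl _ (hmem θ)).const_smul _).const_smul _

/-! ### Fredholm Pfaffians of bounded kernels -/

/-- `K` is an antisymmetric measurable kernel on `(s, ∞)` that is bounded by `m ⊗ m`. -/
structure PfBound (s : ℝ) (m : ℝ → ℝ) (K : ℝ → ℝ → Matrix (Fin 2) (Fin 2) ℂ) : Prop where
  anti : ∀ x y c d, K x y c d = -K y x d c
  meas : ∀ c d, Measurable fun p : ℝ × ℝ => K p.1 p.2 c d
  le : ∀ x y c d, s < x → s < y → ‖K x y c d‖ ≤ m x * m y

section
variable {s : ℝ} {m : ℝ → ℝ} {K : ℝ → ℝ → Matrix (Fin 2) (Fin 2) ℂ}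

theorem integrable_prod_sq (hm2 : IntegrableOn (fun x => m x ^ 2) (Ioi s)) (n : ℕ) :
    IntegrableOn (fun x : Fin n → ℝ => (∏ i, m (x i) ^ 2)) (Set.univ.pi fun _ => Ioi s) ∧
    ∫ x in Set.univ.pi (fun _ : Fin n => Ioi s), (∏ i, m (x i) ^ 2)
      = (∫ x in Ioi s, m x ^ 2) ^ n := by
  rw [IntegrableOn, volume_pi, Measure.restrict_pi_pi]
  constructor
  · exact Integrable.fintype_prod fun _ => hm2
  · rw [integral_fintype_prod_eq_pow (fun x => m x ^ 2)]
    simp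

theorem PfBound.norm_le (h : PfBound s m K) (hm : ∀ x, 0 < m x) {n : ℕ} {x : Fin n → ℝ}
    (hx : x ∈ Set.univ.pi fun _ => Ioi s) :
    ‖pfaffian (blockMatrix K x)‖ ≤ (∏ i, m (x i) ^ 2) * √((2 * n : ℝ) ^ n) := by
  have := norm_pfaffian_le (blockMatrix K x) ?_ (fun p => m (x p.1)) (fun p => hm _)
    fun p q => h.le _ _ _ _ (hx p.1 trivial) (hx q.1 trivial)
  · refine this.trans (le_of_eq ?_)
    simp [Fintype.prod_prod_type, Finset.prod_const, sq]
  · ext p q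
    exact h.anti _ _ _ _

theorem PfBound.measurable (h : PfBound s m K) (n : ℕ) :
    Measurable fun x : Fin n → ℝ => pfaffian (blockMatrix K x) := by
  simp only [pfaffian, blockMatrix, of_apply]
  refine Measurable.const_mul (Finset.measurable_fun_sum _ fun σ _ => Measurable.const_mul
    (Finset.measurable_fun_prod _ fun i _ => ?_) _) _
  exact (h.meas _ _).comp (f := fun x : Fin n → ℝ => (x (σ (i, 0)).1, x (σ (i, 1)).1))
    ((measurable_pi_apply _).prodMk (measurable_pi_apply _))

theorem PfBound.integrable (h : PfBound s m K) (hm : ∀ x, 0 < m x)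
    (hm2 : IntegrableOn (fun x => m x ^ 2) (Ioi s)) (n : ℕ) :
    IntegrableOn (fun x : Fin n → ℝ => pfaffian (blockMatrix K x))
      (Set.univ.pi fun _ : Fin n => Ioi s) :=
  Integrable.mono' ((integrable_prod_sq hm2 n).1.mul_const _) (h.measurable n).aestronglyMeasurable
    ((ae_restrict_iff' (MeasurableSet.univ_pi fun _ => measurableSet_Ioi)).mpr
      (.of_forall fun _ hx => h.norm_le hm hx))

theorem PfBound.term_le (h : PfBound s m K) (hm : ∀ x, 0 < m x)
    (hm2 : IntegrableOn (fun x => m x ^ 2) (Ioi s)) (n : ℕ) :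
    ‖fredholmPfaffianTerm s K n‖
      ≤ (∫ x in Ioi s, m x ^ 2) ^ n * √((2 * n : ℝ) ^ n) / n.factorial := by
  have h1 := (integrable_prod_sq hm2 n).1.mul_const √((2 * n : ℝ) ^ n)
  have h2 : ‖∫ x in Set.univ.pi (fun _ : Fin n => Ioi s), pfaffian (blockMatrix K x)‖
      ≤ (∫ x in Ioi s, m x ^ 2) ^ n * √((2 * n : ℝ) ^ n) := by
    rw [← (integrable_prod_sq hm2 n).2, ← integral_mul_const]
    exact norm_integral_le_of_norm_le h1
      ((ae_restrict_iff' (MeasurableSet.univ_pi fun _ => measurableSet_Ioi)).mpr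
        (.of_forall fun _ hx => h.norm_le hm hx))
  rw [fredholmPfaffianTerm, norm_mul, norm_div, norm_pow, norm_neg, norm_one, one_pow,
    Complex.norm_natCast, mul_comm, mul_one_div]
  gcongr

theorem PfBound.converges (h : PfBound s m K) (hm : ∀ x, 0 < m x)
    (hm2 : IntegrableOn (fun x => m x ^ 2) (Ioi s)) : FredholmPfaffianConverges s K :=
  ⟨h.integrable hm hm2, Summable.of_norm_bounded (summable_hadamard _) (h.term_le hm hm2)⟩

theorem PfBound.norm_fredholmPfaffian_le (h : PfBound s m K) (hm : ∀ x, 0 < m x)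
    (hm2 : IntegrableOn (fun x => m x ^ 2) (Ioi s)) :
    ‖fredholmPfaffian s K‖
      ≤ ∑' n : ℕ, (∫ x in Ioi s, m x ^ 2) ^ n * √((2 * n : ℝ) ^ n) / n.factorial :=
  tsum_of_norm_bounded (summable_hadamard _).hasSum (h.term_le hm hm2)

theorem tendsto_fredholmPfaffian {ι : Type*} {l : Filter ι} [l.IsCountablyGenerated]
    {K' : ι → ℝ → ℝ → Matrix (Fin 2) (Fin 2) ℂ} (h : ∀ᶠ u in l, PfBound s m (K' u))
    (hm : ∀ x, 0 < m x) (hm2 : IntegrableOn (fun x => m x ^ 2) (Ioi s))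
    (hl : ∀ x y c d, s < x → s < y → Tendsto (fun u => K' u x y c d) l (𝓝 (K x y c d))) :
    Tendsto (fun u => fredholmPfaffian s (K' u)) l (𝓝 (fredholmPfaffian s K)) := by
  refine tendsto_tsum_of_dominated_convergence (summable_hadamard (∫ x in Ioi s, m x ^ 2))
    (fun n => Tendsto.const_mul _ ?_) (h.mono fun u hu => hu.term_le hm hm2)
  refine tendsto_integral_filter_of_dominated_convergence
    (fun x => (∏ i, m (x i) ^ 2) * √((2 * n : ℝ) ^ n))
    (h.mono fun u hu => (hu.measurable n).aestronglyMeasurable)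
    (h.mono fun u hu => (ae_restrict_iff' (MeasurableSet.univ_pi fun _ => measurableSet_Ioi)).mpr
      (.of_forall fun _ hx => hu.norm_le hm hx))
    ((integrable_prod_sq hm2 n).1.mul_const _)
    ((ae_restrict_iff' (MeasurableSet.univ_pi fun _ => measurableSet_Ioi)).mpr
      (.of_forall fun x hx => ?_))
  refine Tendsto.const_mul _ (tendsto_finset_sum _ fun σ _ => Tendsto.const_mul _
    (tendsto_finset_prod _ fun i _ => hl _ _ _ _ (hx _ trivial) (hx _ trivial)))

theorem differentiableOn_fredholmPfaffian {c : ℂ} {r : ℝ}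
    {K' : ℂ → ℝ → ℝ → Matrix (Fin 2) (Fin 2) ℂ} (h : ∀ z ∈ ball c r, PfBound s m (K' z))
    (hm : ∀ x, 0 < m x) (hm2 : IntegrableOn (fun x => m x ^ 2) (Ioi s))
    (hd : ∀ x y i j, s < x → s < y → DifferentiableOn ℂ (fun z => K' z x y i j) (ball c r)) :
    DifferentiableOn ℂ (fun z => fredholmPfaffian s (K' z)) (ball c r) := by
  refine differentiableOn_tsum_of_summable_norm (summable_hadamard (∫ x in Ioi s, m x ^ 2))
    (fun n => DifferentiableOn.const_mul ?_ _) isOpen_ball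
    fun n z hz => (h z hz).term_le hm hm2 n
  refine differentiableOn_integral_of_bound
    (bound := fun x => (∏ i, m (x i) ^ 2) * √((2 * n : ℝ) ^ n))
    (fun z hz => ((h z hz).measurable n).aestronglyMeasurable)
    ((ae_restrict_iff' (MeasurableSet.univ_pi fun _ => measurableSet_Ioi)).mpr
      (.of_forall fun x hx => ?_))
    ((ae_restrict_iff' (MeasurableSet.univ_pi fun _ => measurableSet_Ioi)).mpr
      (.of_forall fun x hx z hz => (h z hz).norm_le hm hx))
    ((integrable_prod_sq hm2 n).1.mul_const _)
  refine DifferentiableOn.const_mul (DifferentiableOn.fun_sum fun σ _ =>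
    DifferentiableOn.const_mul (DifferentiableOn.fun_finset_prod fun i _ => ?_) _) _
  exact hd _ _ _ _ (hx _ trivial) (hx _ trivial)

theorem fredholmPfaffianTerm_add (s c : ℝ) (K : ℝ → ℝ → Matrix (Fin 2) (Fin 2) ℂ) (n : ℕ) :
    fredholmPfaffianTerm (s + c) K n = fredholmPfaffianTerm s (fun x y => K (x + c) (y + c)) n := by
  have := (measurePreserving_add_right volume (fun _ : Fin n => c)).setIntegral_preimage_emb
    (MeasurableEquiv.addRight fun _ : Fin n => c).measurableEmbedding
    (fun x => pfaffian (blockMatrix K x)) (Set.univ.pi fun _ : Fin n => Ioi (s + c))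
  rw [fredholmPfaffianTerm, ← this, fredholmPfaffianTerm]
  congr 2
  congr 2
  ext x
  simp

theorem fredholmPfaffianConverges_add {s c : ℝ} {K : ℝ → ℝ → Matrix (Fin 2) (Fin 2) ℂ}
    (h : FredholmPfaffianConverges s fun x y => K (x + c) (y + c)) :
    FredholmPfaffianConverges (s + c) K := by
  refine ⟨fun n => ?_, by simpa only [fredholmPfaffianTerm_add] using h.2⟩
  have := (measurePreserving_add_right volume (fun _ : Fin n => c)).integrableOn_comp_preimage
    (MeasurableEquiv.addRight fun _ : Fin n => c).measurableEmbedding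
    (f := fun x => pfaffian (blockMatrix K x)) (s := Set.univ.pi fun _ : Fin n => Ioi (s + c))
  rw [← this]
  have e : ((fun x => x + fun _ : Fin n => c) ⁻¹' Set.univ.pi fun _ => Ioi (s + c))
      = Set.univ.pi fun _ => Ioi s := by
    ext x
    simp [Set.mem_pi]
  rw [e]
  exact h.1 n

/-- The antisymmetric matrix kernel whose Fredholm Pfaffian is the Fredholm determinant of `k`. -/
def offDiag (k : ℝ → ℝ → ℂ) (x y : ℝ) : Matrix (Fin 2) (Fin 2) ℂ :=
  !![0, k x y; -k y x, 0]

theorem pfaffian_blockMatrix_offDiag (k : ℝ → ℝ → ℂ) {n : ℕ} (x : Fin n → ℝ) :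
    pfaffian (blockMatrix (offDiag k) x) = (Matrix.of fun i j => k (x i) (x j)).det := by
  rw [← pfaffian_offdiag]
  congr 1
  ext ⟨i, c⟩ ⟨j, d⟩
  fin_cases c <;> fin_cases d <;> simp [blockMatrix, offDiag]

theorem fredholmDet_eq_fredholmPfaffian (s : ℝ) (k : ℝ → ℝ → ℂ) :
    fredholmDet s k = fredholmPfaffian s (offDiag k) := by
  simp only [fredholmDet, fredholmPfaffian, fredholmDetTerm, fredholmPfaffianTerm,
    pfaffian_blockMatrix_offDiag]

theorem fredholmDetConverges_iff (s : ℝ) (k : ℝ → ℝ → ℂ) :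
    FredholmDetConverges s k ↔ FredholmPfaffianConverges s (offDiag k) := by
  simp only [FredholmDetConverges, FredholmPfaffianConverges, fredholmDetTerm,
    fredholmPfaffianTerm, pfaffian_blockMatrix_offDiag]

end

/-- `f` is measurable and dominated by `n • m`. -/
def Dom {α : Type*} [MeasurableSpace α] (m : α → ℝ) (n : ℝ) (f : α → ℂ) : Prop :=
  Measurable f ∧ ∀ p, ‖f p‖ ≤ n * m p

section
variable {α : Type*} [MeasurableSpace α] {m : α → ℝ} {n n' : ℝ} {f g : α → ℂ}

theorem Dom.sub (hf : Dom m n f) (hg : Dom m n' g) : Dom m (n + n') (f - g) :=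
  ⟨hf.1.sub hg.1, fun p => (norm_sub_le _ _).trans (by
    rw [add_mul]; exact add_le_add (hf.2 p) (hg.2 p))⟩

theorem Dom.smul (hf : Dom m n f) (c : ℂ) : Dom m (‖c‖ * n) (c • f) :=
  ⟨hf.1.const_smul c, fun p => by
    rw [Pi.smul_apply, norm_smul, mul_assoc]
    exact mul_le_mul_of_nonneg_left (hf.2 p) (norm_nonneg _)⟩

theorem norm_taylor_le {g : ℂ → ℂ} {z₀ k : ℂ} {ρ B : ℝ} (hρ : 0 < ρ)
    (hg : DifferentiableOn ℂ g (ball z₀ (3 * ρ)))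
    (hB : ∀ z ∈ ball z₀ (3 * ρ), ‖g z‖ ≤ B) (hk : ‖k‖ < ρ) :
    ‖g (z₀ + k) - g z₀ - k * deriv g z₀‖ ≤ B / ρ / ρ * ‖k‖ * ‖k‖ := by
  have hcl : ∀ {R : ℝ} {z : ℂ}, z ∈ ball z₀ R → closedBall z ρ
      ⊆ ball z₀ (R + ρ) := fun hz => Metric.closedBall_subset_ball' (by
    rw [mem_ball] at hz; linarith)
  have hdc : ∀ {R : ℝ} {z : ℂ} {q : ℂ → ℂ}, z ∈ ball z₀ R →
      DifferentiableOn ℂ q (ball z₀ (R + ρ)) → DiffContOnCl ℂ q (ball z ρ) :=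
    fun hz hq => DifferentiableOn.diffContOnCl (by
      rw [closure_ball _ hρ.ne']; exact hq.mono (hcl hz))
  have h3 : (2 * ρ + ρ : ℝ) = 3 * ρ := by ring
  have h2 : (ρ + ρ : ℝ) = 2 * ρ := by ring
  have hg' : DifferentiableOn ℂ (deriv g) (ball z₀ (2 * ρ)) :=
    (hg.deriv isOpen_ball).mono (ball_subset_ball (by linarith))
  have d1 : ∀ z ∈ ball z₀ (2 * ρ), ‖deriv g z‖ ≤ B / ρ := fun z hz =>
    Complex.norm_deriv_le_of_forall_mem_sphere_norm_le hρ (hdc hz (h3 ▸ hg)) fun w hw =>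
      hB w (h3 ▸ hcl hz (sphere_subset_closedBall hw))
  have d2 : ∀ z ∈ ball z₀ ρ, ‖deriv (deriv g) z‖ ≤ B / ρ / ρ := fun z hz =>
    Complex.norm_deriv_le_of_forall_mem_sphere_norm_le hρ (hdc hz (h2 ▸ hg')) fun w hw =>
      d1 w (h2 ▸ hcl hz (sphere_subset_closedBall hw))
  have hz0 : z₀ ∈ ball z₀ ρ := mem_ball_self hρ
  have hd2 : ∀ z ∈ ball z₀ ρ, ‖deriv g z - deriv g z₀‖ ≤ B / ρ / ρ * ‖z - z₀‖ :=
    fun z hz => (convex_ball z₀ ρ).norm_image_sub_le_of_norm_deriv_le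
      (fun w hw => hg'.differentiableAt (Metric.isOpen_ball.mem_nhds
        (ball_subset_ball (by linarith) hw))) d2 hz0 hz
  have hkb : z₀ + k ∈ closedBall z₀ ‖k‖ := by simp
  have hsub : ∀ z ∈ closedBall z₀ ‖k‖, z ∈ ball z₀ ρ := fun z hz =>
    closedBall_subset_ball hk hz
  have := (convex_closedBall z₀ ‖k‖).norm_image_sub_le_of_norm_hasDerivWithin_le
    (f := fun z => g z - (z - z₀) * deriv g z₀) (f' := fun z => deriv g z - deriv g z₀)
    (C := B / ρ / ρ * ‖k‖) (x := z₀) (y := z₀ + k) (fun z hz => ?_) (fun z hz => ?_)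
    (Metric.mem_closedBall_self (norm_nonneg _)) hkb
  · have e : g (z₀ + k) - g z₀ - k * deriv g z₀ = g (z₀ + k) - k * deriv g z₀ - g z₀ := by ring
    rw [e]
    simpa only [add_sub_cancel_left, sub_self, zero_mul, sub_zero] using this
  · have h1 : HasDerivAt g (deriv g z) z := (hg.differentiableAt (Metric.isOpen_ball.mem_nhds
      (ball_subset_ball (by linarith) (hsub z hz)))).hasDerivAt
    have h2 := ((hasDerivAt_id z).sub_const z₀).mul_const (deriv g z₀)
    rw [one_mul] at h2
    exact (h1.sub h2).hasDerivWithinAt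
  · refine (hd2 z (hsub z hz)).trans ?_
    rw [Metric.mem_closedBall, dist_eq_norm] at hz
    have hB0 : 0 ≤ B / ρ / ρ := (norm_nonneg _).trans (d2 z₀ hz0)
    gcongr

/-- Dominated holomorphic families are mapped to holomorphic families by linear maps that are
bounded in terms of the dominating constant. -/
theorem differentiableOn_of_dom {E : Type*} [NormedAddCommGroup E] [NormedSpace ℂ E]
    {Φ : (α → ℂ) → E} {C : ℝ} (hm0 : ∀ p, 0 ≤ m p)
    (hsub : ∀ {n n' f g}, Dom m n f → Dom m n' g → Φ (f - g) = Φ f - Φ g)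
    (hsmul : ∀ {n f} (c : ℂ), Dom m n f → Φ (c • f) = c • Φ f)
    (hle : ∀ {n f}, 0 ≤ n → Dom m n f → ‖Φ f‖ ≤ C * n) (hn : 0 ≤ n)
    {F : ℂ → α → ℂ} {c : ℂ} {r : ℝ} (hF : ∀ z ∈ ball c r, Dom m n (F z))
    (hd : ∀ p, DifferentiableOn ℂ (fun z => F z p) (ball c r)) :
    DifferentiableOn ℂ (fun z => Φ (F z)) (ball c r) := by
  intro z₀ hz₀
  have hz₀' := hz₀
  rw [mem_ball, dist_eq_norm] at hz₀
  set ρ := (r - ‖z₀ - c‖) / 3 with hρ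
  have hρ0 : 0 < ρ := by rw [hρ]; linarith
  have hb : ball z₀ (3 * ρ) ⊆ ball c r :=
    Metric.ball_subset_ball' (by rw [dist_eq_norm, hρ]; linarith)
  let F' : α → ℂ := fun p => deriv (fun z => F z p) z₀
  have hdz : ∀ p, HasDerivAt (fun z => F z p) (F' p) z₀ := fun p =>
    ((hd p).differentiableAt (Metric.isOpen_ball.mem_nhds hz₀')).hasDerivAt
  have hF' : Dom m (n / ρ) F' := by
    constructor
    · have h := (tendsto_one_div_add_atTop_nhds_zero_nat (𝕜 := ℝ)).const_mul ρ
      rw [mul_zero] at h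
      let w : ℕ → ℂ := fun i => z₀ + (ρ * (1 / ((i : ℝ) + 1)) : ℝ)
      have hpos : ∀ i : ℕ, (0 : ℝ) < ρ * (1 / ((i : ℝ) + 1)) := fun i => by positivity
      have hw : ∀ i, w i ∈ ball c r := fun i => hb (by
        have h1 : (1 : ℝ) / ((i : ℝ) + 1) ≤ 1 := by
          rw [div_le_one (by positivity)]
          simp
        rw [mem_ball, dist_eq_norm, add_sub_cancel_left,
          Complex.norm_of_nonneg (hpos i).le]
        have := mul_le_mul_of_nonneg_left h1 hρ0.le
        linarith)
      have hwt : Tendsto w atTop (𝓝[≠] z₀) := by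
        refine tendsto_nhdsWithin_iff.mpr ⟨?_, .of_forall fun i => ?_⟩
        · have h2 := ((continuous_ofReal.tendsto 0).comp h).const_add z₀
          simpa [w, Function.comp_def] using h2
        · simp only [w, Set.mem_compl_iff, Set.mem_singleton_iff, add_eq_left, ofReal_eq_zero]
          exact (hpos i).ne'
      refine measurable_of_tendsto_metrizable (f := fun i p => (w i - z₀)⁻¹ * (F (w i) p - F z₀ p))
        (fun i => ((hF _ (hw i)).1.sub (hF _ hz₀').1).const_mul _) ?_
      refine tendsto_pi_nhds.mpr fun p => ?_
      have := ((hdz p).tendsto_slope).comp hwt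
      refine this.congr fun i => ?_
      simp only [Function.comp, slope_def_field]
      rw [inv_mul_eq_div]
    · intro p
      refine (Complex.norm_deriv_le_of_forall_mem_sphere_norm_le (C := n * m p) hρ0 ?_
        fun w hw => ?_).trans (le_of_eq (by ring))
      · refine DifferentiableOn.diffContOnCl ?_
        rw [closure_ball _ hρ0.ne']
        exact (hd p).mono ((closedBall_subset_ball (by linarith)).trans hb)
      · exact (hF w (hb (closedBall_subset_ball (by linarith)
          (sphere_subset_closedBall hw)))).2 p
  have hrem : ∀ k : ℂ, ‖k‖ < ρ →
      ‖Φ (F (z₀ + k)) - Φ (F z₀) - k • Φ F'‖ ≤ C * (n / ρ / ρ * ‖k‖ * ‖k‖) := by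
    intro k hk
    have hk' : z₀ + k ∈ ball c r := hb (by
      rw [mem_ball, dist_eq_norm, add_sub_cancel_left]; linarith)
    have h1 := hF _ hk'
    have h2 := hF _ hz₀'
    rw [← hsub h1 h2, ← hsmul k hF', ← hsub (h1.sub h2) (hF'.smul k)]
    refine hle (by positivity) ⟨((h1.sub h2).sub (hF'.smul k)).1, fun p => ?_⟩
    have := norm_taylor_le hρ0 ((hd p).mono hb) (fun z hz => (hF z (hb hz)).2 p) hk
    exact this.trans (le_of_eq (by ring))
  have : HasDerivAt (fun z => Φ (F z)) (Φ F') z₀ := by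
    rw [hasDerivAt_iff_isLittleO_nhds_zero]
    have hO : (fun k : ℂ => Φ (F (z₀ + k)) - Φ (F z₀) - k • Φ F')
        =O[𝓝 0] fun k => ‖k‖ ^ 2 := by
      refine Asymptotics.IsBigO.of_bound (|C * (n / ρ / ρ)|) ?_
      filter_upwards [ball_mem_nhds (0 : ℂ) hρ0] with k hk
      rw [mem_ball_zero_iff] at hk
      refine (hrem k hk).trans ?_
      rw [norm_pow, norm_norm, show C * (n / ρ / ρ * ‖k‖ * ‖k‖) = C * (n / ρ / ρ) * ‖k‖ ^ 2 by ring]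
      gcongr
      exact le_abs_self _
    refine hO.trans_isLittleO ?_
    have := Asymptotics.isLittleO_pow_id (𝕜 := ℝ) (n := 2) one_lt_two
    exact (this.comp_tendsto (tendsto_norm_zero (E := ℂ))).of_norm_right
  exact this.differentiableAt.differentiableWithinAt

end

/-! ### Integral operators with dominated kernels -/

section
variable {α : Type*} [MeasurableSpace α] {μ : Measure α} [SFinite μ] {m : α → ℝ} {n n' : ℝ}
  {k k' : α → α → ℂ}

theorem HasKernel.unique {T T' : Lp ℂ 2 μ →L[ℂ] Lp ℂ 2 μ} (h : HasKernel μ k T)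
    (h' : HasKernel μ k T') : T = T' := by
  ext1 f
  refine Lp.ext ?_
  filter_upwards [(h f).2, (h' f).2] with x h1 h2
  rw [h1, h2]

theorem HasKernel.integralOp_eq {T : Lp ℂ 2 μ →L[ℂ] Lp ℂ 2 μ} (h : HasKernel μ k T) :
    integralOp μ k = T := by
  have he : ∃ T, HasKernel μ k T := ⟨T, h⟩
  rw [integralOp, dif_pos he]
  exact he.choose_spec.unique h

theorem Dom.memLp {f : α → ℂ} (hm : MemLp m 2 μ) (hf : Dom m n f) : MemLp f 2 μ :=
  (hm.const_mul n).mono' hf.1.aestronglyMeasurable (.of_forall hf.2)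

theorem integrable_mul_of_memLp {f g : α → ℂ} (hf : MemLp f 2 μ) (hg : MemLp g 2 μ) :
    Integrable (fun x => f x * g x) μ := by
  have := hf.integrable_mul (p := 2) (q := 2) hg
  exact this

/-- The bilinear pairing with `g`. -/
def pairWith (μ : Measure α) (g : α → ℂ) : Lp ℂ 2 μ →L[ℂ] ℂ :=
  open Classical in
  if h : MemLp g 2 μ then innerSL ℂ (h.star.toLp (star g)) else 0

theorem pairWith_apply {g : α → ℂ} (hg : MemLp g 2 μ) (φ : Lp ℂ 2 μ) :
    pairWith μ g φ = ∫ x, g x * φ x ∂μ := by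
  rw [pairWith, dif_pos hg, innerSL_apply_apply, L2.inner_def]
  refine integral_congr_ae ?_
  filter_upwards [hg.star.coeFn_toLp] with x hx
  rw [hx]
  simp [mul_comm]

theorem norm_pairWith_le {f : α → ℂ} (hm : MemLp m 2 μ) (hn : 0 ≤ n) (hf : Dom m n f) :
    ‖pairWith μ f‖ ≤ ‖hm.toLp m‖ * n := by
  have h := hf.memLp hm
  rw [pairWith, dif_pos h, innerSL_apply_norm, mul_comm]
  refine Lp.norm_le_mul_norm_of_ae_le_mul ?_
  filter_upwards [h.star.coeFn_toLp, hm.coeFn_toLp] with x h1 h2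
  rw [h1, h2, Pi.star_apply, norm_star]
  exact (hf.2 x).trans (mul_le_mul_of_nonneg_left (le_abs_self _) hn)

theorem pairWith_sub {f g : α → ℂ} (hf : MemLp f 2 μ) (hg : MemLp g 2 μ) :
    pairWith μ (f - g) = pairWith μ f - pairWith μ g := by
  ext φ
  rw [ContinuousLinearMap.sub_apply, pairWith_apply hf, pairWith_apply hg,
    pairWith_apply (hf.sub hg), ← integral_sub (integrable_mul_of_memLp hf (Lp.memLp φ))
      (integrable_mul_of_memLp hg (Lp.memLp φ))]
  simp only [Pi.sub_apply, sub_mul]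

theorem pairWith_smul {f : α → ℂ} (hf : MemLp f 2 μ) (c : ℂ) :
    pairWith μ (c • f) = c • pairWith μ f := by
  ext φ
  rw [ContinuousLinearMap.smul_apply, pairWith_apply hf, pairWith_apply (hf.const_smul c),
    smul_eq_mul, ← integral_const_mul c]
  simp only [Pi.smul_apply, smul_eq_mul, mul_assoc]

/-- The class of `f` in `L²`, or zero. -/
def vec (μ : Measure α) (f : α → ℂ) : Lp ℂ 2 μ :=
  open Classical in if h : MemLp f 2 μ then h.toLp f else 0

theorem vec_sub {f g : α → ℂ} (hf : MemLp f 2 μ) (hg : MemLp g 2 μ) :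
    vec μ (f - g) = vec μ f - vec μ g := by
  rw [vec, vec, vec, dif_pos hf, dif_pos hg, dif_pos (hf.sub hg), MemLp.toLp_sub]

theorem vec_smul {f : α → ℂ} (hf : MemLp f 2 μ) (c : ℂ) : vec μ (c • f) = c • vec μ f := by
  rw [vec, vec, dif_pos hf, dif_pos (hf.const_smul c), MemLp.toLp_const_smul]

theorem norm_vec_le {f : α → ℂ} (hm : MemLp m 2 μ) (hn : 0 ≤ n) (hf : Dom m n f) :
    ‖vec μ f‖ ≤ ‖hm.toLp m‖ * n := by
  have h := hf.memLp hm
  rw [vec, dif_pos h, mul_comm]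
  refine Lp.norm_le_mul_norm_of_ae_le_mul ?_
  filter_upwards [h.coeFn_toLp, hm.coeFn_toLp] with x h1 h2
  rw [h1, h2]
  exact (hf.2 x).trans (mul_le_mul_of_nonneg_left (le_abs_self _) hn)

/-- `k` is measurable and dominated by `n • (m ⊗ m)`. -/
abbrev KDom (m : α → ℝ) (n : ℝ) (k : α → α → ℂ) : Prop :=
  Dom (fun p : α × α => m p.1 * m p.2) n fun p => k p.1 p.2

theorem KDom.row (hk : KDom m n k) (x : α) : Dom m (n * m x) (k x) :=
  ⟨hk.1.comp (f := fun y => (x, y)) (by fun_prop), fun y => by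
    rw [mul_assoc]; exact hk.2 (x, y)⟩

theorem KDom.integrable (hk : KDom m n k) (hm : MemLp m 2 μ) (x : α) {f : α → ℂ}
    (hf : MemLp f 2 μ) : Integrable (fun y => k x y * f y) μ :=
  integrable_mul_of_memLp ((hk.row x).memLp hm) hf

theorem KDom.norm_integral_le (hk : KDom m n k) (hm : MemLp m 2 μ) (hm0 : ∀ p, 0 ≤ m p)
    (hn : 0 ≤ n) (f : Lp ℂ 2 μ) (x : α) :
    ‖∫ y, k x y * f y ∂μ‖ ≤ ‖hm.toLp m‖ * n * ‖f‖ * m x := by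
  have h1 := hk.row x
  rw [← pairWith_apply (h1.memLp hm)]
  refine ((pairWith μ (k x)).le_opNorm f).trans ?_
  have := norm_pairWith_le hm (mul_nonneg hn (hm0 x)) h1
  calc _ ≤ ‖hm.toLp m‖ * (n * m x) * ‖f‖ := by gcongr
    _ = _ := by ring

theorem KDom.exists_hasKernel (hk : KDom m n k) (hm : MemLp m 2 μ) (hm0 : ∀ p, 0 ≤ m p)
    (hn : 0 ≤ n) : ∃ T, HasKernel μ k T ∧ ‖T‖ ≤ ‖hm.toLp m‖ ^ 2 * n := by
  have hmeas : ∀ f : Lp ℂ 2 μ, AEStronglyMeasurable (fun x => ∫ y, k x y * f y ∂μ) μ := fun f => by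
    have : StronglyMeasurable fun p : α × α => k p.1 p.2 * f p.2 :=
      hk.1.stronglyMeasurable.mul ((Lp.stronglyMeasurable f).comp_measurable measurable_snd)
    exact this.integral_prod_right'.aestronglyMeasurable
  have hL : ∀ f : Lp ℂ 2 μ, MemLp (fun x => ∫ y, k x y * f y ∂μ) 2 μ := fun f =>
    (hm.const_mul _).mono' (hmeas f) (.of_forall (hk.norm_integral_le hm hm0 hn f))
  have hi : ∀ (f : Lp ℂ 2 μ) x, Integrable (fun y => k x y * f y) μ := fun f x =>
    hk.integrable hm x (Lp.memLp f)
  let T₀ : Lp ℂ 2 μ →ₗ[ℂ] Lp ℂ 2 μ :=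
    { toFun := fun f => (hL f).toLp _
      map_add' := fun f g => by
        rw [← MemLp.toLp_add]
        refine MemLp.toLp_congr _ _ (.of_forall fun x => ?_)
        rw [Pi.add_apply, ← integral_add (hi f x) (hi g x)]
        refine integral_congr_ae ?_
        filter_upwards [Lp.coeFn_add f g] with y hy
        rw [hy, Pi.add_apply, mul_add]
      map_smul' := fun c f => by
        rw [RingHom.id_apply, ← MemLp.toLp_const_smul]
        refine MemLp.toLp_congr _ _ (.of_forall fun x => ?_)
        rw [Pi.smul_apply, smul_eq_mul, ← integral_const_mul c]
        refine integral_congr_ae ?_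
        filter_upwards [Lp.coeFn_smul c f] with y hy
        rw [hy, Pi.smul_apply, smul_eq_mul, mul_left_comm] }
  have hb : ∀ f, ‖T₀ f‖ ≤ ‖hm.toLp m‖ ^ 2 * n * ‖f‖ := fun f => by
    have : ‖T₀ f‖ ≤ ‖hm.toLp m‖ * n * ‖f‖ * ‖hm.toLp m‖ := by
      refine Lp.norm_le_mul_norm_of_ae_le_mul ?_
      filter_upwards [(hL f).coeFn_toLp, hm.coeFn_toLp] with x h1 h2
      have e : T₀ f = (hL f).toLp _ := rfl
      rw [e, h1, h2, Real.norm_of_nonneg (hm0 x)]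
      exact hk.norm_integral_le hm hm0 hn f x
    exact this.trans (le_of_eq (by ring))
  refine ⟨T₀.mkContinuous _ hb, fun f => ⟨.of_forall (hi f), ?_⟩,
    T₀.mkContinuous_norm_le (by positivity) hb⟩
  exact (hL f).coeFn_toLp

theorem KDom.hasKernel (hk : KDom m n k) (hm : MemLp m 2 μ) (hm0 : ∀ p, 0 ≤ m p) (hn : 0 ≤ n) :
    HasKernel μ k (integralOp μ k) := by
  obtain ⟨T, h, -⟩ := hk.exists_hasKernel hm hm0 hn
  rwa [h.integralOp_eq]

theorem KDom.norm_integralOp_le (hk : KDom m n k) (hm : MemLp m 2 μ) (hm0 : ∀ p, 0 ≤ m p)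
    (hn : 0 ≤ n) : ‖integralOp μ k‖ ≤ ‖hm.toLp m‖ ^ 2 * n := by
  obtain ⟨T, h, h'⟩ := hk.exists_hasKernel hm hm0 hn
  rwa [h.integralOp_eq]

theorem HasKernel.sub {T T' : Lp ℂ 2 μ →L[ℂ] Lp ℂ 2 μ} (h : HasKernel μ k T)
    (h' : HasKernel μ k' T') : HasKernel μ (fun x y => k x y - k' x y) (T - T') := fun f => by
  constructor
  · filter_upwards [(h f).1, (h' f).1] with x h1 h2
    simp only [sub_mul]
    exact h1.sub h2
  · filter_upwards [(h f).1, (h' f).1, (h f).2, (h' f).2, Lp.coeFn_sub (T f) (T' f)]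
      with x h1 h2 h3 h4 h5
    rw [ContinuousLinearMap.sub_apply, h5, Pi.sub_apply, h3, h4, ← integral_sub h1 h2]
    simp only [sub_mul]

theorem HasKernel.smul {T : Lp ℂ 2 μ →L[ℂ] Lp ℂ 2 μ} (h : HasKernel μ k T) (c : ℂ) :
    HasKernel μ (fun x y => c * k x y) (c • T) := fun f => by
  constructor
  · filter_upwards [(h f).1] with x h1
    simpa only [mul_assoc] using h1.const_mul c
  · filter_upwards [(h f).2, Lp.coeFn_smul c (T f)] with x h3 h5
    rw [ContinuousLinearMap.smul_apply, h5, Pi.smul_apply, h3, smul_eq_mul,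
      ← integral_const_mul c]
    simp only [mul_assoc]

theorem resolventApply_eq (μ : Measure α) (k : α → α → ℂ) (h : α → ℂ) :
    resolventApply μ k h = Ring.inverse (1 - integralOp μ k) (vec μ h) := by
  rw [resolventApply, vec]
  split_ifs
  · rfl
  · rw [map_zero]

theorem resolventPairing_eq {g : α → ℂ} (hg : MemLp g 2 μ) (k : α → α → ℂ) (h : α → ℂ) :
    resolventPairing μ k g h = pairWith μ g (Ring.inverse (1 - integralOp μ k) (vec μ h)) := by
  rw [pairWith_apply hg, resolventPairing, resolventApply_eq]

end

/-- A holomorphic family, on the unit disc, of functions dominated by `n • m`. -/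
def HolDom {α : Type*} [MeasurableSpace α] (m : α → ℝ) (n : ℝ) (F : ℂ → α → ℂ) : Prop :=
  (∀ h ∈ ball (0 : ℂ) 1, Dom m n (F h)) ∧
    ∀ p, DifferentiableOn ℂ (fun h => F h p) (ball 0 1)

/-- `F` and `F'` differ by at most `ε • m` on the unit disc. -/
def DomNear {α : Type*} (m : α → ℝ) (ε : ℝ) (F F' : ℂ → α → ℂ) : Prop :=
  ∀ h ∈ ball (0 : ℂ) 1, ∀ p, ‖F h p - F' h p‖ ≤ ε * m p

section
variable {α : Type*} [MeasurableSpace α] {μ : Measure α} [SFinite μ] {m : α → ℝ} {n : ℝ}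

theorem differentiableOn_integralOp (hm : MemLp m 2 μ) (hm0 : ∀ p, 0 ≤ m p) (hn : 0 ≤ n)
    {K : ℂ → α × α → ℂ} (hK : HolDom (fun p : α × α => m p.1 * m p.2) n K) :
    DifferentiableOn ℂ (fun h => integralOp μ fun x y => K h (x, y)) (ball 0 1) := by
  have hH : ∀ {n : ℝ} {f : α × α → ℂ}, Dom (fun p : α × α => m p.1 * m p.2) n f →
      HasKernel μ (fun x y => f (x, y)) (integralOp μ fun x y => f (x, y)) := fun {n f} hf => by
    have : KDom m |n| fun x y => f (x, y) := ⟨hf.1, fun p => (hf.2 p).trans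
      (mul_le_mul_of_nonneg_right (le_abs_self n) (mul_nonneg (hm0 _) (hm0 _)))⟩
    exact this.hasKernel hm hm0 (abs_nonneg n)
  refine differentiableOn_of_dom (Φ := fun f : α × α → ℂ => integralOp μ fun x y => f (x, y))
    (fun p => mul_nonneg (hm0 p.1) (hm0 p.2)) (fun hf hg => ?_) (fun c hf => ?_)
    (fun {n f} hn hf => ?_) hn hK.1 hK.2 (C := ‖hm.toLp m‖ ^ 2)
  · exact ((hH hf).sub (hH hg)).integralOp_eq
  · exact ((hH hf).smul c).integralOp_eq
  · exact KDom.norm_integralOp_le (k := fun x y => f (x, y)) hf hm hm0 hn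

theorem norm_integralOp_sub_le (hm : MemLp m 2 μ) (hm0 : ∀ p, 0 ≤ m p) (hn : 0 ≤ n)
    {k k' : α → α → ℂ} {ε : ℝ} (hε : 0 ≤ ε) (hk : KDom m n k) (hk' : KDom m n k')
    (h : ∀ p q, ‖k p q - k' p q‖ ≤ ε * (m p * m q)) :
    ‖integralOp μ k - integralOp μ k'‖ ≤ ‖hm.toLp m‖ ^ 2 * ε := by
  rw [← ((hk.hasKernel hm hm0 hn).sub (hk'.hasKernel hm hm0 hn)).integralOp_eq]
  exact KDom.norm_integralOp_le ⟨hk.1.sub hk'.1, fun p => h p.1 p.2⟩ hm hm0 hε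

theorem differentiableOn_vec (hm : MemLp m 2 μ) (hm0 : ∀ p, 0 ≤ m p) (hn : 0 ≤ n)
    {F : ℂ → α → ℂ} (hF : HolDom m n F) :
    DifferentiableOn ℂ (fun h => vec μ (F h)) (ball 0 1) :=
  differentiableOn_of_dom hm0 (fun hf hg => vec_sub (hf.memLp hm) (hg.memLp hm))
    (fun c hf => vec_smul (hf.memLp hm) c) (fun hn hf => norm_vec_le hm hn hf) hn hF.1 hF.2

theorem differentiableOn_pairWith (hm : MemLp m 2 μ) (hm0 : ∀ p, 0 ≤ m p) (hn : 0 ≤ n)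
    {F : ℂ → α → ℂ} (hF : HolDom m n F) :
    DifferentiableOn ℂ (fun h => pairWith μ (F h)) (ball 0 1) :=
  differentiableOn_of_dom hm0 (fun hf hg => pairWith_sub (hf.memLp hm) (hg.memLp hm))
    (fun c hf => pairWith_smul (hf.memLp hm) c) (fun hn hf => norm_pairWith_le hm hn hf) hn
    hF.1 hF.2

theorem exists_inverse_bound {E : Type*} [NormedAddCommGroup E] [NormedSpace ℂ E]
    [CompleteSpace E] {T₀ : E →L[ℂ] E} (h : IsUnit (1 - T₀)) :
    ∃ δ B : ℝ, 0 < δ ∧ ∀ T : E →L[ℂ] E, ‖T - T₀‖ < δ →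
      IsUnit (1 - T) ∧ ‖Ring.inverse (1 - T)‖ ≤ B := by
  obtain ⟨x, hx⟩ := h
  have h1 : ∀ᶠ y in 𝓝 (x : E →L[ℂ] E), IsUnit y ∧
      ‖Ring.inverse y‖ ≤ ‖Ring.inverse (x : E →L[ℂ] E)‖ + 1 := by
    have h2 := (NormedRing.inverse_continuousAt x).norm.eventually
      (gt_mem_nhds (lt_add_one _))
    filter_upwards [h2, Units.isOpen.mem_nhds x.isUnit] with y h3 h4 using ⟨h4, h3.le⟩
  obtain ⟨δ, hδ, h5⟩ := Metric.eventually_nhds_iff.mp h1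
  refine ⟨δ, _, hδ, fun T hT => h5 ?_⟩
  rw [dist_eq_norm, hx, ← norm_neg]
  rwa [show -(1 - T - (1 - T₀)) = T - T₀ by abel]

theorem differentiableOn_resolventPairing (hm : MemLp m 2 μ) (hm0 : ∀ p, 0 ≤ m p) (hn : 0 ≤ n)
    {K : ℂ → α × α → ℂ} {G F : ℂ → α → ℂ} (hK : HolDom (fun p : α × α => m p.1 * m p.2) n K)
    (hG : HolDom m n G) (hF : HolDom m n F) {r : ℝ} (hr : r ≤ 1)
    (hU : ∀ h ∈ ball (0 : ℂ) r, IsUnit (1 - integralOp μ fun x y => K h (x, y))) :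
    DifferentiableOn ℂ (fun h => resolventPairing μ (fun x y => K h (x, y)) (G h) (F h))
      (ball 0 r) := by
  have hs := ball_subset_ball (x := (0 : ℂ)) hr
  have h1 : DifferentiableOn ℂ (fun h => pairWith μ (G h)
      (Ring.inverse (1 - integralOp μ fun x y => K h (x, y)) (vec μ (F h)))) (ball 0 r) := by
    refine DifferentiableOn.clm_apply ((differentiableOn_pairWith hm hm0 hn hG).mono hs)
      (DifferentiableOn.clm_apply ?_ ((differentiableOn_vec hm hm0 hn hF).mono hs))
    intro h hh
    have h2 := ((differentiableOn_integralOp hm hm0 hn hK).mono hs) h hh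
    exact (differentiableAt_inverse (𝕜 := ℂ) (hU h hh)).comp_differentiableWithinAt h
      (h2.const_sub 1)
  exact h1.congr fun h hh => resolventPairing_eq ((hG.1 h (hs hh)).memLp hm) _ _

/-- Bounds, holomorphy and convergence of the resolvent pairings of a convergent family. -/
theorem resolvent_family (hm : MemLp m 2 μ) (hm0 : ∀ p, 0 ≤ m p) (hn : 0 ≤ n) {l : Filter ℝ}
    {K : ℝ → ℂ → α × α → ℂ} {G F : ℝ → ℂ → α → ℂ} {K₀ : ℂ → α × α → ℂ} {G₀ F₀ : ℂ → α → ℂ}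
    {ε : ℝ → ℝ} (hε : Tendsto ε l (𝓝 0))
    (hK : ∀ᶠ u in l, HolDom (fun p : α × α => m p.1 * m p.2) n (K u))
    (hG : ∀ᶠ u in l, HolDom m n (G u)) (hF : ∀ᶠ u in l, HolDom m n (F u))
    (hK₀ : HolDom (fun p : α × α => m p.1 * m p.2) n K₀)
    (hG₀ : HolDom m n G₀) (hF₀ : HolDom m n F₀)
    (hKε : ∀ᶠ u in l, DomNear (fun p : α × α => m p.1 * m p.2) (ε u) (K u) K₀)
    (hGε : ∀ᶠ u in l, DomNear m (ε u) (G u) G₀) (hFε : ∀ᶠ u in l, DomNear m (ε u) (F u) F₀)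
    (hU : IsUnit (1 - integralOp μ fun x y => K₀ 0 (x, y))) :
    ∃ r B : ℝ, 0 < r ∧ r ≤ 1 ∧
      (∀ h ∈ ball (0 : ℂ) r, IsUnit (1 - integralOp μ fun x y => K₀ h (x, y))) ∧
      (∀ᶠ u in l, ∀ h ∈ ball (0 : ℂ) r,
        IsUnit (1 - integralOp μ fun x y => K u h (x, y)) ∧
        ‖resolventPairing μ (fun x y => K u h (x, y)) (G u h) (F u h)‖ ≤ B) ∧
      ∀ h ∈ ball (0 : ℂ) r,
        Tendsto (fun u => resolventPairing μ (fun x y => K u h (x, y)) (G u h) (F u h)) l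
          (𝓝 (resolventPairing μ (fun x y => K₀ h (x, y)) (G₀ h) (F₀ h))) := by
  obtain ⟨δ, B, hδ, hB⟩ := exists_inverse_bound hU
  have h0 : (0 : ℂ) ∈ ball (0 : ℂ) 1 := mem_ball_self one_pos
  have hc := ((differentiableOn_integralOp hm hm0 hn hK₀).differentiableAt
    (Metric.isOpen_ball.mem_nhds h0)).continuousAt
  obtain ⟨r₀, hr₀, hr₀'⟩ := Metric.continuousAt_iff.mp hc (δ / 2) (by linarith)
  have hs : ∀ {h : ℂ}, h ∈ ball (0 : ℂ) (min r₀ 1) → h ∈ ball (0 : ℂ) 1 :=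
    fun hh => ball_subset_ball (min_le_right _ _) hh
  have hT₀ : ∀ h ∈ ball (0 : ℂ) (min r₀ 1), ‖(integralOp μ fun x y => K₀ h (x, y))
      - integralOp μ fun x y => K₀ 0 (x, y)‖ < δ / 2 := fun h hh => by
    rw [← dist_eq_norm]
    exact hr₀' (ball_subset_ball (min_le_left _ _) hh)
  set L := ‖hm.toLp m‖ with hL
  have hdiff : ∀ᶠ u in l, ∀ h ∈ ball (0 : ℂ) 1, ‖(integralOp μ fun x y => K u h (x, y))
      - integralOp μ fun x y => K₀ h (x, y)‖ ≤ L ^ 2 * |ε u| := by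
    filter_upwards [hK, hKε] with u h1 h2 h hh
    exact norm_integralOp_sub_le hm hm0 hn (abs_nonneg _) (h1.1 h hh) (hK₀.1 h hh)
      fun p q => (h2 h hh (p, q)).trans
        (mul_le_mul_of_nonneg_right (le_abs_self _) (mul_nonneg (hm0 _) (hm0 _)))
  have hLε : Tendsto (fun u => L ^ 2 * |ε u|) l (𝓝 0) := by
    have := hε.abs.const_mul (L ^ 2)
    rwa [abs_zero, mul_zero] at this
  have hnear : ∀ᶠ u in l, ∀ h ∈ ball (0 : ℂ) (min r₀ 1),
      ‖(integralOp μ fun x y => K u h (x, y)) - integralOp μ fun x y => K₀ 0 (x, y)‖ < δ := by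
    filter_upwards [hdiff, hLε.eventually (gt_mem_nhds (half_pos hδ))] with u h1 h2 h hh
    have h3 := h1 h (hs hh)
    have h4 := hT₀ h hh
    have h5 := norm_add_le ((integralOp μ fun x y => K u h (x, y))
      - integralOp μ fun x y => K₀ h (x, y))
      ((integralOp μ fun x y => K₀ h (x, y)) - integralOp μ fun x y => K₀ 0 (x, y))
    rw [sub_add_sub_cancel] at h5
    linarith
  have hU₀ : ∀ h ∈ ball (0 : ℂ) (min r₀ 1),
      IsUnit (1 - integralOp μ fun x y => K₀ h (x, y)) := fun h hh =>
    (hB _ ((hT₀ h hh).trans (by linarith))).1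
  refine ⟨min r₀ 1, L * n * (B * (L * n)), lt_min hr₀ one_pos, min_le_right _ _, hU₀, ?_, ?_⟩
  · filter_upwards [hnear, hG, hF] with u h1 h2 h3 h hh
    obtain ⟨h4, h5⟩ := hB _ (h1 h hh)
    refine ⟨h4, ?_⟩
    rw [resolventPairing_eq ((h2.1 h (hs hh)).memLp hm)]
    have h6 := norm_pairWith_le hm hn (h2.1 h (hs hh))
    have h7 := norm_vec_le hm hn (h3.1 h (hs hh))
    refine (ContinuousLinearMap.le_opNorm _ _).trans (mul_le_mul h6
      ((ContinuousLinearMap.le_opNorm _ _).trans (mul_le_mul h5 h7 (norm_nonneg _)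
        ((norm_nonneg _).trans h5))) (norm_nonneg _) (by positivity))
  · intro h hh
    have hh1 := hs hh
    rw [resolventPairing_eq ((hG₀.1 h hh1).memLp hm)]
    have e : ∀ᶠ u in l, pairWith μ (G u h) (Ring.inverse (1 - integralOp μ fun x y => K u h (x, y))
        (vec μ (F u h))) = resolventPairing μ (fun x y => K u h (x, y)) (G u h) (F u h) :=
      hG.mono fun u hu => (resolventPairing_eq ((hu.1 h hh1).memLp hm) _ _).symm
    refine Tendsto.congr' e ?_
    have hlim : ∀ {V : Type _} [SeminormedAddCommGroup V] {a : ℝ → V} {b : V} {C : ℝ},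
        (∀ᶠ u in l, ‖a u - b‖ ≤ C * |ε u|) → Tendsto a l (𝓝 b) := fun {V _ a b C} hab => by
      refine tendsto_iff_norm_sub_tendsto_zero.mpr (squeeze_zero' (.of_forall fun _ =>
        norm_nonneg _) hab ?_)
      have := hε.abs.const_mul C
      rwa [abs_zero, mul_zero] at this
    have tK : Tendsto (fun u => integralOp μ fun x y => K u h (x, y)) l
        (𝓝 (integralOp μ fun x y => K₀ h (x, y))) := hlim (hdiff.mono fun u hu => hu h hh1)
    have tG : Tendsto (fun u => pairWith μ (G u h)) l (𝓝 (pairWith μ (G₀ h))) := by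
      refine hlim (C := L) ?_
      filter_upwards [hG, hGε] with u h1 h2
      rw [← pairWith_sub ((h1.1 h hh1).memLp hm) ((hG₀.1 h hh1).memLp hm)]
      exact norm_pairWith_le hm (abs_nonneg _) ⟨(h1.1 h hh1).1.sub (hG₀.1 h hh1).1, fun p =>
        (h2 h hh1 p).trans (mul_le_mul_of_nonneg_right (le_abs_self _) (hm0 _))⟩
    have tF : Tendsto (fun u => vec μ (F u h)) l (𝓝 (vec μ (F₀ h))) := by
      refine hlim (C := L) ?_
      filter_upwards [hF, hFε] with u h1 h2
      rw [← vec_sub ((h1.1 h hh1).memLp hm) ((hF₀.1 h hh1).memLp hm)]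
      exact norm_vec_le hm (abs_nonneg _) ⟨(h1.1 h hh1).1.sub (hF₀.1 h hh1).1, fun p =>
        (h2 h hh1 p).trans (mul_le_mul_of_nonneg_right (le_abs_self _) (hm0 _))⟩
    obtain ⟨x, hx⟩ := hU₀ h hh
    have tI : Tendsto (fun u => Ring.inverse (1 - integralOp μ fun x y => K u h (x, y))) l
        (𝓝 (Ring.inverse (1 - integralOp μ fun x y => K₀ h (x, y)))) := by
      have := NormedRing.inverse_continuousAt x
      rw [hx] at this
      exact this.tendsto.comp (tK.const_sub 1)
    have t1 := (isBoundedBilinearMap_apply (𝕜 := ℂ).continuous.tendsto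
      (Ring.inverse (1 - integralOp μ fun x y => K₀ h (x, y)), vec μ (F₀ h))).comp (tI.prodMk_nhds tF)
    exact (isBoundedBilinearMap_apply (𝕜 := ℂ).continuous.tendsto (pairWith μ (G₀ h), _)).comp
      (tG.prodMk_nhds t1)

end

section
variable {α : Type*} [MeasurableSpace α] {μ : Measure α}

theorem norm_sq_eq_integral (f : Lp ℂ 2 μ) : ‖f‖ ^ 2 = ∫ x, ‖f x‖ ^ 2 ∂μ := by
  have h1 : (inner ℂ f f : ℂ) = ((∫ x, ‖f x‖ ^ 2 ∂μ : ℝ) : ℂ) := by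
    rw [L2.inner_def, ← integral_complex_ofReal]
    simp
  rw [inner_self_eq_norm_sq_to_K] at h1
  exact Complex.ofReal_injective (by rw [← h1]; push_cast; rfl)

theorem tendsto_Lp_of_dominated {m : α → ℝ} (hm : MemLp m 2 μ) {a : ℕ → Lp ℂ 2 μ} {b : Lp ℂ 2 μ}
    (ha : ∀ i, ∀ᵐ x ∂μ, ‖a i x‖ ≤ m x)
    (hl : ∀ᵐ x ∂μ, Tendsto (fun i => a i x) atTop (𝓝 (b x))) : Tendsto a atTop (𝓝 b) := by
  have hb : ∀ᵐ x ∂μ, ‖b x‖ ≤ m x := by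
    filter_upwards [hl, ae_all_iff.mpr ha] with x h1 h2
    exact le_of_tendsto h1.norm (.of_forall h2)
  have h2 : Integrable (fun x => (2 * m x) ^ 2) μ := by
    have := (hm.integrable_sq).const_mul 4
    grind
  have h : Tendsto (fun i => ∫ x, ‖a i x - b x‖ ^ 2 ∂μ) atTop (𝓝 (∫ _x, (0 : ℝ) ∂μ)) := by
    refine tendsto_integral_of_dominated_convergence (fun x => (2 * m x) ^ 2)
      (fun i => ?_) h2 (fun i => ?_) ?_
    · fun_prop
    · filter_upwards [ha i, hb] with x h3 h4
      rw [Real.norm_of_nonneg (by positivity)]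
      have := norm_sub_le (a i x) (b x)
      gcongr
      linarith
    · filter_upwards [hl] with x h3
      have := ((h3.sub_const (b x)).norm).pow 2
      simpa using this
  rw [integral_zero] at h
  refine tendsto_iff_norm_sub_tendsto_zero.mpr ?_
  have h5 : ∀ i, ‖a i - b‖ ^ 2 = ∫ x, ‖a i x - b x‖ ^ 2 ∂μ := fun i => by
    rw [norm_sq_eq_integral]
    refine integral_congr_ae ?_
    filter_upwards [Lp.coeFn_sub (a i) b] with x hx
    rw [hx, Pi.sub_apply]
  simp only [← h5] at h
  have := (Real.continuous_sqrt.tendsto 0).comp h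
  simpa [Function.comp_def] using this

variable [SFinite μ] {m : α → ℝ} {n : ℝ} {k : α → α → ℂ}

theorem KDom.isCompactOperator [MeasurableSpace.CountablyGenerated α] (hk : KDom m n k)
    (hm : MemLp m 2 μ) (hm0 : ∀ p, 0 ≤ m p) (hn : 0 ≤ n) :
    IsCompactOperator (integralOp μ k) := by
  have hK := hk.hasKernel hm hm0 hn
  refine ⟨integralOp μ k '' closedBall 0 1, IsSeqCompact.isCompact ?_,
    mem_of_superset (Metric.closedBall_mem_nhds 0 one_pos) (Set.subset_preimage_image _ _)⟩
  intro y hy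
  choose f hf hfy using hy
  haveI : Fact ((2 : ENNReal) ≠ ⊤) := ⟨ENNReal.ofNat_ne_top⟩
  have hfn : ∀ i, ‖f i‖ ≤ 1 := fun i => by simpa using hf i
  obtain ⟨ℓ, hℓ, ψ, hψ, hlim⟩ := WeakDual.isSeqCompact_closedBall ℂ (Lp ℂ 2 μ) 0 1
    (x := fun i => StrongDual.toWeakDual (innerSL ℂ (f i))) fun i => by
      show innerSL ℂ (f i) ∈ closedBall 0 1
      rw [mem_closedBall_zero_iff, innerSL_apply_norm]
      exact hfn i
  let ℓ' : StrongDual ℂ (Lp ℂ 2 μ) := WeakDual.toStrongDual ℓ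
  have hℓ' : ‖ℓ'‖ ≤ 1 := by
    have : ℓ' ∈ closedBall 0 1 := hℓ
    rwa [mem_closedBall_zero_iff] at this
  let f₀ := (InnerProductSpace.toDual ℂ (Lp ℂ 2 μ)).symm ℓ'
  have hw : ∀ φ, Tendsto (fun i => inner ℂ (f (ψ i)) φ) atTop (𝓝 (inner ℂ f₀ φ)) := fun φ => by
    have h1 := ((WeakDual.eval_continuous φ).tendsto ℓ).comp hlim
    have h2 : (inner ℂ f₀ φ : ℂ) = ℓ φ := InnerProductSpace.toDual_symm_apply
    rw [h2]
    exact h1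
  refine ⟨integralOp μ k f₀, ⟨f₀, ?_, rfl⟩, ψ, hψ, ?_⟩
  · rw [mem_closedBall_zero_iff, LinearIsometryEquiv.norm_map]
    exact hℓ'
  refine tendsto_Lp_of_dominated (hm.const_mul (‖hm.toLp m‖ * n)) (fun i => ?_) ?_
  · filter_upwards [(hK (f (ψ i))).2] with x hx
    rw [Function.comp, ← hfy, hx]
    refine (hk.norm_integral_le hm hm0 hn _ x).trans ?_
    have := hfn (ψ i)
    have h0 := hm0 x
    calc _ ≤ ‖hm.toLp m‖ * n * 1 * m x := by gcongr
      _ = _ := by ring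
  · have h1 : ∀ᵐ x ∂μ, ∀ i, y (ψ i) x = ∫ y, k x y * f (ψ i) y ∂μ := ae_all_iff.mpr fun i => by
      rw [← hfy]
      exact (hK (f (ψ i))).2
    filter_upwards [h1, (hK f₀).2] with x h2 h3
    rw [h3]
    have hx : MemLp (k x) 2 μ := (hk.row x).memLp hm
    have e : ∀ g : Lp ℂ 2 μ, ∫ y, k x y * g y ∂μ = conj (inner ℂ g (hx.star.toLp (star (k x)))) :=
      fun g => by
        rw [← pairWith_apply hx, pairWith, dif_pos hx, innerSL_apply_apply, inner_conj_symm]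
    simp only [Function.comp, h2, e]
    exact (continuous_conj.tendsto _).comp (hw _)

/-- The Fredholm alternative. -/
theorem KDom.isUnit_of_injective [MeasurableSpace.CountablyGenerated α] (hk : KDom m n k)
    (hm : MemLp m 2 μ) (hm0 : ∀ p, 0 ≤ m p) (hn : 0 ≤ n)
    (h : ∀ φ : Lp ℂ 2 μ, (∀ᵐ x ∂μ, φ x = ∫ y, k x y * φ y ∂μ) → φ = 0) :
    IsUnit (1 - integralOp μ k) := by
  have hK := hk.hasKernel hm hm0 hn
  rcases (hk.isCompactOperator hm hm0 hn).hasEigenvalue_or_mem_resolventSet (μ := (1 : ℂ))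
    one_ne_zero with h1 | h1
  · obtain ⟨φ, hφ⟩ := h1.exists_hasEigenvector
    have h2 : integralOp μ k φ = φ := by simpa using hφ.apply_eq_smul
    refine absurd (h φ ?_) hφ.2
    filter_upwards [(hK φ).2] with x hx
    rw [← hx, h2]
  · have := spectrum.mem_resolventSet_iff.mp h1
    simpa using this

theorem resolventApply_solves (hK : HasKernel μ k (integralOp μ k))
    (hU : IsUnit (1 - integralOp μ k)) {h : α → ℂ} (hh : MemLp h 2 μ) :
    ∀ᵐ x ∂μ, resolventApply μ k h x = h x + ∫ y, k x y * resolventApply μ k h y ∂μ := by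
  set φ := resolventApply μ k h with hφ
  have h1 : φ = vec μ h + integralOp μ k φ := by
    have h2 : (1 - integralOp μ k) (Ring.inverse (1 - integralOp μ k) (vec μ h)) = vec μ h := by
      rw [← ContinuousLinearMap.mul_apply, Ring.mul_inverse_cancel _ hU,
        ContinuousLinearMap.one_apply]
    rw [← resolventApply_eq, ← hφ] at h2
    rw [← h2, ContinuousLinearMap.sub_apply, ContinuousLinearMap.one_apply, sub_add_cancel]
  have h3 : ⇑φ = ⇑(vec μ h + integralOp μ k φ) := by rw [← h1]
  have h4 : vec μ h = hh.toLp h := by rw [vec, dif_pos hh]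
  filter_upwards [(hK φ).2, Lp.coeFn_add (vec μ h) (integralOp μ k φ), hh.coeFn_toLp] with x h5 h6 h7
  rw [← h5, congrFun h3 x, h6, Pi.add_apply, h4, h7]

theorem resolventApply_ae_eq (hK : HasKernel μ k (integralOp μ k))
    (hU : IsUnit (1 - integralOp μ k)) {h f : α → ℂ} (hh : MemLp h 2 μ) (hf : MemLp f 2 μ)
    (hs : ∀ᵐ x ∂μ, f x = h x + ∫ y, k x y * f y ∂μ) : ⇑(resolventApply μ k h) =ᵐ[μ] f := by
  have h1 : vec μ h = (1 - integralOp μ k) (hf.toLp f) := by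
    rw [vec, dif_pos hh, ContinuousLinearMap.sub_apply, ContinuousLinearMap.one_apply]
    refine Lp.ext ?_
    filter_upwards [Lp.coeFn_sub (hf.toLp f) (integralOp μ k (hf.toLp f)), (hK (hf.toLp f)).2,
      hf.coeFn_toLp, hh.coeFn_toLp, hs] with x h2 h3 h4 h5 h6
    rw [h5, h2, Pi.sub_apply, h3, h4, h6, add_sub_assoc, left_eq_add, sub_eq_zero]
    refine integral_congr_ae ?_
    filter_upwards [hf.coeFn_toLp] with y hy
    rw [hy]
  rw [resolventApply_eq, h1, ← ContinuousLinearMap.mul_apply, Ring.inverse_mul_cancel _ hU,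
    ContinuousLinearMap.one_apply]
  exact hf.coeFn_toLp

end

section
variable {α β : Type*} [MeasurableSpace α] [MeasurableSpace β] {μ : Measure α} {ν : Measure β}
  [SFinite μ] [SFinite ν] {m : α → ℝ} {n : ℝ}

theorem resolventPairing_add {k : α → α → ℂ} {g h h' : α → ℂ} (hg : MemLp g 2 μ)
    (hh : MemLp h 2 μ) (hh' : MemLp h' 2 μ) : resolventPairing μ k g (h + h')
      = resolventPairing μ k g h + resolventPairing μ k g h' := by
  have : vec μ (h + h') = vec μ h + vec μ h' := by
    rw [vec, vec, vec, dif_pos hh, dif_pos hh', dif_pos (hh.add hh'), MemLp.toLp_add]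
  rw [resolventPairing_eq hg, resolventPairing_eq hg, resolventPairing_eq hg, this, map_add,
    map_add]

theorem resolventPairing_smul {k : α → α → ℂ} {g h : α → ℂ} (hg : MemLp g 2 μ)
    (hh : MemLp h 2 μ) (c : ℂ) : resolventPairing μ k g (c • h)
      = c * resolventPairing μ k g h := by
  rw [resolventPairing_eq hg, resolventPairing_eq hg, vec_smul hh, map_smul, map_smul, smul_eq_mul]

/-- Resolvents of kernels that are related by a measure preserving equivalence and a conjugation
by a function that is bounded above and below. -/
theorem resolvent_transfer [MeasurableSpace.CountablyGenerated β] (e : α ≃ᵐ β)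
    (he : MeasurePreserving e μ ν) {c : α → ℂ} (hc : Measurable c) {a b : ℝ} (ha : 0 < a) (hb : 0 ≤ b)
    (hac : ∀ p, a ≤ ‖c p‖) (hcb : ∀ p, ‖c p‖ ≤ b) {k : β → β → ℂ} {k' : α → α → ℂ}
    (hkk : ∀ p q, k' p q = c p * k (e p) (e q) * (c q)⁻¹) (hk' : KDom m n k') (hm : MemLp m 2 μ)
    (hm0 : ∀ p, 0 ≤ m p) (hn : 0 ≤ n) (hU : IsUnit (1 - integralOp μ k'))
    {g h : β → ℂ} {g' h' : α → ℂ} (hg : ∀ p, g' p = g (e p) * (c p)⁻¹)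
    (hh : h' =ᵐ[μ] fun p => c p * h (e p)) (hgL : MemLp g' 2 μ) (hhL : MemLp h' 2 μ) :
    ResolventPairingDefined ν k g h ∧
      resolventPairing ν k g h = resolventPairing μ k' g' h' := by
  have hes := he.symm e
  have hc0 : ∀ p, c p ≠ 0 := fun p => norm_pos_iff.mp (ha.trans_le (hac p))
  have hK' := hk'.hasKernel hm hm0 hn
  have hk : KDom (m ∘ e.symm) (b * n / a) k := by
    constructor
    · have h1 : Measurable fun p : α × α => (c p.1)⁻¹ * k' p.1 p.2 * c p.2 :=
        ((hc.comp measurable_fst).inv.mul hk'.1).mul (hc.comp measurable_snd)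
      have h2 := h1.comp (e.symm.measurable.prodMap e.symm.measurable)
      convert h2 using 1
      ext p
      simp only [Function.comp, Prod.map, hkk, MeasurableEquiv.apply_symm_apply]
      grind
    · intro p
      have h1 : k p.1 p.2 = (c (e.symm p.1))⁻¹ * k' (e.symm p.1) (e.symm p.2) * c (e.symm p.2) := by
        rw [hkk, MeasurableEquiv.apply_symm_apply, MeasurableEquiv.apply_symm_apply]
        grind
      beta_reduce
      rw [h1, norm_mul, norm_mul, norm_inv]
      have h2 := hk'.2 (e.symm p.1, e.symm p.2)
      have h3 : ‖c (e.symm p.1)‖⁻¹ ≤ a⁻¹ := inv_anti₀ ha (hac _)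
      have h4 := hcb (e.symm p.2)
      have h5 := hm0 (e.symm p.1)
      have h6 := hm0 (e.symm p.2)
      calc _ ≤ a⁻¹ * (n * (m (e.symm p.1) * m (e.symm p.2))) * b := by gcongr
        _ = _ := by simp only [Function.comp]; field_simp
  have hmβ : MemLp (m ∘ e.symm) 2 ν := hm.comp_measurePreserving hes
  have hmβ0 : ∀ p, 0 ≤ (m ∘ e.symm) p := fun p => hm0 _
  have hnβ : 0 ≤ b * n / a := by positivity
  have hK := hk.hasKernel hmβ hmβ0 hnβ
  have hcomp : ∀ F : β → ℂ, ∫ y, F y ∂ν = ∫ q, F (e q) ∂μ := fun F =>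
    (he.integral_comp' F).symm
  have hbd : ∀ f : α → ℂ, MemLp f 2 μ → MemLp (fun p => c p * f p) 2 μ := fun f hf =>
    (hf.norm.const_mul b).mono' (hc.aestronglyMeasurable.mul hf.1) (.of_forall fun p => by
      rw [norm_mul]
      exact mul_le_mul_of_nonneg_right (hcb p) (norm_nonneg _))
  have hbd' : ∀ f : α → ℂ, MemLp f 2 μ → MemLp (fun p => (c p)⁻¹ * f p) 2 μ := fun f hf =>
    (hf.norm.const_mul a⁻¹).mono' (hc.inv.aestronglyMeasurable.mul hf.1)
      (.of_forall fun p => by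
        rw [norm_mul, norm_inv]
        exact mul_le_mul_of_nonneg_right (inv_anti₀ ha (hac p)) (norm_nonneg _))
  have hkint : ∀ (f : β → ℂ) (p : α), ∫ q, k' p q * (c q * f (e q)) ∂μ
      = c p * ∫ y, k (e p) y * f y ∂ν := fun f p => by
    rw [hcomp, ← integral_const_mul (c p)]
    congr 1 with q
    rw [hkk]
    have := hc0 q
    field_simp
  have hUβ : IsUnit (1 - integralOp ν k) := by
    refine hk.isUnit_of_injective hmβ hmβ0 hnβ fun φ hφ => ?_
    have h1 : MemLp (fun p => c p * φ (e p)) 2 μ :=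
      hbd _ ((Lp.memLp φ).comp_measurePreserving he)
    have h2 := resolventApply_ae_eq hK' hU (h := 0) (MemLp.zero' (p := 2)) h1 (by
      filter_upwards [he.quasiMeasurePreserving.ae hφ] with p hp
      rw [hkint, Pi.zero_apply, zero_add, ← hp])
    have h3 : resolventApply μ k' 0 = 0 := by
      have : vec μ (0 : α → ℂ) = 0 := by
        have h0 := vec_smul (μ := μ) (f := 0) (MemLp.zero' (p := 2)) 0
        rwa [smul_zero, zero_smul] at h0
      rw [resolventApply_eq, this, map_zero]
    rw [h3] at h2
    have h4 : ∀ᵐ p ∂μ, φ (e p) = 0 := by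
      filter_upwards [h2, Lp.coeFn_zero ℂ 2 μ] with p h5 h6
      rw [h6, Pi.zero_apply] at h5
      exact (mul_eq_zero.mp h5.symm).resolve_left (hc0 p)
    refine Lp.ext ?_
    filter_upwards [hes.quasiMeasurePreserving.ae h4, Lp.coeFn_zero ℂ 2 ν] with y h5 h6
    rw [h6, Pi.zero_apply, ← h5, MeasurableEquiv.apply_symm_apply]
  set f' := resolventApply μ k' h' with hf'
  let f : β → ℂ := fun y => (c (e.symm y))⁻¹ * f' (e.symm y)
  have hfL : MemLp f 2 ν := (hbd' _ (Lp.memLp f')).comp_measurePreserving hes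
  have hhβ : MemLp h 2 ν := by
    have h1 := (hbd' _ (hhL.ae_eq hh)).comp_measurePreserving hes
    refine h1.ae_eq (.of_forall fun y => ?_)
    simp only [Function.comp, MeasurableEquiv.apply_symm_apply]
    rw [inv_mul_cancel_left₀ (hc0 _)]
  have hfe : ∀ q, c q * f (e q) = f' q := fun q => by
    simp only [f, MeasurableEquiv.symm_apply_apply]
    rw [mul_inv_cancel_left₀ (hc0 _)]
  have hsol : ∀ᵐ y ∂ν, f y = h y + ∫ z, k y z * f z ∂ν := by
    have h1 := resolventApply_solves hK' hU hhL
    have h2 : ∀ᵐ p ∂μ, f (e p) = h (e p) + ∫ z, k (e p) z * f z ∂ν := by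
      filter_upwards [h1, hh] with p h3 h4
      have h5 := hkint f p
      simp only [hfe] at h5
      rw [← hf', h4, h5, ← mul_add, ← hfe] at h3
      exact mul_left_cancel₀ (hc0 p) h3
    filter_upwards [hes.quasiMeasurePreserving.ae h2] with y h3
    simpa only [MeasurableEquiv.apply_symm_apply] using h3
  have hae := resolventApply_ae_eq hK hUβ hhβ hfL hsol
  have hgf : ∀ p, g (e p) * f (e p) = g' p * f' p := fun p => by
    rw [hg, ← hfe, mul_assoc, inv_mul_cancel_left₀ (hc0 p)]
  refine ⟨⟨⟨_, hK⟩, hUβ, hhβ, ?_⟩, ?_⟩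
  · have h1 : Integrable (fun y => g y * f y) ν := by
      rw [← he.integrable_comp_emb e.measurableEmbedding]
      refine (integrable_mul_of_memLp hgL (Lp.memLp f')).congr (.of_forall fun p => ?_)
      exact (hgf p).symm
    refine h1.congr ?_
    filter_upwards [hae] with y hy
    rw [hy]
  · rw [resolventPairing, resolventPairing]
    have h1 : ∫ y, g y * resolventApply ν k h y ∂ν = ∫ y, g y * f y ∂ν := by
      refine integral_congr_ae ?_
      filter_upwards [hae] with y hy
      rw [hy]
    rw [h1, hcomp]
    exact integral_congr_ae (.of_forall hgf)

/-- For an antisymmetric kernel `N` and the associated kernel `J⁻¹ N`, the pairing of a row `g` with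
the column `J⁻¹ g` vanishes. -/
theorem resolventPairing_antisymm (b : α ≃ᵐ α) (hb : MeasurePreserving b μ μ)
    (hbb : ∀ p, b (b p) = p) {ε : α → ℂ} (hε : Measurable ε) (hε1 : ∀ p, ε p * ε p = 1)
    (hεb : ∀ p, ε (b p) = -ε p)
    {N k' : α → α → ℂ} (hN : KDom m n N) (hk' : KDom m n k') (hm : MemLp m 2 μ)
    (hm0 : ∀ p, 0 ≤ m p) (hn : 0 ≤ n)
    (hanti : ∀ p q, N q p = -N p q) (hk : ∀ p q, k' p q = -ε p * N (b p) q)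
    (hU : IsUnit (1 - integralOp μ k')) {g : α → ℂ} (hg : MemLp g 2 μ) :
    MemLp (fun p => -ε p * g (b p)) 2 μ ∧
      resolventPairing μ k' g (fun p => -ε p * g (b p)) = 0 := by
  have hgb : MemLp (fun p => -ε p * g (b p)) 2 μ := by
    have h1 := hg.comp_measurePreserving hb
    refine h1.norm.mono' (hε.neg.aestronglyMeasurable.mul h1.1) (.of_forall fun p => ?_)
    have h2 : ‖ε p‖ = 1 := by
      have := congrArg norm (hε1 p)
      rw [norm_mul, norm_one] at this
      nlinarith [norm_nonneg (ε p)]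
    rw [norm_mul, norm_neg, h2, one_mul]
    rfl
  refine ⟨hgb, ?_⟩
  rw [resolventPairing]
  set φ := resolventApply μ k' (fun p => -ε p * g (b p)) with hφ
  have hs := resolventApply_solves (hk'.hasKernel hm hm0 hn) hU hgb
  rw [← hφ] at hs
  have hφL := Lp.memLp φ
  have h1 : ∀ᵐ p ∂μ, g p * φ p = ε p * φ (b p) * φ p - ∫ q, φ p * N p q * φ q ∂μ := by
    filter_upwards [hb.quasiMeasurePreserving.ae hs] with p hp
    have e1 : ∫ q, k' (b p) q * φ q ∂μ = ε p * ∫ q, N p q * φ q ∂μ := by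
      rw [← integral_const_mul (ε p)]
      grind
    have e2 : ∫ q, φ p * N p q * φ q ∂μ = φ p * ∫ q, N p q * φ q ∂μ := by
      rw [← integral_const_mul (φ p)]
      simp only [mul_assoc]
    grind
  have hi1 : Integrable (fun p => ε p * φ (b p) * φ p) μ := by
    refine integrable_mul_of_memLp ?_ hφL
    have h2 := hφL.comp_measurePreserving hb
    refine h2.norm.mono' (hε.aestronglyMeasurable.mul h2.1) (.of_forall fun p => ?_)
    have h2 : ‖ε p‖ = 1 := by
      have := congrArg norm (hε1 p)
      rw [norm_mul, norm_one] at this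
      nlinarith [norm_nonneg (ε p)]
    rw [norm_mul, h2, one_mul]
    rfl
  have hmφ : Integrable (fun p => m p * ‖φ p‖) μ := hm.integrable_mul (p := 2) (q := 2) hφL.norm
  have hi2 : Integrable (fun p : α × α => φ p.1 * N p.1 p.2 * φ p.2) (μ.prod μ) := by
    refine ((hmφ.mul_prod hmφ).const_mul n).mono' ?_ (.of_forall fun p => ?_)
    · exact ((Lp.aestronglyMeasurable φ).comp_fst.mul hN.1.aestronglyMeasurable).mul
        (Lp.aestronglyMeasurable φ).comp_snd
    · rw [norm_mul, norm_mul]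
      have := hN.2 p
      calc _ ≤ ‖φ p.1‖ * (n * (m p.1 * m p.2)) * ‖φ p.2‖ := by gcongr
        _ = _ := by ring
  rw [integral_congr_ae h1, integral_sub hi1 hi2.integral_prod_left]
  have z1 : ∫ p, ε p * φ (b p) * φ p ∂μ = 0 := by
    have := hb.integral_comp' (fun p => ε p * φ (b p) * φ p)
    have e : ∀ p, ε (b p) * φ (b (b p)) * φ (b p) = -(ε p * φ (b p) * φ p) := fun p => by
      rw [hεb, hbb]; ring
    simp only [e] at this
    rw [integral_neg] at this
    exact self_eq_neg.mp this.symm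
  have z2 : ∫ p, ∫ q, φ p * N p q * φ q ∂μ ∂μ = 0 := by
    have := integral_integral_swap (f := fun p q => φ p * N p q * φ q) hi2
    have e : ∀ p q, φ q * N q p * φ p = -(φ p * N p q * φ q) := fun p q => by
      rw [hanti]; ring
    have e2 : ∫ y, ∫ x, φ x * N x y * φ y ∂μ ∂μ = -∫ y, ∫ x, φ y * N y x * φ x ∂μ ∂μ := by
      rw [← integral_neg]
      congr 1 with y
      rw [← integral_neg]
      grind
    grind
  rw [z1, z2, sub_zero]

end

/-! ### Laplace type integrals -/

section
variable {α : Type*} [MeasurableSpace α] {ν : Measure α} {z w c : α → ℂ} {a b : ℝ}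

/-- A two-variable Laplace type integral. -/
def lap (ν : Measure α) (z w c : α → ℂ) (x y : ℂ) : ℂ :=
  ∫ p, cexp (-(x * z p) + y * w p) * c p ∂ν

/-- A bound for shifted Laplace type integrals. -/
def lapN (ν : Measure α) (z w c : α → ℂ) : ℝ := ∫ p, rexp (‖z p‖ + ‖w p‖) * ‖c p‖ ∂ν

theorem norm_lap_integrand_le (hz : ∀ p, (z p).re = a) (hw : ∀ p, (w p).re = -b) {h : ℂ}
    (hh : ‖h‖ ≤ 1) (x y : ℝ) (p : α) : ‖cexp (-((x + h) * z p) + (y + h) * w p) * c p‖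
      ≤ rexp (-(a * x) - b * y) * (rexp (‖z p‖ + ‖w p‖) * ‖c p‖) := by
  rw [norm_mul, ← mul_assoc, ← Real.exp_add, Complex.norm_exp]
  refine mul_le_mul_of_nonneg_right (Real.exp_le_exp.mpr ?_) (norm_nonneg _)
  have e : (-((x + h) * z p) + (y + h) * w p).re
      = -(a * x) - b * y + (h * (w p - z p)).re := by
    rw [show -((x + h) * z p) + (y + h) * w p = -(x * z p) + y * w p + h * (w p - z p) by ring,
      add_re, add_re, neg_re, re_ofReal_mul, re_ofReal_mul, hz, hw]
    ring
  rw [e]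
  have h1 := (re_le_norm (h * (w p - z p)))
  rw [norm_mul] at h1
  have h2 : ‖h‖ * ‖w p - z p‖ ≤ 1 * ‖w p - z p‖ := by gcongr
  have h3 := norm_sub_le (w p) (z p)
  linarith

theorem norm_lap_le (hz : ∀ p, (z p).re = a) (hw : ∀ p, (w p).re = -b)
    (hi : Integrable (fun p => rexp (‖z p‖ + ‖w p‖) * ‖c p‖) ν) {h : ℂ} (hh : ‖h‖ ≤ 1)
    (x y : ℝ) : ‖lap ν z w c (x + h) (y + h)‖ ≤ rexp (-(a * x) - b * y) * lapN ν z w c := by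
  rw [lapN, ← integral_const_mul]
  exact norm_integral_le_of_norm_le (hi.const_mul _)
    (.of_forall (norm_lap_integrand_le hz hw hh x y))

theorem integrable_lap (hzm : Measurable z) (hwm : Measurable w) (hc : Measurable c)
    (hz : ∀ p, (z p).re = a) (hw : ∀ p, (w p).re = -b)
    (hi : Integrable (fun p => rexp (‖z p‖ + ‖w p‖) * ‖c p‖) ν) {h : ℂ} (hh : ‖h‖ ≤ 1)
    (x y : ℝ) : Integrable (fun p => cexp (-((x + h) * z p) + (y + h) * w p) * c p) ν :=
  (hi.const_mul _).mono' (by fun_prop) (.of_forall (norm_lap_integrand_le hz hw hh x y))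

theorem differentiableOn_lap (hzm : Measurable z) (hwm : Measurable w) (hc : Measurable c)
    (hz : ∀ p, (z p).re = a) (hw : ∀ p, (w p).re = -b)
    (hi : Integrable (fun p => rexp (‖z p‖ + ‖w p‖) * ‖c p‖) ν) (x y : ℝ) :
    DifferentiableOn ℂ (fun h => lap ν z w c (x + h) (y + h)) (ball 0 1) :=
  differentiableOn_integral_of_bound (fun h _ => by fun_prop)
    (.of_forall fun p => by fun_prop)
    (.of_forall fun p h hh => norm_lap_integrand_le hz hw
      (mem_ball_zero_iff.mp hh).le x y p) (hi.const_mul _)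

theorem measurable_lap [SFinite ν] (hzm : Measurable z) (hwm : Measurable w) (hc : Measurable c)
    (h : ℂ) : Measurable fun q : ℝ × ℝ => lap ν z w c (q.1 + h) (q.2 + h) := by
  have : Measurable fun q : (ℝ × ℝ) × α =>
      cexp (-((q.1.1 + h) * z q.2) + (q.1.2 + h) * w q.2) * c q.2 := by fun_prop
  exact this.stronglyMeasurable.integral_prod_right'.measurable

end

/-! ### Complex shifts of the kernels -/

section
variable {τ : ℝ} {R Q : ℂ → ℂ → ℂ} {r q : ℂ → ℂ} {N N' : ℝ}

/-- The vertical line of integration. -/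
def lineZ (τ t : ℝ) : ℂ := lineA τ + t * I

theorem lineZ_re (τ t : ℝ) : (lineZ τ t).re = lineA τ := by simp [lineZ]

@[fun_prop]
theorem measurable_lineZ (τ : ℝ) : Measurable (lineZ τ) := by unfold lineZ; fun_prop

/-- The weight of the vertical line. -/
def gw (τ t : ℝ) : ℝ := ‖aexp ((τ ^ 2 : ℝ)) (lineZ τ t)‖ * rexp (2 * ‖lineZ τ t‖)

theorem integrable_gw (τ : ℝ) : Integrable (gw τ) := by
  obtain ⟨C, ε, hC, hε, h⟩ := aexp_line_bound (τ ^ 2) (lineA_pos τ)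
  have h1 := (integrable_exp_neg_mul_sq (half_pos hε)).const_mul
    (C * rexp (2 * lineA τ + 2 / ε))
  refine h1.mono' ?_ (.of_forall fun t => ?_)
  · unfold gw aexp
    fun_prop
  · have h0 : 0 ≤ gw τ t := by unfold gw; positivity
    rw [Real.norm_of_nonneg h0, gw]
    have h2 : ‖lineZ τ t‖ ≤ lineA τ + |t| := by
      refine (norm_add_le _ _).trans (le_of_eq ?_)
      simp [abs_of_pos (lineA_pos τ)]
    have h3 : 2 * |t| ≤ 2 / ε + ε / 2 * t ^ 2 := by
      have h4 : 0 ≤ (ε * |t| - 2) ^ 2 / (2 * ε) := by positivity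
      have h5 : (ε * |t| - 2) ^ 2 / (2 * ε) = ε / 2 * |t| ^ 2 - 2 * |t| + 2 / ε := by
        field_simp
        ring
      rw [sq_abs] at h5
      linarith
    calc _ ≤ C * rexp (-ε * t ^ 2) * rexp (2 * ‖lineZ τ t‖) := by
          gcongr
          exact h t
      _ ≤ C * rexp (-ε * t ^ 2) * rexp (2 * lineA τ + (2 / ε + ε / 2 * t ^ 2)) := by
          gcongr
          linarith
      _ = _ := by
        rw [mul_assoc, mul_assoc, ← Real.exp_add, ← Real.exp_add]
        ring_nf

/-- A bound for the kernels. -/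
def gW (τ : ℝ) : ℝ := max 1 (∫ t, gw τ t)

theorem gW_pos (τ : ℝ) : 0 < gW τ := lt_max_of_lt_left one_pos

/-- `R` is measurable and bounded by `N (1 + |z|) (1 + |w|)` on the lines. -/
def LL (τ N : ℝ) (R : ℂ → ℂ → ℂ) : Prop :=
  (Measurable fun p : ℂ × ℂ => R p.1 p.2) ∧ ∀ z w : ℂ, z.re = lineA τ → w.re = -lineA τ →
    ‖R z w‖ ≤ N * ((1 + ‖z‖) * (1 + ‖w‖))

/-- `r` is measurable and bounded by `N (1 + |z|)` on the line. -/
def L1 (τ N : ℝ) (r : ℂ → ℂ) : Prop :=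
  Measurable r ∧ ∀ z : ℂ, z.re = lineA τ → ‖r z‖ ≤ N * (1 + ‖z‖)

/-- The kernel `kk` at complex arguments. -/
def kkC (τ : ℝ) (R : ℂ → ℂ → ℂ) : ℂ → ℂ → ℂ :=
  lap (volume : Measure (ℝ × ℝ)) (fun p => lineZ τ p.1) (fun p => -lineZ τ p.2) fun p =>
    (2 * π : ℂ)⁻¹ * (2 * π : ℂ)⁻¹ * (aexp (τ ^ 2 : ℝ) (lineZ τ p.1)
      * aexp (τ ^ 2 : ℝ) (lineZ τ p.2) * R (lineZ τ p.1) (-lineZ τ p.2))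

/-- The function `vv` at complex arguments. -/
def vvC (τ : ℝ) (r : ℂ → ℂ) (x : ℂ) : ℂ :=
  lap volume (lineZ τ) 0 (fun t => (2 * π : ℂ)⁻¹ * (aexp (τ ^ 2 : ℝ) (lineZ τ t)
    * r (lineZ τ t))) x x

theorem aexp_add (x y z : ℂ) : aexp (x + y) z = cexp (-(x * z)) * aexp y z := by
  rw [aexp, aexp, ← Complex.exp_add]
  ring_nf

theorem kk_eq (τ : ℝ) (R : ℂ → ℂ → ℂ) (x y : ℝ) : kk τ R x y = kkC τ R x y := by
  have h := ((MeasurePreserving.id (volume : Measure ℝ)).prod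
    (Measure.measurePreserving_neg (volume : Measure ℝ))).integral_comp
    ((MeasurableEquiv.refl ℝ).prodCongr (MeasurableEquiv.neg ℝ)).measurableEmbedding
    (fun p : ℝ × ℝ => aexp ((x + τ ^ 2 : ℝ)) ((lineA τ : ℝ) + p.1 * I)
      * aexp ((y + τ ^ 2 : ℝ)) (-((-lineA τ : ℝ) + p.2 * I))
      * R ((lineA τ : ℝ) + p.1 * I) ((-lineA τ : ℝ) + p.2 * I))
  rw [kk, vl2, kkC, lap, Measure.volume_eq_prod, ← h, ← integral_const_mul, ← integral_const_mul]
  congr 1 with t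
  have e : ((-lineA τ : ℝ) : ℂ) + ((-t.2 : ℝ) : ℂ) * I = -lineZ τ t.2 := by
    rw [lineZ]; push_cast; ring
  have e2 : ((lineA τ : ℝ) : ℂ) + (t.1 : ℂ) * I = lineZ τ t.1 := rfl
  simp only [Prod.map, id, e, neg_neg, e2]
  push_cast
  rw [aexp_add, aexp_add, mul_neg, ← sub_eq_add_neg, Complex.exp_sub, Complex.exp_neg (y * lineZ τ t.2)]
  rw [div_eq_mul_inv]
  ring

theorem vv_eq (τ : ℝ) (r : ℂ → ℂ) (x : ℝ) : vv τ r x = vvC τ r x := by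
  rw [vv, vl, vvC, lap, ← integral_const_mul]
  congr 1 with t
  simp only [lineZ, Pi.zero_apply, mul_zero, add_zero]
  push_cast
  rw [aexp_add]
  ring

theorem one_add_le_exp_norm (z : ℂ) : 1 + ‖z‖ ≤ rexp ‖z‖ := by
  linarith [Real.add_one_le_exp ‖z‖]

theorem norm_inv_two_pi_le : ‖(2 * π : ℂ)⁻¹‖ ≤ 1 := by
  rw [norm_inv, norm_mul, Complex.norm_of_nonneg Real.pi_pos.le]
  refine inv_le_one_of_one_le₀ ?_
  have := Real.pi_gt_three
  simp
  linarith

theorem LL.integrand_le (h : LL τ N R) (p : ℝ × ℝ) :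
    rexp (‖lineZ τ p.1‖ + ‖-lineZ τ p.2‖) * ‖(2 * π : ℂ)⁻¹ * (2 * π : ℂ)⁻¹
      * (aexp (τ ^ 2 : ℝ) (lineZ τ p.1) * aexp (τ ^ 2 : ℝ) (lineZ τ p.2)
        * R (lineZ τ p.1) (-lineZ τ p.2))‖ ≤ N * (gw τ p.1 * gw τ p.2) := by
  have h1 := h.2 (lineZ τ p.1) (-lineZ τ p.2) (lineZ_re τ _) (by rw [neg_re, lineZ_re])
  have h2 := one_add_le_exp_norm (lineZ τ p.1)
  have h3 := one_add_le_exp_norm (lineZ τ p.2)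
  have hN : 0 ≤ N := by
    by_contra hN
    have : N * ((1 + ‖lineZ τ p.1‖) * (1 + ‖-lineZ τ p.2‖)) < 0 :=
      mul_neg_of_neg_of_pos (not_le.mp hN) (by positivity)
    linarith [norm_nonneg (R (lineZ τ p.1) (-lineZ τ p.2))]
  rw [norm_neg] at h1 ⊢
  rw [norm_mul, norm_mul, norm_mul, norm_mul, Real.exp_add, gw, gw]
  have h4 := norm_inv_two_pi_le
  set X := rexp ‖lineZ τ p.1‖
  set Y := rexp ‖lineZ τ p.2‖
  have e1 : rexp (2 * ‖lineZ τ p.1‖) = X * X := by rw [← Real.exp_add]; ring_nf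
  have e2 : rexp (2 * ‖lineZ τ p.2‖) = Y * Y := by rw [← Real.exp_add]; ring_nf
  rw [e1, e2]
  have hX : 0 < X := Real.exp_pos _
  have hY : 0 < Y := Real.exp_pos _
  calc _ ≤ X * Y * (1 * 1 * (‖aexp (τ ^ 2 : ℝ) (lineZ τ p.1)‖ * ‖aexp (τ ^ 2 : ℝ) (lineZ τ p.2)‖
        * (N * (X * Y)))) := by
        gcongr
        exact h1.trans (by gcongr)
    _ = _ := by ring

theorem LL.measurable (h : LL τ N R) : Measurable fun p : ℝ × ℝ =>
    (2 * π : ℂ)⁻¹ * (2 * π : ℂ)⁻¹ * (aexp (τ ^ 2 : ℝ) (lineZ τ p.1)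
      * aexp (τ ^ 2 : ℝ) (lineZ τ p.2) * R (lineZ τ p.1) (-lineZ τ p.2)) := by
  have h1 := h.1.comp (f := fun p : ℝ × ℝ => (lineZ τ p.1, -lineZ τ p.2)) (by fun_prop)
  unfold aexp
  exact Measurable.const_mul (Measurable.mul (by fun_prop) h1) _

theorem LL.integrable (h : LL τ N R) : Integrable (fun p : ℝ × ℝ =>
    rexp (‖lineZ τ p.1‖ + ‖-lineZ τ p.2‖) * ‖(2 * π : ℂ)⁻¹ * (2 * π : ℂ)⁻¹
      * (aexp (τ ^ 2 : ℝ) (lineZ τ p.1) * aexp (τ ^ 2 : ℝ) (lineZ τ p.2)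
        * R (lineZ τ p.1) (-lineZ τ p.2))‖) := by
  refine (((integrable_gw τ).mul_prod (integrable_gw τ)).const_mul N).mono' ?_
    (.of_forall fun p => ?_)
  · have := h.measurable
    fun_prop
  · rw [Real.norm_of_nonneg (by positivity)]
    exact h.integrand_le p

theorem LL.norm_kkC_le (hR : LL τ N R) (hN : 0 ≤ N) {h : ℂ} (hh : h ∈ ball (0 : ℂ) 1)
    (x y : ℝ) : ‖kkC τ R (x + h) (y + h)‖
      ≤ N * gW τ ^ 2 * (rexp (-(lineA τ * x)) * rexp (-(lineA τ * y))) := by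
  refine (norm_lap_le (a := lineA τ) (b := lineA τ) (fun p => lineZ_re τ _)
    (fun p => by rw [neg_re, lineZ_re]) hR.integrable (mem_ball_zero_iff.mp hh).le x y).trans ?_
  rw [← Real.exp_add, mul_comm, ← sub_eq_add_neg]
  refine mul_le_mul_of_nonneg_right ?_ (Real.exp_pos _).le
  have h1 : lapN (volume : Measure (ℝ × ℝ)) (fun p => lineZ τ p.1) (fun p => -lineZ τ p.2) _
      ≤ ∫ p : ℝ × ℝ, N * (gw τ p.1 * gw τ p.2) := integral_mono hR.integrable
    (((integrable_gw τ).mul_prod (integrable_gw τ)).const_mul N) hR.integrand_le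
  have h2 : ∫ p : ℝ × ℝ, N * (gw τ p.1 * gw τ p.2) = N * (∫ t, gw τ t) ^ 2 := by
    rw [integral_const_mul, Measure.volume_eq_prod, integral_prod_mul, sq]
  rw [h2] at h1
  refine h1.trans ?_
  have h0 : 0 ≤ ∫ t, gw τ t := integral_nonneg fun t => by unfold gw; positivity
  gcongr
  exact le_max_right _ _

theorem LL.differentiableOn_kkC (hR : LL τ N R) (x y : ℝ) :
    DifferentiableOn ℂ (fun h => kkC τ R (x + h) (y + h)) (ball 0 1) :=
  differentiableOn_lap (by fun_prop) (by fun_prop) hR.measurable (fun p => lineZ_re τ _)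
    (fun p => by rw [neg_re, lineZ_re]) hR.integrable x y

theorem LL.measurable_kkC (hR : LL τ N R) (h : ℂ) :
    Measurable fun q : ℝ × ℝ => kkC τ R (q.1 + h) (q.2 + h) :=
  measurable_lap (by fun_prop) (by fun_prop) hR.measurable h

theorem LL.kkC_sub (hR : LL τ N R) (hQ : LL τ N' Q) {h : ℂ} (hh : h ∈ ball (0 : ℂ) 1)
    (x y : ℝ) : kkC τ R (x + h) (y + h) - kkC τ Q (x + h) (y + h)
      = kkC τ (fun z w => R z w - Q z w) (x + h) (y + h) := by
  rw [kkC, kkC, kkC, lap, lap, lap, ← integral_sub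
    (integrable_lap (by fun_prop) (by fun_prop) hR.measurable (fun p => lineZ_re τ _)
      (fun p => by rw [neg_re, lineZ_re]) hR.integrable (mem_ball_zero_iff.mp hh).le x y)
    (integrable_lap (by fun_prop) (by fun_prop) hQ.measurable (fun p => lineZ_re τ _)
      (fun p => by rw [neg_re, lineZ_re]) hQ.integrable (mem_ball_zero_iff.mp hh).le x y)]
  grind

theorem kkC_swap (τ : ℝ) (R : ℂ → ℂ → ℂ) (x y : ℂ) :
    kkC τ R x y = kkC τ (fun z w => R (-w) (-z)) y x := by
  have h := (Measure.measurePreserving_swap (μ := (volume : Measure ℝ))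
    (ν := (volume : Measure ℝ))).integral_comp
    MeasurableEquiv.prodComm.measurableEmbedding (fun p : ℝ × ℝ =>
      cexp (-(x * lineZ τ p.1) + y * -lineZ τ p.2) * ((2 * π : ℂ)⁻¹ * (2 * π : ℂ)⁻¹
        * (aexp (τ ^ 2 : ℝ) (lineZ τ p.1) * aexp (τ ^ 2 : ℝ) (lineZ τ p.2)
          * R (lineZ τ p.1) (-lineZ τ p.2))))
  rw [kkC, lap, Measure.volume_eq_prod, ← h, kkC, lap]
  congr 1 with p
  grind

theorem L1.integrand_le (h : L1 τ N r) (t : ℝ) :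
    rexp (‖lineZ τ t‖ + ‖(0 : ℝ → ℂ) t‖) * ‖(2 * π : ℂ)⁻¹ * (aexp (τ ^ 2 : ℝ) (lineZ τ t)
      * r (lineZ τ t))‖ ≤ N * gw τ t := by
  have h1 := h.2 (lineZ τ t) (lineZ_re τ _)
  have h2 := one_add_le_exp_norm (lineZ τ t)
  have hN : 0 ≤ N := by
    by_contra hN
    have : N * (1 + ‖lineZ τ t‖) < 0 := mul_neg_of_neg_of_pos (not_le.mp hN) (by positivity)
    linarith [norm_nonneg (r (lineZ τ t))]
  have h4 := norm_inv_two_pi_le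
  rw [Pi.zero_apply, norm_zero, add_zero, norm_mul, norm_mul, gw]
  set X := rexp ‖lineZ τ t‖
  have e1 : rexp (2 * ‖lineZ τ t‖) = X * X := by rw [← Real.exp_add]; ring_nf
  rw [e1]
  have hX : 0 < X := Real.exp_pos _
  calc _ ≤ X * (1 * (‖aexp (τ ^ 2 : ℝ) (lineZ τ t)‖ * (N * X))) := by
        gcongr
        exact h1.trans (by gcongr)
    _ = _ := by ring

theorem L1.measurable (h : L1 τ N r) : Measurable fun t : ℝ =>
    (2 * π : ℂ)⁻¹ * (aexp (τ ^ 2 : ℝ) (lineZ τ t) * r (lineZ τ t)) := by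
  have h1 := h.1.comp (measurable_lineZ τ)
  unfold aexp
  exact Measurable.const_mul (Measurable.mul (by fun_prop) h1) _

theorem L1.integrable (h : L1 τ N r) : Integrable (fun t : ℝ =>
    rexp (‖lineZ τ t‖ + ‖(0 : ℝ → ℂ) t‖) * ‖(2 * π : ℂ)⁻¹ * (aexp (τ ^ 2 : ℝ) (lineZ τ t)
      * r (lineZ τ t))‖) := by
  refine ((integrable_gw τ).const_mul N).mono' ?_ (.of_forall fun p => ?_)
  · have := h.measurable
    fun_prop
  · rw [Real.norm_of_nonneg (by positivity)]
    exact h.integrand_le p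

theorem L1.norm_vvC_le (hr : L1 τ N r) (hN : 0 ≤ N) {h : ℂ} (hh : h ∈ ball (0 : ℂ) 1)
    (x : ℝ) : ‖vvC τ r (x + h)‖ ≤ N * gW τ * rexp (-(lineA τ * x)) := by
  refine (norm_lap_le (a := lineA τ) (b := 0) (lineZ_re τ) (fun p => by simp) hr.integrable
    (mem_ball_zero_iff.mp hh).le x x).trans ?_
  rw [zero_mul, sub_zero, mul_comm]
  refine mul_le_mul_of_nonneg_right ?_ (Real.exp_pos _).le
  have h1 : lapN volume (lineZ τ) 0 _ ≤ ∫ t, N * gw τ t := integral_mono hr.integrable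
    ((integrable_gw τ).const_mul N) hr.integrand_le
  rw [integral_const_mul] at h1
  refine h1.trans ?_
  gcongr
  exact le_max_right _ _

theorem L1.differentiableOn_vvC (hr : L1 τ N r) (x : ℝ) :
    DifferentiableOn ℂ (fun h => vvC τ r (x + h)) (ball 0 1) :=
  differentiableOn_lap (by fun_prop) measurable_const hr.measurable (a := lineA τ) (b := 0)
    (lineZ_re τ) (fun p => by simp) hr.integrable x x

theorem L1.measurable_vvC (hr : L1 τ N r) (h : ℂ) :
    Measurable fun x : ℝ => vvC τ r (x + h) := by
  have h1 := hr.measurable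
  have : Measurable fun q : ℝ × ℝ =>
      cexp (-((q.1 + h) * lineZ τ q.2) + (q.1 + h) * (0 : ℂ)) * ((2 * π : ℂ)⁻¹
        * (aexp (τ ^ 2 : ℝ) (lineZ τ q.2) * r (lineZ τ q.2))) :=
    Measurable.mul (by fun_prop) (h1.comp measurable_snd)
  exact this.stronglyMeasurable.integral_prod_right'.measurable

end

/-! ### Rates of convergence of the rational factors -/

section
variable {τ u N N' : ℝ} {R Q : ℂ → ℂ → ℂ}

theorem LL.swap (h : LL τ N R) : LL τ N fun z w => -R (-w) (-z) := by
  refine ⟨(h.1.comp (f := fun p : ℂ × ℂ => (-p.2, -p.1)) (by fun_prop)).neg, fun z w hz hw => ?_⟩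
  rw [norm_neg]
  refine (h.2 (-w) (-z) (by simp [hw]) (by simp [hz])).trans (le_of_eq ?_)
  rw [norm_neg, norm_neg]
  ring

theorem LL.neg (h : LL τ N R) : LL τ N fun z w => -R z w :=
  ⟨h.1.neg, fun z w hz hw => by rw [norm_neg]; exact h.2 z w hz hw⟩

theorem LL.mono (h : LL τ N R) (hN : N ≤ N') : LL τ N' R :=
  ⟨h.1, fun z w hz hw => (h.2 z w hz hw).trans (by gcongr)⟩

theorem LL.mul_inv (h : LL τ N R) : LL τ N fun z w => R z w * (w + τ)⁻¹ := by
  refine ⟨h.1.mul (by fun_prop), fun z w hz hw => ?_⟩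
  have h1 : ‖(w + τ)⁻¹‖ ≤ 1⁻¹ := norm_inv_le_of_re one_pos (by
    rw [add_re, ofReal_re, hw, lineA, abs_of_nonpos (by linarith [le_abs_self τ])]
    linarith [le_abs_self τ])
  rw [norm_mul]
  rw [inv_one] at h1
  calc _ ≤ ‖R z w‖ * 1 := by gcongr
    _ ≤ _ := by rw [mul_one]; exact h.2 z w hz hw

theorem LL.zero : LL τ 0 0 := ⟨measurable_const, fun z w _ _ => by simp⟩

theorem LL.of_bound (hm : Measurable fun p : ℂ × ℂ => R p.1 p.2) (hN : 0 ≤ N)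
    (h : ∀ z w : ℂ, z.re = lineA τ → w.re = -lineA τ → ‖R z w‖ ≤ N) : LL τ N R :=
  ⟨hm, fun z w hz hw => (h z w hz hw).trans (le_mul_of_one_le_right hN (by
    have h1 := norm_nonneg z
    have h2 := norm_nonneg w
    nlinarith))⟩

theorem LL.airy : LL τ 1 fun z w => (z - w)⁻¹ :=
  LL.of_bound (by fun_prop) one_pos.le fun z w hz hw => by
    rw [← inv_one]
    refine norm_inv_le_of_re one_pos ?_
    have := two_le_lineA τ
    rw [sub_re, hz, hw, abs_of_nonneg (by linarith)]
    linarith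

theorem line_facts (hu : 8 * lineA τ ≤ u) {z w : ℂ} (hz : z.re = lineA τ) (hw : w.re = -lineA τ) :
    ‖(z + u)⁻¹‖ ≤ u⁻¹ ∧ ‖(w - u)⁻¹‖ ≤ u⁻¹ ∧ ‖(z - w + 2 * u)⁻¹‖ ≤ u⁻¹ ∧
    ‖(w + (2 * u - τ))⁻¹‖ ≤ u⁻¹ ∧ ‖(z - w - 2 * u)⁻¹‖ ≤ u⁻¹ ∧ ‖(z - (2 * u - τ))⁻¹‖ ≤ u⁻¹ := by
  have hA := two_le_lineA τ
  have hu0 : 0 < u := by linarith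
  have h1 : |τ| ≤ lineA τ := by rw [lineA]; linarith
  obtain ⟨h2, h3⟩ := abs_le.mp h1
  refine ⟨?_, ?_, ?_, ?_, ?_, ?_⟩ <;> refine norm_inv_le_of_re hu0 ?_ <;>
    simp only [add_re, sub_re, mul_re, ofReal_re, ofReal_im, hz, hw, re_ofNat, im_ofNat] <;>
    first
    | exact (by linarith : u ≤ _).trans (le_abs_self _)
    | exact (by linarith : u ≤ _).trans (neg_le_abs _)

theorem norm_one_add_mul_inv_le (hu : 8 * lineA τ ≤ u) {z c : ℂ} (h : ‖z⁻¹‖ ≤ u⁻¹)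
    (hc : ‖c‖ ≤ 2 * u) : ‖1 + c * z⁻¹‖ ≤ 3 := by
  have hu0 : 0 < u := by linarith [two_le_lineA τ]
  refine (norm_add_le _ _).trans ?_
  rw [norm_one, norm_mul]
  have : ‖c‖ * ‖z⁻¹‖ ≤ 2 * u * u⁻¹ := by gcongr
  grind

theorem norm_shift_le (hu : 8 * lineA τ ≤ u) : ‖(u - τ : ℂ)‖ ≤ 2 * u := by
  have hA := two_le_lineA τ
  have h1 : |τ| ≤ lineA τ := by rw [lineA]; linarith
  rw [← ofReal_sub, norm_real, Real.norm_eq_abs]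
  grind

theorem line_ne (hu : 8 * lineA τ ≤ u) {z w : ℂ} (hz : z.re = lineA τ) (hw : w.re = -lineA τ) :
    z + u ≠ 0 ∧ w - u ≠ 0 ∧ w + (2 * u - τ) ≠ 0 ∧ z - (2 * u - τ) ≠ 0 ∧ z - w ≠ 0 := by
  have hA := two_le_lineA τ
  have h1 : |τ| ≤ lineA τ := by rw [lineA]; linarith
  obtain ⟨h2, h3⟩ := abs_le.mp h1
  refine ⟨?_, ?_, ?_, ?_, ?_⟩ <;> apply ne_zero_of_re <;>
    simp only [add_re, sub_re, mul_re, ofReal_re, ofReal_im, hz, hw, re_ofNat, im_ofNat] <;>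
    first
    | exact (by linarith : (0 : ℝ) < _).ne'
    | exact (by linarith : _ < (0 : ℝ)).ne

theorem LL_R11 (hu : 8 * lineA τ ≤ u) : LL τ (9 * u⁻¹) (R11 τ u) := by
  have hu0 : 0 < u := by linarith [two_le_lineA τ]
  refine ⟨by unfold R11; fun_prop, fun z w hz hw => ?_⟩
  obtain ⟨f1, f2, f3, -, -, -⟩ := line_facts hu hz hw
  obtain ⟨n1, n2, -, -, -⟩ := line_ne hu hz hw
  have e1 : (z + (2 * u - τ)) * (z + u)⁻¹ = 1 + (u - τ) * (z + u)⁻¹ := by field_simp; ring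
  have e2 : (w - (2 * u - τ)) * (w - u)⁻¹ = 1 + -(u - τ) * (w - u)⁻¹ := by field_simp; ring
  have h1 := norm_one_add_mul_inv_le hu f1 (norm_shift_le hu)
  have h2 := norm_one_add_mul_inv_le hu f2 (c := -(u - τ)) (by rw [norm_neg]; exact norm_shift_le hu)
  rw [R11, e1, e2, norm_mul, norm_mul, norm_mul, norm_mul]
  have h3 : ‖(4 : ℂ)⁻¹‖ ≤ 1 := by norm_num
  have h4 : ‖z + w‖ ≤ (1 + ‖z‖) * (1 + ‖w‖) := (norm_add_le _ _).trans (by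
    nlinarith [norm_nonneg z, norm_nonneg w, mul_nonneg (norm_nonneg z) (norm_nonneg w)])
  calc _ ≤ 3 * 3 * ((1 + ‖z‖) * (1 + ‖w‖) * u⁻¹) * 1 := by gcongr
    _ = _ := by ring

theorem R12_sub (hu : 8 * lineA τ ≤ u) {z w : ℂ} (hz : z.re = lineA τ) (hw : w.re = -lineA τ) :
    R12 τ u z w - (z - w)⁻¹ = (z + τ) * (z + u)⁻¹ * (w + (2 * u - τ))⁻¹ * 2⁻¹ := by
  obtain ⟨n1, -, n3, -, n5⟩ := line_ne hu hz hw
  rw [R12]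
  field_simp
  ring

theorem LL_R12_sub (hu : 8 * lineA τ ≤ u) : LL τ u⁻¹ fun z w => R12 τ u z w - (z - w)⁻¹ := by
  have hA := two_le_lineA τ
  have hu0 : 0 < u := by linarith
  refine ⟨by unfold R12; fun_prop, fun z w hz hw => ?_⟩
  obtain ⟨f1, -, -, f4, -, -⟩ := line_facts hu hz hw
  beta_reduce
  rw [R12_sub hu hz hw, norm_mul, norm_mul, norm_mul]
  have h3 : ‖(2 : ℂ)⁻¹‖ ≤ 1 := by norm_num
  have h1 : |τ| ≤ u := by rw [lineA] at hu; linarith [abs_nonneg τ]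
  have h4 : ‖z + τ‖ ≤ u * ((1 + ‖z‖) * (1 + ‖w‖)) := by
    refine (norm_add_le _ _).trans ?_
    rw [norm_real, Real.norm_eq_abs]
    have : 1 + ‖z‖ ≤ (1 + ‖z‖) * (1 + ‖w‖) :=
      le_mul_of_one_le_right (by positivity) (by linarith [norm_nonneg w])
    nlinarith [norm_nonneg z, norm_nonneg w]
  calc _ ≤ u * ((1 + ‖z‖) * (1 + ‖w‖)) * u⁻¹ * u⁻¹ * 1 := by gcongr
    _ = _ := by field_simp

theorem LL_R22 (hu : 8 * lineA τ ≤ u) : LL τ (2 * u⁻¹) (R22 τ u) := by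
  have hA := two_le_lineA τ
  have hu0 : 0 < u := by linarith
  refine LL.of_bound (by unfold R22; fun_prop) (by positivity) fun z w hz hw => ?_
  obtain ⟨-, -, -, f4, f5, f6⟩ := line_facts hu hz hw
  rw [R22, norm_mul]
  have h1 : u⁻¹ ≤ 1 := inv_le_one_of_one_le₀ (by linarith)
  have h2 := norm_add_le (z - (2 * u - τ))⁻¹ (w + (2 * u - τ))⁻¹
  calc _ ≤ u⁻¹ * (1 + 1) := by gcongr; linarith
    _ = _ := by ring

theorem L1.vvC_sub {r q : ℂ → ℂ} (hR : L1 τ N r) (hQ : L1 τ N' q) {h : ℂ}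
    (hh : h ∈ ball (0 : ℂ) 1) (x : ℝ) :
    vvC τ r (x + h) - vvC τ q (x + h) = vvC τ (fun z => r z - q z) (x + h) := by
  have h0 : Measurable (0 : ℝ → ℂ) := measurable_const
  refine (integral_sub (integrable_lap (by fun_prop) h0 hR.measurable (lineZ_re τ) (b := 0)
      (fun p => by simp) hR.integrable (mem_ball_zero_iff.mp hh).le x x)
    (integrable_lap (by fun_prop) h0 hQ.measurable (lineZ_re τ) (b := 0)
      (fun p => by simp) hQ.integrable (mem_ball_zero_iff.mp hh).le x x)).symm.trans ?_
  congr 1 with p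
  ring

theorem L1.of_bound {r : ℂ → ℂ} (hm : Measurable r) (hN : 0 ≤ N)
    (h : ∀ z : ℂ, z.re = lineA τ → ‖r z‖ ≤ N) : L1 τ N r :=
  ⟨hm, fun z hz => (h z hz).trans (le_mul_of_one_le_right hN (by linarith [norm_nonneg z]))⟩

theorem L1.mono {r : ℂ → ℂ} (h : L1 τ N r) (hN : N ≤ N') : L1 τ N' r :=
  ⟨h.1, fun z hz => (h.2 z hz).trans (by gcongr)⟩

theorem L1.neg {r : ℂ → ℂ} (h : L1 τ N r) : L1 τ N fun z => -r z :=
  ⟨h.1.neg, fun z hz => by rw [norm_neg]; exact h.2 z hz⟩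

theorem L1_inv_sub : L1 τ 1 fun z => (z - τ)⁻¹ :=
  L1.of_bound (by fun_prop) one_pos.le fun z hz => by
    rw [← inv_one]
    refine norm_inv_le_of_re one_pos (le_trans ?_ (le_abs_self _))
    rw [sub_re, ofReal_re, hz, lineA]
    linarith [le_abs_self τ]

theorem L1_inv_add : L1 τ 1 fun z => (z + τ)⁻¹ :=
  L1.of_bound (by fun_prop) one_pos.le fun z hz => by
    rw [← inv_one]
    refine norm_inv_le_of_re one_pos (le_trans ?_ (le_abs_self _))
    rw [add_re, ofReal_re, hz, lineA]
    linarith [neg_abs_le τ]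

theorem L1_g1 (hu : 8 * lineA τ ≤ u) : L1 τ (lineA τ * u⁻¹) fun z => (z + τ) * (z + u)⁻¹ * 2⁻¹ := by
  have hA := two_le_lineA τ
  have hu0 : 0 < u := by linarith
  refine ⟨by fun_prop, fun z hz => ?_⟩
  obtain ⟨f1, -⟩ := line_facts hu hz (w := -lineA τ) (by simp)
  rw [norm_mul, norm_mul]
  have h3 : ‖(2 : ℂ)⁻¹‖ ≤ 1 := by norm_num
  have h1 : |τ| ≤ lineA τ := by rw [lineA]; linarith
  have h4 : ‖z + τ‖ ≤ lineA τ * (1 + ‖z‖) := by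
    refine (norm_add_le _ _).trans ?_
    rw [norm_real, Real.norm_eq_abs]
    nlinarith [norm_nonneg z]
  calc _ ≤ lineA τ * (1 + ‖z‖) * u⁻¹ * 1 := by gcongr
    _ = _ := by ring

theorem L1_r4 (hu : 8 * lineA τ ≤ u) : L1 τ (6 * u⁻¹) (r4 τ u) := by
  have hA := two_le_lineA τ
  have hu0 : 0 < u := by linarith
  refine L1.of_bound (by unfold r4; fun_prop) (by positivity) fun z hz => ?_
  obtain ⟨-, -, -, -, -, f6⟩ := line_facts hu hz (w := -lineA τ) (by simp)
  obtain ⟨-, -, -, n4, -⟩ := line_ne hu hz (w := -lineA τ) (by simp)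
  have e1 : (z - u) * (z - (2 * u - τ))⁻¹ = 1 + (u - τ) * (z - (2 * u - τ))⁻¹ := by grind
  have h1 := norm_one_add_mul_inv_le hu f6 (norm_shift_le hu)
  have h2 : ‖(z - τ)⁻¹‖ ≤ 1⁻¹ := norm_inv_le_of_re one_pos (le_trans (by
    rw [sub_re, ofReal_re, hz, lineA]
    linarith [le_abs_self τ]) (le_abs_self _))
  rw [r4, e1, norm_mul, norm_mul, norm_mul]
  have h3 : ‖(2 : ℂ)‖ = 2 := by norm_num
  calc _ ≤ 2 * (3 * u⁻¹ * 1⁻¹) := by rw [h3]; gcongr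
    _ = _ := by ring

/-! ### The families of kernels and vectors on the pair space -/

/-- The matrix of rational factors of the rescaled kernel. -/
def Rmat (τ u : ℝ) : Fin 2 → Fin 2 → ℂ → ℂ → ℂ :=
  ![![R11 τ u, R12 τ u], ![fun z w => -R12 τ u (-w) (-z), fun z w => -R22 τ u z w]]

/-- The limit of `Rmat`. -/
def RmatLim : Fin 2 → Fin 2 → ℂ → ℂ → ℂ :=
  ![![0, fun z w => (z - w)⁻¹], ![fun z w => -(z - w)⁻¹, 0]]

theorem LL_RmatLim (τ : ℝ) (c d : Fin 2) : LL τ 1 (RmatLim c d) := by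
  fin_cases c <;> fin_cases d
  exacts [LL.zero.mono one_pos.le, LL.airy, LL.airy.neg, LL.zero.mono one_pos.le]

theorem LL_Rmat_sub (hu : 8 * lineA τ ≤ u) (c d : Fin 2) :
    LL τ (9 * u⁻¹) fun z w => Rmat τ u c d z w - RmatLim c d z w := by
  have hu0 : 0 < u⁻¹ := inv_pos.mpr (by linarith [two_le_lineA τ])
  fin_cases c <;> fin_cases d
  · exact (by simpa [Rmat, RmatLim] using LL_R11 hu)
  · exact (LL_R12_sub hu).mono (by linarith)
  · have := (LL_R12_sub hu).swap.mono (N' := 9 * u⁻¹) (by linarith)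
    convert this using 3 with z w
    simp only [Rmat, RmatLim, Matrix.cons_val', cons_val_zero, cons_val_one,
      cons_val_fin_one, Fin.mk_one, Fin.zero_eta]
    ring_nf
  · have := (LL_R22 hu).neg.mono (N' := 9 * u⁻¹) (by linarith)
    simpa [Rmat, RmatLim] using this

theorem LL.add_sub (hQ : LL τ N Q) (h : LL τ N' fun z w => R z w - Q z w) : LL τ (N + N') R := by
  constructor
  · convert h.1.add hQ.1 using 1
    ext p
    simp
  · intro z w hz hw
    have h1 := norm_add_le (R z w - Q z w) (Q z w)
    rw [sub_add_cancel] at h1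
    have h2 := h.2 z w hz hw
    have h3 := hQ.2 z w hz hw
    rw [add_mul]
    linarith

theorem LL_Rmat (hu : 8 * lineA τ ≤ u) (c d : Fin 2) : LL τ 10 (Rmat τ u c d) := by
  refine ((LL_RmatLim τ c d).add_sub (LL_Rmat_sub hu c d)).mono ?_
  have : u⁻¹ ≤ 1 := inv_le_one_of_one_le₀ (by linarith [two_le_lineA τ])
  linarith

theorem Rmat_swap (τ u : ℝ) (c d : Fin 2) (z w : ℂ) : Rmat τ u d c (-w) (-z) = -Rmat τ u c d z w := by
  fin_cases c <;> fin_cases d <;> simp [Rmat, R11, R22]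
  · rw [show -w + (2 * u - τ) = -(w - (2 * u - τ)) by ring,
      show -w + u = -(w - u) by ring, show -z - (2 * u - τ) = -(z + (2 * u - τ)) by ring,
      show -z - u = -(z + u) by ring, show -w + -z = -(z + w) by ring,
      show -w + z = z - w by ring]
    simp only [inv_neg]
    ring
  · grind

theorem RmatLim_swap (c d : Fin 2) (z w : ℂ) : RmatLim d c (-w) (-z) = -RmatLim c d z w := by
  fin_cases c <;> fin_cases d <;> simp [RmatLim, neg_add_eq_sub]

end

section
variable {τ s N u : ℝ}

/-- The dominating function on the half line. -/
def mW (τ x : ℝ) : ℝ :=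
  rexp (-x) + rexp (-((lineA τ + (1 - τ)) * x)) + rexp (-((lineA τ - (1 - τ)) * x))

theorem mW_pos (τ x : ℝ) : 0 < mW τ x := by unfold mW; positivity

@[fun_prop]
theorem measurable_mW (τ : ℝ) : Measurable (mW τ) := by unfold mW; fun_prop

theorem memLp_exp_neg {b : ℝ} (hb : 0 < b) (s : ℝ) :
    MemLp (fun x => rexp (-(b * x))) 2 (volume.restrict (Ioi s)) := by
  rw [memLp_two_iff_integrable_sq (by fun_prop)]
  have h := integrableOn_Ioi_comp_mul_left_iff (fun x => rexp (-x)) s (a := 2 * b) (by positivity)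
  refine (h.mpr (integrableOn_exp_neg_Ioi _)).congr (.of_forall fun x => ?_)
  beta_reduce
  rw [← Real.exp_nat_mul]
  push_cast
  ring_nf

theorem memLp_mW (τ s : ℝ) : MemLp (mW τ) 2 (volume.restrict (Ioi s)) := by
  have h1 : 0 < lineA τ + (1 - τ) := by rw [lineA]; linarith [le_abs_self τ]
  have h2 : 0 < lineA τ - (1 - τ) := by rw [lineA]; linarith [neg_abs_le τ]
  have := (memLp_exp_neg one_pos s)
  simp only [one_mul] at this
  exact (this.add (memLp_exp_neg h1 s)).add (memLp_exp_neg h2 s)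

instance (s : ℝ) : SFinite (pairMeasure s) := by unfold pairMeasure; infer_instance

theorem memLp_pair {f : ℝ → ℝ} (hf : MemLp f 2 (volume.restrict (Ioi s))) :
    MemLp (fun p : Fin 2 × ℝ => f p.2) 2 (pairMeasure s) :=
  hf.comp_snd (μ := (Measure.count : Measure (Fin 2)))

/-- The exponents of the weights of the two components. -/
def sg (τ : ℝ) (c : Fin 2) : ℝ := if c = 0 then 1 - τ else -(1 - τ)

theorem exp_mul_exp_le {a x : ℝ} (ha : a = 1 - τ ∨ a = -(1 - τ)) :
    rexp (a * x) * rexp (-(lineA τ * x)) ≤ mW τ x := by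
  rw [← Real.exp_add, mW]
  have h1 := Real.exp_pos (-x)
  have h2 := Real.exp_pos (-((lineA τ + (1 - τ)) * x))
  have h3 := Real.exp_pos (-((lineA τ - (1 - τ)) * x))
  grind

theorem sg_or (τ : ℝ) (c : Fin 2) : sg τ c = 1 - τ ∨ sg τ c = -(1 - τ) := by
  unfold sg; split_ifs <;> simp

theorem measurable_fin_prod {β γ : Type*} [MeasurableSpace β] [MeasurableSpace γ]
    {f : Fin 2 × β → γ} (h : ∀ c, Measurable fun x => f (c, x)) : Measurable f :=
  measurable_from_prod_countable_right h

/-- The rescaled kernel on pairs with the matrix `R` of rational factors, shifted by `h`. -/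
def kerF (τ : ℝ) (R : Fin 2 → Fin 2 → ℂ → ℂ → ℂ) (h : ℂ) (p : (Fin 2 × ℝ) × (Fin 2 × ℝ)) : ℂ :=
  rexp (sg τ p.1.1 * p.1.2) * rexp (sg τ p.2.1 * p.2.2)
    * kkC τ (R p.1.1 p.2.1) (p.1.2 + h) (p.2.2 + h)

variable {R R' : Fin 2 → Fin 2 → ℂ → ℂ → ℂ}

theorem norm_kerF_le (hR : ∀ c d, LL τ N (R c d)) (hN : 0 ≤ N) {h : ℂ}
    (hh : h ∈ ball (0 : ℂ) 1) (p : (Fin 2 × ℝ) × (Fin 2 × ℝ)) :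
    ‖kerF τ R h p‖ ≤ N * gW τ ^ 2 * (mW τ p.1.2 * mW τ p.2.2) := by
  rw [kerF, norm_mul, norm_mul, norm_real, norm_real, Real.norm_of_nonneg (Real.exp_pos _).le,
    Real.norm_of_nonneg (Real.exp_pos _).le]
  have h1 := (hR p.1.1 p.2.1).norm_kkC_le hN hh p.1.2 p.2.2
  have h2 := exp_mul_exp_le (x := p.1.2) (sg_or τ p.1.1)
  have h3 := exp_mul_exp_le (x := p.2.2) (sg_or τ p.2.1)
  calc _ ≤ rexp (sg τ p.1.1 * p.1.2) * rexp (sg τ p.2.1 * p.2.2) * (N * gW τ ^ 2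
        * (rexp (-(lineA τ * p.1.2)) * rexp (-(lineA τ * p.2.2)))) := by gcongr
    _ = N * gW τ ^ 2 * ((rexp (sg τ p.1.1 * p.1.2) * rexp (-(lineA τ * p.1.2)))
        * (rexp (sg τ p.2.1 * p.2.2) * rexp (-(lineA τ * p.2.2)))) := by ring
    _ ≤ _ := by gcongr; exact (mW_pos _ _).le

theorem measurable_kerF (hR : ∀ c d, LL τ N (R c d)) (h : ℂ) : Measurable (kerF τ R h) := by
  have e : kerF τ R h = (fun q : Fin 2 × (Fin 2 × (ℝ × ℝ)) =>
      kerF τ R h ((q.1, q.2.2.1), (q.2.1, q.2.2.2))) ∘ fun p => (p.1.1, (p.2.1, (p.1.2, p.2.2))) := rfl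
  rw [e]
  refine Measurable.comp (measurable_fin_prod fun c => measurable_fin_prod fun d => ?_)
    (by fun_prop)
  have := (hR c d).measurable_kkC h
  simp only [kerF]
  fun_prop

theorem holDom_kerF (hR : ∀ c d, LL τ N (R c d)) (hN : 0 ≤ N) :
    HolDom (fun p : (Fin 2 × ℝ) × (Fin 2 × ℝ) => mW τ p.1.2 * mW τ p.2.2) (N * gW τ ^ 2)
      (kerF τ R) := by
  refine ⟨fun h hh => ⟨measurable_kerF hR h, norm_kerF_le hR hN hh⟩, fun p => ?_⟩
  exact ((hR _ _).differentiableOn_kkC _ _).const_mul _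

theorem domNear_kerF {M M' : ℝ} (hR : ∀ c d, LL τ M (R c d)) (hR' : ∀ c d, LL τ M' (R' c d))
    (hd : ∀ c d, LL τ N fun z w => R c d z w - R' c d z w) (hN : 0 ≤ N) :
    DomNear (fun p : (Fin 2 × ℝ) × (Fin 2 × ℝ) => mW τ p.1.2 * mW τ p.2.2) (N * gW τ ^ 2)
      (kerF τ R) (kerF τ R') := by
  intro h hh p
  have e : kerF τ R h p - kerF τ R' h p = kerF τ (fun c d z w => R c d z w - R' c d z w) h p := by
    rw [kerF, kerF, ← mul_sub, (hR _ _).kkC_sub (hR' _ _) hh]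
    rfl
  rw [e]
  exact norm_kerF_le hd hN hh p

theorem kerF_anti (hR : ∀ c d z w, R d c (-w) (-z) = -R c d z w) (h : ℂ) (p q : Fin 2 × ℝ) :
    kerF τ R h (q, p) = -kerF τ R h (p, q) := by
  rw [kerF, kkC_swap]
  simp only [hR, kerF]
  rw [kkC, lap, kkC, lap, mul_comm (Complex.ofReal _), ← mul_neg, ← integral_neg]
  congr 2
  ext t
  ring

/-- A family of vectors on pairs that depends on rational factors. -/
def rowF (τ s : ℝ) (a : Fin 2 → ℝ) (Q : Fin 2 → ℂ → ℂ → ℂ) (q : Fin 2 → ℂ → ℂ) (β : Fin 2 → ℂ)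
    (h : ℂ) (p : Fin 2 × ℝ) : ℂ :=
  rexp (a p.1 * p.2) * (cexp (2 * τ ^ 3 / 3 + τ * (s + h)) * kkC τ (Q p.1) (p.2 + h) (s + h)
    + vvC τ (q p.1) (p.2 + h) + β p.1 * cexp (-(τ * (p.2 + h))))

/-- The bounds on the data of `rowF`. -/
def RowBd (τ N : ℝ) (a : Fin 2 → ℝ) (Q : Fin 2 → ℂ → ℂ → ℂ) (q : Fin 2 → ℂ → ℂ)
    (β : Fin 2 → ℂ) : Prop :=
  ∀ c, LL τ N (Q c) ∧ L1 τ N (q c) ∧ ‖β c‖ ≤ N ∧ (a c = 1 - τ ∨ a c = -(1 - τ)) ∧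
    (β c = 0 ∨ a c = -(1 - τ))

/-- The constant in the bound for `rowF`. -/
def rowC (τ s : ℝ) : ℝ :=
  rexp (2 * |τ| ^ 3 / 3 + |τ| * (|s| + 1)) * gW τ ^ 2 * rexp (-(lineA τ * s)) + gW τ
    + rexp |τ|

theorem rowC_pos (τ s : ℝ) : 0 < rowC τ s := by
  have := gW_pos τ
  unfold rowC
  positivity

variable {a : Fin 2 → ℝ} {Q Q' : Fin 2 → ℂ → ℂ → ℂ} {q q' : Fin 2 → ℂ → ℂ} {β β' : Fin 2 → ℂ}

theorem norm_rowF_le (hR : RowBd τ N a Q q β) (hN : 0 ≤ N) {h : ℂ}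
    (hh : h ∈ ball (0 : ℂ) 1) (p : Fin 2 × ℝ) :
    ‖rowF τ s a Q q β h p‖ ≤ N * rowC τ s * mW τ p.2 := by
  obtain ⟨h1, h2, h3, h4, h5⟩ := hR p.1
  have k1 := h1.norm_kkC_le hN hh p.2 s
  have k2 := h2.norm_vvC_le hN hh p.2
  have hre : ‖h‖ ≤ 1 := (mem_ball_zero_iff.mp hh).le
  have k3 : ‖cexp (2 * τ ^ 3 / 3 + τ * (s + h))‖ ≤ rexp (2 * |τ| ^ 3 / 3 + |τ| * (|s| + 1)) := by
    refine (norm_exp_le_exp_norm _).trans (Real.exp_le_exp.mpr ((norm_add_le _ _).trans ?_))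
    rw [norm_div, norm_mul, norm_mul, norm_pow, norm_real, Real.norm_eq_abs]
    have : ‖(s + h : ℂ)‖ ≤ |s| + 1 := (norm_add_le _ _).trans (by
      rw [norm_real, Real.norm_eq_abs]
      linarith)
    norm_num
    gcongr
  have k4 := exp_mul_exp_le (x := p.2) h4
  have k5 : rexp (a p.1 * p.2) * ‖β p.1 * cexp (-(τ * (p.2 + h)))‖
      ≤ N * rexp |τ| * mW τ p.2 := by
    rcases h5 with h5 | h5
    · rw [h5, zero_mul, norm_zero, mul_zero]
      have := (mW_pos τ p.2).le
      positivity
    · have e1 : rexp (-(1 - τ) * p.2) * ‖cexp (-(τ * (p.2 + h)))‖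
          ≤ rexp |τ| * rexp (-p.2) := by
        rw [Complex.norm_exp, ← Real.exp_add, ← Real.exp_add, Real.exp_le_exp]
        rw [neg_re, re_ofReal_mul, add_re, ofReal_re]
        have e2 : |τ * h.re| ≤ |τ| * 1 := by
          rw [abs_mul]
          gcongr
          exact (abs_re_le_norm h).trans hre
        have := neg_le_abs (τ * h.re)
        linarith
      have e3 : rexp (-p.2) ≤ mW τ p.2 := by
        unfold mW
        linarith [Real.exp_pos (-((lineA τ + (1 - τ)) * p.2)),
          Real.exp_pos (-((lineA τ - (1 - τ)) * p.2))]
      rw [h5, norm_mul]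
      calc _ = ‖β p.1‖ * (rexp (-(1 - τ) * p.2) * ‖cexp (-(τ * (p.2 + h)))‖) := by ring
        _ ≤ N * (rexp |τ| * rexp (-p.2)) := by gcongr
        _ ≤ N * (rexp |τ| * mW τ p.2) := by gcongr
        _ = _ := by ring
  have hg := gW_pos τ
  set E := rexp (a p.1 * p.2)
  have hE : 0 < E := Real.exp_pos _
  rw [rowF, norm_mul, norm_real, Real.norm_of_nonneg hE.le]
  have hsum := norm_add₃_le (a := cexp (2 * τ ^ 3 / 3 + τ * (s + h)) * kkC τ (Q p.1) (p.2 + h) (s + h))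
    (b := vvC τ (q p.1) (p.2 + h)) (c := β p.1 * cexp (-(τ * (p.2 + h))))
  refine (mul_le_mul_of_nonneg_left hsum hE.le).trans ?_
  rw [norm_mul, mul_add, mul_add]
  set X := rexp (-(lineA τ * p.2))
  set D := rexp (2 * |τ| ^ 3 / 3 + |τ| * (|s| + 1))
  have l1 : E * (‖cexp (2 * τ ^ 3 / 3 + τ * (s + h))‖ * ‖kkC τ (Q p.1) (p.2 + h) (s + h)‖)
      ≤ N * (D * gW τ ^ 2 * rexp (-(lineA τ * s))) * mW τ p.2 := by
    calc _ ≤ E * (D * (N * gW τ ^ 2 * (X * rexp (-(lineA τ * s))))) := by gcongr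
      _ = N * (D * gW τ ^ 2 * rexp (-(lineA τ * s))) * (E * X) := by ring
      _ ≤ _ := by gcongr
  have l2 : E * ‖vvC τ (q p.1) (p.2 + h)‖ ≤ N * gW τ * mW τ p.2 := by
    calc _ ≤ E * (N * gW τ * X) := by gcongr
      _ = N * gW τ * (E * X) := by ring
      _ ≤ _ := by gcongr
  rw [rowC]
  linarith

theorem holDom_rowF (hR : RowBd τ N a Q q β) (hN : 0 ≤ N) :
    HolDom (fun p : Fin 2 × ℝ => mW τ p.2) (N * rowC τ s) (rowF τ s a Q q β) := by
  refine ⟨fun h hh => ⟨measurable_fin_prod fun c => ?_, norm_rowF_le hR hN hh⟩, fun p => ?_⟩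
  · have h1 := ((hR c).1.measurable_kkC h).comp
      (measurable_id.prodMk measurable_const : Measurable fun x : ℝ => (x, s))
    simp only [Function.comp_def, id] at h1
    have h2 := (hR c).2.1.measurable_vvC h
    simp only [rowF]
    fun_prop
  · refine DifferentiableOn.const_mul (((DifferentiableOn.mul (by fun_prop)
      ((hR _).1.differentiableOn_kkC _ _)).add ((hR _).2.1.differentiableOn_vvC _)).add
      (by fun_prop)) _

theorem domNear_rowF {M M' : ℝ} (hR : RowBd τ M a Q q β) (hR' : RowBd τ M' a Q' q' β')
    (hd : RowBd τ N a (fun c z w => Q c z w - Q' c z w) (fun c z => q c z - q' c z) (β - β'))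
    (hN : 0 ≤ N) :
    DomNear (fun p : Fin 2 × ℝ => mW τ p.2) (N * rowC τ s) (rowF τ s a Q q β)
      (rowF τ s a Q' q' β') := by
  intro h hh p
  have e : rowF τ s a Q q β h p - rowF τ s a Q' q' β' h p
      = rowF τ s a (fun c z w => Q c z w - Q' c z w) (fun c z => q c z - q' c z) (β - β') h p := by
    simp only [rowF]
    rw [← (hR _).1.kkC_sub (hR' _).1 hh, ← (hR _).2.1.vvC_sub (hR' _).2.1 hh, Pi.sub_apply]
    ring
  rw [e]
  exact norm_rowF_le hd hN hh p

end

/-! ### Plancherel's theorem and the Airy transform -/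

section
open FourierTransform

theorem memLp_fourier {f : ℝ → ℂ} (h1 : Integrable f) (h2 : MemLp f 2) :
    MemLp (𝓕 f) 2 ∧ ∫ x, ‖𝓕 f x‖ ^ 2 = ∫ x, ‖f x‖ ^ 2 := by
  set g : Lp ℂ 2 (volume : Measure ℝ) := 𝓕 (h2.toLp f) with hg
  have hbd : ∀ x, ‖𝓕 f x‖ ≤ ∫ y, ‖f y‖ := fun x =>
    VectorFourier.norm_fourierIntegral_le_integral_norm _ _ _ _ _
  have hcont : Continuous (𝓕 f) := VectorFourier.fourierIntegral_continuous
    Real.continuous_fourierChar (by exact continuous_inner) h1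
  have hgl : LocallyIntegrable g volume := (Lp.memLp g).locallyIntegrable one_le_two
  have hae : 𝓕 f =ᵐ[volume] g := by
    refine ae_eq_of_integral_contDiff_smul_eq hcont.locallyIntegrable hgl fun ψ hψ hs => ?_
    let Ψ : SchwartzMap ℝ ℂ := HasCompactSupport.toSchwartzMap (f := fun x => (ψ x : ℂ))
      (hs.comp_left (g := Complex.ofReal) ofReal_zero) (Complex.ofRealCLM.contDiff.comp hψ)
    have hΨ : ∀ x, Ψ x = ψ x := fun x => rfl
    have e1 := congrArg (fun T => T Ψ) (Lp.fourier_toTemperedDistribution_eq (h2.toLp f))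
    beta_reduce at e1
    rw [TemperedDistribution.fourier_apply, Lp.toTemperedDistribution_apply,
      Lp.toTemperedDistribution_apply, ← hg] at e1
    have e2 : ∫ x, (𝓕 Ψ) x • (h2.toLp f) x = ∫ x, (𝓕 (Ψ : ℝ → ℂ)) x • f x := by
      refine integral_congr_ae ?_
      filter_upwards [h2.coeFn_toLp] with x hx
      rw [hx, SchwartzMap.fourier_coe]
    have e3 := VectorFourier.integral_fourierIntegral_smul_eq_flip (μ := volume) (ν := volume)
      (L := innerₗ ℝ) Real.continuous_fourierChar (by exact continuous_inner) Ψ.integrable h1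
    have e4 : ∫ x, (𝓕 (Ψ : ℝ → ℂ)) x • f x = ∫ x, Ψ x • 𝓕 f x := by
      rw [flip_innerₗ] at e3
      exact e3
    rw [e2, e4] at e1
    simpa only [hΨ, Complex.real_smul, smul_eq_mul] using e1
  refine ⟨(Lp.memLp g).ae_eq hae.symm, ?_⟩
  have e1 : ∫ x, ‖𝓕 f x‖ ^ 2 = ∫ x, ‖g x‖ ^ 2 := integral_congr_ae (by
    filter_upwards [hae] with x hx
    rw [hx])
  have e2 : ∫ x, ‖f x‖ ^ 2 = ∫ x, ‖(h2.toLp f) x‖ ^ 2 := integral_congr_ae (by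
    filter_upwards [h2.coeFn_toLp] with x hx
    rw [hx])
  rw [e1, e2, ← norm_sq_eq_integral, ← norm_sq_eq_integral, hg, Lp.norm_fourier_eq]

variable {τ s ε : ℝ} {φ : ℝ → ℂ}

/-- The Airy transform of a function on a half line. -/
def airyT (τ s : ℝ) (φ : ℝ → ℂ) (l : ℂ) : ℂ :=
  ∫ y in Ioi s, φ y * vvC τ 1 (y + l)

theorem L1_one (τ : ℝ) : L1 τ 1 1 :=
  L1.of_bound measurable_const one_pos.le fun z _ => by simp

theorem vvC_one_eq (hε : 0 < ε) (x : ℝ) :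
    vvC τ 1 x = (2 * π)⁻¹ * ∫ t : ℝ, cexp (-(x * (ε + t * I))) * aexp (τ ^ 2 : ℝ) (ε + t * I) := by
  have h := (decayExp_aexp (x + τ ^ 2)).vl_shift (a := lineA τ) (c := ε) (lo := 0)
    (hi := lineA τ + ε + 1)
    (regOn_const 1 _ _) (lineA_pos τ) hε (by linarith) (by linarith [lineA_pos τ]) hε (lineA_pos τ)
  rw [← vv_eq, vv]
  refine h.trans ?_
  rw [vl]
  congr 1
  congr 1 with t
  rw [mul_one, ofReal_add, aexp_add]

theorem norm_airy_le (τ x : ℝ) : ‖vvC τ 1 x‖ ≤ gW τ * rexp (-(lineA τ * x)) := by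
  simpa using (L1_one τ).norm_vvC_le one_pos.le (mem_ball_self one_pos) x

theorem airy_contraction (h1 : IntegrableOn φ (Ioi s))
    (h2 : MemLp φ 2 (volume.restrict (Ioi s))) (hε : 0 < ε) :
    Integrable (fun l : ℝ => rexp (2 * ε * l) * ‖airyT τ s φ l‖ ^ 2) ∧
    ∫ l : ℝ, rexp (2 * ε * l) * ‖airyT τ s φ l‖ ^ 2 ≤ rexp (2 * (ε ^ 3 / 3 - ε * τ ^ 2))
      * ∫ y in Ioi s, rexp (-(2 * ε * y)) * ‖φ y‖ ^ 2 := by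
  obtain ⟨C, η, hC, hη, ha⟩ := aexp_line_bound (τ ^ 2) hε
  set a : ℝ → ℂ := fun t => aexp (τ ^ 2 : ℝ) (ε + t * I) with hadef
  have ham : Continuous a := by rw [hadef]; unfold aexp; fun_prop
  have hai : Integrable a := ((integrable_exp_neg_mul_sq hη).const_mul C).mono'
    ham.aestronglyMeasurable (.of_forall ha)
  set f : ℝ → ℂ := (Ioi s).indicator fun y => rexp (-(ε * y)) * φ y with hf
  have hexp : ∀ y ∈ Ioi s, ‖(rexp (-(ε * y)) : ℂ)‖ ≤ rexp (-(ε * s)) := fun y hy => by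
    rw [norm_real, Real.norm_of_nonneg (Real.exp_pos _).le]
    exact Real.exp_le_exp.mpr (neg_le_neg (mul_le_mul_of_nonneg_left (le_of_lt hy) hε.le))
  have hexpm : AEStronglyMeasurable (fun y : ℝ => (rexp (-(ε * y)) : ℂ))
    (volume.restrict (Ioi s)) := (by fun_prop : Measurable _).aestronglyMeasurable
  have hfr : IntegrableOn (fun y => (rexp (-(ε * y)) : ℂ) * φ y) (Ioi s) :=
    Integrable.bdd_mul h1 hexpm ((ae_restrict_iff' measurableSet_Ioi).mpr
      (.of_forall hexp))
  have hf1 : Integrable f := hfr.integrable_indicator measurableSet_Ioi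
  have hf2 : MemLp f 2 := by
    rw [hf, memLp_indicator_iff_restrict measurableSet_Ioi]
    refine (h2.norm.const_mul (rexp (-(ε * s)))).mono' (hexpm.mul h2.1)
      ((ae_restrict_iff' measurableSet_Ioi).mpr (.of_forall fun y hy => ?_))
    rw [norm_mul]
    exact mul_le_mul_of_nonneg_right (hexp y hy) (norm_nonneg _)
  obtain ⟨hF2, hFn⟩ := memLp_fourier hf1 hf2
  have hFb : ∀ x, ‖𝓕 f x‖ ≤ ∫ y, ‖f y‖ := fun x =>
    VectorFourier.norm_fourierIntegral_le_integral_norm _ _ _ _ _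
  have hFc : Continuous (𝓕 f) := VectorFourier.fourierIntegral_continuous
    Real.continuous_fourierChar (by exact continuous_inner) hf1
  have hpi : (2 * π) ≠ 0 := by positivity
  set q : ℝ → ℂ := fun t => a t * 𝓕 f (t / (2 * π)) with hq
  have hqm : Continuous q := by rw [hq]; fun_prop
  have hna : ∀ t, ‖a t‖ ≤ rexp (ε ^ 3 / 3 - ε * τ ^ 2) := fun t => by
    change ‖aexp (τ ^ 2 : ℝ) (ε + t * I)‖ ≤ _
    rw [aexp, norm_exp, Real.exp_le_exp]
    have e : ((ε + t * I) ^ 3 / 3 - (ε + t * I) * (τ ^ 2 : ℝ) : ℂ)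
        = ((ε ^ 3 / 3 - ε * t ^ 2 - ε * τ ^ 2 : ℝ) : ℂ)
          + ((ε ^ 2 * t - t ^ 3 / 3 - t * τ ^ 2 : ℝ) : ℂ) * I := by
      push_cast
      linear_combination (ε * t ^ 2 + t ^ 3 / 3 * I) * I_sq
    rw [e, add_re, ofReal_re, re_ofReal_mul, I_re, mul_zero, add_zero]
    have : 0 ≤ ε * t ^ 2 := by positivity
    linarith
  have hq1 : Integrable q := by
    refine (hai.norm.mul_const (∫ y, ‖f y‖)).mono' hqm.aestronglyMeasurable
      (.of_forall fun t => ?_)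
    rw [hq, norm_mul]
    gcongr
    exact hFb _
  have hF2' := ((memLp_two_iff_integrable_sq_norm hF2.1).mp hF2)
  have hqb : ∀ t, ‖q t‖ ^ 2 ≤ rexp (2 * (ε ^ 3 / 3 - ε * τ ^ 2))
      * ‖𝓕 f (t / (2 * π))‖ ^ 2 := fun t => by
    rw [hq, norm_mul, mul_pow, two_mul (ε ^ 3 / 3 - ε * τ ^ 2), Real.exp_add, ← sq]
    gcongr
    exact hna t
  have hFs := (hF2'.comp_div hpi).const_mul (rexp (2 * (ε ^ 3 / 3 - ε * τ ^ 2)))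
  have hq2 : MemLp q 2 := (memLp_two_iff_integrable_sq_norm hqm.aestronglyMeasurable).mpr
    (hFs.mono' (by fun_prop) (.of_forall fun t => by
      rw [Real.norm_of_nonneg (by positivity)]
      exact hqb t))
  obtain ⟨hQ2, hQn⟩ := memLp_fourier hq1 hq2
  have hQ2' := ((memLp_two_iff_integrable_sq_norm hQ2.1).mp hQ2)
  have hff : ∀ t : ℝ, 𝓕 f (t / (2 * π)) = ∫ y in Ioi s, φ y * cexp (-(y * (ε + t * I))) := by
    intro t
    rw [Real.fourier_real_eq_integral_exp_smul, ← integral_indicator measurableSet_Ioi]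
    congr 1 with y
    rw [hf]
    by_cases hy : y ∈ Ioi s
    · rw [Set.indicator_of_mem hy, Set.indicator_of_mem hy, smul_eq_mul, ofReal_exp, ← mul_assoc,
        ← Complex.exp_add, mul_comm]
      congr 2
      push_cast
      field_simp
      ring
    · rw [Set.indicator_of_notMem hy, Set.indicator_of_notMem hy, smul_zero]
  have key : ∀ l : ℝ, rexp (ε * l) * airyT τ s φ l
      = ((2 * π)⁻¹ : ℝ) * 𝓕 q (l / (2 * π)) := by
    intro l
    have hsw : airyT τ s φ l = ∫ y in Ioi s, ∫ t : ℝ, (2 * π : ℂ)⁻¹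
        * (φ y * cexp (-((y + l) * (ε + t * I))) * a t) := by
      refine integral_congr_ae (.of_forall fun y => ?_)
      beta_reduce
      have := vvC_one_eq (τ := τ) hε (y + l)
      rw [ofReal_add] at this
      rw [this, integral_const_mul, ← mul_assoc, mul_comm (φ y), mul_assoc, ← integral_const_mul]
      simp only [hadef, mul_assoc]
      push_cast
      rfl
    rw [hsw, integral_integral_swap]
    · rw [Real.fourier_real_eq_integral_exp_smul, ← integral_const_mul, ← integral_const_mul]
      congr 1 with t
      change _ = ((2 * π)⁻¹ : ℝ) * cexp (↑(-2 * π * t * (l / (2 * π))) * I)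
        • (a t * 𝓕 f (t / (2 * π)))
      rw [hff, integral_const_mul, mul_left_comm, smul_eq_mul, ofReal_inv, ofReal_mul 2 π,
        ofReal_ofNat]
      congr 1
      rw [← integral_const_mul, ← integral_const_mul, ← integral_const_mul]
      congr 1 with y
      have e : (rexp (ε * l) : ℂ) * cexp (-((y + l) * (ε + t * I)))
          = cexp (↑(-2 * π * t * (l / (2 * π))) * I) * cexp (-(y * (ε + t * I))) := by
        rw [ofReal_exp, ← Complex.exp_add, ← Complex.exp_add]
        congr 1
        push_cast
        field_simp
        ring
      grind
    · have hp := (hfr.mul_prod hai)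
      refine (hp.const_mul ((2 * π : ℂ)⁻¹ * rexp (-(ε * l)))).mono ?_
        (.of_forall fun p => ?_)
      · refine (AEStronglyMeasurable.mul (AEStronglyMeasurable.mul h1.1.comp_fst ?_)
          ham.aestronglyMeasurable.comp_snd).const_mul _
        fun_prop
      · simp only [Function.uncurry, norm_mul, norm_exp, norm_real,
          Real.norm_of_nonneg (Real.exp_pos _).le]
        have e : (-((p.1 + l) * (ε + p.2 * I)) : ℂ).re = -(ε * p.1) + -(ε * l) := by
          simp
          ring
        rw [e, Real.exp_add]
        apply le_of_eq
        ring
  have hsq : ∀ l : ℝ, rexp (2 * ε * l) * ‖airyT τ s φ l‖ ^ 2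
      = ((2 * π)⁻¹) ^ 2 * ‖𝓕 q (l / (2 * π))‖ ^ 2 := by
    intro l
    have := congrArg (fun z => ‖z‖ ^ 2) (key l)
    beta_reduce at this
    rw [norm_mul, norm_mul, mul_pow, mul_pow, norm_real, Real.norm_of_nonneg (Real.exp_pos _).le,
      ← Real.exp_nat_mul] at this
    rw [show 2 * ε * l = (2 : ℕ) * (ε * l) by push_cast; ring, this]
    congr 2
    rw [norm_real, Real.norm_of_nonneg (by positivity)]
  simp only [hsq]
  refine ⟨(hQ2'.comp_div hpi).const_mul _, ?_⟩
  have e1 : ∫ y in Ioi s, rexp (-(2 * ε * y)) * ‖φ y‖ ^ 2 = ∫ y, ‖f y‖ ^ 2 := by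
    rw [← integral_indicator measurableSet_Ioi]
    congr 1 with y
    rw [hf]
    by_cases hy : y ∈ Ioi s
    · rw [Set.indicator_of_mem hy, Set.indicator_of_mem hy, norm_mul, mul_pow, norm_real,
        Real.norm_of_nonneg (Real.exp_pos _).le, ← Real.exp_nat_mul]
      congr 2
      push_cast
      ring
    · rw [Set.indicator_of_notMem hy, Set.indicator_of_notMem hy, norm_zero, zero_pow two_ne_zero]
  have i1 : ∫ l : ℝ, ‖𝓕 q (l / (2 * π))‖ ^ 2 = 2 * π * ∫ t, ‖q t‖ ^ 2 := by
    rw [Measure.integral_comp_div (fun x => ‖𝓕 q x‖ ^ 2), smul_eq_mul, hQn,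
      abs_of_pos (by positivity)]
  have i2 : ∫ l : ℝ, ‖𝓕 f (l / (2 * π))‖ ^ 2 = 2 * π * ∫ y, ‖f y‖ ^ 2 := by
    rw [Measure.integral_comp_div (fun x => ‖𝓕 f x‖ ^ 2), smul_eq_mul, hFn,
      abs_of_pos (by positivity)]
  have i3 : ∫ t, ‖q t‖ ^ 2 ≤ rexp (2 * (ε ^ 3 / 3 - ε * τ ^ 2))
      * (2 * π * ∫ y, ‖f y‖ ^ 2) := by
    rw [← i2, ← integral_const_mul]
    exact integral_mono ((memLp_two_iff_integrable_sq_norm hq2.1).mp hq2) hFs hqb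
  rw [integral_const_mul, i1, e1]
  calc _ = (2 * π)⁻¹ * ∫ t, ‖q t‖ ^ 2 := by field_simp
    _ ≤ (2 * π)⁻¹ * _ := mul_le_mul_of_nonneg_left i3 (by positivity)
    _ = _ := by field_simp

end

section
variable {τ s : ℝ}

theorem conj_vvC_one (τ x : ℝ) : conj (vvC τ 1 x) = vvC τ 1 x := by
  rw [vvC, lap, ← integral_conj, ← integral_neg_eq_self]
  congr 1 with t
  have e : conj (lineZ τ (-t)) = lineZ τ t := by simp [lineZ]
  simp only [aexp, Pi.zero_apply, Pi.one_apply, map_mul, ← exp_conj, map_add, map_neg, map_sub,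
    map_div₀, map_pow, map_one, map_inv₀, map_zero, conj_ofReal, e, map_ofNat]

theorem continuous_of_differentiableOn_add {F : ℂ → ℂ}
    (h : ∀ x : ℝ, DifferentiableOn ℂ (fun h => F (x + h)) (ball 0 1)) :
    Continuous fun x : ℝ => F x := by
  refine continuous_iff_continuousAt.mpr fun x => ?_
  have h1 := (h x).continuousOn.continuousAt (ball_mem_nhds 0 one_pos)
  have h2 : ContinuousAt (fun y : ℝ => ((y - x : ℝ) : ℂ)) x := by fun_prop
  have h3 := ContinuousAt.comp_of_eq h1 h2 (by simp)
  simpa [Function.comp_def] using h3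

theorem continuous_vvC_one (τ : ℝ) : Continuous fun x : ℝ => vvC τ 1 x :=
  continuous_of_differentiableOn_add (L1_one τ).differentiableOn_vvC

theorem lap_factor {r : ℂ → ℂ} {N : ℝ} (hr : L1 τ N r) (x y : ℝ) :
    kkC τ (fun z w => (z - w)⁻¹ * r (-w)) x y
      = ∫ l in Ioi (0 : ℝ), vvC τ 1 (x + l) * vvC τ r (y + l) := by
  set c : (ℂ → ℂ) → ℝ → ℝ → ℂ := fun r x t => cexp (-(x * lineZ τ t))
    * ((2 * π : ℂ)⁻¹ * (aexp (τ ^ 2 : ℝ) (lineZ τ t) * r (lineZ τ t))) with hc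
  have h0 : Measurable (0 : ℝ → ℂ) := measurable_const
  have hci : ∀ {r : ℂ → ℂ} {N : ℝ}, L1 τ N r → ∀ x, Integrable (c r x) := fun hr x => by
    have := integrable_lap (by fun_prop) h0 hr.measurable (lineZ_re τ) (b := 0)
      (fun p => by simp) hr.integrable (h := 0) (by simp) x 0
    simpa [hc] using this
  have hA : ∀ (r : ℂ → ℂ) (x l : ℝ), vvC τ r (x + l)
      = ∫ t, cexp (-(l * lineZ τ t)) * c r x t := fun r x l => by
    rw [vvC, lap]
    congr 1 with t
    simp only [hc, Pi.zero_apply, mul_zero, add_zero]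
    rw [add_mul, neg_add, Complex.exp_add]
    ring
  have hAA : ∀ l : ℝ, vvC τ 1 (x + l) * vvC τ r (y + l) = ∫ p : ℝ × ℝ,
      cexp (-(lineZ τ p.1 + lineZ τ p.2) * l) * (c 1 x p.1 * c r y p.2) := fun l => by
    rw [hA, hA, Measure.volume_eq_prod, ← integral_prod_mul]
    congr 1 with p
    rw [neg_add, add_mul, Complex.exp_add]
    ring_nf
  simp only [hAA]
  have hA0 := lineA_pos τ
  rw [(laplace_integral (μ := volume) (κ := fun p : ℝ × ℝ => -(lineZ τ p.1 + lineZ τ p.2)) (r := -(2 * lineA τ))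
    (by fun_prop) (by linarith) (fun p => by rw [neg_re, add_re, lineZ_re, lineZ_re]; ring)
    ((hci (L1_one τ) x).mul_prod (hci hr y)) 0).2, kkC, lap, ← integral_neg]
  congr 1 with p
  simp only [hc, neg_neg, Pi.one_apply, ofReal_zero, mul_zero, Complex.exp_zero, inv_neg,
    sub_neg_eq_add]
  rw [mul_neg, Complex.exp_add]
  ring

theorem airy_factor (τ x y : ℝ) : kkC τ (fun z w => (z - w)⁻¹) x y
    = ∫ l in Ioi (0 : ℝ), vvC τ 1 (x + l) * vvC τ 1 (y + l) := by
  simpa using lap_factor (L1_one τ) x y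

theorem laplace_vvC {r : ℂ → ℂ} {N : ℝ} (hr : L1 τ N r) {σ : ℝ} (hσ : |σ| = |τ|) (x : ℝ) :
    vvC τ (fun z => r z * (z - σ)⁻¹) x
      = ∫ l in Ioi (0 : ℝ), cexp (σ * l) * vvC τ r (x + l) := by
  have h0 : Measurable (0 : ℝ → ℂ) := measurable_const
  set c : ℝ → ℂ := fun t => cexp (-(x * lineZ τ t))
    * ((2 * π : ℂ)⁻¹ * (aexp (τ ^ 2 : ℝ) (lineZ τ t) * r (lineZ τ t))) with hc
  have hci : Integrable c := by
    have := integrable_lap (by fun_prop) h0 hr.measurable (lineZ_re τ) (b := 0)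
      (fun p => by simp) hr.integrable (h := 0) (by simp) x 0
    simpa [hc] using this
  have hA : ∀ l : ℝ, cexp (σ * l) * vvC τ r (x + l) = ∫ t, cexp (-(lineZ τ t - σ) * l) * c t :=
    fun l => by
    rw [vvC, lap, ← integral_const_mul]
    congr 1 with t
    simp only [hc, Pi.zero_apply, mul_zero, add_zero]
    rw [← mul_assoc, ← Complex.exp_add, ← mul_assoc (cexp _) (cexp _), ← Complex.exp_add]
    ring_nf
  simp only [hA]
  have hA0 : -(lineA τ - σ) < 0 := by rw [lineA, ← hσ]; linarith [le_abs_self σ]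
  rw [(laplace_integral (κ := fun t => -(lineZ τ t - σ)) (by fun_prop) hA0
    (fun t => by rw [neg_re, sub_re, lineZ_re, ofReal_re]) hci 0).2, vvC, lap, ← integral_neg]
  congr 1 with t
  simp only [hc, Pi.zero_apply, mul_zero, add_zero, ofReal_zero, Complex.exp_zero, inv_neg]
  ring

theorem airy_memLp (τ s : ℝ) :
    MemLp (fun x => rexp (-(lineA τ * x))) 2 (volume.restrict (Ioi s)) :=
  memLp_exp_neg (lineA_pos τ) s

theorem integrableOn_exp_lineA (τ s : ℝ) :
    IntegrableOn (fun x => rexp (-(lineA τ * x))) (Ioi s) := by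
  simpa only [neg_mul] using integrableOn_exp_mul_Ioi (neg_lt_zero.mpr (lineA_pos τ)) s

theorem airy_kdom (τ : ℝ) : KDom (fun x => rexp (-(lineA τ * x))) (1 * gW τ ^ 2)
    (airyKernel τ) := by
  have e : ∀ x y : ℝ, airyKernel τ x y = kkC τ (fun z w => (z - w)⁻¹) (x + 0) (y + 0) := fun x y => by
    rw [airyKernel_eq, kk_eq, add_zero, add_zero]
  constructor
  · simp only [e]
    exact LL.airy.measurable_kkC 0
  · intro p
    beta_reduce
    rw [e]
    exact LL.airy.norm_kkC_le one_pos.le (mem_ball_self one_pos) _ _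

section
variable {φ : ℝ → ℂ}

theorem differentiableOn_airyT (h1 : IntegrableOn φ (Ioi s)) (x : ℝ) :
    DifferentiableOn ℂ (fun h => airyT τ s φ (x + h)) (ball 0 1) := by
  refine differentiableOn_integral_of_bound (bound := fun y => ‖φ y‖ * (1 * gW τ
    * rexp (-(lineA τ * (s + x))))) (fun h _ => ?_) (.of_forall fun y => ?_)
    ((ae_restrict_iff' measurableSet_Ioi).mpr (.of_forall fun y hy h hh => ?_))
    (h1.norm.mul_const _)
  · refine h1.1.mul ?_
    have := (L1_one τ).measurable_vvC (x + h)
    exact this.aestronglyMeasurable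
  · have := (L1_one τ).differentiableOn_vvC (y + x)
    push_cast at this
    simp only [add_assoc] at this
    exact this.const_mul _
  · rw [norm_mul]
    have := (L1_one τ).norm_vvC_le one_pos.le hh (y + x)
    rw [← add_assoc, ← ofReal_add]
    have hg := gW_pos τ
    have hA := lineA_pos τ
    have hy' : s < y := hy
    refine mul_le_mul_of_nonneg_left (this.trans ?_) (norm_nonneg _)
    gcongr

theorem continuous_airyT (h1 : IntegrableOn φ (Ioi s)) :
    Continuous fun l : ℝ => airyT τ s φ l :=
  continuous_of_differentiableOn_add (differentiableOn_airyT h1)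

theorem norm_airyT_le (h1 : IntegrableOn φ (Ioi s)) (l : ℝ) :
    ‖airyT τ s φ l‖ ≤ (∫ y in Ioi s, ‖φ y‖) * (gW τ * rexp (-(lineA τ * s)))
      * rexp (-(lineA τ * l)) := by
  rw [mul_assoc, ← integral_mul_const]
  refine norm_integral_le_of_norm_le (h1.norm.mul_const _)
    ((ae_restrict_iff' measurableSet_Ioi).mpr (.of_forall fun y hy => ?_))
  have := norm_airy_le τ (y + l)
  rw [ofReal_add] at this
  rw [norm_mul, mul_assoc, ← Real.exp_add]
  refine mul_le_mul_of_nonneg_left (this.trans ?_) (norm_nonneg _)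
  have hg := gW_pos τ
  have hA := lineA_pos τ
  have hy' : s < y := hy
  gcongr
  nlinarith

/-- A function that is equal to its Airy transform on `(-1, 0)` up to zero vanishes. -/
theorem airyT_eq_zero (h1 : IntegrableOn φ (Ioi s))
    (h : ∀ᵐ l : ℝ ∂(volume.restrict (Ioo (-1 : ℝ) 0)), airyT τ s φ l = 0) (l : ℝ) :
    airyT τ s φ l = 0 := by
  have h0 := Measure.eqOn_open_of_ae_eq h isOpen_Ioo (continuous_airyT h1).continuousOn
    continuousOn_const
  set U : Set ℂ := im ⁻¹' Ioo (-1) 1 with hU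
  have hUo : IsOpen U := isOpen_Ioo.preimage continuous_im
  have hd : DifferentiableOn ℂ (airyT τ s φ) U := fun z hz => by
    refine DifferentiableAt.differentiableWithinAt ?_
    have hz' : z.im * I ∈ ball (0 : ℂ) 1 := by
      rw [mem_ball_zero_iff, norm_mul, norm_I, mul_one, norm_real]
      exact abs_lt.mpr hz
    have h2 := ((differentiableOn_airyT (τ := τ) h1 z.re)).differentiableAt
      (Metric.isOpen_ball.mem_nhds hz')
    have h3 : DifferentiableAt ℂ (fun w : ℂ => w - z.re) z := by fun_prop
    have h4 : z - z.re = z.im * I := by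
      nth_rw 1 [← re_add_im z]
      ring
    have := DifferentiableAt.comp (g := fun h => airyT τ s φ (z.re + h)) z (by rw [h4]; exact h2) h3
    simpa [Function.comp_def] using this
  have hconv : IsPreconnected U :=
    (((convex_Ioo (-1 : ℝ) 1).linear_preimage imLm)).isPreconnected
  have hfreq : ∃ᶠ z in 𝓝[≠] (((-1 / 2 : ℝ)) : ℂ), airyT τ s φ z = 0 := by
    have h5 : ∀ᶠ x : ℝ in 𝓝[≠] (-1 / 2 : ℝ), airyT τ s φ x = 0 :=
      mem_nhdsWithin_of_mem_nhds (Filter.mem_of_superset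
        (Ioo_mem_nhds (by norm_num) (by norm_num)) fun x hx => h0 hx)
    have h6 : Tendsto (fun x : ℝ => (x : ℂ)) (𝓝[≠] (-1 / 2 : ℝ)) (𝓝[≠] (((-1 / 2 : ℝ)) : ℂ)) :=
      tendsto_nhdsWithin_iff.mpr ⟨(continuous_ofReal.tendsto _).mono_left nhdsWithin_le_nhds,
        eventually_nhdsWithin_of_forall fun x hx => fun e => hx (ofReal_injective e)⟩
    exact h6.frequently h5.frequently
  refine AnalyticOnNhd.eqOn_zero_of_preconnected_of_frequently_eq_zero
    (hd.analyticOnNhd hUo) hconv (z₀ := ((-1 / 2 : ℝ) : ℂ)) ?_ hfreq ?_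
  · simp [hU]
  · simp [hU]

end

theorem airy_injective (φ : Lp ℂ 2 (volume.restrict (Ioi s)))
    (h : ∀ᵐ x ∂(volume.restrict (Ioi s)), φ x = ∫ y in Ioi s, airyKernel τ x y * φ y) :
    φ = 0 := by
  have hk := airy_kdom τ
  have hm := airy_memLp τ s
  have hφL := Lp.memLp φ
  have hgn : 0 ≤ 1 * gW τ ^ 2 := by positivity
  have h1 : IntegrableOn φ (Ioi s) := by
    refine ((integrableOn_exp_lineA τ s).const_mul (‖hm.toLp _‖ * (1 * gW τ ^ 2) * ‖φ‖)).mono' hφL.1 ?_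
    filter_upwards [h] with x hx
    rw [hx]
    exact hk.norm_integral_le hm (fun _ => (Real.exp_pos _).le) hgn φ x
  set B := (∫ y in Ioi s, ‖φ y‖) * (gW τ * rexp (-(lineA τ * s)))
  have hB : ∀ l : ℝ, ‖airyT τ s φ l‖ ≤ B * rexp (-(lineA τ * l)) := norm_airyT_le h1
  have hFc := continuous_airyT (τ := τ) h1
  have hAc : Continuous fun p : ℝ × ℝ => vvC τ 1 (p.1 + p.2) := by
    simpa [Function.comp_def] using (continuous_vvC_one τ).comp (continuous_fst.add continuous_snd)
  have hAb : ∀ x l : ℝ, ‖vvC τ 1 (x + l)‖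
      ≤ gW τ * rexp (-(lineA τ * x)) * rexp (-(lineA τ * l)) := fun x l => by
    have := norm_airy_le τ (x + l)
    rwa [mul_add, neg_add, Real.exp_add, ofReal_add, ← mul_assoc] at this
  have hgw := gW_pos τ
  have hAs : ∀ x l : ℝ, s < x → 0 < l → ‖vvC τ 1 (x + l)‖ ≤ gW τ * rexp (-(lineA τ * s)) := by
    intro x l hx hl
    refine (hAb x l).trans ?_
    have hA := lineA_pos τ
    rw [mul_assoc, ← Real.exp_add]
    gcongr
    nlinarith
  have hsol : ∀ᵐ x ∂(volume.restrict (Ioi s)),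
      φ x = ∫ l in Ioi (0 : ℝ), vvC τ 1 (x + l) * airyT τ s φ l := by
    filter_upwards [h] with x hx
    rw [hx]
    have e : ∀ y, airyKernel τ x y * φ y
        = ∫ l in Ioi (0 : ℝ), vvC τ 1 (x + l) * vvC τ 1 (y + l) * φ y := fun y => by
      rw [airyKernel_eq, kk_eq, airy_factor, integral_mul_const]
    simp only [e]
    rw [integral_integral_swap]
    · congr 1 with l
      rw [airyT, ← integral_const_mul]
      grind
    · have i1 := (h1.norm.mul_prod (integrableOn_exp_lineA τ 0)).const_mul
        (gW τ * rexp (-(lineA τ * x)) * (gW τ * rexp (-(lineA τ * s))))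
      refine i1.mono' ?_ ?_
      · refine (Continuous.aestronglyMeasurable ?_).mul h1.1.comp_fst
        have a1 : Continuous fun p : ℝ × ℝ => vvC τ 1 (x + p.2) :=
          hAc.comp (by fun_prop : Continuous fun p : ℝ × ℝ => (x, p.2))
        exact a1.mul hAc
      · rw [Measure.prod_restrict]
        refine (ae_restrict_iff' (measurableSet_Ioi.prod measurableSet_Ioi)).mpr
          (.of_forall fun p hp => ?_)
        simp only [Function.uncurry, norm_mul]
        have b1 := hAb x p.2
        have b2 := hAs p.1 p.2 hp.1 hp.2
        calc _ ≤ gW τ * rexp (-(lineA τ * x)) * rexp (-(lineA τ * p.2))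
              * (gW τ * rexp (-(lineA τ * s))) * ‖φ p.1‖ := by gcongr
          _ = _ := by ring
  have hnorm : ‖φ‖ ^ 2 = ∫ l in Ioi (0 : ℝ), ‖airyT τ s φ l‖ ^ 2 := by
    have e0 : ((‖φ‖ ^ 2 : ℝ) : ℂ) = ((∫ l in Ioi (0 : ℝ), ‖airyT τ s φ l‖ ^ 2 : ℝ) : ℂ) := by
      rw [norm_sq_eq_integral, ← integral_complex_ofReal, ← integral_complex_ofReal]
      have e1 : ∫ x in Ioi s, ((‖φ x‖ ^ 2 : ℝ) : ℂ)
          = ∫ x in Ioi s, ∫ l in Ioi (0 : ℝ),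
            conj (φ x) * (vvC τ 1 (x + l) * airyT τ s φ l) := by
        refine integral_congr_ae ?_
        filter_upwards [hsol] with x hx
        rw [integral_const_mul, ← hx, ofReal_pow, conj_mul']
      rw [e1, integral_integral_swap]
      · congr 1 with l
        rw [ofReal_pow, ← mul_conj', airyT, mul_comm, ← integral_conj, ← integral_mul_const]
        congr 1 with x
        have := conj_vvC_one τ (x + l)
        rw [ofReal_add] at this
        grind
      · have hB0 : 0 ≤ B := by positivity
        have i1 := (h1.norm.mul_prod (integrableOn_exp_lineA τ 0)).const_mul
          (gW τ * rexp (-(lineA τ * s)) * B)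
        refine i1.mono' ?_ ?_
        · exact (continuous_conj.comp_aestronglyMeasurable h1.1).comp_fst.mul
            (hAc.aestronglyMeasurable.mul hFc.aestronglyMeasurable.comp_snd)
        · rw [Measure.prod_restrict]
          refine (ae_restrict_iff' (measurableSet_Ioi.prod measurableSet_Ioi)).mpr
            (.of_forall fun p hp => ?_)
          simp only [Function.uncurry, norm_mul, RCLike.norm_conj]
          have b1 := hB p.2
          have b2 := hAs p.1 p.2 hp.1 hp.2
          calc _ ≤ ‖φ p.1‖ * (gW τ * rexp (-(lineA τ * s)) * (B * rexp (-(lineA τ * p.2)))) := by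
                gcongr
            _ = _ := by ring
    exact_mod_cast e0
  have hmain : ∀ ε : ℝ, 0 < ε → rexp (-(2 * ε)) * (∫ l in Ioo (-1 : ℝ) 0, ‖airyT τ s φ l‖ ^ 2)
      + ‖φ‖ ^ 2 ≤ rexp (2 * (ε ^ 3 / 3 - ε * τ ^ 2)) * (rexp (-(2 * ε * s)) * ‖φ‖ ^ 2) := by
    intro ε hε
    obtain ⟨i1, i2⟩ := airy_contraction (τ := τ) h1 hφL hε
    set w : ℝ → ℝ := fun l => rexp (2 * ε * l) * ‖airyT τ s φ l‖ ^ 2 with hw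
    have hw0 : ∀ l, 0 ≤ w l := fun l => by rw [hw]; positivity
    have hsqi : ∀ S : Set ℝ, MeasurableSet S → S ⊆ Ioi (-1) →
        IntegrableOn (fun l : ℝ => ‖airyT τ s φ l‖ ^ 2) S := fun S hS hsub => by
      refine ((i1.const_mul (rexp (2 * ε))).integrableOn (s := S)).mono'
        (hFc.norm.pow 2).aestronglyMeasurable ((ae_restrict_iff' hS).mpr (.of_forall fun l hl => ?_))
      have hl' : -1 < l := hsub hl
      rw [Real.norm_of_nonneg (by positivity), ← mul_assoc, ← Real.exp_add]
      refine le_mul_of_one_le_left (by positivity) (Real.one_le_exp ?_)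
      nlinarith
    have j1 : rexp (-(2 * ε)) * (∫ l in Ioo (-1 : ℝ) 0, ‖airyT τ s φ l‖ ^ 2)
        ≤ ∫ l in Ioo (-1 : ℝ) 0, w l := by
      rw [← integral_const_mul]
      refine setIntegral_mono_on ((hsqi _ measurableSet_Ioo fun l hl => hl.1).const_mul _)
        i1.integrableOn measurableSet_Ioo fun l hl => ?_
      refine mul_le_mul_of_nonneg_right (Real.exp_le_exp.mpr ?_) (by positivity)
      nlinarith [hl.1]
    have j2 : ‖φ‖ ^ 2 ≤ ∫ l in Ioi (0 : ℝ), w l := by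
      rw [hnorm]
      refine setIntegral_mono_on (hsqi _ measurableSet_Ioi (Set.Ioi_subset_Ioi (by norm_num)))
        i1.integrableOn measurableSet_Ioi fun l (hl : 0 < l) => ?_
      exact le_mul_of_one_le_left (by positivity) (Real.one_le_exp (by positivity))
    have j3 : (∫ l in Ioo (-1 : ℝ) 0, w l) + ∫ l in Ioi (0 : ℝ), w l ≤ ∫ l, w l := by
      have hdis : Disjoint (Ioo (-1 : ℝ) 0) (Ioi 0) :=
        Set.disjoint_left.mpr fun l h1 h2 => lt_asymm h1.2 h2
      rw [← setIntegral_union hdis measurableSet_Ioi i1.integrableOn i1.integrableOn]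
      exact setIntegral_le_integral i1 (.of_forall hw0)
    have j4 : ∫ y in Ioi s, rexp (-(2 * ε * y)) * ‖φ y‖ ^ 2
        ≤ rexp (-(2 * ε * s)) * ‖φ‖ ^ 2 := by
      have hsq := (memLp_two_iff_integrable_sq_norm hφL.1).mp hφL
      rw [norm_sq_eq_integral, ← integral_const_mul]
      refine integral_mono_of_nonneg (.of_forall fun y => by positivity)
        (hsq.const_mul _) ((ae_restrict_iff' measurableSet_Ioi).mpr (.of_forall
          fun y hy => ?_))
      have hy' : s < y := hy
      beta_reduce
      gcongr
    have j5 := mul_le_mul_of_nonneg_left j4 (Real.exp_pos (2 * (ε ^ 3 / 3 - ε * τ ^ 2))).le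
    linarith
  have hlim : (∫ l in Ioo (-1 : ℝ) 0, ‖airyT τ s φ l‖ ^ 2) + ‖φ‖ ^ 2 ≤ ‖φ‖ ^ 2 := by
    set P := ∫ l in Ioo (-1 : ℝ) 0, ‖airyT τ s φ l‖ ^ 2
    have t1 : Continuous fun ε : ℝ => rexp (-(2 * ε)) * P + ‖φ‖ ^ 2 := by fun_prop
    have t2 : Continuous fun ε : ℝ => rexp (2 * (ε ^ 3 / 3 - ε * τ ^ 2))
        * (rexp (-(2 * ε * s)) * ‖φ‖ ^ 2) := by fun_prop
    have := le_of_tendsto_of_tendsto (t1.continuousWithinAt (s := Ioi 0) (x := 0))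
      t2.continuousWithinAt (eventually_nhdsWithin_of_forall hmain)
    simpa using this
  have hzero : ∀ᵐ l : ℝ ∂(volume.restrict (Ioo (-1 : ℝ) 0)), airyT τ s φ l = 0 := by
    have i1 : IntegrableOn (fun l : ℝ => ‖airyT τ s φ l‖ ^ 2) (Ioo (-1 : ℝ) 0) :=
      ((by fun_prop : Continuous fun l : ℝ => ‖airyT τ s φ l‖ ^ 2).integrableOn_Icc).mono_set
        Set.Ioo_subset_Icc_self
    have i2 : ∫ l in Ioo (-1 : ℝ) 0, ‖airyT τ s φ l‖ ^ 2 = 0 :=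
      le_antisymm (by linarith) (integral_nonneg fun l => by positivity)
    have i3 := (integral_eq_zero_iff_of_nonneg (fun l => by positivity) i1).mp i2
    filter_upwards [i3] with l hl
    simpa using hl
  have hF := airyT_eq_zero (τ := τ) h1 hzero
  refine Lp.eq_zero_iff_ae_eq_zero.mpr ?_
  filter_upwards [hsol] with x hx
  rw [hx]
  simp [hF]

theorem airy_isUnit (τ s : ℝ) :
    IsUnit (1 - integralOp (volume.restrict (Ioi s)) (airyKernel τ)) :=
  (airy_kdom τ).isUnit_of_injective (airy_memLp τ s) (fun _ => (Real.exp_pos _).le) (by positivity)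
    airy_injective

end

/-! ### The function `R_τ` -/
theorem DecayNear.deriv {f : ℂ → ℂ} {ρ C ε t : ℝ} {z : ℂ} (h : DecayNear f ρ C ε t z)
    (hρ : 0 < ρ) : DecayNear (deriv f) (ρ / 2) (C / (ρ / 2)) ε t z := fun w hw => by
  have h' : DecayNear f (ρ / 2) C ε t w := fun v hv => h v (by
    have := norm_add_le (v - w) (w - z)
    rw [sub_add_sub_cancel] at this
    linarith)
  refine ⟨?_, h'.norm_deriv_le (by linarith)⟩
  have : DifferentiableOn ℂ f (ball w (ρ / 2)) := fun v hv =>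
    (h' v (by rw [mem_ball, dist_eq_norm] at hv; exact hv.le)).1.differentiableWithinAt
  exact (this.analyticAt (ball_mem_nhds w (by linarith))).deriv.differentiableAt

theorem halfRay_deriv {f : ℂ → ℂ} {ρ C ε v : ℝ} {d : ℂ} (hρ : 0 < ρ) (hε : 0 < ε)
    (h : ∀ t : ℝ, 0 ≤ t → DecayNear f ρ C ε t (v + t * d)) : halfRay v d (deriv f) = -f v := by
  have hi := integrableOn_halfRay (f := deriv f) (d := d) (v := v) (by linarith : 0 ≤ ρ / 2) hε
    fun t ht => (h t ht).deriv hρ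
  have hl : Tendsto (fun t : ℝ => f (v + t * d)) atTop (𝓝 0) := by
    have h2 : Tendsto (fun t : ℝ => C * rexp (-ε * t ^ 2)) atTop (𝓝 (C * 0)) := by
      refine (Real.tendsto_exp_atBot.comp ?_).const_mul C
      exact (tendsto_pow_atTop two_ne_zero).const_mul_atTop_of_neg (by linarith)
    rw [mul_zero] at h2
    refine squeeze_zero_norm' ?_ h2
    filter_upwards [eventually_ge_atTop 0] with t ht
    exact (h t ht (v + t * d) (by rw [sub_self, norm_zero]; exact hρ.le)).2
  have := integral_Ioi_of_hasDerivAt_of_tendsto' (f := fun t : ℝ => f (v + t * d)) (a := 0)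
    (f' := fun t : ℝ => d * deriv f (v + t * d)) (fun t ht => ?_) hi hl
  · simpa [halfRay] using this
  · have h1 := (h t ht (v + t * d) (by simpa using hρ.le)).1.hasDerivAt
    have h2 : HasDerivAt (fun t : ℝ => (v + t * d : ℂ)) d t := by
      simpa using ((ofRealCLM.hasDerivAt (x := t)).mul_const d).const_add (v : ℂ)
    have := h1.comp t h2
    rwa [mul_comm] at this

theorem RayDecay.deriv {f : ℂ → ℂ} {ρ C ε v : ℝ} {d : ℂ} (hρ : 0 < ρ) (hε : 0 < ε)
    (h : RayDecay f ρ C ε v d) :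
    RayDecay (deriv f) (ρ / 2) (C / (ρ / 2)) ε v d ∧ ray v d (deriv f) = 0 :=
  ⟨fun t ht => ⟨(h t ht).1.deriv hρ, (h t ht).2.deriv hρ⟩, by
    rw [ray, halfRay_deriv hρ hε fun t ht => (h t ht).1,
      halfRay_deriv hρ hε fun t ht => (h t ht).2, sub_self, mul_zero]⟩

theorem Rfun_eq (τ s : ℝ) :
    Rfun τ s = s + (expP τ s)⁻¹ * vv τ (fun z => (z + τ)⁻¹ * (z + τ)⁻¹) s := by
  set e := aexp (s + τ ^ 2 : ℝ) with he
  have hde := decayExp_aexp (s + τ ^ 2)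
  have hA := two_le_lineA τ
  have hAτ : -τ + 2 ≤ lineA τ := by rw [lineA]; linarith [neg_abs_le τ]
  set p : ℝ := -τ with hp
  set q : ℝ := p - 4 with hq
  have i1 : RegOn (fun z => (z - p)⁻¹) (p - 2) (p - 1 / 2) _ := regOn_inv_right (by linarith) _
  have i2 : RegOn (fun z => (z - p)⁻¹) (p + 1) (lineA τ + 1) _ :=
    regOn_inv_left (p := p) (by rw [ofReal_re]; linarith) _
  have iq : RegOn (fun z => (z - q)⁻¹) (p - 2) (lineA τ + 1) _ :=
    regOn_inv_left (p := q) (by rw [ofReal_re, hq]; linarith) _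
  have jR : RegOn (fun z => 4 * (1 + (p + q : ℝ) * (z - q)⁻¹)) (p - 2) (lineA τ + 1) _ :=
    (regOn_const 4 _ _).mul ((regOn_const 1 _ _).add ((regOn_const _ _ _).mul iq))
  have jQ : RegOn (fun z => (z - q)⁻¹ * ((1 - 4 * s : ℝ) + (-4 : ℂ) * (z - q)⁻¹)) (p - 2)
    (lineA τ + 1) _ := iq.mul ((regOn_const _ _ _).add ((regOn_const _ _ _).mul iq))
  set G : ℂ → ℂ := fun z => e z * ((z - p)⁻¹ * (z - q)⁻¹) with hG
  have key : ∀ z : ℂ, z ≠ p → z ≠ q → e z * ((z - p)⁻¹ * (z - p)⁻¹)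
      = e z * (4 * (1 + (p + q : ℝ) * (z - q)⁻¹)) + e z * ((z - q)⁻¹ * ((1 - 4 * s : ℝ)
        + (-4 : ℂ) * (z - q)⁻¹) * (z - p)⁻¹) + -4 * deriv G z := by
    intro z h1 h2
    have h1' := sub_ne_zero.mpr h1
    have h2' := sub_ne_zero.mpr h2
    have d1 : HasDerivAt e ((z ^ 2 - (s + τ ^ 2)) * e z) z := by
      have : HasDerivAt (fun z : ℂ => z ^ 3 / 3 - z * (s + τ ^ 2 : ℝ)) (z ^ 2 - (s + τ ^ 2)) z := by
        have h3 := ((hasDerivAt_pow 3 z).div_const 3).sub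
          ((hasDerivAt_id z).mul_const ((s + τ ^ 2 : ℝ) : ℂ))
        refine h3.congr_deriv ?_
        push_cast
        ring
      have := this.cexp
      rw [mul_comm] at this
      exact this
    have d2 := (((hasDerivAt_id z).sub_const (p : ℂ)).inv h1').mul
      (((hasDerivAt_id z).sub_const (q : ℂ)).inv h2')
    have d3 := (d1.mul d2).deriv
    have d4 : deriv G z = _ := d3
    rw [d4]
    simp only [id, Pi.mul_apply, Pi.inv_apply, Pi.sub_apply]
    have e3 : z - q = z - p + 4 := by rw [hq]; push_cast; ring
    have e4 : z = (z - p) + p := by ring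
    rw [e3] at h2' ⊢
    have e5 : z ^ 2 - (s + τ ^ 2 : ℂ) = (z - p) * (z - p + 2 * p) - s := by
      rw [hp]; push_cast; ring
    have e6 : ((p + q : ℝ) : ℂ) = 2 * p - 4 := by rw [hq]; push_cast; ring
    rw [e5, e6]
    generalize z - p = y at *
    push_cast
    field_simp
    ring
  have cne : ∀ z : ℂ, z.re = lineA τ → z ≠ p ∧ z ≠ q := fun z hz => by
    constructor <;> rintro rfl <;> rw [ofReal_re] at hz <;> linarith
  have hv : vv τ (fun z => (z + τ)⁻¹ * (z + τ)⁻¹) s = vl (lineA τ) (fun z => e z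
      * (4 * (1 + (p + q : ℝ) * (z - q)⁻¹))) + vl (lineA τ) (fun z => e z * ((z - q)⁻¹
        * ((1 - 4 * s : ℝ) + (-4 : ℂ) * (z - q)⁻¹) * (z - p)⁻¹)) := by
    obtain ⟨ρ, C, ε, hρ, hC, hε, h⟩ := hde.exists_rayDecay
      (i2.mul (iq.mono (by linarith) le_rfl)) (v₀ := lineA τ) (v₁ := lineA τ) (by linarith)
      (by linarith) (by linarith) (by linarith)
    have h' := h 0 le_rfl zero_le_one I steepDir_I (Or.inr ⟨by linarith, by linarith⟩)
    simp only [zero_mul, add_zero] at h'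
    obtain ⟨k1, k2⟩ := h'.deriv hρ hε
    have k3 := integrable_vl (by linarith) hε k1
    have l1 := hde.integrable_vl jR (c := lineA τ) (by linarith) (by linarith) (by linarith)
    have l2 := hde.integrable_vl ((jQ.mono (by linarith) le_rfl).mul i2) (c := lineA τ)
      (by linarith) (by linarith) (by linarith)
    rw [ray_I_eq_vl k3] at k2
    have e1 : vv τ (fun z => (z + τ)⁻¹ * (z + τ)⁻¹) s = vl (lineA τ) (fun z => (e z
      * (4 * (1 + (p + q : ℝ) * (z - q)⁻¹)) + e z * ((z - q)⁻¹
        * ((1 - 4 * s : ℝ) + (-4 : ℂ) * (z - q)⁻¹) * (z - p)⁻¹)) + -4 * deriv G z) :=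
      vl_congr fun z hz => by
        rw [← key z (cne z hz).1 (cne z hz).2, hp, ofReal_neg, sub_neg_eq_add]
    rw [e1, vl_add (l1.add l2) (k3.const_mul _), vl_add l1 l2, vl_const_mul, k2, mul_zero, add_zero]
  have hc : contourDown (p - 1) (fun z => e z * ((z - p)⁻¹ * (z - p)⁻¹))
      = contourDown (p - 1) (fun z => e z
      * (4 * (1 + (p + q : ℝ) * (z - q)⁻¹))) + contourDown (p - 1) (fun z => e z * ((z - q)⁻¹
        * ((1 - 4 * s : ℝ) + (-4 : ℂ) * (z - q)⁻¹) * (z - p)⁻¹)) := by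
    obtain ⟨ρ, C, ε, hρ, hC, hε, h⟩ := hde.exists_rayDecay
      (i1.mul (iq.mono le_rfl (by linarith))) (v₀ := p - 1) (v₁ := p - 1) (by linarith)
      (by linarith) (by linarith) (by linarith)
    have h' := h 0 le_rfl zero_le_one _ steepDir_exp (Or.inl exp_dir_re)
    simp only [zero_mul, add_zero] at h'
    obtain ⟨k1, k2⟩ := h'.deriv hρ hε
    have k0 := contourDown_eq_ray (by linarith) hε k1
    rw [k2, neg_zero] at k0
    have k3 := k1.integrableOn_ray (exp_ne_zero _) (by linarith) hε
    have l1 := hde.integrableOn_ray jR (a := p - 1) (by linarith) (by linarith)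
    have l2 := hde.integrableOn_ray ((jQ.mono le_rfl (by linarith)).mul i1) (a := p - 1)
      (by linarith) (by linarith)
    rw [contourDown_congr fun z h1 h2 => key z (fun h => ?_) (fun h => ?_),
      contourDown_add (a := p - 1) (f := fun z => e z * (4 * (1 + (p + q : ℝ) * (z - q)⁻¹))
        + e z * ((z - q)⁻¹ * ((1 - 4 * s : ℝ) + (-4 : ℂ) * (z - q)⁻¹) * (z - p)⁻¹))
        (g := fun z => -4 * deriv G z) (l1.1.add l2.1) (l1.2.add l2.2) (k3.1.const_mul (-4))
        (k3.2.const_mul (-4)), contourDown_add (a := p - 1) l1.1 l1.2 l2.1 l2.2, contourDown_const_mul, k0, mul_zero, add_zero]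
    · rw [h, ofReal_re, ofReal_im, abs_zero] at h2
      linarith
    · rw [h, ofReal_re] at h1
      linarith
  rw [hde.contourDown_eq jR (c := lineA τ) (by linarith) (by linarith) (by linarith) (by linarith)
    (by linarith), hde.contourDown_cross (c := lineA τ) jQ (by linarith) (by linarith) (by linarith)
    (by linarith) (by linarith)] at hc
  have hR : Rfun τ s = -(expP τ s)⁻¹
      * contourDown (p - 1) (fun z => e z * ((z - p)⁻¹ * (z - p)⁻¹)) := by
    rw [Rfun, expP, ← Complex.exp_neg]
    congr 2
    · ring_nf
    · ext z
      rw [he, aexp, hp]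
      push_cast
      grind
  have hep : e p = expP τ s := by
    rw [he, aexp, expP, hp]
    push_cast
    ring_nf
  have hpq : (p - q : ℂ) = 4 := by rw [hq]; push_cast; ring
  rw [hR, hc, hv, ← he, hep, hpq]
  have hne : expP τ s ≠ 0 := exp_ne_zero _
  generalize vl _ _ = V
  generalize vl _ _ = V'
  push_cast
  field_simp
  ring

/-! ### The Hankel operator and the symmetry of the Baik-Rains function -/

section
variable {τ s n n' : ℝ} {f g P Q : ℝ → ℂ}

/-- The Hankel operator whose square is the Airy kernel on `(s, ∞)`. -/
def hankT (τ s : ℝ) (f : ℝ → ℂ) (x : ℝ) : ℂ := ∫ y in Ioi s, vvC τ 1 (x + y - s : ℝ) * f y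

/-- The exponential that dominates the Airy kernel. -/
def mA (τ x : ℝ) : ℝ := rexp (-(lineA τ * x))

@[fun_prop]
theorem measurable_mA (τ : ℝ) : Measurable (mA τ) := by unfold mA; fun_prop

theorem mA_pos (τ x : ℝ) : 0 < mA τ x := Real.exp_pos _

/-- The functions to which the Hankel operator applies. -/
def Adm (τ s : ℝ) (f : ℝ → ℂ) : Prop :=
  Measurable f ∧ IntegrableOn (fun y => mA τ y * ‖f y‖) (Ioi s)

theorem Dom.adm (hf : Dom (mA τ) n f) (s : ℝ) : Adm τ s f := by
  refine ⟨hf.1, (((memLp_two_iff_integrable_sq (airy_memLp τ s).1).mp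
    (airy_memLp τ s)).const_mul n).mono' ?_ (.of_forall fun y => ?_)⟩
  · have := hf.1
    fun_prop
  · rw [Real.norm_of_nonneg (mul_nonneg (mA_pos τ y).le (norm_nonneg _))]
    calc _ ≤ mA τ y * (n * mA τ y) := mul_le_mul_of_nonneg_left (hf.2 y) (mA_pos τ y).le
      _ = n * rexp (-(lineA τ * y)) ^ 2 := by rw [mA]; ring

theorem Adm.integrable_mul (hf : Adm τ s f) (hg : Dom (mA τ) n g) :
    IntegrableOn (fun x => f x * g x) (Ioi s) := by
  refine (hf.2.const_mul n).mono' (hf.1.mul hg.1).aestronglyMeasurable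
    (.of_forall fun y => ?_)
  rw [norm_mul]
  calc _ ≤ ‖f y‖ * (n * mA τ y) := mul_le_mul_of_nonneg_left (hg.2 y) (norm_nonneg _)
    _ = _ := by ring

theorem hank_le (τ s x y : ℝ) :
    ‖vvC τ 1 (x + y - s : ℝ)‖ ≤ gW τ * rexp (lineA τ * s) * (mA τ x * mA τ y) := by
  refine (norm_airy_le τ _).trans (le_of_eq ?_)
  rw [mA, mA, mul_assoc, ← Real.exp_add, ← Real.exp_add]
  ring_nf

theorem measurable_hank (τ s : ℝ) : Measurable fun p : ℝ × ℝ => vvC τ 1 (p.1 + p.2 - s : ℝ) :=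
  (continuous_vvC_one τ).measurable.comp (by fun_prop)

theorem Adm.hankT (hf : Adm τ s f) : ∃ n, Dom (mA τ) n (hankT τ s f) := by
  refine ⟨gW τ * rexp (lineA τ * s) * ∫ y in Ioi s, mA τ y * ‖f y‖,
    ((measurable_hank τ s).mul (hf.1.comp measurable_snd)).stronglyMeasurable.integral_prod_right'
      |>.measurable, fun x => ?_⟩
  rw [mul_right_comm, ← integral_const_mul]
  refine norm_integral_le_of_norm_le (hf.2.const_mul _) (.of_forall fun y => ?_)
  rw [norm_mul]
  calc _ ≤ gW τ * rexp (lineA τ * s) * (mA τ x * mA τ y) * ‖f y‖ := by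
        gcongr
        exact hank_le τ s x y
    _ = _ := by ring

theorem hankT_swap (hf : Adm τ s f) (hg : Adm τ s g) :
    ∫ x in Ioi s, f x * hankT τ s g x = ∫ x in Ioi s, hankT τ s f x * g x := by
  simp only [hankT, ← integral_const_mul, ← integral_mul_const]
  rw [integral_integral_swap]
  · grind
  · refine ((hf.2.mul_prod hg.2).const_mul (gW τ * rexp (lineA τ * s))).mono' ?_
      (.of_forall fun p => ?_)
    · exact ((hf.1.comp measurable_fst).mul ((measurable_hank τ s).mul
        (hg.1.comp measurable_snd))).aestronglyMeasurable
    · simp only [Function.uncurry, norm_mul]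
      calc _ ≤ ‖f p.1‖ * (gW τ * rexp (lineA τ * s) * (mA τ p.1 * mA τ p.2) * ‖g p.2‖) := by
            gcongr
            exact hank_le τ s _ _
        _ = _ := by ring

theorem dom_hank (τ s x : ℝ) : Dom (mA τ) (gW τ * rexp (lineA τ * s) * mA τ x)
    fun y => vvC τ 1 (x + y - s : ℝ) :=
  ⟨(measurable_hank τ s).comp (f := fun y => (x, y)) (by fun_prop), fun y =>
    (hank_le τ s x y).trans (le_of_eq (by ring))⟩

theorem Adm.integrable_hank (hf : Adm τ s f) (x : ℝ) :
    IntegrableOn (fun y => vvC τ 1 (x + y - s : ℝ) * f y) (Ioi s) := by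
  simpa only [mul_comm] using hf.integrable_mul (dom_hank τ s x)

theorem airy_hankT (hf : Adm τ s f) (x : ℝ) :
    ∫ y in Ioi s, airyKernel τ x y * f y = hankT τ s (hankT τ s f) x := by
  rw [hankT, hankT_swap ((dom_hank τ s x).adm s) hf]
  congr 1
  ext y
  rw [airyKernel_eq, kk_eq, airy_factor]
  congr 1
  have := integral_Ioi_add (fun z => vvC τ 1 (y + z - s : ℝ) * vvC τ 1 (x + z - s : ℝ)) 0 s
  rw [zero_add] at this
  rw [hankT, this]
  congr 1 with l
  push_cast
  ring_nf

theorem hankT_sub (hf : Adm τ s f) (hg : Adm τ s g) :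
    hankT τ s (fun x => f x - g x) = fun x => hankT τ s f x - hankT τ s g x := by
  ext x
  rw [hankT, hankT, hankT, ← integral_sub (hf.integrable_hank x) (hg.integrable_hank x)]
  simp only [mul_sub]

theorem hankT_const_mul (c : ℂ) :
    hankT τ s (fun x => c * f x) = fun x => c * hankT τ s f x := by
  ext x
  rw [hankT, hankT, ← integral_const_mul]
  simp only [mul_left_comm]

theorem Adm.const_mul (hf : Adm τ s f) (c : ℂ) : Adm τ s fun x => c * f x :=
  ⟨hf.1.const_mul c, by simpa only [norm_mul, mul_left_comm, IntegrableOn] using hf.2.const_mul ‖c‖⟩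

theorem Adm.sub (hf : Adm τ s f) (hg : Adm τ s g) : Adm τ s fun x => f x - g x :=
  ⟨hf.1.sub hg.1, (hf.2.add hg.2).mono' (by
    have := hf.1
    have := hg.1
    fun_prop) (.of_forall fun y => by
    rw [Real.norm_of_nonneg (mul_nonneg (mA_pos τ y).le (norm_nonneg _)), Pi.add_apply, ← mul_add]
    exact mul_le_mul_of_nonneg_left (norm_sub_le _ _) (mA_pos τ y).le)⟩

theorem airy_solution (s : ℝ) (hf : Dom (mA τ) n f) :
    ∃ n' P, Dom (mA τ) n' P ∧ ∀ x, P x = f x + hankT τ s (hankT τ s P) x := by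
  have hm := airy_memLp τ s
  have hK := (airy_kdom τ).hasKernel hm (fun _ => (Real.exp_pos _).le) (by positivity)
  set φ := resolventApply (volume.restrict (Ioi s)) (airyKernel τ) f
  have hs := resolventApply_solves hK (airy_isUnit τ s) (hf.memLp hm)
  have hφ : Adm τ s φ := ⟨(Lp.stronglyMeasurable φ).measurable,
    hm.integrable_mul (Lp.memLp φ).norm⟩
  obtain ⟨n₁, h1⟩ := hφ.hankT
  obtain ⟨n₂, h2⟩ := (h1.adm s).hankT
  have hP : hankT τ s φ = hankT τ s (f + hankT τ s (hankT τ s φ)) := by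
    ext x
    refine integral_congr_ae ?_
    filter_upwards [hs] with y hy
    rw [hy, airy_hankT hφ, Pi.add_apply]
  refine ⟨n + n₂, f + hankT τ s (hankT τ s φ), ⟨hf.1.add h2.1, fun x => ?_⟩, fun x => ?_⟩
  · rw [add_mul]
    exact (norm_add_le _ _).trans (add_le_add (hf.2 x) (h2.2 x))
  · rw [← hP, Pi.add_apply]

theorem airy_pairing (hg : Adm τ s g) (hf : Dom (mA τ) n f) (hP : Dom (mA τ) n' P)
    (he : ∀ x, P x = f x + hankT τ s (hankT τ s P) x) :
    ResolventPairingDefined (volume.restrict (Ioi s)) (airyKernel τ) g f ∧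
    resolventPairing (volume.restrict (Ioi s)) (airyKernel τ) g f
      = ∫ x in Ioi s, g x * P x := by
  have hm := airy_memLp τ s
  have hK := (airy_kdom τ).hasKernel hm (fun _ => (Real.exp_pos _).le) (by positivity)
  have h1 := resolventApply_ae_eq hK (airy_isUnit τ s) (hf.memLp hm) (hP.memLp hm)
    (.of_forall fun x => by rw [airy_hankT (hP.adm s)]; exact he x)
  have h2 : (fun x => g x * resolventApply (volume.restrict (Ioi s)) (airyKernel τ) f x)
      =ᵐ[volume.restrict (Ioi s)] fun x => g x * P x := by
    filter_upwards [h1] with x hx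
    rw [hx]
  exact ⟨⟨⟨_, hK⟩, airy_isUnit τ s, hf.memLp hm, (hg.integrable_mul hP).congr h2.symm⟩,
    integral_congr_ae h2⟩

theorem L1.dom {r : ℂ → ℂ} {N : ℝ} (hr : L1 τ N r) (hN : 0 ≤ N) :
    Dom (mA τ) (N * gW τ) fun x => vvC τ r x :=
  ⟨by simpa using hr.measurable_vvC 0, fun x => by
    rw [mA]
    simpa using hr.norm_vvC_le hN (mem_ball_self one_pos) x⟩

theorem adm_exp {σ : ℝ} (hσ : |σ| = |τ|) : Adm τ s fun x => cexp (σ * (x - s)) := by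
  refine ⟨by fun_prop, ?_⟩
  have hA : 0 < lineA τ - σ := by rw [lineA, ← hσ]; linarith [le_abs_self σ]
  refine ((integrableOn_exp_mul_Ioi (neg_lt_zero.mpr hA) s).const_mul (rexp (-(σ * s)))).congr
    (.of_forall fun x => ?_)
  beta_reduce
  rw [mA, ← ofReal_sub, ← ofReal_mul, norm_exp, ofReal_re, ← Real.exp_add, ← Real.exp_add]
  ring_nf

theorem laplace_Ioi {r : ℂ → ℂ} {N : ℝ} (hr : L1 τ N r) {σ : ℝ} (hσ : |σ| = |τ|) (x : ℝ) :
    ∫ y in Ioi s, cexp (σ * (y - s)) * vvC τ r (x + y - s : ℝ)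
      = vvC τ (fun z => r z * (z - σ)⁻¹) x := by
  have := integral_Ioi_add (fun y => cexp (σ * (y - s)) * vvC τ r (x + y - s : ℝ)) 0 s
  rw [zero_add] at this
  rw [this, laplace_vvC hr hσ]
  congr 1 with l
  push_cast
  ring_nf

theorem hankT_exp {σ : ℝ} (hσ : |σ| = |τ|) :
    hankT τ s (fun x => cexp (σ * (x - s))) = fun x : ℝ => vvC τ (fun z => (z - σ)⁻¹) x := by
  ext x
  have := laplace_Ioi (s := s) (L1_one τ) hσ x
  simp only [Pi.one_apply, one_mul] at this
  rw [← this, hankT]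
  simp only [mul_comm]

theorem Psi_neg_eq' (τ s x : ℝ) : Psi (-τ) x
    = (expP τ s)⁻¹ * cexp ((-τ : ℝ) * (x - s)) - vvC τ (fun z => (z - τ)⁻¹) x := by
  rw [Psi_neg_eq, vv_eq, neg_add_eq_sub]
  congr 1
  rw [aexp, expP, ← Complex.exp_neg, ← Complex.exp_add]
  congr 1
  push_cast
  ring

theorem Phi_neg_eq' (τ s x : ℝ) : Phi (-τ) s x
    = expP τ s * hankT τ s (fun y => vvC τ (fun z => (z - τ)⁻¹) y) x
      - vvC τ (fun z => (z + τ)⁻¹) x := by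
  have h1 := lap_factor (L1_inv_sub (τ := τ)) x s
  have h2 := integral_Ioi_add (fun y => vvC τ 1 (x + y - s : ℝ) * vvC τ (fun z => (z - τ)⁻¹) y) 0 s
  rw [zero_add] at h2
  have h3 : kkC τ (fun z w => (z - w)⁻¹ * (w + τ)⁻¹) x s
      = -kkC τ (fun z w => (z - w)⁻¹ * (-w - τ)⁻¹) x s := by
    rw [kkC, kkC, lap, lap, ← integral_neg]
    congr 1
    ext p
    rw [show -lineZ τ p.2 + τ = -(lineZ τ p.2 - τ) by ring, neg_neg, inv_neg]
    ring
  rw [Phi_neg_eq, vv_eq, kk_eq, h3, h1, hankT, h2, mul_neg, neg_neg]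
  congr 3
  ext l
  rw [← add_assoc, add_sub_cancel_right, add_comm l s]
  push_cast
  rfl

theorem lineA_neg (τ : ℝ) : lineA (-τ) = lineA τ := by rw [lineA, lineA, abs_neg]
theorem vvC_neg (τ : ℝ) : vvC (-τ) = vvC τ := by
  ext r x
  rw [vvC, vvC, neg_sq, show lineZ (-τ) = lineZ τ from funext fun t => by rw [lineZ, lineZ, lineA_neg]]

theorem expP_neg (τ s : ℝ) : expP (-τ) s = (expP τ s)⁻¹ := by
  rw [expP, expP, ← Complex.exp_neg]
  congr 1
  push_cast
  ring

theorem Dom.const_mul_sub (hf : Dom (mA τ) n f) (hg : Dom (mA τ) n' g) (c : ℂ) :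
    Dom (mA τ) (‖c‖ * n + n') fun x => c * f x - g x :=
  ⟨(hf.1.const_mul c).sub hg.1, fun x => (norm_sub_le _ _).trans (by
    rw [norm_mul, add_mul, mul_assoc]
    exact add_le_add (mul_le_mul_of_nonneg_left (hf.2 x) (norm_nonneg _)) (hg.2 x))⟩

theorem dom_Phi (τ s : ℝ) : ∃ n, Dom (mA τ) n (Phi (-τ) s) := by
  have hb := (L1_inv_add (τ := τ)).dom zero_le_one
  obtain ⟨n, hT⟩ := (((L1_inv_sub (τ := τ)).dom zero_le_one).adm s).hankT
  rw [show Phi (-τ) s = _ from funext (Phi_neg_eq' τ s)]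
  exact ⟨_, hT.const_mul_sub hb _⟩

theorem adm_Psi (τ s : ℝ) : Adm τ s (Psi (-τ)) := by
  rw [show Psi (-τ) = _ from funext (Psi_neg_eq' τ s)]
  exact ((adm_exp (abs_neg τ)).const_mul _).sub
    (((L1_inv_sub (τ := τ)).dom zero_le_one).adm s)

theorem br_formula (hP : Dom (mA τ) n P) (hQ : Dom (mA τ) n' Q)
    (hPe : ∀ x : ℝ, P x = vvC τ (fun z => (z - τ)⁻¹) x + hankT τ s (hankT τ s P) x)
    (hQe : ∀ x : ℝ, Q x = vvC τ (fun z => (z + τ)⁻¹) x + hankT τ s (hankT τ s Q) x) :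
    Rfun (-τ) s - resolventPairing (volume.restrict (Ioi s)) (airyKernel τ) (Psi (-τ))
      (Phi (-τ) s) = s + expP τ s * (vvC τ (fun z => (z - τ)⁻¹ * (z - τ)⁻¹) s
        + ∫ x in Ioi s, vvC τ (fun z => (z - τ)⁻¹) x * hankT τ s P x)
      + (expP τ s)⁻¹ * (vvC τ (fun z => (z + τ)⁻¹ * (z + τ)⁻¹) s
        + ∫ x in Ioi s, vvC τ (fun z => (z + τ)⁻¹) x * hankT τ s Q x)
      - (∫ x in Ioi s, vvC τ (fun z => (z - τ)⁻¹) x * Q x)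
      - ∫ x in Ioi s, vvC τ (fun z => (z + τ)⁻¹) x * P x := by
  have hp : expP τ s ≠ 0 := Complex.exp_ne_zero _
  set p := expP τ s
  have ha := (L1_inv_sub (τ := τ)).dom zero_le_one
  have hb := (L1_inv_add (τ := τ)).dom zero_le_one
  set a : ℝ → ℂ := fun x => vvC τ (fun z => (z - τ)⁻¹) x
  set b : ℝ → ℂ := fun x => vvC τ (fun z => (z + τ)⁻¹) x
  have hE : Adm τ s fun x => cexp ((-τ : ℝ) * (x - s)) := adm_exp (abs_neg τ)
  have hTE := hankT_exp (s := s) (abs_neg τ)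
  simp only [ofReal_neg, sub_neg_eq_add] at hTE hE
  set E : ℝ → ℂ := fun x => cexp (-τ * (x - s))
  obtain ⟨n₁, hTP⟩ := (hP.adm s).hankT
  obtain ⟨n₂, hTQ⟩ := (hQ.adm s).hankT
  obtain ⟨n₃, hTTQ⟩ := (hTQ.adm s).hankT
  obtain ⟨n₄, hTTP⟩ := (hTP.adm s).hankT
  have hTP' : hankT τ s a = fun x => hankT τ s P x - hankT τ s (hankT τ s (hankT τ s P)) x := by
    rw [← hankT_sub (hP.adm s) (hTTP.adm s)]
    exact congrArg _ (funext fun x => eq_sub_of_add_eq (hPe x).symm)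
  have hφ := hTP.const_mul_sub hQ p
  have hΨ : Psi (-τ) = fun x => p⁻¹ * E x - a x := by
    ext x
    rw [Psi_neg_eq' τ s x]
    simp only [E, ofReal_neg]
    rfl
  have hΦ : Phi (-τ) s = fun x => p * hankT τ s a x - b x := funext (Phi_neg_eq' τ s)
  obtain ⟨_, hΦd⟩ := dom_Phi τ s
  have key := (airy_pairing (adm_Psi τ s) hΦd hφ fun x => by
    rw [hankT_sub ((hTP.adm s).const_mul p) (hQ.adm s), hankT_const_mul,
      hankT_sub ((hTTP.adm s).const_mul p) (hTQ.adm s), hankT_const_mul, hΦ, hTP', hQe x]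
    ring).2
  have hR : Rfun (-τ) s = s + p * vvC τ (fun z => (z - τ)⁻¹ * (z - τ)⁻¹) s := by
    rw [Rfun_eq, vv_eq, expP_neg, inv_inv, vvC_neg]
    simp only [ofReal_neg, ← sub_eq_add_neg]
    rfl
  have hEb : ∫ x in Ioi s, E x * b x = vvC τ (fun z => (z + τ)⁻¹ * (z + τ)⁻¹) s := by
    have := laplace_Ioi (s := s) (L1_inv_add (τ := τ)) (abs_neg τ) s
    simp only [ofReal_neg, sub_neg_eq_add, add_sub_cancel_left] at this
    exact this
  have i1 := hE.integrable_mul hTP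
  have i2 := hE.integrable_mul hQ
  have i3 := (ha.adm s).integrable_mul hTP
  have i4 := (ha.adm s).integrable_mul hQ
  have hEQ : ∫ x in Ioi s, E x * Q x = vvC τ (fun z => (z + τ)⁻¹ * (z + τ)⁻¹) s
      + ∫ x in Ioi s, b x * hankT τ s Q x := by
    rw [show b = hankT τ s E from hTE.symm] at hEb hb ⊢
    rw [← hEb, ← hankT_swap hE (hTQ.adm s), ← integral_add (hE.integrable_mul hb)
      (hE.integrable_mul hTTQ)]
    simp only [← mul_add]
    exact integral_congr_ae (.of_forall fun x => by
      beta_reduce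
      rw [hQe x, hTE])
  have hEP := hankT_swap hE (hP.adm s)
  rw [hTE] at hEP
  have hsum : ∫ x in Ioi s, Psi (-τ) x * (p * hankT τ s P x - Q x)
      = (∫ x in Ioi s, E x * hankT τ s P x) - p⁻¹ * (∫ x in Ioi s, E x * Q x)
        - p * (∫ x in Ioi s, a x * hankT τ s P x) + ∫ x in Ioi s, a x * Q x := by
    have i5 := i1.sub (i2.const_mul p⁻¹)
    have i6 := i5.sub (i3.const_mul p)
    rw [← integral_const_mul p⁻¹, ← integral_const_mul p, ← integral_sub i1 (i2.const_mul _)]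
    refine Eq.trans ?_ ((integral_add i6 i4).trans (congrArg (· + _) (integral_sub i5
      (i3.const_mul p))))
    congr 1 with x
    simp only [hΨ, Pi.sub_apply, Pi.add_apply]
    field_simp
    ring
  grind

theorem airyKernel_neg' (τ : ℝ) : airyKernel (-τ) = airyKernel τ :=
  funext₂ (airyKernel_neg τ)

theorem mA_neg (τ : ℝ) : mA (-τ) = mA τ := funext fun x => by rw [mA, mA, lineA_neg]
theorem hankT_neg (τ : ℝ) : hankT (-τ) = hankT τ := by
  ext s f x
  rw [hankT, hankT, vvC_neg]

theorem brFactor_neg (τ s : ℝ) :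
    Rfun (-τ) s - resolventPairing (volume.restrict (Ioi s)) (airyKernel τ) (Psi (-τ))
      (Phi (-τ) s) = Rfun τ s - resolventPairing (volume.restrict (Ioi s)) (airyKernel τ)
      (Psi τ) (Phi τ s) := by
  obtain ⟨n, P, hP, hPe⟩ := airy_solution s ((L1_inv_sub (τ := τ)).dom zero_le_one)
  obtain ⟨n', Q, hQ, hQe⟩ := airy_solution s ((L1_inv_add (τ := τ)).dom zero_le_one)
  have h := br_formula (τ := -τ) (s := s) (P := Q) (Q := P) (by rwa [mA_neg]) (by rwa [mA_neg])
    (by simpa only [vvC_neg, hankT_neg, ofReal_neg, sub_neg_eq_add] using hQe)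
    (by simpa only [vvC_neg, hankT_neg, ofReal_neg, ← sub_eq_add_neg] using hPe)
  simp only [vvC_neg, hankT_neg, ofReal_neg, sub_neg_eq_add, ← sub_eq_add_neg, neg_neg, expP_neg,
    inv_inv, airyKernel_neg'] at h
  rw [br_formula hP hQ hPe hQe, h]
  ring

theorem brPairing_defined_neg (τ s : ℝ) : ResolventPairingDefined (volume.restrict (Ioi s))
    (airyKernel τ) (Psi (-τ)) (Phi (-τ) s) := by
  obtain ⟨n, h⟩ := dom_Phi τ s
  obtain ⟨n', P, hP, hPe⟩ := airy_solution s h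
  exact (airy_pairing (adm_Psi τ s) h hP hPe).1

theorem airyKernel_shift (τ x y : ℝ) :
    airyKernel 0 (x + τ ^ 2) (y + τ ^ 2) = airyKernel τ x y := by
  simp [airyKernel]

theorem FGUE_shift (τ s : ℝ) : FGUE (s + τ ^ 2) = fredholmPfaffian s (offDiag (airyKernel τ)) := by
  rw [FGUE, fredholmDet_eq_fredholmPfaffian, fredholmPfaffian, fredholmPfaffian]
  congr 1
  ext n
  rw [fredholmPfaffianTerm_add]
  simp only [offDiag, airyKernel_shift]
  rfl

theorem brPrimitive_eq (τ s : ℝ) : brPrimitive τ s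
    = fredholmPfaffian s (offDiag (airyKernel τ)) * (Rfun (-τ) s
      - resolventPairing (volume.restrict (Ioi s)) (airyKernel τ) (Psi (-τ)) (Phi (-τ) s)) := by
  rw [brPrimitive, brFactor_neg, FGUE_shift]

theorem brDefined (τ s : ℝ)
    (h : FredholmPfaffianConverges s (offDiag (airyKernel τ))) : BRDefined τ s := by
  refine ⟨(fredholmDetConverges_iff _ _).mpr (fredholmPfaffianConverges_add ?_), ?_⟩
  · simp only [offDiag, airyKernel_shift]
    exact h
  · simpa only [neg_neg, airyKernel_neg'] using brPairing_defined_neg (-τ) s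

end

/-! ### The families of operators on pairs of functions -/

section
variable {τ s t u : ℝ}

theorem integral_pair {f : Fin 2 × ℝ → ℂ} (hf : Integrable f (pairMeasure s)) :
    ∫ p, f p ∂pairMeasure s = ∑ c, ∫ x in Ioi s, f (c, x) := by
  rw [pairMeasure, integral_prod f hf, integral_count]

theorem ae_pair {P : Fin 2 × ℝ → Prop} (h : ∀ᵐ p ∂pairMeasure s, P p) (c : Fin 2) :
    ∀ᵐ x ∂volume.restrict (Ioi s), P (c, x) :=
  Measure.ae_count_iff.mp (Measure.ae_ae_of_ae_prod h) c

theorem ae_pair_gt (s : ℝ) : ∀ᵐ p ∂pairMeasure s, s < p.2 :=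
  Measure.quasiMeasurePreserving_snd.ae (ae_restrict_mem measurableSet_Ioi)

/-- The translation by `t` on pairs. -/
def pairShift (t : ℝ) : Fin 2 × ℝ ≃ᵐ Fin 2 × ℝ :=
  (MeasurableEquiv.refl _).prodCongr (MeasurableEquiv.addRight t)

theorem measurePreserving_pairShift (s t : ℝ) :
    MeasurePreserving (pairShift t) (pairMeasure s) (pairMeasure (s + t)) := by
  have h := (measurePreserving_add_right volume t).restrict_preimage_emb
    (MeasurableEquiv.addRight t).measurableEmbedding (Ioi (s + t))
  rw [Set.preimage_add_const_Ioi, add_sub_cancel_right] at h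
  exact (MeasurePreserving.id _).prod h

/-- The exchange of the two components. -/
def pairSwap : Fin 2 × ℝ ≃ᵐ Fin 2 × ℝ :=
  (MeasurableEquiv.addRight 1).prodCongr (MeasurableEquiv.refl _)

theorem pairSwap_mk (c : Fin 2) (x : ℝ) : pairSwap (c, x) = (c + 1, x) := rfl

theorem measurePreserving_pairSwap (s : ℝ) :
    MeasurePreserving pairSwap (pairMeasure s) (pairMeasure s) :=
  (measurePreserving_add_right Measure.count (1 : Fin 2)).prod (MeasurePreserving.id _)

/-- The signs of the components of `J`. -/
def eps (p : Fin 2 × ℝ) : ℂ := ![1, -1] p.1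

/-- The rescaled kernel `J⁻¹ 𝒜`. -/
def famK (τ : ℝ) (R : Fin 2 → Fin 2 → ℂ → ℂ → ℂ) (h : ℂ) (p : (Fin 2 × ℝ) × (Fin 2 × ℝ)) : ℂ :=
  -eps p.1 * kerF τ R h (pairSwap p.1, p.2)

variable {R R' : Fin 2 → Fin 2 → ℂ → ℂ → ℂ} {N : ℝ}

theorem measurable_eps : Measurable eps := measurable_fin_prod fun _ => measurable_const

theorem norm_eps (p : Fin 2 × ℝ) : ‖-eps p‖ = 1 := by
  obtain ⟨c, x⟩ := p
  fin_cases c <;> simp [eps]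

theorem holDom_famK (hR : ∀ c d, LL τ N (R c d)) (hN : 0 ≤ N) :
    HolDom (fun p : (Fin 2 × ℝ) × (Fin 2 × ℝ) => mW τ p.1.2 * mW τ p.2.2) (N * gW τ ^ 2)
      (famK τ R) := by
  have h := holDom_kerF hR hN
  refine ⟨fun z hz => ⟨?_, fun p => ?_⟩, fun p => (h.2 (pairSwap p.1, p.2)).const_mul _⟩
  · exact (measurable_eps.comp measurable_fst).neg.mul ((h.1 z hz).1.comp
      ((pairSwap.measurable.comp measurable_fst).prodMk measurable_snd))
  · rw [famK, norm_mul, norm_eps, one_mul]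
    exact (h.1 z hz).2 (pairSwap p.1, p.2)

theorem domNear_famK {M M' : ℝ} (hR : ∀ c d, LL τ M (R c d)) (hR' : ∀ c d, LL τ M' (R' c d))
    (hd : ∀ c d, LL τ N fun z w => R c d z w - R' c d z w) (hN : 0 ≤ N) :
    DomNear (fun p : (Fin 2 × ℝ) × (Fin 2 × ℝ) => mW τ p.1.2 * mW τ p.2.2) (N * gW τ ^ 2)
      (famK τ R) (famK τ R') := fun h hh p => by
  rw [famK, famK, ← mul_sub, norm_mul, norm_eps, one_mul]
  exact domNear_kerF hR hR' hd hN h hh (pairSwap p.1, p.2)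

theorem kkC_zero (τ : ℝ) (x y : ℂ) : kkC τ 0 x y = 0 := by simp [kkC, lap]
theorem kkC_neg (τ : ℝ) (R : ℂ → ℂ → ℂ) (x y : ℂ) :
    kkC τ (fun z w => -R z w) x y = -kkC τ R x y := by
  simp only [kkC, lap, mul_neg, integral_neg]

theorem vvC_zero (τ : ℝ) (x : ℂ) : vvC τ 0 x = 0 := by simp [vvC, lap]
theorem vvC_neg_fun (τ : ℝ) (r : ℂ → ℂ) (x : ℂ) : vvC τ (fun z => -r z) x = -vvC τ r x := by
  simp only [vvC, lap, mul_neg, integral_neg]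

theorem famK_lim (τ h : ℝ) (p q : Fin 2 × ℝ) : famK τ RmatLim h (p, q)
    = if p.1 = q.1 then rexp (-(sg τ p.1 * p.2)) * rexp (sg τ q.1 * q.2)
      * airyKernel τ (p.2 + h) (q.2 + h) else 0 := by
  have e : airyKernel τ (p.2 + h) (q.2 + h) = kkC τ (fun z w => (z - w)⁻¹) (p.2 + h) (q.2 + h) := by
    rw [airyKernel_eq, kk_eq]
    push_cast
    rfl
  rw [e]
  obtain ⟨c, x⟩ := p
  obtain ⟨d, y⟩ := q
  fin_cases c <;> fin_cases d <;>
    simp [famK, kerF, eps, pairSwap_mk, RmatLim, sg, kkC_zero, kkC_neg, -ofReal_exp]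
  all_goals exact Or.inl (by ring)

theorem integral_famK_lim {h x : ℝ} {c : Fin 2} {φ : Fin 2 × ℝ → ℂ}
    (hi : Integrable (fun q => famK τ RmatLim h ((c, x), q) * φ q) (pairMeasure s)) :
    ∫ q, famK τ RmatLim h ((c, x), q) * φ q ∂pairMeasure s = rexp (-(sg τ c * x))
      * ∫ y in Ioi s, airyKernel τ (x + h) (y + h) * (rexp (sg τ c * y) * φ (c, y)) := by
  rw [integral_pair hi, Finset.sum_eq_single c (fun d _ hd => ?_) (by simp), ← integral_const_mul]
  · congr 1 with y
    rw [famK_lim, if_pos rfl]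
    ring
  · simp [famK_lim, hd.symm]

/-- Solutions of `f = K f` for the Airy kernel `K` vanish, also when they grow exponentially. -/
theorem airy_injective_adm {f : ℝ → ℂ} (hf : Adm τ s f)
    (h : ∀ᵐ x ∂volume.restrict (Ioi s), f x = ∫ y in Ioi s, airyKernel τ x y * f y) :
    f =ᵐ[volume.restrict (Ioi s)] 0 := by
  obtain ⟨_, h1⟩ := hf.hankT
  obtain ⟨_, h2⟩ := (h1.adm s).hankT
  have hL : MemLp f 2 (volume.restrict (Ioi s)) := by
    refine (h2.memLp (airy_memLp τ s)).ae_eq ?_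
    filter_upwards [h] with x hx
    rw [hx, airy_hankT hf]
  have h3 := airy_injective (τ := τ) (hL.toLp f) (by
    filter_upwards [h, hL.coeFn_toLp] with x hx hx'
    rw [hx', hx]
    refine integral_congr_ae ?_
    filter_upwards [hL.coeFn_toLp] with y hy
    rw [hy])
  have h4 := hL.coeFn_toLp
  rw [h3] at h4
  exact h4.symm.trans (Lp.coeFn_zero _ _ _)

theorem isUnit_famK_lim (τ s : ℝ) :
    IsUnit (1 - integralOp (pairMeasure s) fun x y => famK τ RmatLim 0 (x, y)) := by
  have hK : KDom (fun p : Fin 2 × ℝ => mW τ p.2) (1 * gW τ ^ 2)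
      fun x y => famK τ RmatLim 0 (x, y) :=
    (holDom_famK (LL_RmatLim τ) zero_le_one).1 0 (mem_ball_self one_pos)
  have hm := memLp_pair (memLp_mW τ s)
  refine hK.isUnit_of_injective hm (fun p => (mW_pos τ _).le) (by positivity) fun φ hφ => ?_
  have hφL := Lp.memLp φ
  have hz : ∀ c, ∀ᵐ x ∂volume.restrict (Ioi s), φ (c, x) = 0 := fun c => by
    have hA : Adm τ s fun x => rexp (sg τ c * x) * φ (c, x) := by
      constructor
      · fun_prop
      · have h1 : Integrable (fun p : Fin 2 × ℝ => mW τ p.2 * ‖φ p‖) (pairMeasure s) :=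
          hm.integrable_mul (p := 2) (q := 2) hφL.norm
        have h2 := Measure.ae_count_iff.mp h1.prod_right_ae c
        refine h2.mono' ?_ (.of_forall fun y => ?_)
        · fun_prop
        · beta_reduce
          rw [norm_mul (Complex.ofReal _), norm_real, Real.norm_of_nonneg (Real.exp_pos _).le, ← mul_assoc, norm_mul,
            norm_norm, Real.norm_of_nonneg (mul_nonneg (mA_pos τ y).le (Real.exp_pos _).le), mA,
            mul_comm (rexp _)]
          exact mul_le_mul_of_nonneg_right (exp_mul_exp_le (sg_or τ c)) (norm_nonneg _)
    have h3 := airy_injective_adm hA (by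
      filter_upwards [ae_pair hφ c] with x hx
      have h4 := integral_famK_lim (h := 0) (hK.integrable hm (c, x) hφL)
      rw [ofReal_zero] at h4
      rw [hx, h4, ← mul_assoc, ← ofReal_mul, ← Real.exp_add, add_neg_cancel, Real.exp_zero,
        ofReal_one, one_mul]
      simp only [add_zero])
    filter_upwards [h3] with x hx
    exact (mul_eq_zero.mp hx).resolve_left (ofReal_ne_zero.mpr (Real.exp_pos _).ne')
  refine (Lp.eq_zero_iff_ae_eq_zero).mpr ?_
  have hms : MeasurableSet {p | φ p = 0} :=
    (Lp.stronglyMeasurable φ).measurable (measurableSet_singleton 0)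
  exact (Measure.ae_prod_iff_ae_ae hms).mpr (Measure.ae_count_iff.mpr hz)

/-- A constant for the row and column vectors. -/
def rB (τ : ℝ) : ℝ := lineA τ + 10 + ‖aexp (τ ^ 2 : ℝ) τ‖

theorem rB_ge (τ : ℝ) : 10 ≤ rB τ ∧ lineA τ ≤ rB τ ∧ ‖aexp (τ ^ 2 : ℝ) τ‖ ≤ rB τ := by
  have := lineA_pos τ
  have := norm_nonneg (aexp (τ ^ 2 : ℝ) τ)
  exact ⟨by rw [rB]; linarith, by rw [rB]; linarith, by rw [rB]; linarith⟩

/-- The rescaled row vector, with the rational factor `q` of its first component. -/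
def famG (τ s : ℝ) (q : ℂ → ℂ) : ℂ → Fin 2 × ℝ → ℂ :=
  rowF τ s ![1 - τ, -(1 - τ)] 0 ![q, fun z => -(z - τ)⁻¹] ![0, aexp (τ ^ 2 : ℝ) τ]

/-- The rescaled column vector. -/
def famF (τ s : ℝ) (Q₀ Q₁ : ℂ → ℂ → ℂ) (q : ℂ → ℂ) (β : ℂ) : ℂ → Fin 2 × ℝ → ℂ :=
  rowF τ s ![-(1 - τ), 1 - τ] ![fun z w => -(Q₀ z w * (w + τ)⁻¹), fun z w => -(Q₁ z w * (w + τ)⁻¹)]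
    ![q, fun z => -(z + τ)⁻¹] ![β, 0]

theorem L1.zero : L1 τ 0 0 := ⟨measurable_const, fun z _ => by simp⟩

theorem rowBd_G {q : ℂ → ℂ} (hq : L1 τ (rB τ) q) : RowBd τ (rB τ) ![1 - τ, -(1 - τ)] 0
    ![q, fun z => -(z - τ)⁻¹] ![0, aexp (τ ^ 2 : ℝ) τ] := fun c => by
  obtain ⟨h1, -, h3⟩ := rB_ge τ
  refine ⟨LL.zero.mono (by linarith), ?_⟩
  fin_cases c
  · exact ⟨hq, by simp; linarith, by simp, by simp⟩
  · exact ⟨L1_inv_sub.neg.mono (by linarith), h3, by simp, by simp⟩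

theorem rowBd_F {Q₀ Q₁ : ℂ → ℂ → ℂ} {q : ℂ → ℂ} {β : ℂ} (h0 : LL τ (rB τ) Q₀)
    (h1 : LL τ (rB τ) Q₁) (hq : L1 τ (rB τ) q) (hβ : ‖β‖ ≤ rB τ) :
    RowBd τ (rB τ) ![-(1 - τ), 1 - τ] ![fun z w => -(Q₀ z w * (w + τ)⁻¹),
      fun z w => -(Q₁ z w * (w + τ)⁻¹)] ![q, fun z => -(z + τ)⁻¹] ![β, 0] := fun c => by
  have h2 := (rB_ge τ).1
  fin_cases c
  · exact ⟨h0.mul_inv.neg, hq, hβ, by simp, by simp⟩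
  · exact ⟨h1.mul_inv.neg, L1_inv_add.neg.mono (by linarith), by simp; linarith, by simp, by simp⟩

/-- The rational factor of the rescaled `g₁`. -/
def qG (τ u : ℝ) (z : ℂ) : ℂ := (z + τ) * (z + u)⁻¹ * 2⁻¹

/-- The coefficient of the exponential function in the rescaled `h₁`. -/
def bF (τ u : ℝ) : ℂ := aexp (τ ^ 2 : ℝ) τ * (2 * (τ - u : ℂ))⁻¹

theorem norm_bF_le (hu : 8 * lineA τ ≤ u) : ‖bF τ u‖ ≤ rB τ * u⁻¹ := by
  have hA := two_le_lineA τ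
  have hu0 : 0 < u := by linarith
  rw [bF, norm_mul]
  have h1 : |τ| ≤ lineA τ := by rw [lineA]; linarith
  have h2 : ‖(2 * (τ - u : ℂ))⁻¹‖ ≤ u⁻¹ := norm_inv_le_of_re hu0 (le_trans (by
    simp
    linarith [le_abs_self τ]) (neg_le_abs _))
  obtain ⟨h3, -, h4⟩ := rB_ge τ
  have : 0 ≤ rB τ := by linarith
  gcongr

theorem inv_le_one_of (hu : 8 * lineA τ ≤ u) : 0 < u⁻¹ ∧ u⁻¹ ≤ 1 ∧ 6 * u⁻¹ ≤ 1 := by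
  have hA := two_le_lineA τ
  have hu0 : 0 < u := by linarith
  refine ⟨inv_pos.mpr hu0, inv_le_one_of_one_le₀ (by linarith), ?_⟩
  rw [← div_eq_mul_inv, div_le_one hu0]
  linarith

theorem holDom_limG (τ s : ℝ) :
    HolDom (fun p : Fin 2 × ℝ => mW τ p.2) (rB τ * rowC τ s) (famG τ s 0) := by
  have b0 := (rB_ge τ).1
  exact holDom_rowF (rowBd_G (L1.zero.mono (by linarith))) (by linarith)

theorem holDom_limF (τ s : ℝ) : HolDom (fun p : Fin 2 × ℝ => mW τ p.2) (rB τ * rowC τ s)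
    (famF τ s 0 (fun z w => (z - w)⁻¹) 0 0) := by
  have b0 := (rB_ge τ).1
  exact holDom_rowF (rowBd_F (LL.zero.mono (by linarith)) (LL.airy.mono (by linarith))
    (L1.zero.mono (by linarith)) (by simp; linarith)) (by linarith)

theorem famG_near (hu : 8 * lineA τ ≤ u) :
    HolDom (fun p : Fin 2 × ℝ => mW τ p.2) (rB τ * rowC τ s) (famG τ s (qG τ u)) ∧
    DomNear (fun p : Fin 2 × ℝ => mW τ p.2) (rB τ * u⁻¹ * rowC τ s) (famG τ s (qG τ u))
      (famG τ s 0) := by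
  obtain ⟨h1, h2, h3⟩ := rB_ge τ
  obtain ⟨i1, i2, -⟩ := inv_le_one_of hu
  have hA := lineA_pos τ
  have hq : L1 τ (rB τ * u⁻¹) (qG τ u) := (L1_g1 hu).mono (by gcongr)
  have hR := rowBd_G (hq.mono (mul_le_of_le_one_right (by linarith) i2))
  refine ⟨holDom_rowF hR (by linarith), domNear_rowF hR
    (rowBd_G (L1.zero.mono (by linarith))) (fun c => ⟨?_, ?_⟩) (by positivity)⟩
  · simp only [Pi.zero_apply, sub_self]
    exact LL.zero.mono (by positivity : 0 ≤ rB τ * u⁻¹)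
  · have := L1.zero.mono (by positivity : 0 ≤ rB τ * u⁻¹) (τ := τ)
    fin_cases c
    · exact ⟨by simpa using hq, by simp; positivity, by simp, by simp⟩
    · exact ⟨by simp only [Fin.mk_one, cons_val_one, sub_self]; exact this, by simp; positivity, by simp, by simp⟩

theorem famF_near (hu : 8 * lineA τ ≤ u) :
    HolDom (fun p : Fin 2 × ℝ => mW τ p.2) (rB τ * rowC τ s)
      (famF τ s (R22 τ u) (R12 τ u) (fun z => -r4 τ u z) (bF τ u)) ∧
    DomNear (fun p : Fin 2 × ℝ => mW τ p.2) (rB τ * u⁻¹ * rowC τ s)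
      (famF τ s (R22 τ u) (R12 τ u) (fun z => -r4 τ u z) (bF τ u))
      (famF τ s 0 (fun z w => (z - w)⁻¹) 0 0) := by
  obtain ⟨h1, -, h3⟩ := rB_ge τ
  obtain ⟨i1, i2, i3⟩ := inv_le_one_of hu
  have h22 : LL τ (rB τ * u⁻¹) (R22 τ u) := (LL_R22 hu).mono (by gcongr; linarith)
  have hr4 : L1 τ (rB τ * u⁻¹) fun z => -r4 τ u z := (L1_r4 hu).neg.mono (by gcongr; linarith)
  have hb : rB τ * u⁻¹ ≤ rB τ := mul_le_of_le_one_right (by linarith) i2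
  have hR := rowBd_F (h22.mono hb) ((LL_Rmat hu 0 1).mono h1) (hr4.mono hb) ((norm_bF_le hu).trans hb)
  refine ⟨holDom_rowF hR (by linarith), domNear_rowF hR (rowBd_F (LL.zero.mono (by linarith))
    (LL.airy.mono (by linarith)) (L1.zero.mono (by linarith)) (by simp; linarith))
    (fun c => ?_) (by positivity)⟩
  have h0 := L1.zero.mono (by positivity : 0 ≤ rB τ * u⁻¹) (τ := τ)
  fin_cases c
  · exact ⟨by simpa using h22.mul_inv.neg, by simpa using hr4, by simpa using norm_bF_le hu,
      by simp, by simp⟩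
  · refine ⟨?_, by simp only [Fin.mk_one, cons_val_one, sub_self]; exact h0, by simp; positivity, by simp, by simp⟩
    have := (LL_R12_sub hu).mul_inv.neg.mono (N' := rB τ * u⁻¹)
      (le_mul_of_one_le_left i1.le (by linarith))
    convert this using 3 with z w
    simp
    ring

/-- A common constant for the kernels and the vectors. -/
def rK (τ s : ℝ) : ℝ := rB τ * (gW τ ^ 2 + rowC τ s)

theorem rK_ge (τ s : ℝ) : 0 < rK τ s ∧ rB τ * gW τ ^ 2 ≤ rK τ s ∧ rB τ * rowC τ s ≤ rK τ s := by
  have h1 := rowC_pos τ s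
  have h2 := gW_pos τ
  have h3 : 0 < rB τ := by linarith [(rB_ge τ).1]
  refine ⟨by unfold rK; positivity, ?_, ?_⟩ <;> unfold rK <;> gcongr <;> nlinarith

theorem HolDom.mono {α : Type*} [MeasurableSpace α] {m : α → ℝ} {n n' : ℝ} {F : ℂ → α → ℂ}
    (h : HolDom m n F) (hm : ∀ p, 0 ≤ m p) (hn : n ≤ n') : HolDom m n' F :=
  ⟨fun z hz => ⟨(h.1 z hz).1, fun p => ((h.1 z hz).2 p).trans
    (mul_le_mul_of_nonneg_right hn (hm p))⟩, h.2⟩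

theorem DomNear.mono {α : Type*} {m : α → ℝ} {n n' : ℝ} {F F' : ℂ → α → ℂ}
    (h : DomNear m n F F') (hm : ∀ p, 0 ≤ m p) (hn : n ≤ n') : DomNear m n' F F' :=
  fun z hz p => (h z hz p).trans (mul_le_mul_of_nonneg_right hn (hm p))

/-- The rescaled scalar product. -/
def pairU (τ s u : ℝ) (h : ℂ) : ℂ :=
  resolventPairing (pairMeasure s) (fun x y => famK τ (Rmat τ u) h (x, y)) (famG τ s (qG τ u) h)
    (famF τ s (R22 τ u) (R12 τ u) (fun z => -r4 τ u z) (bF τ u) h)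

/-- The limit of the rescaled scalar product. -/
def pairL (τ s : ℝ) (h : ℂ) : ℂ :=
  resolventPairing (pairMeasure s) (fun x y => famK τ RmatLim h (x, y)) (famG τ s 0 h)
    (famF τ s 0 (fun z w => (z - w)⁻¹) 0 0 h)

theorem pairU_family (τ s : ℝ) : ∃ r B : ℝ, 0 < r ∧ r ≤ 1 ∧
    DifferentiableOn ℂ (pairL τ s) (ball 0 r) ∧
    (∀ᶠ u in atTop, DifferentiableOn ℂ (pairU τ s u) (ball 0 r) ∧
      ∀ h ∈ ball (0 : ℂ) r, IsUnit (1 - integralOp (pairMeasure s)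
        fun x y => famK τ (Rmat τ u) h (x, y)) ∧ ‖pairU τ s u h‖ ≤ B) ∧
    ∀ h ∈ ball (0 : ℂ) r, IsUnit (1 - integralOp (pairMeasure s)
        fun x y => famK τ RmatLim h (x, y)) ∧
      Tendsto (fun u => pairU τ s u h) atTop (𝓝 (pairL τ s h)) := by
  obtain ⟨k0, k1, k2⟩ := rK_ge τ s
  obtain ⟨b0, -, -⟩ := rB_ge τ
  have hm := memLp_pair (memLp_mW τ s)
  have hm0 : ∀ p : Fin 2 × ℝ, 0 ≤ mW τ p.2 := fun p => (mW_pos τ _).le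
  have hm1 : ∀ p : (Fin 2 × ℝ) × (Fin 2 × ℝ), 0 ≤ mW τ p.1.2 * mW τ p.2.2 :=
    fun p => mul_nonneg (hm0 _) (hm0 _)
  have hev : ∀ᶠ u : ℝ in atTop, 8 * lineA τ ≤ u := eventually_ge_atTop _
  have hε : Tendsto (fun u : ℝ => rK τ s * u⁻¹) atTop (𝓝 0) := by
    simpa using tendsto_inv_atTop_zero.const_mul (rK τ s)
  have hK : ∀ u, 8 * lineA τ ≤ u → HolDom _ (rK τ s) (famK τ (Rmat τ u)) := fun u hu =>
    (holDom_famK (fun c d => (LL_Rmat hu c d).mono b0) (by linarith)).mono hm1 k1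
  have hG : ∀ u, 8 * lineA τ ≤ u → HolDom _ (rK τ s) (famG τ s (qG τ u)) := fun u hu =>
    (famG_near hu).1.mono hm0 k2
  have hF := fun u (hu : 8 * lineA τ ≤ u) => (famF_near (s := s) hu).1.mono hm0 k2
  have hK₀ : HolDom _ (rK τ s) (famK τ RmatLim) :=
    (holDom_famK (fun c d => (LL_RmatLim τ c d).mono (by linarith)) (by linarith)).mono hm1 k1
  have hG₀ := (holDom_limG τ s).mono hm0 k2
  have hF₀ := (holDom_limF τ s).mono hm0 k2
  have hmul {u c : ℝ} (hu : 8 * lineA τ ≤ u) (hc : rB τ * c ≤ rK τ s) :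
      rB τ * u⁻¹ * c ≤ rK τ s * u⁻¹ := by
    rw [mul_right_comm]
    exact mul_le_mul_of_nonneg_right hc (inv_le_one_of hu).1.le
  obtain ⟨r, B, hr, hr1, hU₀, hU, hl⟩ := resolvent_family hm hm0 k0.le hε (hev.mono hK)
    (hev.mono hG) (hev.mono hF) hK₀ hG₀ hF₀
    (hev.mono fun u hu => by
      have := (inv_le_one_of hu).1
      refine (domNear_famK (LL_Rmat hu) (LL_RmatLim τ) (fun c d => (LL_Rmat_sub hu c d).mono
        (N' := rB τ * u⁻¹) ?_) (by positivity)).mono hm1 (hmul hu k1)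
      gcongr
      linarith)
    (hev.mono fun u hu => (famG_near hu).2.mono hm0 (hmul hu k2))
    (hev.mono fun u hu => (famF_near hu).2.mono hm0 (hmul hu k2)) (isUnit_famK_lim τ s)
  refine ⟨r, B, hr, hr1, differentiableOn_resolventPairing hm hm0 k0.le hK₀ hG₀ hF₀ hr1 hU₀, ?_,
    fun h hh => ⟨hU₀ h hh, hl h hh⟩⟩
  filter_upwards [hU, hev] with u h1 h2
  exact ⟨differentiableOn_resolventPairing hm hm0 k0.le (hK u h2) (hG u h2) (hF u h2) hr1
    fun h hh => (h1 h hh).1, h1⟩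

end

section
variable {τ s h u : ℝ}

theorem famG_one (q : ℂ → ℂ) (x : ℝ) : famG τ s q h (1, x)
    = rexp (-((1 - τ) * x)) * Psi (-τ) (x + h) := by
  have e : aexp (x + h + τ ^ 2 : ℝ) τ = aexp (τ ^ 2 : ℝ) τ * cexp (-(τ * (x + h))) := by
    rw [ofReal_add, aexp_add, mul_comm]
    push_cast
    ring_nf
  rw [Psi_neg_eq, e, vv_eq]
  simp only [famG, rowF, cons_val_one, cons_val_fin_one, Pi.zero_apply, kkC_zero,
    vvC_neg_fun, neg_mul, mul_zero, zero_add]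
  push_cast
  rfl

theorem famF_zero_zero (x : ℝ) : famF τ s 0 (fun z w => (z - w)⁻¹) 0 0 h (0, x) = 0 := by
  have := kkC_zero τ (x + h) (s + h)
  have := vvC_zero τ (x + h)
  simp_all [famF, rowF, kkC_neg, Pi.zero_def]

theorem famF_zero_one (x : ℝ) : famF τ s 0 (fun z w => (z - w)⁻¹) 0 0 h (1, x)
    = rexp ((1 - τ) * x) * Phi (-τ) (s + h) (x + h) := by
  rw [Phi_neg_eq, vv_eq, kk_eq, expP]
  simp only [famF, rowF, cons_val_one, cons_val_fin_one, kkC_neg, vvC_neg_fun]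
  push_cast
  ring

theorem pairL_eq (hh : (h : ℂ) ∈ ball (0 : ℂ) 1)
    (hU : IsUnit (1 - integralOp (pairMeasure s) fun x y => famK τ RmatLim h (x, y))) :
    pairL τ s h = resolventPairing (volume.restrict (Ioi (s + h))) (airyKernel τ) (Psi (-τ))
      (Phi (-τ) (s + h)) := by
  have hm := memLp_pair (memLp_mW τ s)
  have hm0 : ∀ p : Fin 2 × ℝ, 0 ≤ mW τ p.2 := fun p => (mW_pos τ _).le
  have hK : KDom (fun p : Fin 2 × ℝ => mW τ p.2) (1 * gW τ ^ 2)
      fun x y => famK τ RmatLim h (x, y) := (holDom_famK (LL_RmatLim τ) zero_le_one).1 h hh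
  have hG := ((holDom_limG τ s).1 h hh).memLp hm
  have hF := ((holDom_limF τ s).1 h hh).memLp hm
  obtain ⟨n, hΦ⟩ := dom_Phi τ (s + h)
  obtain ⟨n', φ, hφ, hφe⟩ := airy_solution (s + h) hΦ
  let P : Fin 2 × ℝ → ℂ := fun p => ![0, rexp ((1 - τ) * p.2) * φ (p.2 + h)] p.1
  have hn' : 0 ≤ n' := nonneg_of_mul_nonneg_left ((norm_nonneg _).trans (hφ.2 0)) (mA_pos τ 0)
  have hP : MemLp P 2 (pairMeasure s) := by
    refine Dom.memLp (n := n' * rexp (-(lineA τ * h))) hm ⟨measurable_fin_prod fun c => ?_,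
      fun p => ?_⟩
    · have := hφ.1
      fin_cases c
      · exact measurable_const
      · exact (by fun_prop : Measurable fun x : ℝ => (rexp ((1 - τ) * x) : ℂ) * φ (x + h))
    · obtain ⟨c, x⟩ := p
      have h0 := mW_pos τ x
      fin_cases c
      · simpa [P] using by positivity
      · have h1 := hφ.2 (x + h)
        have h2 := exp_mul_exp_le (τ := τ) (x := x) (Or.inl rfl)
        have h3 : mA τ (x + h) = rexp (-(lineA τ * h)) * rexp (-(lineA τ * x)) := by
          rw [mA, ← Real.exp_add]
          ring_nf
        simp only [P, Fin.mk_one, cons_val_one, cons_val_fin_one, norm_mul, norm_real,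
          Real.norm_of_nonneg (Real.exp_pos _).le]
        calc _ ≤ rexp ((1 - τ) * x) * (n' * mA τ (x + h)) := by gcongr
          _ = n' * rexp (-(lineA τ * h)) * (rexp ((1 - τ) * x)
            * rexp (-(lineA τ * x))) := by rw [h3]; ring
          _ ≤ _ := by gcongr
  have hs := resolventApply_ae_eq (hK.hasKernel hm hm0 (by positivity)) hU hF hP
    (.of_forall fun ⟨c, x⟩ => by
      rw [integral_famK_lim (hK.integrable hm (c, x) hP)]
      fin_cases c
      · simp only [Fin.zero_eta, famF_zero_zero]
        simp [P]
      · have e : ∫ y in Ioi s, airyKernel τ (x + h) (y + h) * (rexp (sg τ 1 * y) * P (1, y))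
            = hankT τ (s + h) (hankT τ (s + h) φ) (x + h) := by
          rw [← airy_hankT (hφ.adm _), integral_Ioi_add]
          congr 1 with y
          simp only [P, cons_val_one, cons_val_fin_one, sg, one_ne_zero, if_false]
          rw [← mul_assoc (Complex.ofReal _), ← ofReal_mul, ← Real.exp_add, neg_mul,
            neg_add_cancel, Real.exp_zero, ofReal_one, one_mul]
        simp only [Fin.mk_one]
        rw [e]
        simp only [P, cons_val_one, cons_val_fin_one]
        rw [hφe (x + h), mul_add]
        refine congrArg₂ _ (famF_zero_one x).symm ?_
        rw [sg, if_neg one_ne_zero, neg_mul, neg_neg])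
  rw [pairL, resolventPairing, (airy_pairing (adm_Psi τ (s + h)) hΦ hφ hφe).2]
  have e1 : ∫ p, famG τ s 0 h p * resolventApply (pairMeasure s)
      (fun x y => famK τ RmatLim h (x, y)) (famF τ s 0 (fun z w => (z - w)⁻¹) 0 0 h) p
      ∂pairMeasure s = ∫ p, famG τ s 0 h p * P p ∂pairMeasure s := by
    refine integral_congr_ae ?_
    filter_upwards [hs] with p hp
    rw [← hp]
  rw [e1, integral_pair (integrable_mul_of_memLp hG hP), Fin.sum_univ_two, integral_Ioi_add]
  simp only [P, cons_val_zero, mul_zero, integral_zero, zero_add, famG_one,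
    cons_val_one, cons_val_fin_one]
  congr 1 with y
  rw [Real.exp_neg, ofReal_inv]
  field_simp [Real.exp_ne_zero]

end

/-! ### The rescaled half-space functions -/

section
variable {τ s h u N : ℝ} {K K' : ℝ → ℝ → Matrix (Fin 2) (Fin 2) ℂ} {R : Fin 2 → Fin 2 → ℂ → ℂ → ℂ}

theorem pfaffian_blockMatrix_conj {a : Fin 2 → ℝ → ℂ} (ha : ∀ x, a 0 x * a 1 x = 1)
    (h : ∀ x y c d, K x y c d = a c x * a d y * K' x y c d) {n : ℕ} (x : Fin n → ℝ) :
    pfaffian (blockMatrix K x) = pfaffian (blockMatrix K' x) := by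
  have e : blockMatrix K x = Matrix.diagonal (fun p : Fin n × Fin 2 => a p.2 (x p.1))
      * blockMatrix K' x * (Matrix.diagonal fun p : Fin n × Fin 2 => a p.2 (x p.1)).transpose := by
    ext p q
    rw [Matrix.diagonal_transpose, Matrix.mul_diagonal, Matrix.diagonal_mul, blockMatrix,
      of_apply, h, blockMatrix, of_apply]
    ring
  rw [e, pfaffian_conj, Matrix.det_diagonal, Fintype.prod_prod_type]
  simp [Fin.prod_univ_two, ha]

theorem fredholmPfaffian_shift {a : Fin 2 → ℝ → ℂ} (ha : ∀ x, a 0 x * a 1 x = 1) {t : ℝ}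
    (h : ∀ x y c d, K (x + t) (y + t) c d = a c x * a d y * K' x y c d) :
    fredholmPfaffian (s + t) K = fredholmPfaffian s K' ∧
    (FredholmPfaffianConverges s K' → FredholmPfaffianConverges (s + t) K) := by
  have e : ∀ n : ℕ, ∀ x : Fin n → ℝ, pfaffian (blockMatrix (fun x y => K (x + t) (y + t)) x)
      = pfaffian (blockMatrix K' x) := fun n x => pfaffian_blockMatrix_conj ha h x
  refine ⟨?_, fun hc => fredholmPfaffianConverges_add ?_⟩
  · rw [fredholmPfaffian, fredholmPfaffian]
    congr 1
    ext n
    rw [fredholmPfaffianTerm_add, fredholmPfaffianTerm, fredholmPfaffianTerm]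
    simp only [e]
  · simpa only [FredholmPfaffianConverges, fredholmPfaffianTerm, e] using hc

/-- The rescaled anti-symmetric kernel. -/
def matK (τ : ℝ) (R : Fin 2 → Fin 2 → ℂ → ℂ → ℂ) (h : ℂ) (x y : ℝ) : Matrix (Fin 2) (Fin 2) ℂ :=
  Matrix.of fun c d => kerF τ R h ((c, x), (d, y))

theorem pfBound_matK (hR : ∀ c d, LL τ N (R c d)) (hN : 0 ≤ N)
    (hs : ∀ c d z w, R d c (-w) (-z) = -R c d z w) {z : ℂ} (hz : z ∈ ball (0 : ℂ) 1) :
    PfBound s (fun x => √(N * gW τ ^ 2) * mW τ x) (matK τ R z) where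
  anti x y c d := by
    rw [matK, matK, of_apply, of_apply]
    exact kerF_anti hs z (d, y) (c, x)
  meas c d := (measurable_kerF hR z).comp
    (f := fun p : ℝ × ℝ => ((c, p.1), (d, p.2))) (by fun_prop)
  le x y c d _ _ := by
    refine (norm_kerF_le hR hN hz ((c, x), (d, y))).trans (le_of_eq ?_)
    rw [mul_mul_mul_comm (√_), Real.mul_self_sqrt (by positivity)]

theorem sqrt_mW (hN : 0 < N) (s : ℝ) : (∀ x, 0 < √(N * gW τ ^ 2) * mW τ x) ∧
    IntegrableOn (fun x => (√(N * gW τ ^ 2) * mW τ x) ^ 2) (Ioi s) := by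
  have := gW_pos τ
  refine ⟨fun x => mul_pos (Real.sqrt_pos.mpr (by positivity)) (mW_pos τ x), ?_⟩
  simp only [mul_pow]
  exact (memLp_mW τ s).integrable_sq.const_mul _

/-- The Fredholm Pfaffians of the rescaled kernels, as holomorphic functions. -/
theorem pfaffian_family (τ s : ℝ) : ∃ B : ℝ,
    DifferentiableOn ℂ (fun z => fredholmPfaffian s (matK τ RmatLim z)) (ball 0 1) ∧
    (∀ u, 8 * lineA τ ≤ u →
      DifferentiableOn ℂ (fun z => fredholmPfaffian s (matK τ (Rmat τ u) z)) (ball 0 1) ∧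
      ∀ z ∈ ball (0 : ℂ) 1, FredholmPfaffianConverges s (matK τ (Rmat τ u) z) ∧
        ‖fredholmPfaffian s (matK τ (Rmat τ u) z)‖ ≤ B) ∧
    ∀ z ∈ ball (0 : ℂ) 1, FredholmPfaffianConverges s (matK τ RmatLim z) ∧
      Tendsto (fun u => fredholmPfaffian s (matK τ (Rmat τ u) z)) atTop
        (𝓝 (fredholmPfaffian s (matK τ RmatLim z))) := by
  obtain ⟨hm, hm2⟩ := sqrt_mW (τ := τ) (N := 10) (by norm_num) s
  have hL := fun c d => (LL_RmatLim τ c d).mono (N' := 10) (by norm_num)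
  have hU := fun u (hu : 8 * lineA τ ≤ u) z (hz : z ∈ ball (0 : ℂ) 1) =>
    pfBound_matK (s := s) (LL_Rmat hu) (by norm_num) (Rmat_swap τ u) hz
  have hU₀ := fun z (hz : z ∈ ball (0 : ℂ) 1) =>
    pfBound_matK (s := s) hL (by norm_num) RmatLim_swap hz
  refine ⟨_, differentiableOn_fredholmPfaffian hU₀ hm hm2 fun x y c d _ _ =>
    (holDom_kerF hL (by norm_num)).2 ((c, x), (d, y)), fun u hu =>
    ⟨differentiableOn_fredholmPfaffian (hU u hu) hm hm2 fun x y c d _ _ =>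
      (holDom_kerF (LL_Rmat hu) (by norm_num)).2 ((c, x), (d, y)), fun z hz =>
      ⟨(hU u hu z hz).converges hm hm2, (hU u hu z hz).norm_fredholmPfaffian_le hm hm2⟩⟩,
    fun z hz => ⟨(hU₀ z hz).converges hm hm2, tendsto_fredholmPfaffian
      ((eventually_ge_atTop (8 * lineA τ)).mono fun u hu => hU u hu z hz) hm hm2
      fun x y c d _ _ => ?_⟩⟩
  have hε : Tendsto (fun u : ℝ => 9 * u⁻¹ * gW τ ^ 2 * (mW τ x * mW τ y)) atTop (𝓝 0) := by
    simpa using ((tendsto_inv_atTop_zero.const_mul (9 : ℝ)).mul_const (gW τ ^ 2)).mul_const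
      (mW τ x * mW τ y)
  refine tendsto_iff_norm_sub_tendsto_zero.mpr (squeeze_zero' (.of_forall fun _ =>
    norm_nonneg _) ((eventually_ge_atTop (8 * lineA τ)).mono fun u hu => ?_) hε)
  exact domNear_kerF (LL_Rmat hu) hL (LL_Rmat_sub hu)
    (by have := (inv_le_one_of hu).1; positivity) z hz ((c, x), (d, y))

theorem sg_exp (τ x : ℝ) : (rexp (sg τ 0 * x) : ℂ) * rexp (sg τ 1 * x) = 1 := by
  rw [← ofReal_mul, ← Real.exp_add, sg, sg, if_pos rfl, if_neg one_ne_zero, neg_mul,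
    add_neg_cancel, Real.exp_zero, ofReal_one]

theorem pfaffian_airy (τ s h : ℝ) :
    fredholmPfaffian s (matK τ RmatLim h) = fredholmPfaffian (s + h) (offDiag (airyKernel τ)) ∧
    (FredholmPfaffianConverges s (matK τ RmatLim h) →
      FredholmPfaffianConverges (s + h) (offDiag (airyKernel τ))) := by
  have e := fredholmPfaffian_shift (s := s) (t := h) (K := offDiag (airyKernel τ))
    (K' := matK τ RmatLim h) (a := fun c x => (rexp (sg τ c * x) : ℂ)⁻¹)
    (fun x => by rw [← mul_inv, sg_exp, inv_one]) fun x y c d => by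
      have e1 : ∀ x y : ℝ, airyKernel τ (x + h) (y + h)
          = kkC τ (fun z w => (z - w)⁻¹) (x + h) (y + h) := fun x y => by
        rw [airyKernel_eq, kk_eq]
        push_cast
        rfl
      have e2 : kkC τ (fun z w => -(z - w)⁻¹) (x + h) (y + h)
          = -kkC τ (fun z w => (z - w)⁻¹) (y + h) (x + h) := by
        rw [kkC_neg, kkC_swap]
        simp only [neg_sub_neg]
      rw [matK, of_apply, kerF]
      fin_cases c <;> fin_cases d <;> simp [offDiag, RmatLim, e1, e2, kkC_zero, -ofReal_exp] <;>
        field_simp [Real.exp_ne_zero]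
  exact ⟨e.1.symm, e.2⟩

end

section
variable {τ s h u : ℝ}

/-- The exponential prefactors of the rescaled half-space functions. -/
def dd (τ u : ℝ) (c : Fin 2) (x : ℝ) : ℂ :=
  ![cexp (u ^ 3 / 3 - u * (x + τ ^ 2)), cexp (-(u ^ 3 / 3) + u * (x + τ ^ 2))] c

theorem dd_mul (τ u x : ℝ) : dd τ u 0 x * dd τ u 1 x = 1 := by
  simp only [dd, cons_val_zero, cons_val_one, cons_val_fin_one]
  rw [← Complex.exp_add, ← Complex.exp_zero]
  ring_nf

theorem dd_ne_zero (τ u : ℝ) (c : Fin 2) (x : ℝ) : dd τ u c x ≠ 0 := by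
  fin_cases c <;> exact Complex.exp_ne_zero _

theorem kernelA_eq (hu : 8 * lineA τ ≤ u) (x y : ℝ) (c d : Fin 2) :
    kernelA (τ - u) u (x + τ ^ 2 - u ^ 2) (y + τ ^ 2 - u ^ 2) c d
      = dd τ u c x * dd τ u d y * kkC τ (Rmat τ u c d) x y := by
  have e : kkC τ (fun z w => -R12 τ u (-w) (-z)) x y = -kkC τ (R12 τ u) y x := by
    rw [kkC_neg τ fun z w => R12 τ u (-w) (-z), kkC_swap]
    simp only [neg_neg]
  fin_cases c <;> fin_cases d <;>
    simp only [kernelA, dd, Rmat, Fin.zero_eta, Fin.mk_one, of_apply, Matrix.cons_val', cons_val_zero,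
      cons_val_one, cons_val_fin_one, A11_eq hu, A12_eq hu, A22_eq hu, kk_eq, e,
      kkC_neg, mul_neg] <;> simp only [← Complex.exp_add] <;> ring_nf

/-- The constant by which the two weights differ. -/
def cW (τ u h : ℝ) (c : Fin 2) : ℂ :=
  ![cexp (u * τ ^ 2 - u ^ 3 / 3 - (1 - τ) * h - (u + (1 - τ)) * (τ ^ 2 - u ^ 2)) ,
    cexp (-(u * τ ^ 2 - u ^ 3 / 3 - (1 - τ) * h - (u + (1 - τ)) * (τ ^ 2 - u ^ 2)))] c

theorem cW_ne_zero (c : Fin 2) : cW τ u h c ≠ 0 := by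
  fin_cases c <;> exact Complex.exp_ne_zero _

theorem weight_eq (hu : 8 * lineA τ ≤ u) (c : Fin 2) (x : ℝ) :
    weight (τ - u) c (x + h + τ ^ 2 - u ^ 2)
      = cW τ u h c * dd τ u c (x + h) * (rexp (sg τ c * x) : ℂ)⁻¹ := by
  have h1 : |τ - u| = u - τ := by
    rw [abs_sub_comm, abs_of_nonneg]
    have := lineA_pos τ
    have : |τ| ≤ lineA τ := by rw [lineA]; linarith
    linarith [le_abs_self τ]
  rw [weight, h1]
  fin_cases c <;>
    simp only [cW, dd, sg, Fin.zero_eta, Fin.mk_one, cons_val_zero, cons_val_one,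
      cons_val_fin_one, if_pos, one_ne_zero, if_false, ofReal_exp] <;>
    rw [← Complex.exp_neg, ← Complex.exp_add, ← Complex.exp_add] <;> congr 1 <;> push_cast <;> ring

theorem inv_J : (J)⁻¹ = !![0, -1; 1, 0] :=
  Matrix.inv_eq_right_inv (by ext i j; fin_cases i <;> fin_cases j <;> simp [J])

theorem J_inv_mul (A : Matrix (Fin 2) (Fin 2) ℂ) (p : Fin 2 × ℝ) (d : Fin 2) :
    (J⁻¹ * A) p.1 d = -eps p * A (pairSwap p).1 d := by
  obtain ⟨c, x⟩ := p
  rw [inv_J, pairSwap_mk]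
  fin_cases c <;> simp [eps, Matrix.mul_apply, Fin.sum_univ_two]

theorem pairShift_snd (p : Fin 2 × ℝ) : (pairShift (h + (τ ^ 2 - u ^ 2)) p).1 = p.1 ∧
    (pairShift (h + (τ ^ 2 - u ^ 2)) p).2 = p.2 + h + τ ^ 2 - u ^ 2 :=
  ⟨rfl, show p.2 + (h + (τ ^ 2 - u ^ 2)) = _ by ring⟩

theorem dd_swap_mul (p : Fin 2 × ℝ) (x : ℝ) : dd τ u (pairSwap p).1 x = (dd τ u p.1 x)⁻¹ := by
  obtain ⟨c, y⟩ := p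
  rw [pairSwap_mk]
  fin_cases c
  · exact eq_inv_of_mul_eq_one_right (dd_mul τ u x)
  · exact eq_inv_of_mul_eq_one_left (dd_mul τ u x)

theorem sg_swap (p : Fin 2 × ℝ) (x : ℝ) :
    (rexp (sg τ (pairSwap p).1 * x) : ℂ) = (rexp (sg τ p.1 * x) : ℂ)⁻¹ := by
  obtain ⟨c, y⟩ := p
  rw [pairSwap_mk]
  fin_cases c
  · exact eq_inv_of_mul_eq_one_right (sg_exp τ x)
  · exact eq_inv_of_mul_eq_one_left (sg_exp τ x)

theorem conjKernel_eq (hu : 8 * lineA τ ≤ u) (p q : Fin 2 × ℝ) :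
    famK τ (Rmat τ u) h (p, q) = (cW τ u h p.1)⁻¹ * conjKernel (τ - u) u
      (pairShift (h + (τ ^ 2 - u ^ 2)) p) (pairShift (h + (τ ^ 2 - u ^ 2)) q)
      * ((cW τ u h q.1)⁻¹)⁻¹ := by
  have h1 := cW_ne_zero (τ := τ) (u := u) (h := h) p.1
  have h2 := cW_ne_zero (τ := τ) (u := u) (h := h) q.1
  have h3 := dd_ne_zero τ u p.1 (p.2 + h)
  have h4 := dd_ne_zero τ u q.1 (q.2 + h)
  have e1 : (rexp (sg τ p.1 * p.2) : ℂ) ≠ 0 := ofReal_ne_zero.mpr (Real.exp_pos _).ne'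
  have e2 : (rexp (sg τ q.1 * q.2) : ℂ) ≠ 0 := ofReal_ne_zero.mpr (Real.exp_pos _).ne'
  rw [conjKernel, (pairShift_snd p).1, (pairShift_snd p).2, (pairShift_snd q).1,
    (pairShift_snd q).2, weight_eq hu, weight_eq hu, J_inv_mul, kernelA_eq hu, dd_swap_mul, famK,
    kerF, sg_swap]
  simp only [ofReal_add, show (pairSwap p).2 = p.2 from rfl]
  field_simp

theorem famG_zero (x : ℝ) :
    famG τ s (qG τ u) h (0, x) = rexp (sg τ 0 * x) * vv τ (qG τ u) (x + h) := by
  rw [vv_eq]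
  simp only [famG, rowF, cons_val_zero, Pi.zero_apply, kkC_zero, mul_zero, zero_mul, zero_add,
    add_zero, sg, if_pos]
  push_cast
  rfl

theorem conjRow_eq (hu : 8 * lineA τ ≤ u) (p : Fin 2 × ℝ) :
    famG τ s (qG τ u) h p = conjRow (τ - u) u (pairShift (h + (τ ^ 2 - u ^ 2)) p)
      * ((cW τ u h p.1)⁻¹)⁻¹ := by
  have h1 := cW_ne_zero (τ := τ) (u := u) (h := h) p.1
  have h3 := dd_ne_zero τ u p.1 (p.2 + h)
  have e1 : (rexp (sg τ p.1 * p.2) : ℂ) ≠ 0 := ofReal_ne_zero.mpr (Real.exp_pos _).ne'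
  rw [conjRow, (pairShift_snd p).1, (pairShift_snd p).2, weight_eq hu]
  obtain ⟨c, x⟩ := p
  fin_cases c
  · have e : g1 (τ - u) u (x + h + τ ^ 2 - u ^ 2) = -(_ * vv τ (qG τ u) (x + h)) := g1_eq hu (x + h)
    simp only [Fin.zero_eta, famG_zero, cons_val_zero] at *
    rw [e, neg_neg]
    change _ = dd τ u 0 (x + h) * _ * _ * _
    field_simp
  · have e := g2_eq (τ := τ) (u := u) (x + h)
    simp only [Fin.mk_one, famG_one, cons_val_one, cons_val_fin_one] at *
    rw [e, ← neg_mul, ← show sg τ 1 = -(1 - τ) from if_neg one_ne_zero]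
    change _ = dd τ u 1 (x + h) * _ * _ * _
    field_simp

theorem conjColumn_eq (hu : 8 * lineA τ ≤ u) (p : Fin 2 × ℝ) (hp : s < p.2) :
    (cW τ u h p.1)⁻¹ * conjColumn (τ - u) u (s + (h + (τ ^ 2 - u ^ 2)))
      (pairShift (h + (τ ^ 2 - u ^ 2)) p)
      = famF τ s (R22 τ u) (R12 τ u) (fun z => -r4 τ u z) (bF τ u) h p
        + coefC τ u (s + h) * (-eps p * famG τ s (qG τ u) h (pairSwap p)) := by
  have h1 := cW_ne_zero (τ := τ) (u := u) (h := h) p.1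
  have h3 := dd_ne_zero τ u p.1 (p.2 + h)
  have e1 : (rexp (sg τ p.1 * p.2) : ℂ) ≠ 0 := ofReal_ne_zero.mpr (Real.exp_pos _).ne'
  have e0 := dd_swap_mul (τ := τ) (u := u) p (p.2 + h)
  rw [conjColumn, (pairShift_snd p).1, (pairShift_snd p).2, weight_eq hu, ← add_assoc]
  obtain ⟨c, x⟩ := p
  fin_cases c
  · have e := h1_eq hu (add_lt_add_left hp h : s + h < x + h)
    have e2 : aexp (x + h + τ ^ 2 : ℝ) τ = aexp (τ ^ 2 : ℝ) τ * cexp (-(τ * (x + h))) := by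
      rw [ofReal_add, aexp_add, mul_comm]
      push_cast
      ring_nf
    have e6 : (rexp (-(1 - τ) * x) : ℂ) = (rexp (sg τ 0 * x) : ℂ)⁻¹ := by
      rw [← show sg τ 1 = -(1 - τ) from if_neg one_ne_zero]
      exact eq_inv_of_mul_eq_one_right (sg_exp τ x)
    simp only [Fin.zero_eta, pairSwap_mk, zero_add, famG_one, cons_val_zero, eps] at *
    rw [← neg_mul, e6, e, g2_eq, famF, rowF, kk_eq, vv_eq, e2]
    simp only [cons_val_zero, kkC_neg, vvC_neg_fun, e6]
    rw [show cexp (-(u ^ 3 / 3) + u * ((x + h : ℝ) + τ ^ 2)) = (dd τ u 0 (x + h))⁻¹ from e0, bF]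
    simp only [expP, ofReal_add]
    field_simp
    ring
  · have e := h2_eq hu (s + h) (x + h)
    have e7 : (rexp (sg τ 0 * x) : ℂ) = (rexp (sg τ 1 * x) : ℂ)⁻¹ :=
      eq_inv_of_mul_eq_one_left (sg_exp τ x)
    have e6 : (rexp ((1 - τ) * x) : ℂ) = (rexp (sg τ 1 * x) : ℂ)⁻¹ := by
      rw [← e7, show sg τ 0 = 1 - τ from if_pos rfl]
    have e8 : g1 (τ - u) u (x + h + τ ^ 2 - u ^ 2) = -(_ * vv τ (qG τ u) (x + h)) := g1_eq hu (x + h)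
    simp only [Fin.mk_one, pairSwap_mk, show (1 + 1 : Fin 2) = 0 from rfl, famG_zero,
      cons_val_one, cons_val_fin_one, eps] at *
    rw [e7, e, e8, famF, rowF, kk_eq, vv_eq]
    simp only [cons_val_one, cons_val_fin_one, kkC_neg, vvC_neg_fun, e6]
    rw [show cexp (u ^ 3 / 3 - u * ((x + h : ℝ) + τ ^ 2)) = (dd τ u 1 (x + h))⁻¹ from e0]
    simp only [expP, ofReal_add]
    field_simp
    ring

end

section
variable {τ s h u : ℝ}

/-- The function `R_{-τ}` at complex arguments. -/
def brR (τ s : ℝ) (z : ℂ) : ℂ :=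
  s + z + cexp (2 * τ ^ 3 / 3 + τ * (s + z)) * vvC τ (fun w => (w - τ)⁻¹ * (w - τ)⁻¹) (s + z)

theorem brR_eq (τ s h : ℝ) : Rfun (-τ) (s + h) = brR τ s h := by
  rw [Rfun_eq, vv_eq, expP_neg, inv_inv, vvC_neg, expP, brR]
  simp only [ofReal_neg, ← sub_eq_add_neg, ofReal_add]

theorem differentiableOn_brR (τ s : ℝ) : DifferentiableOn ℂ (brR τ s) (ball 0 1) := by
  have h1 : L1 τ 1 fun w => (w - τ)⁻¹ * (w - τ)⁻¹ :=
    L1.of_bound (by fun_prop) one_pos.le fun z hz => by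
      have : ‖(z - τ)⁻¹‖ ≤ 1⁻¹ := norm_inv_le_of_re one_pos (le_trans (by
        rw [sub_re, ofReal_re, hz, lineA]
        linarith [le_abs_self τ]) (le_abs_self _))
      rw [inv_one] at this
      rw [norm_mul]
      exact mul_le_one₀ this (norm_nonneg _) this
  exact DifferentiableOn.add (by fun_prop) (DifferentiableOn.mul (by fun_prop)
    (h1.differentiableOn_vvC s))

theorem half_eq (hu : 8 * lineA τ ≤ u) (hh : (h : ℂ) ∈ ball (0 : ℂ) 1)
    (hU : IsUnit (1 - integralOp (pairMeasure s) fun x y => famK τ (Rmat τ u) h (x, y)))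
    (hc : FredholmPfaffianConverges s (matK τ (Rmat τ u) h)) :
    HalfDefined (τ - u) u (s + (h + (τ ^ 2 - u ^ 2))) ∧
    halfPrimitive (τ - u) u (s + (h + (τ ^ 2 - u ^ 2)))
      = fredholmPfaffian s (matK τ (Rmat τ u) h) * (brR τ s h - pairU τ s u h) := by
  obtain ⟨p1, p2⟩ := fredholmPfaffian_shift (s := s) (t := h + (τ ^ 2 - u ^ 2))
    (K := kernelA (τ - u) u) (K' := matK τ (Rmat τ u) h)
    (a := fun c x => dd τ u c (x + h) * (rexp (sg τ c * x) : ℂ)⁻¹)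
    (fun x => by rw [mul_mul_mul_comm, dd_mul, ← mul_inv, sg_exp, inv_one, one_mul])
    fun x y c d => by
      have e := kernelA_eq hu (x + h) (y + h) c d
      have e1 : (rexp (sg τ c * x) : ℂ) ≠ 0 := ofReal_ne_zero.mpr (Real.exp_pos _).ne'
      have e2 : (rexp (sg τ d * y) : ℂ) ≠ 0 := ofReal_ne_zero.mpr (Real.exp_pos _).ne'
      rw [show x + (h + (τ ^ 2 - u ^ 2)) = x + h + τ ^ 2 - u ^ 2 by ring,
        show y + (h + (τ ^ 2 - u ^ 2)) = y + h + τ ^ 2 - u ^ 2 by ring, e, matK, of_apply,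
        kerF]
      simp only [ofReal_add]
      field_simp
  have hm := memLp_pair (memLp_mW τ s)
  have hm0 : ∀ p : Fin 2 × ℝ, 0 ≤ mW τ p.2 := fun p => (mW_pos τ _).le
  have hK : KDom (fun p : Fin 2 × ℝ => mW τ p.2) (10 * gW τ ^ 2)
      fun x y => famK τ (Rmat τ u) h (x, y) := (holDom_famK (LL_Rmat hu) (by norm_num)).1 h hh
  have hN : KDom (fun p : Fin 2 × ℝ => mW τ p.2) (10 * gW τ ^ 2)
      fun x y => kerF τ (Rmat τ u) h (x, y) := (holDom_kerF (LL_Rmat hu) (by norm_num)).1 h hh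
  have hn : 0 ≤ 10 * gW τ ^ 2 := by positivity
  have hG := ((famG_near (s := s) hu).1.1 h hh).memLp hm
  have hF := ((famF_near (s := s) hu).1.1 h hh).memLp hm
  obtain ⟨a1, a2⟩ := resolventPairing_antisymm pairSwap (measurePreserving_pairSwap s)
    (ε := eps) (fun ⟨c, x⟩ => by rw [pairSwap_mk, pairSwap_mk]; fin_cases c <;> rfl)
    measurable_eps (fun ⟨c, x⟩ => by fin_cases c <;> simp [eps])
    (fun ⟨c, x⟩ => by rw [pairSwap_mk]; fin_cases c <;> simp [eps]) hN hK hm hm0 hn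
    (fun p q => kerF_anti (Rmat_swap τ u) h p q) (fun p q => rfl) hU hG
  have hcm : Measurable fun p : Fin 2 × ℝ => (cW τ u h p.1)⁻¹ :=
    measurable_fin_prod fun c => (measurable_const : Measurable fun _ : ℝ => (cW τ u h c)⁻¹)
  have c0 : ∀ c, 0 < ‖(cW τ u h c)⁻¹‖ := fun c => norm_pos_iff.mpr (inv_ne_zero (cW_ne_zero c))
  obtain ⟨t1, t2⟩ := resolvent_transfer (pairShift (h + (τ ^ 2 - u ^ 2)))
    (measurePreserving_pairShift s _) hcm (lt_min (c0 0) (c0 1))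
    (add_pos (c0 0) (c0 1)).le (fun ⟨c, x⟩ => by fin_cases c <;> simp [-norm_inv])
    (fun ⟨c, x⟩ => by fin_cases c <;> simp [-norm_inv]) (conjKernel_eq hu) hK hm hm0 hn hU
    (h := conjColumn (τ - u) u (s + (h + (τ ^ 2 - u ^ 2))))
    (h' := famF τ s (R22 τ u) (R12 τ u) (fun z => -r4 τ u z) (bF τ u) h
      + coefC τ u (s + h) • fun p => -eps p * famG τ s (qG τ u) h (pairSwap p))
    (conjRow_eq hu) (by
      filter_upwards [ae_pair_gt s] with p hp
      rw [conjColumn_eq hu p hp]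
      rfl) hG (hF.add (a1.const_smul _))
  refine ⟨⟨p2 hc, fun Y hY => ?_, t1⟩, ?_⟩
  · obtain ⟨y, rfl⟩ : ∃ y, Y = y + τ ^ 2 - u ^ 2 := ⟨Y - τ ^ 2 + u ^ 2, by ring⟩
    rw [← add_assoc]
    exact ⟨(A22tilde_laplace hu _ y).1, (E1_laplace hu (by linarith)).1,
      (A12tilde_laplace hu _ y).1⟩
  · rw [halfPrimitive, p1, t2, resolventPairing_add hG hF (a1.const_smul _),
      resolventPairing_smul hG a1, a2, mul_zero, add_zero, ← add_assoc, eFun_eq, brR_eq]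
    rfl

theorem hasDerivAt_of_holomorphic {F : ℂ → ℂ} {g : ℝ → ℂ} {x₀ r : ℝ} (hr : 0 < r)
    (hF : DifferentiableOn ℂ F (ball 0 r)) (hg : ∀ h : ℝ, |h| < r → g (x₀ + h) = F h) :
    HasDerivAt g (deriv F 0) x₀ := by
  have h1 : HasDerivAt F (deriv F 0) ((0 : ℝ) : ℂ) := by
    rw [ofReal_zero]
    exact ((hF 0 (mem_ball_self hr)).differentiableAt (ball_mem_nhds _ hr)).hasDerivAt
  have h2 : HasDerivAt (fun h : ℝ => F h) (deriv F 0) (x₀ - x₀) := by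
    rw [sub_self]
    exact h1.comp_ofReal
  refine (h2.comp_sub_const x₀ x₀).congr_of_eventuallyEq ?_
  filter_upwards [ball_mem_nhds x₀ hr] with x hx
  rw [mem_ball, Real.dist_eq] at hx
  rw [← hg _ hx, add_sub_cancel]

/-- The convergence of the half-space distributions to the Baik-Rains distribution. -/
theorem half_limit (τ s : ℝ) :
    (BRDefined τ s ∧ DifferentiableAt ℝ (brPrimitive τ) s) ∧
    (∀ᶠ u : ℝ in atTop, (∀ᶠ S' in 𝓝 (s + (τ ^ 2 - u ^ 2)), HalfDefined (τ - u) u S') ∧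
      DifferentiableAt ℝ (halfPrimitive (τ - u) u) (s + (τ ^ 2 - u ^ 2))) ∧
    Tendsto (fun u : ℝ => Fhalf (τ - u) u (s + (τ ^ 2 - u ^ 2))) atTop (𝓝 (FBR τ s)) := by
  obtain ⟨r, B, hr, hr1, q1, q2, q3⟩ := pairU_family τ s
  obtain ⟨B', f1, f2, f3⟩ := pfaffian_family τ s
  obtain ⟨M, hM⟩ := (isCompact_closedBall (0 : ℂ) (r / 2)).exists_bound_of_continuousOn
    ((differentiableOn_brR τ s).continuousOn.mono
      (closedBall_subset_ball (by linarith)))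
  have s1 : ball (0 : ℂ) (r / 2) ⊆ ball 0 r := ball_subset_ball (by linarith)
  have s2 : ball (0 : ℂ) (r / 2) ⊆ ball 0 1 := ball_subset_ball (by linarith)
  have hr2 : 0 < r / 2 := by linarith
  have hball : ∀ h : ℝ, |h| < r / 2 → (h : ℂ) ∈ ball (0 : ℂ) (r / 2) := fun h hh => by
    rwa [mem_ball_zero_iff, norm_real, Real.norm_eq_abs]
  have hb := (differentiableOn_brR τ s).mono s2
  have dL := (f1.mono s2).mul (hb.sub (q1.mono s1))
  have hbr : ∀ h : ℝ, |h| < r / 2 → brPrimitive τ (s + h) = _ := fun h hh => by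
    have e := pairL_eq (s2 (hball h hh)) (q3 h (s1 (hball h hh))).1
    rw [brPrimitive_eq, ← (pfaffian_airy τ s h).1, brR_eq, ← e]
  have derL := hasDerivAt_of_holomorphic hr2 dL hbr
  let F : ℝ → ℂ → ℂ := fun u => (fun z => fredholmPfaffian s (matK τ (Rmat τ u) z))
    * (brR τ s - pairU τ s u)
  have key : ∀ᶠ u in atTop, DifferentiableOn ℂ (F u) (ball 0 (r / 2)) ∧
      (∀ z ∈ ball (0 : ℂ) (r / 2), ‖F u z‖ ≤ B' * (M + B)) ∧
      ∀ h : ℝ, |h| < r / 2 → HalfDefined (τ - u) u (s + (τ ^ 2 - u ^ 2) + h) ∧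
        halfPrimitive (τ - u) u (s + (τ ^ 2 - u ^ 2) + h) = F u h := by
    filter_upwards [eventually_ge_atTop (8 * lineA τ), q2] with u hu hu2
    refine ⟨((f2 u hu).1.mono s2).mul (hb.sub (hu2.1.mono s1)), fun z hz => ?_, fun h hh => ?_⟩
    · have k1 := ((f2 u hu).2 z (s2 hz)).2
      refine (norm_mul_le _ _).trans (mul_le_mul k1 ((norm_sub_le _ _).trans
        (add_le_add (hM z (Metric.ball_subset_closedBall hz)) (hu2.2 z (s1 hz)).2))
        (norm_nonneg _) ((norm_nonneg _).trans k1))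
    · rw [add_assoc, add_comm _ h]
      exact half_eq hu (s2 (hball h hh)) (hu2.2 h (s1 (hball h hh))).1
        ((f2 u hu).2 h (s2 (hball h hh))).1
  have h0 : |(0 : ℝ)| < r / 2 := by rwa [abs_zero]
  have der := key.mono fun u hu => hasDerivAt_of_holomorphic hr2 hu.1 fun h hh => (hu.2.2 h hh).2
  refine ⟨⟨brDefined τ s ?_, derL.differentiableAt⟩, ?_, ?_⟩
  · have := (pfaffian_airy τ s 0).2 (f3 _ (s2 (hball 0 h0))).1
    rwa [add_zero] at this
  · filter_upwards [key, der] with u hu hd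
    refine ⟨?_, hd.differentiableAt⟩
    filter_upwards [ball_mem_nhds _ hr2] with x hx
    rw [mem_ball, Real.dist_eq] at hx
    simpa only [add_sub_cancel] using (hu.2.2 _ hx).1
  · rw [FBR, derL.deriv]
    refine (tendsto_deriv_of_bound hr2 (key.mono fun u hu => hu.1) dL
      (key.mono fun u hu => hu.2.1) fun z hz => ?_).congr' (der.mono fun u hu => hu.deriv.symm)
    exact (f3 z (s2 hz)).2.mul (tendsto_const_nhds.sub (q3 z (s1 hz)).2)

end

end HalfSpaceLPP
end

theorem theorem2p9 (τ s : ℝ) (δ : ℝ → ℝ) (hδ : ∀ u : ℝ, u + δ u = τ)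
    (S : ℝ → ℝ) (hS : ∀ u : ℝ, S u = s + δ u * (2 * u + δ u)) :
    (HalfSpaceLPP.BRDefined τ s ∧ DifferentiableAt ℝ (HalfSpaceLPP.brPrimitive τ) s) ∧
    (∀ᶠ u : ℝ in atTop,
      (∀ᶠ S' : ℝ in 𝓝 (S u), HalfSpaceLPP.HalfDefined (δ u) u S') ∧
      DifferentiableAt ℝ (HalfSpaceLPP.halfPrimitive (δ u) u) (S u)) ∧
    Tendsto (fun u : ℝ => HalfSpaceLPP.Fhalf (δ u) u (S u)) atTop
      (𝓝 (HalfSpaceLPP.FBR τ s)) := by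
  have e1 : ∀ u, δ u = τ - u := fun u => by linarith [hδ u]
  have e2 : ∀ u, S u = s + (τ ^ 2 - u ^ 2) := fun u => by rw [hS, e1]; ring
  simp only [e1, e2]
  exact HalfSpaceLPP.half_limit τ s
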